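/- **Theorem (Likelihood approximations).** *Process.* Let $\kappa>0$, let $\ell(j)=1$ for $|j|\le 1$ and $\ell(j)=|j|\log^{1+\kappa}|j|$ for $|j|>1$, and let $V$ denote total variation over the unit interval. Let $X_{t,n}$ ($1\le t\le n$) be a Gaussian locally stationary process: for each $n$ the vector $(X_{1,n},\dots,X_{n,n})$ is Gaussian and $X_{t,n}=\sum_{j\in\mathbb Z}a_{t,n}(j)\varepsilon_{t-j}$ with identically distributed, uncorrelated $\varepsilon_t$ of mean $0$ and variance $1$, and there are a constant $K$ and functions $a(\cdot,j):(0,1]\to\mathbb R$ with $$|a_{t,n}(j)|\le \tfrac{K}{\ell(j)},\quad \sup_u|a(u,j)|\le \tfrac{K}{\ell(j)},\quad V(a(\cdot,j))\le\tfrac{K}{\ell(j)},\quad \sum_{t=1}^n\big|a_{t,n}(j)-a(\tfrac tn,j)\big|\le K$$ for all $j,t,n$. Its time-varying spectral density is $f(u,\lambda)=\frac1{2\pi}\big|\sum_j a(u,j)e^{-i\lambda j}\big|^2$. *Contrasts.* For $g:[0,1]\times[-\pi,\pi]\to(0,\infty)$ let $$\mathcal L_n(g)=\frac1n\sum_{t=1}^n\frac1{4\pi}\int_{-\pi}^{\pi}\Big\{\log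 g(\tfrac tn,\lambda)+\frac{J_n(\frac tn,\lambda)}{g(\frac tn,\lambda)}\Big\}d\lambda,\qquad \mathcal L(g)=\int_0^1\frac1{4\pi}\int_{-\pi}^{\pi}\Big\{\log g+\frac fg\Big\}d\lambda\,du,$$ where $J_n(\frac tn,\lambda)=\frac1{2\pi}\sum_{k:\,1\le[t+1/2\pm k/2]\le n}X_{[t+1/2+k/2],n}X_{[t+1/2-k/2],n}e^{-i\lambda k}$. *Norms.* Let $\rho_2(\phi)=\big(\int_0^1\int_{-\pi}^{\pi}|\phi|^2d\lambda\,du\big)^{1/2}$, $\rho_2(\phi,\psi)=\rho_2(\phi-\psi)$, $\hat\phi(u,j)=\int_{-\pi}^{\pi}\phi(u,\lambda)e^{i\lambda j}d\lambda$, $\rho_\infty(\phi)=\sum_j\sup_u|\hat\phi(u,j)|$, $\tilde v(\phi)=\sup_jV(\hat\phi(\cdot,j))$, $v_\Sigma(\phi)=\sum_jV(\hat\phi(\cdot,j))$. Let $N(\eta,\Phi,\rho_2)$ be the smallest number $m\ge1$ of open $\rho_2$-balls of radius $\eta$ with centres in $\Phi$ that cover $\Phi$. For a class $\mathcal G$ put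 $\mathcal G^*=\{1/g:g\in\mathcal G\}$. *Assumptions.* Let $\mathcal F$ and $\mathcal F_n$ ($n\ge1$) be classes of measurable functions $g:[0,1]\times[-\pi,\pi]\to(0,\infty)$ such that: (a) $\mathcal L$ has a minimizer $f_{\mathcal F}$ over $\mathcal F$, unique up to null sets; (b) for every $\phi\in\mathcal F^*$ there are $\pi_n(\phi)\in\mathcal F_n^*$ with $\rho_2(\phi,\pi_n(\phi))\to0$; (c) there are constants, which may depend on $n$, with $0<M_*\le1\le M^*<\infty$, $M_*\le|\phi(u,\lambda)|<M^*$ for all $u,\lambda$ and $\phi\in\mathcal F_n^*$, $\sup_{\phi\in\mathcal F_n^*}\rho_\infty(\phi)\le\rho_\infty<\infty$, $\sup_{\phi\in\mathcal F_n^*}\tilde v(\phi)<\tilde v<\infty$ and $\sup_{\phi\in\mathcal F_n^*}v_\Sigma(\phi)\le v_\Sigma<\infty$. Let $\tilde{\mathcal L}_n$ be a (random) criterion function that has a minimizer $\tilde f_n=\operatorname{argmin}_{g\in\mathcal F_n}\tilde{\mathcal L}_n(g)$ over $\mathcal F_n$ almost surely, for every $n\ge1$. In each of the cases below, with the sequence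 $\delta_n$ given there, $$\text{if}\quad\sup_{g\in\mathcal F_n}|\tilde{\mathcal L}_n(g)-\mathcal L_n(g)|=o_P\big(\delta_n^2/(M^*)^2\big),\quad\text{then}\quad \rho_2\Big(\frac1{\tilde f_n},\frac1{f_{\mathcal F}}\Big)=O_P(\delta_n).$$ (Membership $f\in\mathcal F$ is understood up to null sets.) **Part I (sieve estimation).** Suppose that there are $A>0$ (not depending on $n$) and $k_n\ge1$ with $\log N(\eta,\mathcal F_n^*,\rho_2)\le Ak_n\log(n/\eta)$ for all $0<\eta\le1$ and $n\ge2$, and let $c_n=\max\{\rho_\infty,v_\Sigma,(M^*)^2\}$. (i) If $f\in\mathcal F$, take $\delta_n=\frac{M^*}{M_*}\max\big(\sqrt{c_nk_n\log n/n},\,a_n\big)$ with $a_n=\inf_{g\in\mathcal F_n}\rho_2(\frac1f,\frac1g)$. (ii) If $f\notin\mathcal F$, all $\mathcal F_n^*$ are convex, and $f_{\mathcal F_n}$ is a minimizer of $\mathcal L$ over $\mathcal F_n$ for each $n\ge1$, take $\delta_n=\frac{M^*}{M_*}\max\big(\sqrt{c_nk_n\log n/n},\,b_n\big)$ with $b_n=\rho_2(\frac1{f_{\mathcal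 F}},\frac1{f_{\mathcal F_n}})$. **Part II (global estimation).** Suppose that $\mathcal F_n=\mathcal F$ for all $n$, that $f\in\mathcal F$ or $\mathcal F^*$ is convex, and that there are $0<\gamma<2$, $0<A<\infty$ and a continuous decreasing function $\tilde H$ on $(0,\infty)$ with $\log N(\eta,\mathcal F^*,\rho_2)\le\tilde H(\eta)\le A\eta^{-\gamma}$ for all $\eta>0$. Take $$\delta_n=\begin{cases}n^{-\frac1{2(\gamma+1)}}&\text{for }0<\gamma<1,\\ n^{-\frac{2-\gamma}{4\gamma}}(\log n)^{\frac{\gamma-1}{2\gamma}}&\text{for }1\le\gamma<2.\end{cases}$$ -/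

import Mathlib

open MeasureTheory ProbabilityTheory Filter Topology
open scoped NNReal ENNReal

noncomputable section

namespace LocStat

/-! ### Stochastic order symbols

Probabilities of sets that are not known to be measurable are read as outer probabilities; on
measurable sets these are the usual ones. -/

/-- `Z n = O_P (r n)` for nonnegative random quantities `Z n`. -/
def IsBigOP {Ω : Type*} [MeasurableSpace Ω] (P : Measure Ω) (Z : ℕ → Ω → ℝ≥0∞) (r : ℕ → ℝ≥0∞) :
    Prop :=
  ∀ ε : ℝ≥0∞, 0 < ε → ∃ C : ℝ≥0, ∀ᶠ n in atTop, P {ω | (C : ℝ≥0∞) * r n < Z n ω} ≤ ε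

/-- `Z n = o_P (r n)` for nonnegative random quantities `Z n`. -/
def IsLittleOP {Ω : Type*} [MeasurableSpace Ω] (P : Measure Ω) (Z : ℕ → Ω → ℝ≥0∞)
    (r : ℕ → ℝ≥0∞) : Prop :=
  ∀ c : ℝ≥0, 0 < c → Tendsto (fun n => P {ω | (c : ℝ≥0∞) * r n < Z n ω}) atTop (𝓝 0)

/-! ### Locally stationary processes -/

/-- The weight `ℓ(j)`: `1` for `|j| ≤ 1` and `|j| (log |j|) ^ (1 + κ)` for `|j| > 1`. -/
def ell (κ : ℝ) (j : ℤ) : ℝ :=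
  if |j| ≤ 1 then 1 else |(j : ℝ)| * Real.log |(j : ℝ)| ^ (1 + κ)

/-- `X n t`, for `1 ≤ t ≤ n`, is a locally stationary process with innovations `ε`, coefficients
`aT n t j`, coefficient curves `a u j` for `u ∈ (0,1]`, and constants `κ` and `K`. -/
structure IsLocallyStationary {Ω : Type*} [MeasurableSpace Ω] (P : Measure Ω) (κ K : ℝ)
    (ε : ℤ → Ω → ℝ) (aT : ℕ → ℤ → ℤ → ℝ) (a : ℝ → ℤ → ℝ) (X : ℕ → ℤ → Ω → ℝ) : Prop where
  kappa_pos : 0 < κ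
  innov_memLp : ∀ t, MemLp (ε t) 2 P
  innov_identDistrib : ∀ s t, IdentDistrib (ε s) (ε t) P P
  innov_mean : ∀ t, ∫ ω, ε t ω ∂P = 0
  innov_uncorrelated : ∀ s t, s ≠ t → ∫ ω, ε s ω * ε t ω ∂P = 0
  innov_variance : ∀ t, ∫ ω, ε t ω ^ 2 ∂P = 1
  /-- the two-sided moving average representation; under `coeff_bound` the series converges
  absolutely almost surely -/
  representation : ∀ (n : ℕ) (t : ℤ), 1 ≤ t → t ≤ n →
    ∀ᵐ ω ∂P, X n t ω = ∑' j : ℤ, aT n t j * ε (t - j) ω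
  coeff_bound : ∀ (n : ℕ) (t j : ℤ), 1 ≤ t → t ≤ n → |aT n t j| ≤ K / ell κ j
  curve_bound : ∀ u ∈ Set.Ioc (0 : ℝ) 1, ∀ j : ℤ, |a u j| ≤ K / ell κ j
  coeff_approx : ∀ (n : ℕ) (j : ℤ), ∑ t ∈ Finset.Icc (1 : ℤ) n, |aT n t j - a (t / n) j| ≤ K
  curve_variation : ∀ j : ℤ,
    eVariationOn (fun u => a u j) (Set.Ioc 0 1) ≤ ENNReal.ofReal (K / ell κ j)

/-- For each `n`, the observations `X n 1, …, X n n` are jointly Gaussian. -/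
def IsGaussianArray {Ω : Type*} [MeasurableSpace Ω] (P : Measure Ω) (X : ℕ → ℤ → Ω → ℝ) : Prop :=
  ∀ n : ℕ, IsGaussianProcess (fun (t : Set.Icc (1 : ℤ) n) => X n t) P

/-- The time-varying spectral density `f(u, λ) = |A(u, λ)|² / (2π)` with transfer function
`A(u, λ) = ∑ⱼ a(u, j) exp(-iλj)`. -/
def spectralDensity (a : ℝ → ℤ → ℝ) (u l : ℝ) : ℝ :=
  1 / (2 * Real.pi) *
    ‖∑' j : ℤ, (a u j : ℂ) * Complex.exp (-Complex.I * (l : ℂ) * (j : ℂ))‖ ^ 2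

/-! ### Contrast functionals

Functions of rescaled time `u ∈ [0,1]` and frequency `λ ∈ [-π,π]` are represented by functions
`ℝ → ℝ → ℝ`; only their values on this rectangle are used. -/

/-- Lebesgue measure on the time-frequency rectangle `[0,1] × [-π,π]`. -/
def tfMeasure : Measure (ℝ × ℝ) :=
  (volume : Measure (ℝ × ℝ)).restrict (Set.Icc (0 : ℝ) 1 ×ˢ Set.Icc (-Real.pi) Real.pi)

/-- The summation range of the pre-periodogram: those `k` with `1 ≤ [t + 1/2 ± k/2] ≤ n`. The two
indices differ by `k`, so that necessarily `|k| ≤ n`. -/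
def lagSet (n : ℕ) (t : ℤ) : Finset ℤ :=
  (Finset.Icc (-(n : ℤ)) n).filter fun k =>
    (1 ≤ ⌊(t : ℝ) + 1 / 2 + k / 2⌋ ∧ ⌊(t : ℝ) + 1 / 2 + k / 2⌋ ≤ n) ∧
      (1 ≤ ⌊(t : ℝ) + 1 / 2 - k / 2⌋ ∧ ⌊(t : ℝ) + 1 / 2 - k / 2⌋ ≤ n)

/-- The pre-periodogram `J_n(t/n, λ)` of the data `x 1, …, x n`, as a complex number. -/
def prePeriodogram (n : ℕ) (x : ℤ → ℝ) (t : ℤ) (l : ℝ) : ℂ :=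
  1 / (2 * (Real.pi : ℂ)) * ∑ k ∈ lagSet n t,
    ((x ⌊(t : ℝ) + 1 / 2 + k / 2⌋ * x ⌊(t : ℝ) + 1 / 2 - k / 2⌋ : ℝ) : ℂ) *
      Complex.exp (-Complex.I * (l : ℂ) * (k : ℂ))

/-- The pre-periodogram is real-valued. -/
theorem prePeriodogram_im (n : ℕ) (x : ℤ → ℝ) (t : ℤ) (l : ℝ) :
    (prePeriodogram n x t l).im = 0 := by
  rw [← Complex.conj_eq_iff_im]
  unfold prePeriodogram
  rw [map_mul, map_sum]
  congr 1
  · simp [Complex.conj_ofNat]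
  · refine Finset.sum_equiv (Equiv.neg ℤ) ?_ ?_
    · intro k
      simp only [lagSet, Finset.mem_filter, Finset.mem_Icc, Equiv.neg_apply, Int.cast_neg,
        neg_div, sub_neg_eq_add, ← sub_eq_add_neg]
      constructor <;> rintro ⟨⟨h1, h2⟩, h3, h4⟩ <;> exact ⟨⟨by omega, by omega⟩, h4, h3⟩
    · intro k _
      simp only [map_mul, Complex.conj_ofReal, ← Complex.exp_conj, map_neg, Complex.conj_I,
        Equiv.neg_apply, Int.cast_neg, neg_div, sub_neg_eq_add, ← sub_eq_add_neg, map_intCast,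
        neg_neg, mul_neg, neg_mul]
      congr 2
      exact mul_comm _ _

/-- The empirical contrast `L_n(g)`, computed from the data `x 1, …, x n`. -/
def empContrast (n : ℕ) (x : ℤ → ℝ) (g : ℝ → ℝ → ℝ) : ℝ :=
  1 / n * ∑ t ∈ Finset.Icc (1 : ℤ) n, 1 / (4 * Real.pi) *
    ∫ l in (-Real.pi)..Real.pi,
      (Real.log (g (t / n) l) + (prePeriodogram n x t l).re / g (t / n) l)

/-- The integrand `(log g + f / g) / (4π)` of the limiting contrast. -/
def contrastIntegrand (f g : ℝ → ℝ → ℝ) (p : ℝ × ℝ) : ℝ :=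
  1 / (4 * Real.pi) * (Real.log (g p.1 p.2) + f p.1 p.2 / g p.1 p.2)

/-- The limiting contrast `L(g)`, the integral of `(log g + f / g) / (4π)` over `[0,1] × [-π,π]`, as
an extended real number: the integral of the positive part minus the integral of the negative
part. -/
def contrast (f g : ℝ → ℝ → ℝ) : EReal :=
  ((∫⁻ p, ENNReal.ofReal (contrastIntegrand f g p) ∂tfMeasure : ℝ≥0∞) : EReal) -
    ((∫⁻ p, ENNReal.ofReal (-contrastIntegrand f g p) ∂tfMeasure : ℝ≥0∞) : EReal)

/-- `g₀` minimizes the limiting contrast over the class `G`. -/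
def IsContrastMin (f : ℝ → ℝ → ℝ) (G : Set (ℝ → ℝ → ℝ)) (g₀ : ℝ → ℝ → ℝ) : Prop :=
  g₀ ∈ G ∧ ∀ g ∈ G, contrast f g₀ ≤ contrast f g

/-- Equality almost everywhere on `[0,1] × [-π,π]`. -/
def EqAE (g h : ℝ → ℝ → ℝ) : Prop :=
  ∀ᵐ p ∂tfMeasure, g p.1 p.2 = h p.1 p.2

/-- Membership in a class of functions, up to null sets. This is what correct specification
`f ∈ F` means. -/
def MemAE (f : ℝ → ℝ → ℝ) (G : Set (ℝ → ℝ → ℝ)) : Prop :=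
  ∃ g ∈ G, EqAE g f

/-! ### Norms, variations and entropy -/

/-- `ρ₂(φ)`, the `L²` norm on `[0,1] × [-π,π]`. -/
def rho2 (φ : ℝ → ℝ → ℝ) : ℝ≥0∞ :=
  eLpNorm (fun p : ℝ × ℝ => φ p.1 p.2) 2 tfMeasure

/-- `ρ₂(φ, ψ) = ρ₂(φ - ψ)`. -/
def rho2Dist (φ ψ : ℝ → ℝ → ℝ) : ℝ≥0∞ :=
  rho2 fun u l => φ u l - ψ u l

/-- The pointwise reciprocal `1 / g`. -/
def recip (g : ℝ → ℝ → ℝ) : ℝ → ℝ → ℝ := fun u l => 1 / g u l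

/-- The class `G* = {1 / g : g ∈ G}`. -/
def recipClass (G : Set (ℝ → ℝ → ℝ)) : Set (ℝ → ℝ → ℝ) := recip '' G

/-- The Fourier coefficient `φ̂(u, j) = ∫ φ(u, λ) exp(iλj) dλ` over `[-π,π]`. -/
def fourierCoef (φ : ℝ → ℝ → ℝ) (u : ℝ) (j : ℤ) : ℂ :=
  ∫ l in (-Real.pi)..Real.pi, (φ u l : ℂ) * Complex.exp (Complex.I * (l : ℂ) * (j : ℂ))

/-- The total variation over `[0,1]` of the Fourier coefficient of order `j`. -/
def coefVariation (φ : ℝ → ℝ → ℝ) (j : ℤ) : ℝ≥0∞ :=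
  eVariationOn (fun u => fourierCoef φ u j) (Set.Icc 0 1)

/-- `ρ_∞(φ) = ∑ⱼ sup_u |φ̂(u, j)|`. -/
def rhoInf (φ : ℝ → ℝ → ℝ) : ℝ≥0∞ :=
  ∑' j : ℤ, ⨆ u ∈ Set.Icc (0 : ℝ) 1, ‖fourierCoef φ u j‖ₑ

/-- `ṽ(φ) = sup_j V(φ̂(·, j))`. -/
def vTilde (φ : ℝ → ℝ → ℝ) : ℝ≥0∞ := ⨆ j : ℤ, coefVariation φ j

/-- `v_Σ(φ) = ∑ⱼ V(φ̂(·, j))`. -/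
def vSum (φ : ℝ → ℝ → ℝ) : ℝ≥0∞ := ∑' j : ℤ, coefVariation φ j

/-- `Φ` is covered by `m` open `ρ₂`-balls of radius `η` with centres in `Φ`. -/
def HasCover (η : ℝ) (Φ : Set (ℝ → ℝ → ℝ)) (m : ℕ) : Prop :=
  ∃ c : Fin m → ℝ → ℝ → ℝ, (∀ i, c i ∈ Φ) ∧
    ∀ φ ∈ Φ, ∃ i, rho2Dist φ (c i) < ENNReal.ofReal η

/-- The covering number `N(η, Φ, ρ₂)`, equal to `∞` if there is no finite cover. -/
def coveringNumber (η : ℝ) (Φ : Set (ℝ → ℝ → ℝ)) : ℕ∞ :=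
  ⨅ (m : ℕ) (_ : 1 ≤ m ∧ HasCover η Φ m), (m : ℕ∞)

/-- The metric entropy `H(η, Φ, ρ₂) = log N(η, Φ, ρ₂)`. -/
def metricEntropy (η : ℝ) (Φ : Set (ℝ → ℝ → ℝ)) : EReal :=
  ENNReal.log ((coveringNumber η Φ : ℕ∞) : ℝ≥0∞)

/-! ### Model classes -/

/-- A class of candidate spectral densities: (jointly measurable) functions that are finite and
strictly positive on `[0,1] × [-π,π]`. -/
def IsModelClass (G : Set (ℝ → ℝ → ℝ)) : Prop :=
  ∀ g ∈ G, Measurable (Function.uncurry g) ∧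
    ∀ u ∈ Set.Icc (0 : ℝ) 1, ∀ l ∈ Set.Icc (-Real.pi) Real.pi, 0 < g u l

/-- The conditions on the sieve `Fn n` (`n ≥ 1`), the target class `F` and the minimizer `fF` of
the limiting contrast. The bounds `Mlow`, `Mup`, `rInf`, `vT`, `vS` may depend on `n`. -/
structure ModelAssumptions (f : ℝ → ℝ → ℝ) (Fn : ℕ → Set (ℝ → ℝ → ℝ)) (F : Set (ℝ → ℝ → ℝ))
    (fF : ℝ → ℝ → ℝ) (Mlow Mup rInf vT vS : ℕ → ℝ) : Prop where
  target_model : IsModelClass F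
  sieve_model : ∀ n, 1 ≤ n → IsModelClass (Fn n)
  min_exists : IsContrastMin f F fF
  min_unique : ∀ g, IsContrastMin f F g → EqAE g fF
  approximation : ∀ φ ∈ recipClass F, ∃ π : ℕ → ℝ → ℝ → ℝ,
    (∀ n, 1 ≤ n → π n ∈ recipClass (Fn n)) ∧
      Tendsto (fun n => rho2Dist φ (π n)) atTop (𝓝 0)
  low_pos : ∀ n, 1 ≤ n → 0 < Mlow n
  low_le_one : ∀ n, 1 ≤ n → Mlow n ≤ 1
  one_le_up : ∀ n, 1 ≤ n → 1 ≤ Mup n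
  bounds : ∀ n, 1 ≤ n → ∀ φ ∈ recipClass (Fn n), ∀ u ∈ Set.Icc (0 : ℝ) 1,
    ∀ l ∈ Set.Icc (-Real.pi) Real.pi, Mlow n ≤ |φ u l| ∧ |φ u l| < Mup n
  rhoInf_le : ∀ n, 1 ≤ n → (⨆ φ ∈ recipClass (Fn n), rhoInf φ) ≤ ENNReal.ofReal (rInf n)
  vTilde_lt : ∀ n, 1 ≤ n → (⨆ φ ∈ recipClass (Fn n), vTilde φ) < ENNReal.ofReal (vT n)
  vSum_le : ∀ n, 1 ≤ n → (⨆ φ ∈ recipClass (Fn n), vSum φ) ≤ ENNReal.ofReal (vS n)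

/-! ### Rates -/

/-- The sieve rate `(M^*/M_*) max(√(c k log n / n), e)` at sample size `n`, with
`c = max(ρ_∞, v_Σ, (M^*)²)` and approximation error `e`. -/
def sieveRate (Mlow Mup rInf vS k : ℕ → ℝ) (e : ℕ → ℝ≥0∞) (n : ℕ) : ℝ≥0∞ :=
  ENNReal.ofReal (Mup n / Mlow n) *
    max (ENNReal.ofReal
      (Real.sqrt (max (max (rInf n) (vS n)) (Mup n ^ 2) * k n * Real.log n / n))) (e n)

/-- The global rate: `n ^ (-1/(2(γ+1)))` for `γ < 1` and
`n ^ (-(2-γ)/(4γ)) (log n) ^ ((γ-1)/(2γ))` for `γ ≥ 1`. -/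
def globalRate (γ : ℝ) (n : ℕ) : ℝ≥0∞ :=
  ENNReal.ofReal (if γ < 1 then (n : ℝ) ^ (-(1 / (2 * (γ + 1))))
    else (n : ℝ) ^ (-((2 - γ) / (4 * γ))) * Real.log n ^ ((γ - 1) / (2 * γ)))

/-- `sup_{g ∈ G} |L̃(g) - L(g)|`. -/
def supGap (G : Set (ℝ → ℝ → ℝ)) (L' L : (ℝ → ℝ → ℝ) → ℝ) : ℝ≥0∞ :=
  ⨆ g ∈ G, ENNReal.ofReal |L' g - L g|

/-- The criterion `Lt` approximates the likelihood contrast of the data `X` uniformly over the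
sieve, up to `o_P (δ_n² / (M^*)²)`. -/
def CriterionClose {Ω : Type*} [MeasurableSpace Ω] (P : Measure Ω) (X : ℕ → ℤ → Ω → ℝ)
    (Fn : ℕ → Set (ℝ → ℝ → ℝ)) (Mup : ℕ → ℝ) (Lt : ℕ → Ω → (ℝ → ℝ → ℝ) → ℝ) (δ : ℕ → ℝ≥0∞) :
    Prop :=
  IsLittleOP P (fun n ω => supGap (Fn n) (Lt n ω) (empContrast n fun t => X n t ω))
    (fun n => δ n ^ 2 / ENNReal.ofReal (Mup n) ^ 2)

/-- `ρ₂(1/f̃_n, 1/f_F) = O_P(δ_n)`. -/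
def ConvergesAtRate {Ω : Type*} [MeasurableSpace Ω] (P : Measure Ω) (ft : ℕ → Ω → ℝ → ℝ → ℝ)
    (fF : ℝ → ℝ → ℝ) (δ : ℕ → ℝ≥0∞) : Prop :=
  IsBigOP P (fun n ω => rho2Dist (recip (ft n ω)) (recip fF)) δ

/-- The approximation error `a_n = inf_{g ∈ F_n} ρ₂(1/f, 1/g)`. -/
def approxError (f : ℝ → ℝ → ℝ) (Fn : ℕ → Set (ℝ → ℝ → ℝ)) (n : ℕ) : ℝ≥0∞ :=
  ⨅ g ∈ Fn n, rho2Dist (recip f) (recip g)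

end LocStat

end

open MeasureTheory ProbabilityTheory Filter Topology
open scoped NNReal ENNReal

set_option linter.unusedSectionVars false

noncomputable section

namespace LocStat

/-! ### Quadratic forms in Gaussian vectors -/

/-! Write φ = 1/g. In terms of φ the limiting contrast is ∫ φ f minus ∫ log φ, up to the factor
1/(4π), hence convex in φ. The empirical contrast differs from it by a term that is linear in φ and
by a Riemann sum error in the logarithm. The rate comes from balancing the curvature of the limit
against the size of the linear term.

Curvature. If the reciprocals form a convex class, strong concavity of the logarithm on (0, M^*],
used at the midpoint of φ and the minimizer, bounds the squared ρ₂-distance by a multiple of (M^*)²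
times the excess contrast (`sq_l2_le_of_convex`). In a correctly specified model the excess contrast
is a difference of integrals of z - 1 - log z at z = φ f. The first integral dominates the squared
distance to 1/f clipped at M^*, and the second is at most quadratic in the distance of the reference
point from 1/f (`sq_l2_le_of_correct`). Clipping is needed because f has no positive lower bound.

Linear term. Integrating the pre-periodogram against φ gives a quadratic form in the observations.
Its coefficients, Fourier coefficients of φ at the times t/n, are replaced by averages over the
cells ((t-1)/n, t/n]. This costs at most v_Σ max X²/n. The matrix then has Frobenius norm at most
ρ₂(φ)/√n and absolute row sums at most ρ_∞(φ)/n, and the expectation of the form is within a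
multiple of ρ_∞/n of ∫ φ f (`exists_bias_bound`). Diagonalization turns the centred form into a
weighted sum of independent centred chi-squared variables. This yields a Bernstein inequality in ρ₂
and ρ_∞ (`smoothedDev_tail`), an exponential inequality in ρ₂ alone (`smoothedDev_tail_l2`), and
sixth moments.

Combination. Minimality of the estimator bounds the excess contrast by the fluctuation of the form
at the difference of the reciprocals, plus remainders (`exists_basic_inequality`). Suppose that,
uniformly over the class, the fluctuation at distance x from the reference point is at most C(xτ +
cτ²). Then curvature gives x² ≤ αxδ + βδ², so x is of order δ (`convergesAtRate`). It remains to
prove the uniform bound.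

For a sieve one net of radius n⁻² suffices: Bernstein's inequality on the net, a deterministic bound
below it (`sieve_fluctuation`). For polynomial entropy, Bernstein's inequality is used on one coarse
net (`fluctuation_of_hasModulus`), and the remaining task is to control differences at the radius of
that net. When γ < 1, finitely many chaining steps lead from radius n^(-1/(γ+1)) down to n⁻²
(`hasModulus_rpow`). When γ ≥ 1, the radius is n^(-1/2) and no entropy enters (`hasModulus_sqrt`):
for each lag the coefficients have bounded variation in time, and a Haar expansion against partial
sums with bounded normalized sixth moments gives a fluctuation of order n^(-1/2). -/

theorem inv_sqrt_one_sub_le {y : ℝ} (hy : |y| ≤ 1 / 2) :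
    (Real.sqrt (1 - y))⁻¹ ≤ Real.exp (y / 2 + 3 / 4 * y ^ 2) := by
  obtain ⟨h1, h2⟩ := abs_le.1 hy
  have hpos : 0 < 1 - y := by linarith
  -- The Taylor polynomial contributes y + y²/2, and the remainder |y|³/(1 - |y|) is at most y²
  -- because |y| ≤ 1/2.
  have hlog : -(y + 3 / 2 * y ^ 2) ≤ Real.log (1 - y) := by
    have habs : |y| < 1 := by linarith
    have h := Real.abs_log_sub_add_sum_range_le habs 2
    simp only [Finset.sum_range_succ, Finset.sum_range_zero] at h
    have h3 : |y| ^ 3 / (1 - |y|) ≤ |y| ^ 2 := by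
      rw [div_le_iff₀ (by linarith)]
      have := sq_nonneg |y|
      nlinarith [abs_nonneg y]
    have h4 := (abs_le.1 h).1
    norm_num at h4
    rw [sq_abs] at h3
    linarith
  rw [← Real.exp_log (inv_pos.2 (Real.sqrt_pos.2 hpos)), Real.exp_le_exp, Real.log_inv,
    Real.log_sqrt hpos.le]
  linarith

/-- The exponential turns the standard normal density into a multiple of the normal density of
variance 1/(1 - y), so the integral is a ratio of normalizing constants. -/
theorem integrable_exp_sq_gaussian {y : ℝ} (hy : y < 1) :
    Integrable (fun x : ℝ => Real.exp (y / 2 * x ^ 2)) (gaussianReal 0 1) ∧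
    ∫ x, Real.exp (y / 2 * x ^ 2) ∂(gaussianReal 0 1) = (Real.sqrt (1 - y))⁻¹ := by
  have hb : 0 < (1 - y) / 2 := by linarith
  have key : ∀ x : ℝ, gaussianPDFReal 0 1 x * Real.exp (y / 2 * x ^ 2)
      = (Real.sqrt (2 * Real.pi))⁻¹ * Real.exp (-((1 - y) / 2) * x ^ 2) := by
    intro x
    rw [gaussianPDFReal]
    simp only [NNReal.coe_one, mul_one, sub_zero]
    rw [mul_assoc, ← Real.exp_add]
    congr 2
    ring
  constructor
  · rw [gaussianReal_of_var_ne_zero _ one_ne_zero]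
    rw [integrable_withDensity_iff_integrable_smul' (measurable_gaussianPDF 0 1)
      (ae_of_all _ fun x => gaussianPDF_lt_top)]
    simp only [gaussianPDF, ENNReal.toReal_ofReal (gaussianPDFReal_nonneg 0 1 _), smul_eq_mul, key]
    exact (integrable_exp_neg_mul_sq hb).const_mul _
  · rw [integral_gaussianReal_eq_integral_smul one_ne_zero]
    simp only [smul_eq_mul, key]
    rw [integral_const_mul, integral_gaussian, ← Real.sqrt_inv, ← Real.sqrt_mul (by positivity),
      ← Real.sqrt_inv]
    congr 1
    have := Real.pi_pos
    field_simp

/-- By independence the transform is a product of chi-squared transforms. Centring cancels the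
linear term in each exponent, and `inv_sqrt_one_sub_le` at y = 2sμᵢ leaves 3s²μᵢ². The restriction
on s keeps |y| ≤ 1/2. -/
theorem chaos_mgf_le {ι : Type*} [Fintype ι] (μ : ι → ℝ) {L s : ℝ} (hμ : ∀ i, |μ i| ≤ L)
    (hs : |s| * L ≤ 1 / 4) :
    Integrable (fun z : ι → ℝ => Real.exp (s * (∑ i, μ i * z i ^ 2 - ∑ i, μ i)))
      (Measure.pi fun _ => gaussianReal 0 1) ∧
    ∫ z, Real.exp (s * (∑ i, μ i * z i ^ 2 - ∑ i, μ i)) ∂(Measure.pi fun _ => gaussianReal 0 1)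
      ≤ Real.exp (3 * s ^ 2 * ∑ i, μ i ^ 2) := by
  have hy : ∀ i, |2 * s * μ i| ≤ 1 / 2 := by
    intro i
    rw [abs_mul, abs_mul, abs_two]
    nlinarith [hμ i, abs_nonneg s, mul_le_mul_of_nonneg_left (hμ i) (abs_nonneg s)]
  have hy1 : ∀ i, 2 * s * μ i < 1 := fun i => by linarith [(abs_le.1 (hy i)).2]
  have key : ∀ z : ι → ℝ, Real.exp (s * (∑ i, μ i * z i ^ 2 - ∑ i, μ i))
      = ∏ i, (Real.exp (-(s * μ i)) * Real.exp ((2 * s * μ i) / 2 * z i ^ 2)) := by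
    intro z
    simp only [← Real.exp_add]
    rw [← Real.exp_sum, mul_sub, Finset.mul_sum, Finset.mul_sum, ← Finset.sum_sub_distrib]
    congr 1
    refine Finset.sum_congr rfl fun i _ => ?_
    ring
  simp only [key]
  constructor
  · exact Integrable.fintype_prod (μ := fun _ : ι => gaussianReal 0 1)
      (f := fun i x => Real.exp (-(s * μ i)) * Real.exp ((2 * s * μ i) / 2 * x ^ 2))
      fun i => (integrable_exp_sq_gaussian (hy1 i)).1.const_mul _
  · rw [integral_fintype_prod_eq_prod (μ := fun _ : ι => gaussianReal 0 1)
      (f := fun i x => Real.exp (-(s * μ i)) * Real.exp ((2 * s * μ i) / 2 * x ^ 2))]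
    rw [Finset.mul_sum, Real.exp_sum]
    refine Finset.prod_le_prod (fun i _ => ?_) fun i _ => ?_
    · exact integral_nonneg fun x => by positivity
    · rw [integral_const_mul, (integrable_exp_sq_gaussian (hy1 i)).2]
      calc _ ≤ Real.exp (-(s * μ i)) * Real.exp (2 * s * μ i / 2 + 3 / 4 * (2 * s * μ i) ^ 2) := by
            gcongr
            exact inv_sqrt_one_sub_le (hy i)
        _ = _ := by
            rw [← Real.exp_add]
            congr 1
            ring

/-- Both sides are the squared Hilbert–Schmidt norm, the sum of the squared matrix entries. It
allows an eigenbasis to be exchanged for the coordinate basis. -/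
theorem sum_norm_sq_eq_adjoint {E ι κ : Type*} [NormedAddCommGroup E] [InnerProductSpace ℝ E]
    [CompleteSpace E] [Fintype ι] [Fintype κ] (b : OrthonormalBasis ι ℝ E)
    (e : OrthonormalBasis κ ℝ E) (S : E →L[ℝ] E) :
    ∑ i, ‖S (b i)‖ ^ 2 = ∑ j, ‖ContinuousLinearMap.adjoint S (e j)‖ ^ 2 := by
  have h1 : ∀ i, ‖S (b i)‖ ^ 2 = ∑ j, (inner ℝ (e j) (S (b i))) ^ 2 := fun i => by
    rw [← e.sum_sq_norm_inner_right]
    simp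
  have h2 : ∀ j, ‖ContinuousLinearMap.adjoint S (e j)‖ ^ 2
      = ∑ i, (inner ℝ (b i) (ContinuousLinearMap.adjoint S (e j))) ^ 2 := fun i => by
    rw [← b.sum_sq_norm_inner_right]
    simp
  simp only [h1, h2]
  rw [Finset.sum_comm]
  refine Finset.sum_congr rfl fun j _ => Finset.sum_congr rfl fun i _ => ?_
  rw [ContinuousLinearMap.adjoint_inner_right, real_inner_comm]

/-- Diagonalization of a quadratic form in a Gaussian image `A z` of a standard Gaussian vector. -/
theorem exists_eigenvalues_stdGaussian {E κ : Type*} [NormedAddCommGroup E] [InnerProductSpace ℝ E]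
    [FiniteDimensional ℝ E] [MeasurableSpace E] [BorelSpace E] [Fintype κ]
    (e : OrthonormalBasis κ ℝ E) (A U : E →L[ℝ] E) (hA : ContinuousLinearMap.adjoint A = A)
    (hU : ContinuousLinearMap.adjoint U = U) {C L : ℝ} (hL0 : 0 ≤ L) (hAC : ∀ x, ‖A x‖ ^ 2 ≤ C * ‖x‖ ^ 2)
    (hL : ∀ x, |inner ℝ x (U x)| ≤ L * ‖x‖ ^ 2) :
    ∃ μ : Fin (Module.finrank ℝ E) → ℝ, (∀ i, |μ i| ≤ C * L) ∧
      ∑ i, μ i ^ 2 ≤ C ^ 2 * ∑ j, ‖U (e j)‖ ^ 2 ∧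
      (stdGaussian E).map (fun x => inner ℝ (A x) (U (A x)))
        = (Measure.pi fun _ => gaussianReal 0 1).map (fun z => ∑ i, μ i * z i ^ 2) := by
  -- The form at `A z` is the form of the symmetric operator A U A at z. By rotation invariance of
  -- the standard Gaussian, its coordinates in an eigenbasis are again independent standard normal.
  set T : E →L[ℝ] E := A ∘L U ∘L A with hT
  have hTs : (T : E →ₗ[ℝ] E).IsSymmetric := by
    intro x y
    simp only [hT, ContinuousLinearMap.coe_coe, ContinuousLinearMap.comp_apply]
    nth_rewrite 1 [← hA]
    rw [ContinuousLinearMap.adjoint_inner_left]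
    nth_rewrite 1 [← hU]
    rw [ContinuousLinearMap.adjoint_inner_left]
    nth_rewrite 1 [← hA]
    rw [ContinuousLinearMap.adjoint_inner_left]
  set b := hTs.eigenvectorBasis rfl with hb
  set μ := hTs.eigenvalues rfl with hμ
  have hTb : ∀ i, T (b i) = μ i • b i := fun i => hTs.apply_eigenvectorBasis rfl i
  have hAA : ∀ x y, inner ℝ x (A y) = inner ℝ (A x) y := fun x y => by
    rw [← ContinuousLinearMap.adjoint_inner_left, hA]
  refine ⟨μ, fun i => ?_, ?_, ?_⟩
  · have h1 : inner ℝ (b i) (T (b i)) = μ i := by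
      rw [hTb, inner_smul_right, real_inner_self_eq_norm_sq, b.norm_eq_one]
      simp
    rw [← h1]
    simp only [hT, ContinuousLinearMap.comp_apply, hAA]
    refine (hL _).trans ?_
    have := hAC (b i)
    rw [b.norm_eq_one] at this
    nlinarith
  · have hC : ∀ i, 0 ≤ C := fun i : Fin (Module.finrank ℝ E) => by
      have := hAC (b i)
      rw [b.norm_eq_one] at this
      nlinarith [sq_nonneg ‖A (b i)‖]
    have h1 : ∀ i, μ i ^ 2 ≤ C * ‖(U ∘L A) (b i)‖ ^ 2 := fun i => by
      have : ‖T (b i)‖ ^ 2 = μ i ^ 2 := by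
        rw [hTb, norm_smul, b.norm_eq_one]
        simp
      rw [← this]
      exact hAC _
    rcases isEmpty_or_nonempty (Fin (Module.finrank ℝ E)) with he | ⟨⟨i0⟩⟩
    · simp only [Finset.univ_eq_empty, Finset.sum_empty]
      positivity
    have hC0 := hC i0
    -- The left factor `A` costs one `C`. Passing to the adjoint moves the other `A` to the left,
    -- where it costs a second one.
    calc ∑ i, μ i ^ 2 ≤ ∑ i, C * ‖(U ∘L A) (b i)‖ ^ 2 := Finset.sum_le_sum fun i _ => h1 i
      _ = C * ∑ j, ‖(A ∘L U) (e j)‖ ^ 2 := by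
          rw [← Finset.mul_sum, sum_norm_sq_eq_adjoint b e, ContinuousLinearMap.adjoint_comp, hA, hU]
      _ ≤ C * ∑ j, C * ‖U (e j)‖ ^ 2 := by
          gcongr with j
          exact hAC _
      _ = _ := by
          rw [← Finset.mul_sum]
          ring
  · rw [stdGaussian_eq_map_pi_orthonormalBasis b, Measure.map_map]
    · congr 1
      ext z
      simp only [Function.comp_apply]
      rw [← hAA, show A (U (A (∑ i, z i • b i))) = T (∑ i, z i • b i) from rfl, map_sum]
      simp only [map_smul, hTb, smul_smul]
      rw [b.orthonormal.inner_sum]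
      refine Finset.sum_congr rfl fun i _ => ?_
      simp
      ring
    · fun_prop
    · fun_prop

/-- Gaussian measures are determined by mean and covariance form, so it is enough to compare these
two. -/
theorem map_toLp_eq_multivariateGaussian {Ω ι : Type*} [MeasurableSpace Ω] {P : Measure Ω}
    [IsProbabilityMeasure P] [Fintype ι] [DecidableEq ι] {X : ι → Ω → ℝ}
    (hX : HasGaussianLaw (fun ω i => X i ω) P) (h0 : ∀ i, ∫ ω, X i ω ∂P = 0) :
    (Matrix.of fun i j => cov[X i, X j; P]).PosSemidef ∧
    P.map (fun ω => WithLp.toLp 2 (X · ω))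
      = multivariateGaussian 0 (Matrix.of fun i j => cov[X i, X j; P]) := by
  have hL : ∀ i, MemLp (X i) 2 P := fun i => (hX.eval i).memLp_two
  have hG := (hX.toLp_pi 2)
  have hpos : (Matrix.of fun i j => cov[X i, X j; P]).PosSemidef := by
    refine Matrix.PosSemidef.of_dotProduct_mulVec_nonneg ?_ fun x => ?_
    · ext i j
      simp [covariance_comm]
    · have h := covarianceBilin_self_nonneg (μ := P.map (fun ω => WithLp.toLp 2 (X · ω)))
        (WithLp.toLp 2 x)
      rw [covarianceBilin_apply_pi hL] at h
      refine h.trans_eq ?_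
      simp only [dotProduct, Matrix.mulVec, Matrix.of_apply, Finset.mul_sum]
      refine Finset.sum_congr rfl fun i _ => Finset.sum_congr rfl fun j _ => ?_
      simp
      ring
  refine ⟨hpos, ?_⟩
  have : IsGaussian (P.map (fun ω => WithLp.toLp 2 (X · ω))) := hG.isGaussian_map
  refine IsGaussian.ext ?_ ?_
  · rw [integral_id_multivariateGaussian']
    rw [integral_map hG.aemeasurable (by fun_prop)]
    ext i
    simp only [id_eq]
    rw [eval_integral_piLp fun i => (hX.eval i).integrable]
    simpa using h0 i
  · ext x y
    rw [covarianceBilin_apply_pi hL, covarianceBilin_multivariateGaussian hpos]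
    simp only [dotProduct, Matrix.mulVec, Matrix.of_apply, Finset.mul_sum]
    refine Finset.sum_congr rfl fun i _ => Finset.sum_congr rfl fun j _ => ?_
    ring

open scoped MatrixOrder in
/-- A quadratic form in a centred Gaussian vector is distributed as a weighted sum of independent
chi-squared variables, with weights controlled by the operator and Frobenius norms. -/
theorem exists_chaos_law {Ω ι : Type*} [MeasurableSpace Ω] {P : Measure Ω}
    [IsProbabilityMeasure P] [Fintype ι] [DecidableEq ι] {X : ι → Ω → ℝ}
    (hX : HasGaussianLaw (fun ω i => X i ω) P) (h0 : ∀ i, ∫ ω, X i ω ∂P = 0) {C L : ℝ} (hL0 : 0 ≤ L)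
    (hC : ∀ x : ι → ℝ, ∑ i, ∑ j, x i * x j * ∫ ω, X i ω * X j ω ∂P ≤ C * ∑ i, x i ^ 2)
    (U : Matrix ι ι ℝ) (hU : ∀ i j, U i j = U j i)
    (hL : ∀ x : ι → ℝ, |∑ i, ∑ j, U i j * (x i * x j)| ≤ L * ∑ i, x i ^ 2) :
    ∃ (m : ℕ) (μ : Fin m → ℝ), (∀ i, |μ i| ≤ C * L) ∧
      ∑ i, μ i ^ 2 ≤ C ^ 2 * ∑ i, ∑ j, U i j ^ 2 ∧
      P.map (fun ω => ∑ i, ∑ j, U i j * (X i ω * X j ω))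
        = (Measure.pi fun _ => gaussianReal 0 1).map (fun z => ∑ i, μ i * z i ^ 2) := by
  obtain ⟨hpos, hlaw⟩ := map_toLp_eq_multivariateGaussian hX h0
  set S : Matrix ι ι ℝ := Matrix.of fun i j => cov[X i, X j; P] with hS
  have hMem : ∀ i, MemLp (X i) 2 P := fun i => (hX.eval i).memLp_two
  have hcov : ∀ i j, S i j = ∫ ω, X i ω * X j ω ∂P := fun i j => by
    simp only [hS, Matrix.of_apply]
    rw [covariance_eq_sub (hMem i) (hMem j), h0, h0]
    simp
  have hsq : ∀ x : EuclideanSpace ℝ ι, ‖x‖ ^ 2 = ∑ i, x i ^ 2 := fun x =>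
    EuclideanSpace.real_norm_sq_eq x
  -- The square root of the covariance matrix represents the Gaussian vector as `A z` with z
  -- standard. Then ‖A x‖² is the covariance form at x, which `hC` bounds.
  set A : EuclideanSpace ℝ ι →L[ℝ] EuclideanSpace ℝ ι :=
    Matrix.toEuclideanCLM (𝕜 := ℝ) (CFC.sqrt S) with hAdef
  set V : EuclideanSpace ℝ ι →L[ℝ] EuclideanSpace ℝ ι := Matrix.toEuclideanCLM (𝕜 := ℝ) U with hV
  have hA : ContinuousLinearMap.adjoint A = A :=
    IsSelfAdjoint.adjoint_eq ((CFC.sqrt_nonneg S).isSelfAdjoint.map _)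
  have hUs : IsSelfAdjoint U := by
    ext i j
    simp [hU i j]
  have hVs : ContinuousLinearMap.adjoint V = V := IsSelfAdjoint.adjoint_eq (hUs.map _)
  have hVq : ∀ x : EuclideanSpace ℝ ι, inner ℝ x (V x) = ∑ i, ∑ j, U i j * (x i * x j) := by
    intro x
    rw [hV, Matrix.inner_toEuclideanCLM]
    simp only [dotProduct, Matrix.mulVec, Finset.mul_sum]
    refine Finset.sum_congr rfl fun i _ => Finset.sum_congr rfl fun j _ => ?_
    ring
  have hAC : ∀ x, ‖A x‖ ^ 2 ≤ C * ‖x‖ ^ 2 := by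
    intro x
    rw [← real_inner_self_eq_norm_sq]
    nth_rewrite 1 [← hA]
    rw [ContinuousLinearMap.adjoint_inner_left, ← mul_apply_eq_comp, hAdef, ← map_mul,
      CFC.sqrt_mul_sqrt_self _ hpos.nonneg, Matrix.inner_toEuclideanCLM, hsq]
    refine le_trans (le_of_eq ?_) (hC fun i => x i)
    simp only [dotProduct, Matrix.mulVec, Finset.mul_sum, ← hcov]
    refine Finset.sum_congr rfl fun i _ => Finset.sum_congr rfl fun j _ => ?_
    ring
  obtain ⟨μ, h1, h2, h3⟩ := exists_eigenvalues_stdGaussian (EuclideanSpace.basisFun ι ℝ) A V hA hVs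
    hL0 hAC (fun x => by rw [hVq, hsq]; exact hL _)
  refine ⟨_, μ, h1, h2.trans_eq ?_, ?_⟩
  · congr 1
    rw [Finset.sum_comm]
    refine Finset.sum_congr rfl fun j _ => ?_
    rw [hsq]
    refine Finset.sum_congr rfl fun i _ => ?_
    simp [hV]
  · rw [← h3]
    have e1 : (fun ω => ∑ i, ∑ j, U i j * (X i ω * X j ω))
        = (fun x : EuclideanSpace ℝ ι => inner ℝ x (V x)) ∘ fun ω => WithLp.toLp 2 (X · ω) := by
      ext ω
      simp only [Function.comp_apply, hVq]
    rw [e1, ← AEMeasurable.map_map_of_aemeasurable (by fun_prop) (hX.toLp_pi 2).aemeasurable, hlaw,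
      multivariateGaussian, Measure.map_map (by fun_prop) (by fun_prop)]
    congr 1
    ext x
    simp [hAdef]

theorem integral_sum_mul_sq_gaussian {m : ℕ} (μ : Fin m → ℝ) :
    ∫ z, (∑ i, μ i * z i ^ 2) ∂(Measure.pi fun _ : Fin m => gaussianReal 0 1) = ∑ i, μ i := by
  have hsq : ∀ i : Fin m, Integrable (fun z : Fin m → ℝ => z i ^ 2)
      (Measure.pi fun _ => gaussianReal 0 1) := fun i =>
    integrable_comp_eval (μ := fun _ : Fin m => gaussianReal 0 1) (i := i)
      (f := fun x => x ^ 2) (memLp_id_gaussianReal 2).integrable_sq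
  rw [integral_finsetSum _ fun i _ => (hsq i).const_mul _]
  refine Finset.sum_congr rfl fun i _ => ?_
  rw [integral_const_mul, integral_comp_eval (μ := fun _ : Fin m => gaussianReal 0 1) (i := i)
    (f := fun x => x ^ 2) (by fun_prop)]
  have h := variance_eq_sub (memLp_id_gaussianReal (μ := 0) (v := 1) 2)
  rw [variance_id_gaussianReal] at h
  simp at h
  rw [← h, mul_one]

/-- Chernoff's bound. The optimal exponent is of order √T/F, and it is used when `chaos_mgf_le`
admits it. Otherwise the largest admissible value 1/(4L) is taken; in that regime F ≤ 4L√T, which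
absorbs the quadratic term into √T F/L. -/
theorem chaos_tail {m : ℕ} (μ : Fin m → ℝ) {F L T : ℝ} (hF : 0 < F) (hL : 0 < L) (hT : 0 ≤ T)
    (hμ : ∀ i, |μ i| ≤ L) (hμF : ∑ i, μ i ^ 2 ≤ F ^ 2) :
    (Measure.pi fun _ : Fin m => gaussianReal 0 1)
      {z | 4 * (Real.sqrt T * F + L * T) < |∑ i, μ i * z i ^ 2 - ∑ i, μ i|}
      ≤ ENNReal.ofReal (2 * Real.exp (-T)) := by
  set W : (Fin m → ℝ) → ℝ := fun z => ∑ i, μ i * z i ^ 2 - ∑ i, μ i with hW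
  set π : Measure (Fin m → ℝ) := Measure.pi fun _ : Fin m => gaussianReal 0 1 with hπ
  obtain ⟨s, hs0, hsL, hs⟩ : ∃ s, 0 ≤ s ∧ s * L ≤ 1 / 4 ∧
      T + 3 * s ^ 2 * F ^ 2 ≤ s * (4 * (Real.sqrt T * F + L * T)) := by
    have hq := Real.sq_sqrt hT
    have hq0 := Real.sqrt_nonneg T
    rcases le_total (Real.sqrt T / F * L) (1 / 4) with h | h
    · refine ⟨Real.sqrt T / F, by positivity, h, ?_⟩
      have h1 : Real.sqrt T / F * F = Real.sqrt T := by field_simp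
      have h2 : (Real.sqrt T / F) ^ 2 * F ^ 2 = T := by rw [← mul_pow, h1, hq]
      have h3 : Real.sqrt T / F * (4 * (Real.sqrt T * F + L * T))
          = 4 * (Real.sqrt T * (Real.sqrt T / F * F)) + 4 * (Real.sqrt T / F * L) * T := by ring
      rw [h3, mul_assoc, h2, h1, ← sq, hq]
      have : 0 ≤ 4 * (Real.sqrt T / F * L) * T := by positivity
      linarith
    · refine ⟨1 / (4 * L), by positivity, by field_simp; norm_num, ?_⟩
      have h1 : F ≤ 4 * L * Real.sqrt T := by
        rw [div_mul_eq_mul_div, le_div_iff₀ hF] at h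
        linarith
      have h3 : 1 / (4 * L) * (4 * (Real.sqrt T * F + L * T)) = Real.sqrt T * F / L + T := by
        field_simp
      rw [h3]
      have h4 : 3 * (1 / (4 * L)) ^ 2 * F ^ 2 = 3 / 16 * (F * F) / L ^ 2 := by field_simp; ring
      have h5 : Real.sqrt T * F / L = Real.sqrt T * L * F / L ^ 2 := by field_simp
      rw [h4, h5, add_comm]
      refine add_le_add (div_le_div_of_nonneg_right ?_ (by positivity)) le_rfl
      nlinarith [mul_nonneg hq0 hL.le]
  have key : ∀ r : ℝ, |r| = s → π {z | s * (4 * (Real.sqrt T * F + L * T)) ≤ r * W z}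
      ≤ ENNReal.ofReal (Real.exp (-T)) := by
    intro r hr
    obtain ⟨hi, hb⟩ := chaos_mgf_le μ hμ (s := r) (by rw [hr]; exact hsL)
    have hm := measure_ge_le_exp_mul_mgf (μ := π) (X := fun z => r * W z) (t := 1)
      (s * (4 * (Real.sqrt T * F + L * T))) zero_le_one (by simpa using hi)
    have h2 : π.real {z | s * (4 * (Real.sqrt T * F + L * T)) ≤ r * W z} ≤ Real.exp (-T) := by
      refine hm.trans ?_
      have h3 : mgf (fun z => r * W z) π 1 ≤ Real.exp (3 * s ^ 2 * F ^ 2) := by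
        simp only [mgf, one_mul]
        refine hb.trans ?_
        rw [← sq_abs r, hr]
        gcongr
      calc _ ≤ Real.exp (-1 * (s * (4 * (Real.sqrt T * F + L * T)))) * Real.exp (3 * s ^ 2 * F ^ 2) := by
            gcongr
        _ ≤ _ := by
            rw [← Real.exp_add, Real.exp_le_exp]
            linarith
    rw [← ENNReal.ofReal_toReal (measure_ne_top π _)]
    exact ENNReal.ofReal_le_ofReal h2
  have hsub : {z | 4 * (Real.sqrt T * F + L * T) < |W z|} ⊆
      {z | s * (4 * (Real.sqrt T * F + L * T)) ≤ s * W z} ∪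
      {z | s * (4 * (Real.sqrt T * F + L * T)) ≤ -s * W z} := by
    intro z hz
    simp only [Set.mem_ofPred_eq, Set.mem_union] at hz ⊢
    rcases lt_abs.1 hz with h | h
    · exact Or.inl (by gcongr)
    · right
      rw [neg_mul, ← mul_neg]
      gcongr
  calc π {z | 4 * (Real.sqrt T * F + L * T) < |W z|} ≤ _ := measure_mono hsub
    _ ≤ _ := measure_union_le _ _
    _ ≤ ENNReal.ofReal (Real.exp (-T)) + ENNReal.ofReal (Real.exp (-T)) :=
        add_le_add (key s (abs_of_nonneg hs0)) (key (-s) (by rw [abs_neg, abs_of_nonneg hs0]))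
    _ = _ := by
        rw [← ENNReal.ofReal_add (by positivity) (by positivity)]
        congr 1
        ring

/-- Since |w|⁶/720 ≤ exp |w|, the sixth moment is controlled by the transform at ±1/(4F). The bound
on the sum of squares makes each weight at most F, so these exponents are admissible, and 720 · 4⁶ ·
6 is below 10⁸. -/
theorem chaos_sixth_moment {m : ℕ} (μ : Fin m → ℝ) {F : ℝ} (hF : 0 < F)
    (hμF : ∑ i, μ i ^ 2 ≤ F ^ 2) :
    ∫⁻ z, ENNReal.ofReal ((∑ i, μ i * z i ^ 2 - ∑ i, μ i) ^ 6)
      ∂(Measure.pi fun _ : Fin m => gaussianReal 0 1) ≤ ENNReal.ofReal (10 ^ 8 * F ^ 6) := by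
  have hμ : ∀ i, |μ i| ≤ F := fun i => by
    refine abs_le_of_sq_le_sq ?_ hF.le
    exact (Finset.single_le_sum (f := fun i => μ i ^ 2) (fun i _ => sq_nonneg _)
      (Finset.mem_univ i)).trans hμF
  set s := 1 / (4 * F) with hs
  have hs0 : 0 < s := by positivity
  have hsF : s * F = 1 / 4 := by rw [hs]; field_simp
  obtain ⟨hi1, hb1⟩ := chaos_mgf_le μ hμ (s := s) (by rw [abs_of_pos hs0, hsF])
  obtain ⟨hi2, hb2⟩ := chaos_mgf_le μ hμ (s := -s) (by rw [abs_neg, abs_of_pos hs0, hsF])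
  have hpt : ∀ w : ℝ, w ^ 6 ≤ 720 * (4 * F) ^ 6 * (Real.exp (s * w) + Real.exp (-s * w)) := by
    intro w
    have h1 : |s * w| ^ 6 / 720 ≤ Real.exp |s * w| := by
      have := Real.pow_div_factorial_le_exp (x := |s * w|) (abs_nonneg _) 6
      simpa only [show (Nat.factorial 6 : ℝ) = 720 by norm_num [Nat.factorial]] using this
    have h2 : Real.exp |s * w| ≤ Real.exp (s * w) + Real.exp (-s * w) := by
      rcases abs_cases (s * w) with ⟨h, _⟩ | ⟨h, _⟩ <;> rw [h]
      · linarith [Real.exp_pos (-s * w)]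
      · rw [neg_mul]; linarith [Real.exp_pos (s * w)]
    have h3 : |s * w| ^ 6 = s ^ 6 * w ^ 6 := by
      rw [← mul_pow, ← abs_pow, abs_of_nonneg (by positivity)]
    have h4 : (4 * F) ^ 6 * s ^ 6 = 1 := by
      rw [← mul_pow, hs]
      field_simp
    calc w ^ 6 = ((4 * F) ^ 6 * s ^ 6) * w ^ 6 := by rw [h4, one_mul]
      _ = 720 * (4 * F) ^ 6 * (|s * w| ^ 6 / 720) := by rw [h3]; ring
      _ ≤ _ := by
          gcongr
          exact h1.trans h2
  have hexp : Real.exp (3 * s ^ 2 * ∑ i, μ i ^ 2) ≤ 3 := by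
    have : 3 * s ^ 2 * ∑ i, μ i ^ 2 ≤ 1 := by
      calc 3 * s ^ 2 * ∑ i, μ i ^ 2 ≤ 3 * s ^ 2 * F ^ 2 := by gcongr
        _ = 3 * (s * F) ^ 2 := by ring
        _ ≤ 1 := by rw [hsF]; norm_num
    calc _ ≤ Real.exp 1 := Real.exp_le_exp.2 this
      _ ≤ 3 := Real.exp_one_lt_three.le
  rw [neg_sq] at hb2
  calc _ ≤ ∫⁻ z, ENNReal.ofReal (720 * (4 * F) ^ 6 *
        (Real.exp (s * (∑ i, μ i * z i ^ 2 - ∑ i, μ i)) +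
          Real.exp (-s * (∑ i, μ i * z i ^ 2 - ∑ i, μ i))))
        ∂(Measure.pi fun _ : Fin m => gaussianReal 0 1) :=
        lintegral_mono fun z => ENNReal.ofReal_le_ofReal (hpt _)
    _ = ENNReal.ofReal (∫ z, (720 * (4 * F) ^ 6 *
        (Real.exp (s * (∑ i, μ i * z i ^ 2 - ∑ i, μ i)) +
          Real.exp (-s * (∑ i, μ i * z i ^ 2 - ∑ i, μ i))))
        ∂(Measure.pi fun _ : Fin m => gaussianReal 0 1)) :=
        (ofReal_integral_eq_lintegral_ofReal ((hi1.add hi2).const_mul _)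
          (ae_of_all _ fun z => by
            simp only [Pi.zero_apply, Pi.add_apply]
            have : 0 ≤ (4 * F) ^ 6 := by positivity
            positivity)).symm
    _ ≤ _ := by
        refine ENNReal.ofReal_le_ofReal ?_
        rw [integral_const_mul, integral_add hi1 hi2]
        calc _ ≤ 720 * (4 * F) ^ 6 * (3 + 3) := by
              gcongr
              · exact hb1.trans hexp
              · exact hb2.trans hexp
          _ ≤ _ := by
              have : 0 < F ^ 6 := by positivity
              ring_nf
              nlinarith

section QuadForm

variable {Ω ι : Type*} [MeasurableSpace Ω] {P : Measure Ω} [IsProbabilityMeasure P] [Fintype ι]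
  {X : ι → Ω → ℝ}

/-- The centred quadratic form `∑ U i j (X i X j - E X i X j)`. -/
def centredForm (P : Measure Ω) (X : ι → Ω → ℝ) (U : ι → ι → ℝ) (ω : Ω) : ℝ :=
  ∑ i, ∑ j, U i j * (X i ω * X j ω - ∫ ω', X i ω' * X j ω' ∂P)

/-- The products of observations are symmetric in the indices, so only the symmetric part of the
coefficients matters. Diagonalization needs a symmetric matrix. -/
theorem centredForm_symmetrize (U : ι → ι → ℝ) (ω : Ω) :
    centredForm P X U ω = centredForm P X (fun i j => (U i j + U j i) / 2) ω := by
  have h : centredForm P X U ω = centredForm P X (fun i j => U j i) ω := by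
    unfold centredForm
    rw [Finset.sum_comm]
    refine Finset.sum_congr rfl fun i _ => Finset.sum_congr rfl fun j _ => ?_
    simp only [mul_comm (X j _) (X i _)]
  have h2 : centredForm P X (fun i j => (U i j + U j i) / 2) ω
      = (centredForm P X U ω + centredForm P X (fun i j => U j i) ω) / 2 := by
    unfold centredForm
    rw [← Finset.sum_add_distrib, Finset.sum_div]
    refine Finset.sum_congr rfl fun i _ => ?_
    rw [← Finset.sum_add_distrib, Finset.sum_div]
    refine Finset.sum_congr rfl fun j _ => ?_
    ring
  rw [h2, ← h]
  ring

theorem sum_sq_symmetrize_le (U : ι → ι → ℝ) :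
    ∑ i, ∑ j, ((U i j + U j i) / 2) ^ 2 ≤ ∑ i, ∑ j, U i j ^ 2 := by
  have h : ∑ i, ∑ j, ((U i j + U j i) / 2) ^ 2 ≤ ∑ i, ∑ j, (U i j ^ 2 + U j i ^ 2) / 2 := by
    gcongr with i _ j _
    nlinarith [sq_nonneg (U i j - U j i)]
  refine h.trans_eq ?_
  simp only [← Finset.sum_div, Finset.sum_add_distrib]
  rw [Finset.sum_comm (f := fun i j => U j i ^ 2)]
  ring

/-- The Schur test. -/
theorem abs_form_le_of_row_sums {U : ι → ι → ℝ} {L : ℝ} (hr : ∀ i, ∑ j, |U i j| ≤ L)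
    (hc : ∀ j, ∑ i, |U i j| ≤ L) (x : ι → ℝ) :
    |∑ i, ∑ j, U i j * (x i * x j)| ≤ L * ∑ i, x i ^ 2 := by
  calc |∑ i, ∑ j, U i j * (x i * x j)| ≤ ∑ i, ∑ j, |U i j * (x i * x j)| :=
        (Finset.abs_sum_le_sum_abs _ _).trans
          (Finset.sum_le_sum fun i _ => Finset.abs_sum_le_sum_abs _ _)
    _ ≤ ∑ i, ∑ j, (|U i j| * x i ^ 2 / 2 + |U i j| * x j ^ 2 / 2) := by
        gcongr with i _ j _
        rw [abs_mul, ← add_div, ← mul_add, mul_div_assoc]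
        gcongr
        rw [abs_le]
        constructor <;> nlinarith [sq_nonneg (x i + x j), sq_nonneg (x i - x j)]
    _ = ∑ i, (∑ j, |U i j|) * x i ^ 2 / 2 + ∑ j, (∑ i, |U i j|) * x j ^ 2 / 2 := by
        simp only [Finset.sum_add_distrib]
        congr 1
        · simp only [Finset.sum_mul, Finset.sum_div]
        · rw [Finset.sum_comm]
          simp only [Finset.sum_mul, Finset.sum_div]
    _ ≤ ∑ i, L * x i ^ 2 / 2 + ∑ j, L * x j ^ 2 / 2 := by
        gcongr with i _ i _
        · exact hr i
        · exact hc i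
    _ = L * ∑ i, x i ^ 2 := by
        rw [← Finset.sum_div, ← Finset.mul_sum]
        ring

/-- Cauchy–Schwarz over pairs of indices: the Frobenius norm dominates the operator norm. -/
theorem abs_form_le_of_sum_sq {U : ι → ι → ℝ} {F : ℝ} (hF : 0 ≤ F)
    (hU : ∑ i, ∑ j, U i j ^ 2 ≤ F ^ 2) (x : ι → ℝ) :
    |∑ i, ∑ j, U i j * (x i * x j)| ≤ F * ∑ i, x i ^ 2 := by
  refine abs_le_of_sq_le_sq ?_ (by positivity)
  simp only [← Finset.sum_product', Finset.univ_product_univ] at *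
  calc (∑ p : ι × ι, U p.1 p.2 * (x p.1 * x p.2)) ^ 2
      ≤ (∑ p : ι × ι, U p.1 p.2 ^ 2) * ∑ p : ι × ι, (x p.1 * x p.2) ^ 2 :=
        Finset.sum_mul_sq_le_sq_mul_sq _ _ _
    _ = (∑ p : ι × ι, U p.1 p.2 ^ 2) * (∑ i, x i ^ 2) ^ 2 := by
        congr 1
        rw [sq (∑ i, x i ^ 2), Finset.sum_mul_sum, ← Finset.sum_product', Finset.univ_product_univ]
        simp only [mul_pow]
    _ ≤ F ^ 2 * (∑ i, x i ^ 2) ^ 2 := by gcongr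
    _ = _ := by ring

/-- Distributional representation of a centred quadratic form with symmetric coefficients. -/
theorem exists_centred_chaos_law (hX : HasGaussianLaw (fun ω i => X i ω) P)
    (h0 : ∀ i, ∫ ω, X i ω ∂P = 0) {C L : ℝ} (hL0 : 0 ≤ L)
    (hC : ∀ i, ∑ j, |∫ ω, X i ω * X j ω ∂P| ≤ C)
    (U : ι → ι → ℝ) (hU : ∀ i j, U i j = U j i)
    (hL : ∀ x : ι → ℝ, |∑ i, ∑ j, U i j * (x i * x j)| ≤ L * ∑ i, x i ^ 2) :
    ∃ (m : ℕ) (μ : Fin m → ℝ), (∀ i, |μ i| ≤ C * L) ∧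
      ∑ i, μ i ^ 2 ≤ C ^ 2 * ∑ i, ∑ j, U i j ^ 2 ∧ AEMeasurable (centredForm P X U) P ∧
      P.map (centredForm P X U)
        = (Measure.pi fun _ => gaussianReal 0 1).map (fun z => ∑ i, μ i * z i ^ 2 - ∑ i, μ i) := by
  classical
  have hCx : ∀ x : ι → ℝ, ∑ i, ∑ j, x i * x j * ∫ ω, X i ω * X j ω ∂P ≤ C * ∑ i, x i ^ 2 := by
    intro x
    refine le_trans (le_of_eq ?_) ((le_abs_self _).trans (abs_form_le_of_row_sums
      (U := fun i j => ∫ ω, X i ω * X j ω ∂P) hC (fun j => ?_) x))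
    · refine Finset.sum_congr rfl fun i _ => Finset.sum_congr rfl fun j _ => ?_
      ring
    · simpa only [mul_comm] using hC j
  obtain ⟨m, μ, h1, h2, h3⟩ := exists_chaos_law hX h0 hL0 hCx (Matrix.of U) hU hL
  simp only [Matrix.of_apply] at h2 h3
  have hint : ∀ i j, Integrable (fun ω => X i ω * X j ω) P := fun i j =>
    (hX.eval i).memLp_two.integrable_mul (hX.eval j).memLp_two
  have hme : AEMeasurable (fun ω => ∑ i, ∑ j, U i j * (X i ω * X j ω)) P := by
    have : ∀ i, AEMeasurable (X i) P := fun i => (hX.eval i).aemeasurable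
    fun_prop
  -- Equality of the uncentred laws gives equality of their means, so both sides can be centred
  -- simultaneously.
  have hmean : ∑ i, ∑ j, U i j * ∫ ω, X i ω * X j ω ∂P = ∑ i, μ i := by
    rw [← integral_sum_mul_sq_gaussian]
    have e1 := integral_map (μ := P) hme (f := fun y : ℝ => y) (by fun_prop)
    have e2 := integral_map (μ := Measure.pi fun _ : Fin m => gaussianReal 0 1)
      (φ := fun z => ∑ i, μ i * z i ^ 2) (Measurable.aemeasurable (by fun_prop)) (f := fun y : ℝ => y) (by fun_prop)
    rw [h3] at e1
    rw [← e2, e1, integral_finsetSum _ fun i _ => integrable_finsetSum _ fun j _ =>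
      (hint i j).const_mul _]
    refine Finset.sum_congr rfl fun i _ => ?_
    rw [integral_finsetSum _ fun j _ => (hint i j).const_mul _]
    refine Finset.sum_congr rfl fun j _ => ?_
    rw [integral_const_mul]
  have hform : centredForm P X U
      = (fun y => y - ∑ i, μ i) ∘ fun ω => ∑ i, ∑ j, U i j * (X i ω * X j ω) := by
    ext ω
    simp only [centredForm, mul_sub, Finset.sum_sub_distrib, hmean, Function.comp_apply]
  refine ⟨m, μ, h1, h2, ?_, ?_⟩
  · rw [hform]
    exact (measurable_id.sub_const _).comp_aemeasurable hme
  · rw [hform, ← AEMeasurable.map_map_of_aemeasurable (by fun_prop) hme, h3,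
      Measure.map_map (by fun_prop) (by fun_prop)]
    rfl

/-- After symmetrization the form is a chi-squared chaos whose two norms are those of `U` multiplied
by the covariance bound `C`; `chaos_tail` then applies. -/
theorem centredForm_tail_of_form_bound (hX : HasGaussianLaw (fun ω i => X i ω) P)
    (h0 : ∀ i, ∫ ω, X i ω ∂P = 0) {C F L T : ℝ} (hC0 : 0 < C) (hF0 : 0 ≤ F) (hL0 : 0 < L)
    (hT : 0 ≤ T) (hC : ∀ i, ∑ j, |∫ ω, X i ω * X j ω ∂P| ≤ C)
    (U : ι → ι → ℝ) (hUF : ∑ i, ∑ j, U i j ^ 2 ≤ F ^ 2)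
    (hL : ∀ x : ι → ℝ, |∑ i, ∑ j, U i j * (x i * x j)| ≤ L * ∑ i, x i ^ 2) :
    P {ω | 4 * C * (F * Real.sqrt T + L * T) < |centredForm P X U ω|}
      ≤ ENNReal.ofReal (2 * Real.exp (-T)) := by
  set V : ι → ι → ℝ := fun i j => (U i j + U j i) / 2 with hV
  have hVF : ∑ i, ∑ j, V i j ^ 2 ≤ F ^ 2 := (sum_sq_symmetrize_le U).trans hUF
  have hVL : ∀ x : ι → ℝ, |∑ i, ∑ j, V i j * (x i * x j)| ≤ L * ∑ i, x i ^ 2 := by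
    intro x
    convert hL x using 2
    have : ∑ i, ∑ j, U i j * (x i * x j) = ∑ i, ∑ j, U j i * (x i * x j) := by
      rw [Finset.sum_comm]
      simp only [mul_comm (x _) (x _)]
    have h2 : ∑ i, ∑ j, V i j * (x i * x j)
        = (∑ i, ∑ j, U i j * (x i * x j) + ∑ i, ∑ j, U j i * (x i * x j)) / 2 := by
      simp only [hV, ← Finset.sum_add_distrib, Finset.sum_div]
      refine Finset.sum_congr rfl fun i _ => Finset.sum_congr rfl fun j _ => ?_
      ring
    rw [h2, ← this]
    ring
  have hUV : ∀ ω, centredForm P X U ω = centredForm P X V ω := centredForm_symmetrize U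
  simp only [hUV]
  obtain ⟨m, μ, h1, h2, hme, h3⟩ := exists_centred_chaos_law hX h0 hL0.le hC V
    (fun i j => by simp only [hV]; ring) hVL
  have hmeas : MeasurableSet {y : ℝ | 4 * C * (F * Real.sqrt T + L * T) < |y|} :=
    measurableSet_lt measurable_const measurable_id.abs
  have e : P {ω | 4 * C * (F * Real.sqrt T + L * T) < |centredForm P X V ω|}
      = (Measure.pi fun _ : Fin m => gaussianReal 0 1)
        {z | 4 * C * (F * Real.sqrt T + L * T) < |∑ i, μ i * z i ^ 2 - ∑ i, μ i|} := by
    have := Measure.map_apply_of_aemeasurable hme hmeas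
    rw [h3, Measure.map_apply (by fun_prop) hmeas] at this
    exact this.symm
  rw [e]
  have hμF : ∑ i, μ i ^ 2 ≤ (C * F) ^ 2 := by
    rw [mul_pow]
    exact h2.trans (by gcongr)
  -- `chaos_tail` needs F > 0. For F = 0 all weights vanish and the exceptional set is empty.
  rcases hF0.eq_or_lt with rfl | hFpos
  · have hμ0 : ∀ i, μ i = 0 := fun i => by
      have h4 := (Finset.single_le_sum (f := fun i => μ i ^ 2) (fun i _ => sq_nonneg _)
        (Finset.mem_univ i)).trans hμF
      simp only [mul_zero, ne_eq, OfNat.ofNat_ne_zero, not_false_eq_true, zero_pow] at h4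
      exact pow_eq_zero_iff two_ne_zero |>.1 (le_antisymm h4 (sq_nonneg _))
    have : {z : Fin m → ℝ | 4 * C * (0 * Real.sqrt T + L * T)
        < |∑ i, μ i * z i ^ 2 - ∑ i, μ i|} = ∅ := by
      ext z
      simp only [hμ0, zero_mul, Finset.sum_const_zero, sub_zero, abs_zero, Set.mem_ofPred_eq,
        Set.mem_empty_iff_false, iff_false, not_lt]
      positivity
    rw [this]
    simp
  · have := chaos_tail μ (F := C * F) (L := C * L) (by positivity) (by positivity) hT h1 hμF
    refine le_trans (measure_mono fun z hz => ?_) this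
    simp only [Set.mem_ofPred_eq] at hz ⊢
    refine lt_of_eq_of_lt ?_ hz
    ring

/-- A Bernstein inequality for quadratic forms in Gaussian vectors. -/
theorem centredForm_tail (hX : HasGaussianLaw (fun ω i => X i ω) P)
    (h0 : ∀ i, ∫ ω, X i ω ∂P = 0) {C F L T : ℝ} (hC0 : 0 < C) (hF0 : 0 ≤ F) (hL0 : 0 < L)
    (hT : 0 ≤ T) (hC : ∀ i, ∑ j, |∫ ω, X i ω * X j ω ∂P| ≤ C)
    (U : ι → ι → ℝ) (hUF : ∑ i, ∑ j, U i j ^ 2 ≤ F ^ 2)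
    (hr : ∀ i, ∑ j, |U i j| ≤ L) (hc : ∀ j, ∑ i, |U i j| ≤ L) :
    P {ω | 4 * C * (F * Real.sqrt T + L * T) < |centredForm P X U ω|}
      ≤ ENNReal.ofReal (2 * Real.exp (-T)) :=
  centredForm_tail_of_form_bound hX h0 hC0 hF0 hL0 hT hC U hUF (abs_form_le_of_row_sums hr hc)

/-- An exponential inequality for quadratic forms in terms of the Frobenius norm alone. -/
theorem centredForm_tail_frobenius (hX : HasGaussianLaw (fun ω i => X i ω) P)
    (h0 : ∀ i, ∫ ω, X i ω ∂P = 0) {C F T : ℝ} (hC0 : 0 < C) (hF0 : 0 < F)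
    (hT : 1 ≤ T) (hC : ∀ i, ∑ j, |∫ ω, X i ω * X j ω ∂P| ≤ C)
    (U : ι → ι → ℝ) (hUF : ∑ i, ∑ j, U i j ^ 2 ≤ F ^ 2) :
    P {ω | 8 * C * F * T < |centredForm P X U ω|} ≤ ENNReal.ofReal (2 * Real.exp (-T)) := by
  refine (measure_mono fun ω hω => ?_).trans (centredForm_tail_of_form_bound hX h0 hC0 hF0.le hF0
    (by linarith) hC U hUF (abs_form_le_of_sum_sq hF0.le hUF))
  simp only [Set.mem_ofPred_eq] at hω ⊢
  refine lt_of_le_of_lt ?_ hω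
  have h1 : Real.sqrt T ≤ T := by
    rw [Real.sqrt_le_left (by linarith)]
    nlinarith
  calc _ ≤ 4 * C * (F * T + F * T) := by gcongr
    _ = _ := by ring

theorem centredForm_sixth_moment (hX : HasGaussianLaw (fun ω i => X i ω) P)
    (h0 : ∀ i, ∫ ω, X i ω ∂P = 0) {C F : ℝ} (hC0 : 0 < C) (hF0 : 0 < F)
    (hC : ∀ i, ∑ j, |∫ ω, X i ω * X j ω ∂P| ≤ C)
    (U : ι → ι → ℝ) (hUF : ∑ i, ∑ j, U i j ^ 2 ≤ F ^ 2) :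
    ∫⁻ ω, ENNReal.ofReal (centredForm P X U ω ^ 6) ∂P ≤ ENNReal.ofReal (10 ^ 8 * (C * F) ^ 6) := by
  set V : ι → ι → ℝ := fun i j => (U i j + U j i) / 2 with hV
  have hVF : ∑ i, ∑ j, V i j ^ 2 ≤ F ^ 2 := (sum_sq_symmetrize_le U).trans hUF
  have hUV : ∀ ω, centredForm P X U ω = centredForm P X V ω := centredForm_symmetrize U
  simp only [hUV]
  obtain ⟨m, μ, -, h2, hme, h3⟩ := exists_centred_chaos_law hX h0 hF0.le hC V
    (fun i j => by simp only [hV]; ring) (abs_form_le_of_sum_sq hF0.le hVF)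
  have hf : Measurable fun y : ℝ => ENNReal.ofReal (y ^ 6) := by fun_prop
  have e := lintegral_map' (μ := P) hf.aemeasurable hme
  rw [h3, lintegral_map hf (by fun_prop)] at e
  rw [← e]
  refine chaos_sixth_moment μ (by positivity) ?_
  rw [mul_pow]
  exact h2.trans (by gcongr)

theorem aemeasurable_centredForm (hX : HasGaussianLaw (fun ω i => X i ω) P) (U : ι → ι → ℝ) :
    AEMeasurable (centredForm P X U) P := by
  have : ∀ i, AEMeasurable (X i) P := fun i => (hX.eval i).aemeasurable
  unfold centredForm
  fun_prop

end QuadForm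

/-! ### The weights `ℓ` -/

theorem ell_of_two_le {κ : ℝ} {j : ℤ} (hj : 2 ≤ |j|) :
    ell κ j = |(j : ℝ)| * Real.log |(j : ℝ)| ^ (1 + κ) := by
  rw [ell, if_neg (by omega)]

theorem two_le_cast_abs {j : ℤ} (hj : 2 ≤ |j|) : (2 : ℝ) ≤ |(j : ℝ)| := by
  rw [← Int.cast_abs]
  exact_mod_cast hj

theorem ell_pos (κ : ℝ) (j : ℤ) : 0 < ell κ j := by
  by_cases h : |j| ≤ 1
  · rw [ell, if_pos h]
    exact one_pos
  · have h2 := two_le_cast_abs (j := j) (by omega)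
    rw [ell, if_neg h]
    have : 0 < Real.log |(j : ℝ)| := Real.log_pos (by linarith)
    positivity

theorem ell_neg (κ : ℝ) (j : ℤ) : ell κ (-j) = ell κ j := by
  simp [ell]

theorem exists_abs_le_mul_ell {κ : ℝ} (hκ : 0 < κ) : ∃ B : ℝ, 1 ≤ B ∧ ∀ j : ℤ, |(j : ℝ)| ≤ B * ell κ j := by
  have hl : 0 < Real.log 2 := Real.log_pos (by norm_num)
  refine ⟨max 1 (1 / Real.log 2 ^ (1 + κ)), le_max_left _ _, fun j => ?_⟩
  by_cases h : |j| ≤ 1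
  · rw [ell, if_pos h, mul_one]
    refine le_trans ?_ (le_max_left _ _)
    rw [← Int.cast_abs]
    exact_mod_cast h
  · have h2 := two_le_cast_abs (j := j) (by omega)
    rw [ell_of_two_le (by omega)]
    have h3 : Real.log 2 ^ (1 + κ) ≤ Real.log |(j : ℝ)| ^ (1 + κ) := by
      gcongr
    calc |(j : ℝ)| = 1 / Real.log 2 ^ (1 + κ) * (|(j : ℝ)| * Real.log 2 ^ (1 + κ)) := by
          field_simp
      _ ≤ max 1 (1 / Real.log 2 ^ (1 + κ)) * (|(j : ℝ)| * Real.log |(j : ℝ)| ^ (1 + κ)) := by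
          gcongr
          exact le_max_right _ _

/-- Cauchy condensation: at n = 2^k the condensed term is at most (k log 2)^(-(1+κ)), a convergent
power series term since κ > 0. -/
theorem summable_inv_mul_log_rpow {κ : ℝ} (hκ : 0 < κ) :
    Summable fun n : ℕ => 1 / (((n : ℝ) + 2) * Real.log ((n : ℝ) + 2) ^ (1 + κ)) := by
  have hlog : ∀ n : ℕ, 0 < Real.log ((n : ℝ) + 2) := fun n =>
    Real.log_pos (by have : (0 : ℝ) ≤ n := n.cast_nonneg; linarith)
  rw [← summable_condensed_iff_of_nonneg]
  · have hl : 0 < Real.log 2 := Real.log_pos (by norm_num)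
    -- The index k = 0 is dropped because the comparison term k log 2 vanishes there.
    rw [← summable_nat_add_iff 1]
    have hs : Summable fun k : ℕ => (1 / Real.log 2 ^ (1 + κ)) * (1 / ((k + 1 : ℕ) : ℝ) ^ (1 + κ)) :=
      ((summable_nat_add_iff 1).2
        (Real.summable_one_div_nat_rpow.2 (by linarith : 1 < 1 + κ))).mul_left _
    refine Summable.of_nonneg_of_le (fun k => ?_) (fun k => ?_) hs
    · have := hlog (2 ^ (k + 1))
      positivity
    · have hk : (0 : ℝ) < ((k + 1 : ℕ) : ℝ) := by positivity
      have h1 : ((k + 1 : ℕ) : ℝ) * Real.log 2 ≤ Real.log (((2 ^ (k + 1) : ℕ) : ℝ) + 2) := by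
        rw [← Real.log_pow]
        refine Real.log_le_log (by positivity) ?_
        push_cast
        linarith
      rw [mul_one_div, one_div_mul_one_div, ← Real.mul_rpow hl.le hk.le, div_le_div_iff₀]
      · push_cast at h1 ⊢
        have h2 : (Real.log 2 * ((k : ℝ) + 1)) ^ (1 + κ) ≤ Real.log ((2 : ℝ) ^ (k + 1) + 2) ^ (1 + κ) := by
          rw [mul_comm]
          gcongr
        have h3 : (0 : ℝ) < 2 ^ (k + 1) := by positivity
        rw [one_mul]
        gcongr
        linarith
      · have := hlog (2 ^ (k + 1))
        positivity
      · positivity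
  · intro n
    have := hlog n
    positivity
  · intro m n _ hmn
    have := hlog m
    have hc : (m : ℝ) ≤ n := by exact_mod_cast hmn
    gcongr

theorem summable_inv_ell {κ : ℝ} (hκ : 0 < κ) : Summable fun j : ℤ => 1 / ell κ j := by
  have h : Summable fun n : ℕ => 1 / ell κ (n : ℤ) := by
    rw [← summable_nat_add_iff 2]
    refine (summable_inv_mul_log_rpow hκ).congr fun n => ?_
    have h0 : |((n + 2 : ℕ) : ℤ)| = ((n + 2 : ℕ) : ℤ) := abs_of_nonneg (by positivity)
    rw [ell_of_two_le (by rw [h0]; push_cast; omega)]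
    have h1 : |(((n + 2 : ℕ) : ℤ) : ℝ)| = (n : ℝ) + 2 := by
      rw [← Int.cast_abs, h0]
      push_cast
      ring
    rw [h1]
  exact Summable.of_nat_of_neg h (by simpa only [ell_neg] using h)

/-- By Tonelli the sum of the norms has finite expectation, so it is finite almost surely. -/
theorem ae_summable_norm_of_summable_integral_norm {Ω ι : Type*} [MeasurableSpace Ω] {P : Measure Ω}
    [Countable ι] {F : ι → Ω → ℝ} (hF : ∀ i, Integrable (F i) P)
    (hs : Summable fun i => ∫ ω, ‖F i ω‖ ∂P) : ∀ᵐ ω ∂P, Summable fun i => ‖F i ω‖ := by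
  have h : ∫⁻ ω, ∑' i, ‖F i ω‖ₑ ∂P ≠ ∞ := by
    rw [lintegral_tsum fun i => (hF i).1.enorm]
    have : ∀ i, ∫⁻ ω, ‖F i ω‖ₑ ∂P = ENNReal.ofReal (∫ ω, ‖F i ω‖ ∂P) := fun i =>
      (ofReal_integral_norm_eq_lintegral_enorm (hF i)).symm
    simp only [this]
    exact hs.tsum_ofReal_ne_top
  filter_upwards [ae_lt_top' (AEMeasurable.tsum fun i => (hF i).1.enorm) h] with ω hω
  have h2 := ENNReal.summable_toReal hω.ne
  simpa using h2

/-! ### Mean and covariances of the process -/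

section Sample

variable {Ω : Type*} [MeasurableSpace Ω] {P : Measure Ω} [IsProbabilityMeasure P]
  {κ K : ℝ} {ε : ℤ → Ω → ℝ} {aT : ℕ → ℤ → ℤ → ℝ} {a : ℝ → ℤ → ℝ} {X : ℕ → ℤ → Ω → ℝ}

namespace IsLocallyStationary

theorem K_nonneg (hX : IsLocallyStationary P κ K ε aT a X) : 0 ≤ K := by
  have h := hX.curve_bound 1 ⟨one_pos, le_rfl⟩ 0
  have h0 : ell κ 0 = 1 := by simp [ell]
  rw [h0, div_one] at h
  exact (abs_nonneg _).trans h

theorem weight_nonneg (hX : IsLocallyStationary P κ K ε aT a X) (j : ℤ) : 0 ≤ K / ell κ j :=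
  div_nonneg hX.K_nonneg (ell_pos κ j).le

theorem summable_weight (hX : IsLocallyStationary P κ K ε aT a X) :
    Summable fun j : ℤ => K / ell κ j := by
  simpa only [mul_one_div] using (summable_inv_ell hX.kappa_pos).mul_left K

theorem innov_integrable (hX : IsLocallyStationary P κ K ε aT a X) (t : ℤ) : Integrable (ε t) P :=
  (hX.innov_memLp t).integrable one_le_two

theorem innov_mul_integrable (hX : IsLocallyStationary P κ K ε aT a X) (s t : ℤ) :
    Integrable (fun ω => ε s ω * ε t ω) P :=
  (hX.innov_memLp s).integrable_mul (hX.innov_memLp t)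

theorem innov_mul_integral (hX : IsLocallyStationary P κ K ε aT a X) (s t : ℤ) :
    ∫ ω, ε s ω * ε t ω ∂P = if s = t then 1 else 0 := by
  split_ifs with h
  · subst h
    simpa only [sq] using hX.innov_variance s
  · exact hX.innov_uncorrelated s t h

theorem innov_mul_abs_le (hX : IsLocallyStationary P κ K ε aT a X) (s t : ℤ) :
    ∫ ω, ‖ε s ω * ε t ω‖ ∂P ≤ 1 := by
  have hs := (hX.innov_memLp s).integrable_sq
  have ht := (hX.innov_memLp t).integrable_sq
  calc ∫ ω, ‖ε s ω * ε t ω‖ ∂P ≤ ∫ ω, (ε s ω ^ 2 / 2 + ε t ω ^ 2 / 2) ∂P := by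
        refine integral_mono (hX.innov_mul_integrable s t).norm
          ((hs.div_const 2).add (ht.div_const 2)) fun ω => ?_
        simp only [Real.norm_eq_abs, abs_le]
        constructor <;> nlinarith [sq_nonneg (ε s ω + ε t ω), sq_nonneg (ε s ω - ε t ω)]
    _ = 1 := by
        rw [integral_add (hs.div_const 2) (ht.div_const 2), integral_div, integral_div,
          hX.innov_variance, hX.innov_variance]
        norm_num

theorem innov_abs_le (hX : IsLocallyStationary P κ K ε aT a X) (s : ℤ) :
    ∫ ω, ‖ε s ω‖ ∂P ≤ 1 := by
  have hs := (hX.innov_memLp s).integrable_sq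
  calc ∫ ω, ‖ε s ω‖ ∂P ≤ ∫ ω, (ε s ω ^ 2 / 2 + 1 / 2) ∂P := by
        refine integral_mono (hX.innov_integrable s).norm
          ((hs.div_const 2).add (integrable_const _)) fun ω => ?_
        simp only [Real.norm_eq_abs, abs_le]
        constructor <;> nlinarith [sq_nonneg (ε s ω + 1), sq_nonneg (ε s ω - 1)]
    _ = 1 := by
        rw [integral_add (hs.div_const 2) (integrable_const _), integral_div, hX.innov_variance]
        norm_num

theorem term_summable (hX : IsLocallyStationary P κ K ε aT a X) {n : ℕ} {r : ℤ} (h1 : 1 ≤ r)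
    (h2 : r ≤ n) : Summable fun i : ℤ => ∫ ω, ‖aT n r i * ε (r - i) ω‖ ∂P := by
  refine Summable.of_nonneg_of_le (fun i => integral_nonneg fun ω => norm_nonneg _) (fun i => ?_)
    hX.summable_weight
  simp only [norm_mul]
  rw [integral_const_mul, Real.norm_eq_abs]
  calc _ ≤ K / ell κ i * 1 := by
        gcongr
        · exact hX.weight_nonneg i
        · exact hX.coeff_bound n r i h1 h2
        · exact hX.innov_abs_le _
    _ = _ := mul_one _

theorem term_ae_summable (hX : IsLocallyStationary P κ K ε aT a X) {n : ℕ} {r : ℤ} (h1 : 1 ≤ r)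
    (h2 : r ≤ n) : ∀ᵐ ω ∂P, Summable fun i : ℤ => ‖aT n r i * ε (r - i) ω‖ :=
  ae_summable_norm_of_summable_integral_norm (fun _ => (hX.innov_integrable _).const_mul _)
    (hX.term_summable h1 h2)

theorem mean_zero (hX : IsLocallyStationary P κ K ε aT a X) {n : ℕ} {r : ℤ} (h1 : 1 ≤ r)
    (h2 : r ≤ n) : ∫ ω, X n r ω ∂P = 0 := by
  rw [integral_congr_ae (hX.representation n r h1 h2)]
  have h := hasSum_integral_of_summable_integral_norm
    (F := fun (i : ℤ) ω => aT n r i * ε (r - i) ω)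
    (fun i => (hX.innov_integrable _).const_mul _) (hX.term_summable h1 h2)
  rw [← h.tsum_eq]
  simp [integral_const_mul, hX.innov_mean]

theorem coeff_summable (hX : IsLocallyStationary P κ K ε aT a X) {n : ℕ} {r : ℤ} (h1 : 1 ≤ r)
    (h2 : r ≤ n) : Summable fun i : ℤ => |aT n r i| :=
  Summable.of_nonneg_of_le (fun _ => abs_nonneg _) (fun i => hX.coeff_bound n r i h1 h2)
    hX.summable_weight

/-- The covariances of the process. -/
theorem covariance_eq (hX : IsLocallyStationary P κ K ε aT a X) {n : ℕ} {r s : ℤ} (hr1 : 1 ≤ r)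
    (hr2 : r ≤ n) (hs1 : 1 ≤ s) (hs2 : s ≤ n) :
    ∫ ω, X n r ω * X n s ω ∂P = ∑' i : ℤ, aT n r i * aT n s (i - (r - s)) := by
  have hrep : ∀ᵐ ω ∂P, X n r ω * X n s ω
      = ∑' p : ℤ × ℤ, (aT n r p.1 * ε (r - p.1) ω) * (aT n s p.2 * ε (s - p.2) ω) := by
    filter_upwards [hX.representation n r hr1 hr2, hX.representation n s hs1 hs2,
      hX.term_ae_summable hr1 hr2, hX.term_ae_summable hs1 hs2] with ω h1 h2 h3 h4
    rw [h1, h2, tsum_mul_tsum_of_summable_norm h3 h4]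
  have hsumm : Summable fun p : ℤ × ℤ => |aT n r p.1| * |aT n s p.2| :=
    (hX.coeff_summable hr1 hr2).mul_of_nonneg (hX.coeff_summable hs1 hs2)
      (fun _ => abs_nonneg _) fun _ => abs_nonneg _
  have heq : ∀ (p : ℤ × ℤ) ω, (aT n r p.1 * ε (r - p.1) ω) * (aT n s p.2 * ε (s - p.2) ω)
      = aT n r p.1 * aT n s p.2 * (ε (r - p.1) ω * ε (s - p.2) ω) := fun p ω => by ring
  rw [integral_congr_ae hrep]
  simp only [heq]
  have h := hasSum_integral_of_summable_integral_norm
    (F := fun (p : ℤ × ℤ) ω => aT n r p.1 * aT n s p.2 * (ε (r - p.1) ω * ε (s - p.2) ω))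
    (μ := P) (fun p => (hX.innov_mul_integrable _ _).const_mul _) (by
      refine Summable.of_nonneg_of_le (fun i => integral_nonneg fun ω => norm_nonneg _)
        (fun p => ?_) hsumm
      simp only [norm_mul (aT n r p.1 * aT n s p.2)]
      rw [integral_const_mul, Real.norm_eq_abs, abs_mul]
      exact mul_le_of_le_one_right (by positivity) (hX.innov_mul_abs_le _ _))
  rw [← h.tsum_eq]
  -- Only index pairs with the same innovation time survive, so for each i the inner sum reduces to
  -- the single index i - (r - s).
  simp only [integral_const_mul, hX.innov_mul_integral]
  have hs2 : Summable fun p : ℤ × ℤ =>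
      aT n r p.1 * aT n s p.2 * (if r - p.1 = s - p.2 then (1 : ℝ) else 0) := by
    refine Summable.of_norm_bounded hsumm fun p => ?_
    rw [norm_mul, Real.norm_eq_abs, abs_mul]
    refine mul_le_of_le_one_right (by positivity) ?_
    split_ifs <;> simp
  rw [hs2.tsum_prod]
  refine tsum_congr fun i => ?_
  rw [tsum_eq_single (i - (r - s))]
  · rw [if_pos (by ring), mul_one]
  · intro j hj
    rw [if_neg (by omega), mul_zero]

theorem tsum_weight_nonneg (hX : IsLocallyStationary P κ K ε aT a X) : 0 ≤ ∑' j : ℤ, K / ell κ j :=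
  tsum_nonneg hX.weight_nonneg

theorem summable_weight_mul (hX : IsLocallyStationary P κ K ε aT a X) (k : ℤ) :
    Summable fun i : ℤ => K / ell κ i * (K / ell κ (i - k)) := by
  refine Summable.of_nonneg_of_le (fun i => mul_nonneg (hX.weight_nonneg _) (hX.weight_nonneg _))
    (fun i => ?_) (hX.summable_weight.mul_right (∑' j : ℤ, K / ell κ j))
  gcongr
  · exact hX.weight_nonneg i
  · exact hX.summable_weight.le_tsum _ fun j _ => hX.weight_nonneg j

theorem abs_covariance_le (hX : IsLocallyStationary P κ K ε aT a X) {n : ℕ} {r s : ℤ} (hr1 : 1 ≤ r)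
    (hr2 : r ≤ n) (hs1 : 1 ≤ s) (hs2 : s ≤ n) :
    |∫ ω, X n r ω * X n s ω ∂P| ≤ ∑' i : ℤ, K / ell κ i * (K / ell κ (i - (r - s))) := by
  rw [hX.covariance_eq hr1 hr2 hs1 hs2, ← Real.norm_eq_abs]
  refine tsum_of_norm_bounded (hX.summable_weight_mul (r - s)).hasSum fun i => ?_
  rw [Real.norm_eq_abs, abs_mul]
  gcongr
  · exact hX.weight_nonneg i
  · exact hX.coeff_bound n r i hr1 hr2
  · exact hX.coeff_bound n s _ hs1 hs2

/-- The substitution (k, i) ↦ (i, i - k) turns the convolution into a product of two summable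
families. -/
theorem summable_weight_conv (hX : IsLocallyStationary P κ K ε aT a X) :
    Summable (fun p : ℤ × ℤ => K / ell κ p.2 * (K / ell κ (p.2 - p.1))) := by
  have h := hX.summable_weight.mul_of_nonneg hX.summable_weight hX.weight_nonneg hX.weight_nonneg
  let e : ℤ × ℤ ≃ ℤ × ℤ :=
    { toFun := fun p => (p.2, p.2 - p.1)
      invFun := fun q => (q.1 - q.2, q.1)
      left_inv := fun p => by ext <;> simp
      right_inv := fun q => by ext <;> simp }
  exact (e.summable_iff (f := fun q : ℤ × ℤ => K / ell κ q.1 * (K / ell κ q.2))).2 h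

/-- The row sums of the covariance matrices are bounded. -/
theorem sum_abs_covariance_le (hX : IsLocallyStationary P κ K ε aT a X) {n : ℕ} {r : ℤ}
    (hr1 : 1 ≤ r) (hr2 : r ≤ n) :
    ∑ s ∈ Finset.Icc (1 : ℤ) n, |∫ ω, X n r ω * X n s ω ∂P| ≤
      ∑' p : ℤ × ℤ, K / ell κ p.2 * (K / ell κ (p.2 - p.1)) := by
  have hsum := hX.summable_weight_conv
  rw [hsum.tsum_prod]
  calc _ ≤ ∑ s ∈ Finset.Icc (1 : ℤ) n, ∑' i : ℤ, K / ell κ i * (K / ell κ (i - (r - s))) := by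
        refine Finset.sum_le_sum fun s hs => ?_
        rw [Finset.mem_Icc] at hs
        exact hX.abs_covariance_le hr1 hr2 hs.1 hs.2
    -- Within a row the lags r - s are distinct, so the sum is dominated by the sum over all integer
    -- lags.
    _ = ∑ k ∈ (Finset.Icc (1 : ℤ) n).image (fun s => r - s),
          ∑' i : ℤ, K / ell κ i * (K / ell κ (i - k)) := by
        rw [Finset.sum_image]
        intro x _ y _ h
        simpa using h
    _ ≤ _ := by
        refine Summable.sum_le_tsum _ (fun k _ => ?_) hsum.prod
        exact tsum_nonneg fun i => mul_nonneg (hX.weight_nonneg _) (hX.weight_nonneg _)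

end IsLocallyStationary

end Sample

/-! ### The pre-periodogram as a quadratic form -/

/-- Once the floors are integer divisions, membership in `lagSet` becomes linear integer arithmetic.
-/
theorem floor_half (m : ℤ) : ⌊(m : ℝ) / 2⌋ = m / 2 := by
  rw [Int.floor_eq_iff]
  have h1 : (2 : ℤ) * (m / 2) ≤ m := by omega
  have h2 : m < 2 * (m / 2) + 2 := by omega
  have h1' : (2 : ℝ) * ((m / 2 : ℤ) : ℝ) ≤ m := by exact_mod_cast h1
  have h2' : (m : ℝ) < 2 * ((m / 2 : ℤ) : ℝ) + 2 := by exact_mod_cast h2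
  constructor <;> linarith

theorem floor_lag_add (t k : ℤ) : ⌊(t : ℝ) + 1 / 2 + k / 2⌋ = (2 * t + 1 + k) / 2 := by
  rw [← floor_half]
  congr 1
  push_cast
  ring

theorem floor_lag_sub (t k : ℤ) : ⌊(t : ℝ) + 1 / 2 - k / 2⌋ = (2 * t + 1 - k) / 2 := by
  rw [← floor_half]
  congr 1
  push_cast
  ring

/-- Midpoints and lags are in bijection with pairs (r, s) of observation times, with inverse t =
⌊(r+s)/2⌋ and k = r - s. This rewrites sums of pre-periodogram type as ordinary double sums over the
data. -/
theorem sum_lagSet_eq {M : Type*} [AddCommMonoid M] (n : ℕ) (g : ℤ → ℤ → ℤ → ℤ → M) :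
    ∑ t ∈ Finset.Icc (1 : ℤ) n, ∑ k ∈ lagSet n t,
      g t k ⌊(t : ℝ) + 1 / 2 + k / 2⌋ ⌊(t : ℝ) + 1 / 2 - k / 2⌋ =
    ∑ r ∈ Finset.Icc (1 : ℤ) n, ∑ s ∈ Finset.Icc (1 : ℤ) n, g ((r + s) / 2) (r - s) r s := by
  simp only [floor_lag_add, floor_lag_sub]
  rw [Finset.sum_sigma', ← Finset.sum_product']
  refine Finset.sum_nbij' (fun p => ((2 * p.1 + 1 + p.2) / 2, (2 * p.1 + 1 - p.2) / 2))
    (fun q => ⟨(q.1 + q.2) / 2, q.1 - q.2⟩) ?_ ?_ ?_ ?_ ?_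
  · rintro ⟨t, k⟩ h
    simp only [Finset.mem_sigma, lagSet, Finset.mem_filter, Finset.mem_Icc, floor_lag_add,
      floor_lag_sub, Finset.mem_product] at h ⊢
    exact h.2.2
  · rintro ⟨r, s⟩ h
    simp only [Finset.mem_sigma, lagSet, Finset.mem_filter, Finset.mem_Icc, floor_lag_add,
      floor_lag_sub, Finset.mem_product] at h ⊢
    omega
  · rintro ⟨t, k⟩ h
    ext
    · simp only
      omega
    · simp only [heq_eq_eq]
      omega
  · rintro ⟨r, s⟩ h
    ext <;> simp only <;> omega
  · rintro ⟨t, k⟩ h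
    simp only
    congr 1 <;> omega

/-- Sums over pairs of time points are dominated by sums over midpoints and lags. -/
theorem sum_pairs_le (n : ℕ) (g : ℤ → ℤ → ℝ) (hg : ∀ t k, 0 ≤ g t k) :
    ∑ r ∈ Finset.Icc (1 : ℤ) n, ∑ s ∈ Finset.Icc (1 : ℤ) n, g ((r + s) / 2) (r - s) ≤
      ∑ t ∈ Finset.Icc (1 : ℤ) n, ∑ k ∈ Finset.Icc (-(n : ℤ)) n, g t k := by
  rw [← sum_lagSet_eq n (fun t k _ _ => g t k)]
  refine Finset.sum_le_sum fun t _ => Finset.sum_le_sum_of_subset_of_nonneg ?_ fun k _ _ => hg t k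
  exact Finset.filter_subset _ _

/-! ### Bounded measurable functions on the rectangle -/

/-- Measurable functions that are bounded on the time-frequency rectangle. -/
structure Tame (φ : ℝ → ℝ → ℝ) : Prop where
  meas : Measurable (Function.uncurry φ)
  bdd : ∃ M : ℝ, ∀ u ∈ Set.Icc (0 : ℝ) 1, ∀ l ∈ Set.Icc (-Real.pi) Real.pi, |φ u l| ≤ M

namespace Tame

variable {φ ψ : ℝ → ℝ → ℝ}

theorem sub (hφ : Tame φ) (hψ : Tame ψ) : Tame fun u l => φ u l - ψ u l := by
  obtain ⟨M, hM⟩ := hφ.bdd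
  obtain ⟨N, hN⟩ := hψ.bdd
  exact ⟨hφ.meas.sub hψ.meas, M + N, fun u hu l hl =>
    (abs_sub _ _).trans (add_le_add (hM u hu l hl) (hN u hu l hl))⟩

theorem measurable_slice (hφ : Tame φ) (u : ℝ) : Measurable (φ u) :=
  hφ.meas.comp (measurable_const.prodMk measurable_id)

theorem memLp_slice (hφ : Tame φ) {u : ℝ} (hu : u ∈ Set.Icc (0 : ℝ) 1) (p : ℝ≥0∞) :
    MemLp (φ u) p (volume.restrict (Set.Ioc (-Real.pi) Real.pi)) := by
  obtain ⟨M, hM⟩ := hφ.bdd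
  refine MemLp.of_bound (hφ.measurable_slice u).aestronglyMeasurable M ?_
  filter_upwards [ae_restrict_mem measurableSet_Ioc] with l hl
  exact hM u hu l (Set.Ioc_subset_Icc_self hl)

theorem neg_pi_le_pi : -Real.pi ≤ Real.pi := by linarith [Real.pi_pos]

theorem intervalIntegrable (hφ : Tame φ) {u : ℝ} (hu : u ∈ Set.Icc (0 : ℝ) 1) :
    IntervalIntegrable (φ u) volume (-Real.pi) Real.pi := by
  rw [intervalIntegrable_iff_integrableOn_Ioc_of_le neg_pi_le_pi]
  exact memLp_one_iff_integrable.1 (hφ.memLp_slice hu 1)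

theorem intervalIntegrable_mul_exp (hφ : Tame φ) {u : ℝ} (hu : u ∈ Set.Icc (0 : ℝ) 1) (j : ℤ) :
    IntervalIntegrable (fun l => (φ u l : ℂ) * Complex.exp (Complex.I * (l : ℂ) * (j : ℂ))) volume
      (-Real.pi) Real.pi := by
  refine IntervalIntegrable.mul_continuousOn
    ⟨(hφ.intervalIntegrable hu).1.ofReal, (hφ.intervalIntegrable hu).2.ofReal⟩ ?_
  fun_prop

theorem fourierCoef_sub (hφ : Tame φ) (hψ : Tame ψ) {u : ℝ} (hu : u ∈ Set.Icc (0 : ℝ) 1) (j : ℤ) :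
    fourierCoef (fun u l => φ u l - ψ u l) u j = fourierCoef φ u j - fourierCoef ψ u j := by
  unfold fourierCoef
  rw [← intervalIntegral.integral_sub (hφ.intervalIntegrable_mul_exp hu j)
    (hψ.intervalIntegrable_mul_exp hu j)]
  congr 1
  ext l
  push_cast
  ring

end Tame

/-- The real part of the Fourier coefficient. -/
def cosCoef (φ : ℝ → ℝ → ℝ) (u : ℝ) (k : ℤ) : ℝ := (fourierCoef φ u k).re

theorem re_exp_I_mul (l : ℝ) (k : ℤ) :
    (Complex.exp (Complex.I * (l : ℂ) * (k : ℂ))).re = Real.cos (k * l) := by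
  have : Complex.I * (l : ℂ) * (k : ℂ) = ((k * l : ℝ) : ℂ) * Complex.I := by push_cast; ring
  rw [this, Complex.exp_ofReal_mul_I_re]

theorem Tame.cosCoef_eq {φ : ℝ → ℝ → ℝ} (hφ : Tame φ) {u : ℝ} (hu : u ∈ Set.Icc (0 : ℝ) 1) (k : ℤ) :
    cosCoef φ u k = ∫ l in (-Real.pi)..Real.pi, φ u l * Real.cos (k * l) := by
  unfold cosCoef fourierCoef
  rw [← Complex.reCLM_apply, ← ContinuousLinearMap.intervalIntegral_comp_comm _
    (hφ.intervalIntegrable_mul_exp hu k)]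
  congr 1
  ext l
  rw [Complex.reCLM_apply, Complex.re_ofReal_mul, re_exp_I_mul]

theorem Tame.cosCoef_sub {φ ψ : ℝ → ℝ → ℝ} (hφ : Tame φ) (hψ : Tame ψ) {u : ℝ}
    (hu : u ∈ Set.Icc (0 : ℝ) 1) (k : ℤ) :
    cosCoef (fun u l => φ u l - ψ u l) u k = cosCoef φ u k - cosCoef ψ u k := by
  unfold cosCoef
  rw [hφ.fourierCoef_sub hψ hu, Complex.sub_re]

theorem prePeriodogram_re (n : ℕ) (x : ℤ → ℝ) (t : ℤ) (l : ℝ) :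
    (prePeriodogram n x t l).re = 1 / (2 * Real.pi) * ∑ k ∈ lagSet n t,
      x ⌊(t : ℝ) + 1 / 2 + k / 2⌋ * x ⌊(t : ℝ) + 1 / 2 - k / 2⌋ * Real.cos (k * l) := by
  unfold prePeriodogram
  have : (1 / (2 * (Real.pi : ℂ))) = ((1 / (2 * Real.pi) : ℝ) : ℂ) := by push_cast; rfl
  rw [this, Complex.re_ofReal_mul, Complex.re_sum]
  congr 1
  refine Finset.sum_congr rfl fun k _ => ?_
  rw [Complex.re_ofReal_mul]
  congr 1
  have : -Complex.I * (l : ℂ) * (k : ℂ) = Complex.I * (l : ℂ) * ((-k : ℤ) : ℂ) := by push_cast; ring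
  rw [this, re_exp_I_mul]
  push_cast
  rw [neg_mul, Real.cos_neg]

/-- The pre-periodogram is a cosine polynomial, so only the real parts of the Fourier coefficients
of φ enter. -/
theorem Tame.integral_mul_prePeriodogram {φ : ℝ → ℝ → ℝ} (hφ : Tame φ) (n : ℕ) (x : ℤ → ℝ) (t : ℤ)
    {u : ℝ} (hu : u ∈ Set.Icc (0 : ℝ) 1) :
    IntervalIntegrable (fun l => φ u l * (prePeriodogram n x t l).re) volume (-Real.pi) Real.pi ∧
    ∫ l in (-Real.pi)..Real.pi, φ u l * (prePeriodogram n x t l).re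
      = 1 / (2 * Real.pi) * ∑ k ∈ lagSet n t, cosCoef φ u k *
        (x ⌊(t : ℝ) + 1 / 2 + k / 2⌋ * x ⌊(t : ℝ) + 1 / 2 - k / 2⌋) := by
  have e : ∀ l, φ u l * (prePeriodogram n x t l).re = ∑ k ∈ lagSet n t, 1 / (2 * Real.pi) *
      (x ⌊(t : ℝ) + 1 / 2 + k / 2⌋ * x ⌊(t : ℝ) + 1 / 2 - k / 2⌋) *
      (φ u l * Real.cos (k * l)) := by
    intro l
    rw [prePeriodogram_re, Finset.mul_sum, Finset.mul_sum]
    refine Finset.sum_congr rfl fun k _ => ?_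
    ring
  have hi : ∀ k : ℤ, IntervalIntegrable (fun l => φ u l * Real.cos (k * l)) volume
      (-Real.pi) Real.pi := fun k =>
    (hφ.intervalIntegrable hu).mul_continuousOn (by fun_prop)
  simp only [e]
  constructor
  · have h := IntervalIntegrable.sum (lagSet n t) fun k _ => (hi k).const_mul (1 / (2 * Real.pi) *
      (x ⌊(t : ℝ) + 1 / 2 + k / 2⌋ * x ⌊(t : ℝ) + 1 / 2 - k / 2⌋))
    refine h.congr (fun l _ => ?_)
    simp
  · rw [intervalIntegral.integral_finsetSum fun k _ => (hi k).const_mul _, Finset.mul_sum]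
    refine Finset.sum_congr rfl fun k _ => ?_
    rw [intervalIntegral.integral_const_mul, hφ.cosCoef_eq hu]
    ring

/-- Parseval's identity. -/
theorem Tame.hasSum_sq_fourierCoef {φ : ℝ → ℝ → ℝ} (hφ : Tame φ) {u : ℝ}
    (hu : u ∈ Set.Icc (0 : ℝ) 1) :
    HasSum (fun k : ℤ => ‖fourierCoef φ u k‖ ^ 2)
      (2 * Real.pi * ∫ l in (-Real.pi)..Real.pi, φ u l ^ 2) := by
  have hab : -Real.pi < Real.pi := by linarith [Real.pi_pos]
  have h := hasSum_sq_fourierCoeffOn hab (f := fun l => (φ u l : ℂ)) (hφ.memLp_slice hu 2).ofReal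
  -- `fourierCoef` carries exp(+iλj) and no normalization, whereas `fourierCoeffOn` carries the
  -- opposite sign and divides by the length of the interval; hence the index -k and the factor 2π.
  have e : ∀ k : ℤ, fourierCoef φ u (-k)
      = (2 * Real.pi : ℝ) * fourierCoeffOn hab (fun l => (φ u l : ℂ)) k := by
    intro k
    rw [fourierCoeffOn_eq_integral]
    unfold fourierCoef
    have hpi := Real.pi_ne_zero
    rw [show Real.pi - -Real.pi = 2 * Real.pi by ring, Complex.real_smul, ← mul_assoc,
      ← Complex.ofReal_mul, mul_one_div_cancel (by positivity), Complex.ofReal_one, one_mul]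
    congr 1
    ext l
    rw [fourier_coe_apply, smul_eq_mul, mul_comm]
    congr 2
    push_cast
    have : (Real.pi : ℂ) ≠ 0 := by exact_mod_cast hpi
    field_simp
    try ring
  rw [← (Equiv.neg ℤ).hasSum_iff]
  have h2 := h.mul_left ((2 * Real.pi) ^ 2)
  have e1 : (2 * Real.pi) ^ 2 * ((Real.pi - -Real.pi)⁻¹ •
      ∫ l in (-Real.pi)..Real.pi, ‖(φ u l : ℂ)‖ ^ 2)
      = 2 * Real.pi * ∫ l in (-Real.pi)..Real.pi, φ u l ^ 2 := by
    rw [show Real.pi - -Real.pi = 2 * Real.pi by ring, smul_eq_mul]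
    have hpi := Real.pi_ne_zero
    simp only [Complex.norm_real, Real.norm_eq_abs, sq_abs]
    field_simp
  rw [e1] at h2
  refine h2.congr_fun fun k => ?_
  simp only [Function.comp_apply, Equiv.neg_apply, e, norm_mul, mul_pow, Complex.norm_real,
    Real.norm_eq_abs, abs_of_pos Real.pi_pos, abs_two]

theorem Tame.sum_sq_cosCoef_le {φ : ℝ → ℝ → ℝ} (hφ : Tame φ) {u : ℝ}
    (hu : u ∈ Set.Icc (0 : ℝ) 1) (s : Finset ℤ) :
    ∑ k ∈ s, cosCoef φ u k ^ 2 ≤ 2 * Real.pi * ∫ l in (-Real.pi)..Real.pi, φ u l ^ 2 := by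
  calc _ ≤ ∑ k ∈ s, ‖fourierCoef φ u k‖ ^ 2 := by
        refine Finset.sum_le_sum fun k _ => ?_
        rw [← sq_abs]
        gcongr
        exact Complex.abs_re_le_norm _
    _ ≤ _ := sum_le_hasSum s (fun k _ => by positivity) (hφ.hasSum_sq_fourierCoef hu)

/-- The `L¹` norm of a slice is bounded by the sum of the Fourier coefficients. -/
theorem Tame.integral_abs_le {φ : ℝ → ℝ → ℝ} (hφ : Tame φ) {u : ℝ} (hu : u ∈ Set.Icc (0 : ℝ) 1) :
    ENNReal.ofReal (∫ l in (-Real.pi)..Real.pi, |φ u l|) ≤ ∑' k : ℤ, ‖fourierCoef φ u k‖ₑ := by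
  by_cases htop : ∑' k : ℤ, ‖fourierCoef φ u k‖ₑ = ∞
  · rw [htop]
    exact le_top
  have hs : Summable fun k : ℤ => ‖fourierCoef φ u k‖ := by
    simpa using ENNReal.summable_toReal htop
  have e : ∑' k : ℤ, ‖fourierCoef φ u k‖ₑ = ENNReal.ofReal (∑' k : ℤ, ‖fourierCoef φ u k‖) := by
    rw [ENNReal.ofReal_tsum_of_nonneg (fun _ => norm_nonneg _) hs]
    simp
  rw [e]
  refine ENNReal.ofReal_le_ofReal ?_
  set S := ∑' k : ℤ, ‖fourierCoef φ u k‖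
  have hS0 : 0 ≤ S := tsum_nonneg fun _ => norm_nonneg _
  have hP := hφ.hasSum_sq_fourierCoef hu
  -- Parseval's identity, with the ℓ² norm of the coefficients bounded by their ℓ¹ norm.
  have hsq : 2 * Real.pi * ∫ l in (-Real.pi)..Real.pi, φ u l ^ 2 ≤ S ^ 2 := by
    refine hasSum_le_of_sum_le hP fun s => ?_
    calc ∑ k ∈ s, ‖fourierCoef φ u k‖ ^ 2 ≤ (∑ k ∈ s, ‖fourierCoef φ u k‖) ^ 2 :=
          by
            rw [sq, Finset.sum_mul]
            refine Finset.sum_le_sum fun k hk => ?_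
            rw [sq]
            gcongr
            exact Finset.single_le_sum (f := fun k => ‖fourierCoef φ u k‖)
              (fun _ _ => norm_nonneg _) hk
      _ ≤ S ^ 2 := by
          gcongr
          exact hs.sum_le_tsum s fun _ _ => norm_nonneg _
  have hcs : (∫ l in (-Real.pi)..Real.pi, |φ u l|) ^ 2
      ≤ 2 * Real.pi * ∫ l in (-Real.pi)..Real.pi, φ u l ^ 2 := by
    simp only [intervalIntegral.integral_of_le Tame.neg_pi_le_pi]
    set ν := volume.restrict (Set.Ioc (-Real.pi) Real.pi) with hν
    set I := ∫ l, |φ u l| ∂ν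
    have h1 : Integrable (fun l => |φ u l|) ν := (memLp_one_iff_integrable.1 (hφ.memLp_slice hu 1)).abs
    have h2 : Integrable (fun l => φ u l ^ 2) ν := (hφ.memLp_slice hu 2).integrable_sq
    have hvol : ν.real Set.univ = 2 * Real.pi := by
      simp [hν, Measure.real, Real.volume_Ioc]
      rw [ENNReal.toReal_ofReal (by linarith [Real.pi_pos])]
      ring
    -- Cauchy–Schwarz on an interval of length 2π, obtained by expanding the square around the mean
    -- of |φ|.
    have h3 : 0 ≤ ∫ l, (2 * Real.pi * |φ u l| - I) ^ 2 ∂ν := integral_nonneg fun l => sq_nonneg _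
    have h4 : ∫ l, (2 * Real.pi * |φ u l| - I) ^ 2 ∂ν
        = (2 * Real.pi) ^ 2 * ∫ l, φ u l ^ 2 ∂ν - 2 * Real.pi * I ^ 2 := by
      have e : ∀ l, (2 * Real.pi * |φ u l| - I) ^ 2
          = (2 * Real.pi) ^ 2 * φ u l ^ 2 - (4 * Real.pi * I) * |φ u l| + I ^ 2 := fun l => by
        rw [← sq_abs (φ u l)]
        ring
      simp only [e]
      rw [integral_add (f := fun l => (2 * Real.pi) ^ 2 * φ u l ^ 2 - 4 * Real.pi * I * |φ u l|)
          ((h2.const_mul _).sub (h1.const_mul _)) (integrable_const _),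
        integral_sub (h2.const_mul _) (h1.const_mul _), integral_const_mul, integral_const_mul,
        integral_const, hvol, smul_eq_mul]
      ring
    rw [h4] at h3
    have hpi := Real.pi_pos
    have : 0 ≤ 2 * Real.pi * (2 * Real.pi * (∫ l, φ u l ^ 2 ∂ν) - I ^ 2) := by linarith
    have := nonneg_of_mul_nonneg_right this (by positivity)
    linarith
  exact abs_le_of_sq_le_sq' (hcs.trans hsq) hS0 |>.2

/-! ### Functions of bounded variation -/

/-- The function v is the variation accumulated up to x; superadditivity of the variation over
adjacent pieces bounds increments. A bounded monotone majorant makes sums of increments over a grid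
telescope. -/
theorem exists_monotone_dist_le {E : Type*} [PseudoMetricSpace E] {f : ℝ → E} {s : Set ℝ}
    (h : eVariationOn f s ≠ ∞) :
    ∃ v : ℝ → ℝ, Monotone v ∧ (∀ x, 0 ≤ v x) ∧ (∀ x, v x ≤ (eVariationOn f s).toReal) ∧
      ∀ x ∈ s, ∀ y ∈ s, x ≤ y → dist (f x) (f y) ≤ v y - v x := by
  have hfin : ∀ x, eVariationOn f (s ∩ Set.Iic x) ≠ ∞ := fun x =>
    ne_top_of_le_ne_top h (eVariationOn.mono f Set.inter_subset_left)
  refine ⟨fun x => (eVariationOn f (s ∩ Set.Iic x)).toReal, ?_, fun x => ENNReal.toReal_nonneg,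
    fun x => ENNReal.toReal_mono h (eVariationOn.mono f Set.inter_subset_left), ?_⟩
  · intro x y hxy
    exact ENNReal.toReal_mono (hfin y)
      (eVariationOn.mono f (Set.inter_subset_inter_right _ (Set.Iic_subset_Iic.2 hxy)))
  · intro x hx y hy hxy
    have h1 : eVariationOn f (s ∩ Set.Iic x) + eVariationOn f (s ∩ Set.Icc x y)
        ≤ eVariationOn f (s ∩ Set.Iic y) := by
      refine (eVariationOn.add_le_union f fun a ha b hb => ?_).trans (eVariationOn.mono f ?_)
      · exact le_trans ha.2 hb.2.1
      · rintro z (hz | hz)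
        · exact ⟨hz.1, le_trans hz.2 hxy⟩
        · exact ⟨hz.1, hz.2.2⟩
    have h2 : edist (f x) (f y) ≤ eVariationOn f (s ∩ Set.Icc x y) :=
      eVariationOn.edist_le f ⟨hx, le_rfl, hxy⟩ ⟨hy, hxy, le_rfl⟩
    have h3 : eVariationOn f (s ∩ Set.Iic x) + edist (f x) (f y) ≤ eVariationOn f (s ∩ Set.Iic y) :=
      (add_le_add le_rfl h2).trans h1
    have h4 := ENNReal.toReal_mono (hfin y) h3
    rw [ENNReal.toReal_add (hfin x) (edist_ne_top _ _), edist_dist,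
      ENNReal.toReal_ofReal dist_nonneg] at h4
    linarith

theorem sum_Icc_one_eq {M : Type*} [AddCommMonoid M] (n : ℕ) (f : ℤ → M) :
    ∑ t ∈ Finset.Icc (1 : ℤ) n, f t = ∑ i ∈ Finset.range n, f (i + 1) := by
  symm
  refine Finset.sum_nbij' (fun i : ℕ => (i : ℤ) + 1) (fun t => (t - 1).toNat) ?_ ?_ ?_ ?_ ?_
  · intro i hi
    simp only [Finset.mem_range, Finset.mem_Icc] at hi ⊢
    omega
  · intro t ht
    simp only [Finset.mem_range, Finset.mem_Icc] at ht ⊢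
    omega
  · intro i hi
    simp
  · intro t ht
    simp only [Finset.mem_Icc] at ht
    omega
  · intro i hi
    rfl

theorem sum_Icc_sub (n : ℕ) (w : ℤ → ℝ) :
    ∑ t ∈ Finset.Icc (1 : ℤ) n, (w t - w (t - 1)) = w n - w 0 := by
  rw [sum_Icc_one_eq]
  simp only [add_sub_cancel_right]
  have := Finset.sum_range_sub (fun i : ℕ => w i) n
  push_cast at this
  exact this

/-- An increment over N steps is a sum of N unit increments, and each of the N resulting families
telescopes to at most V. -/
theorem sum_Icc_increment_le (n : ℕ) (w : ℤ → ℝ) {V : ℝ} (h0 : ∀ i, 0 ≤ w i) (hV : ∀ i, w i ≤ V)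
    (d : ℤ) (N : ℕ) :
    ∑ t ∈ Finset.Icc (1 : ℤ) n, (w (t + d + N) - w (t + d)) ≤ N * V := by
  induction N with
  | zero => simp
  | succ N ih =>
    have h := sum_Icc_sub n (fun i => w (i + d + N + 1))
    have h2 : ∑ t ∈ Finset.Icc (1 : ℤ) n, (w (t + d + (N + 1 : ℕ)) - w (t + d))
        = ∑ t ∈ Finset.Icc (1 : ℤ) n, (w (t + d + N) - w (t + d)) +
          ∑ t ∈ Finset.Icc (1 : ℤ) n, (w (t + d + N + 1) - w (t - 1 + d + N + 1)) := by
      rw [← Finset.sum_add_distrib]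
      refine Finset.sum_congr rfl fun t _ => ?_
      rw [show t - 1 + d + N + 1 = t + d + N by ring,
        show t + d + ((N + 1 : ℕ) : ℤ) = t + d + N + 1 by push_cast; ring]
      ring
    rw [h2, h]
    push_cast
    linarith [h0 (0 + d + N + 1), hV (n + d + N + 1)]

/-! ### Cells of the time axis -/

theorem cell_mem {n : ℕ} {t : ℤ} (h1 : 1 ≤ t) (h2 : t ≤ n) :
    (0 : ℝ) ≤ ((t : ℝ) - 1) / n ∧ ((t : ℝ) - 1) / n ≤ t / n ∧ (t : ℝ) / n ≤ 1 ∧ (0 : ℝ) < t / n := by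
  have hn : (0 : ℝ) < n := by
    have : (1 : ℤ) ≤ n := h1.trans h2
    exact_mod_cast this
  have h1' : (1 : ℝ) ≤ t := by exact_mod_cast h1
  have h2' : (t : ℝ) ≤ n := by exact_mod_cast h2
  refine ⟨div_nonneg (by linarith) hn.le, by gcongr; linarith, ?_, by positivity⟩
  rw [div_le_one hn]
  exact h2'

theorem cell_subset {n : ℕ} {t : ℤ} (h1 : 1 ≤ t) (h2 : t ≤ n) :
    Set.Icc (((t : ℝ) - 1) / n) (t / n) ⊆ Set.Icc 0 1 := by
  obtain ⟨a, b, c, d⟩ := cell_mem h1 h2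
  exact Set.Icc_subset_Icc a c

theorem sum_cell_integral {n : ℕ} (hn : 1 ≤ n) {E : Type*} [NormedAddCommGroup E] [NormedSpace ℝ E]
    {h : ℝ → E} (hh : IntervalIntegrable h volume 0 1) :
    ∑ t ∈ Finset.Icc (1 : ℤ) n, ∫ u in (((t : ℝ) - 1) / n)..(t / n), h u = ∫ u in (0 : ℝ)..1, h u := by
  have hn' : (0 : ℝ) < n := by exact_mod_cast hn
  rw [sum_Icc_one_eq]
  have := intervalIntegral.sum_integral_adjacent_intervals (μ := volume) (f := h)
    (a := fun i : ℕ => (i : ℝ) / n) (n := n) (fun k hk => ?_)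
  · simp only [Nat.cast_zero, zero_div, div_self hn'.ne'] at this
    rw [← this]
    refine Finset.sum_congr rfl fun i _ => ?_
    push_cast
    rw [add_sub_cancel_right]
  · refine hh.mono_set ?_
    rw [Set.uIcc_of_le (by gcongr; simp), Set.uIcc_of_le zero_le_one]
    refine Set.Icc_subset_Icc (by positivity) ?_
    rw [div_le_one hn']
    exact_mod_cast hk

/-! ### Averages of Fourier coefficients over cells -/

theorem measurable_fourierCoef {φ : ℝ → ℝ → ℝ} (hφ : Measurable (Function.uncurry φ)) (k : ℤ) :
    Measurable fun u => fourierCoef φ u k := by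
  unfold fourierCoef
  simp only [intervalIntegral.integral_of_le Tame.neg_pi_le_pi]
  refine (StronglyMeasurable.integral_prod_right
    (f := fun u l => (φ u l : ℂ) * Complex.exp (Complex.I * (l : ℂ) * (k : ℂ))) ?_).measurable
  refine Measurable.stronglyMeasurable ?_
  have h1 : Measurable fun p : ℝ × ℝ => (φ p.1 p.2 : ℂ) := Complex.measurable_ofReal.comp hφ
  exact h1.mul (by fun_prop)

theorem measurable_cosCoef {φ : ℝ → ℝ → ℝ} (hφ : Measurable (Function.uncurry φ)) (k : ℤ) :
    Measurable fun u => cosCoef φ u k :=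
  Complex.measurable_re.comp (measurable_fourierCoef hφ k)

theorem Tame.exists_cosCoef_bound {φ : ℝ → ℝ → ℝ} (hφ : Tame φ) :
    ∃ M : ℝ, ∀ u ∈ Set.Icc (0 : ℝ) 1, ∀ k, |cosCoef φ u k| ≤ M := by
  obtain ⟨M, hM⟩ := hφ.bdd
  refine ⟨M * |Real.pi - -Real.pi|, fun u hu k => ?_⟩
  rw [hφ.cosCoef_eq hu, ← Real.norm_eq_abs]
  refine intervalIntegral.norm_integral_le_of_norm_le_const fun l hl => ?_
  rw [Set.uIoc_of_le Tame.neg_pi_le_pi] at hl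
  have h := hM u hu l (Set.Ioc_subset_Icc_self hl)
  rw [norm_mul, Real.norm_eq_abs, Real.norm_eq_abs]
  exact (mul_le_of_le_one_right (abs_nonneg _) (Real.abs_cos_le_one _)).trans h

theorem Tame.cosCoef_integrable {φ : ℝ → ℝ → ℝ} (hφ : Tame φ) (k : ℤ) :
    IntegrableOn (fun u => cosCoef φ u k) (Set.Icc 0 1) := by
  obtain ⟨M, hM⟩ := hφ.exists_cosCoef_bound
  refine Integrable.of_bound (measurable_cosCoef hφ.meas k).aestronglyMeasurable M ?_
  filter_upwards [ae_restrict_mem measurableSet_Icc] with u hu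
  exact hM u hu k

theorem intervalIntegrable_of_integrableOn_unit {E : Type*} [NormedAddCommGroup E]
    {h : ℝ → E} (hh : IntegrableOn h (Set.Icc 0 1)) {a b : ℝ} (ha : a ∈ Set.Icc (0 : ℝ) 1)
    (hb : b ∈ Set.Icc (0 : ℝ) 1) : IntervalIntegrable h volume a b := by
  refine (hh.mono_set ?_).intervalIntegrable
  exact Set.uIcc_subset_Icc ha hb

/-- The integral of the coefficient over the cell `((t-1)/n, t/n]`. -/
def cellCoef (φ : ℝ → ℝ → ℝ) (n : ℕ) (t k : ℤ) : ℝ :=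
  ∫ u in (((t : ℝ) - 1) / n)..(t / n), cosCoef φ u k

theorem Tame.cosCoef_intervalIntegrable {φ : ℝ → ℝ → ℝ} (hφ : Tame φ) (k : ℤ) {a b : ℝ}
    (ha : a ∈ Set.Icc (0 : ℝ) 1) (hb : b ∈ Set.Icc (0 : ℝ) 1) :
    IntervalIntegrable (fun u => cosCoef φ u k) volume a b :=
  intervalIntegrable_of_integrableOn_unit (hφ.cosCoef_integrable k) ha hb

theorem cell_ends_mem {n : ℕ} {t : ℤ} (h1 : 1 ≤ t) (h2 : t ≤ n) :
    ((t : ℝ) - 1) / n ∈ Set.Icc (0 : ℝ) 1 ∧ (t : ℝ) / n ∈ Set.Icc (0 : ℝ) 1 := by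
  obtain ⟨a, b, c, d⟩ := cell_mem h1 h2
  exact ⟨⟨a, b.trans c⟩, ⟨a.trans b, c⟩⟩

theorem Tame.cellCoef_sub {φ ψ : ℝ → ℝ → ℝ} (hφ : Tame φ) (hψ : Tame ψ) {n : ℕ} {t : ℤ}
    (h1 : 1 ≤ t) (h2 : t ≤ n) (k : ℤ) :
    cellCoef (fun u l => φ u l - ψ u l) n t k = cellCoef φ n t k - cellCoef ψ n t k := by
  obtain ⟨ha, hb⟩ := cell_ends_mem h1 h2
  unfold cellCoef
  rw [← intervalIntegral.integral_sub (hφ.cosCoef_intervalIntegrable k ha hb)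
    (hψ.cosCoef_intervalIntegrable k ha hb)]
  refine intervalIntegral.integral_congr fun u hu => ?_
  exact hφ.cosCoef_sub hψ (Set.uIcc_subset_Icc ha hb hu) k

theorem cell_length {n : ℕ} (t : ℤ) : (t : ℝ) / n - ((t : ℝ) - 1) / n = 1 / n := by
  rw [← sub_div]
  ring_nf

/-- Monotone majorants of the increments of the Fourier coefficients. -/
theorem exists_variation_majorants {φ : ℝ → ℝ → ℝ} {v : ℝ} (hv : vSum φ ≤ ENNReal.ofReal v) :
    ∃ w : ℤ → ℝ → ℝ, (∀ k, Monotone (w k)) ∧ (∀ k x, 0 ≤ w k x) ∧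
      (∀ x, Summable fun k => w k x) ∧ (∀ x, ∑' k, w k x ≤ max v 0) ∧
      ∀ k, ∀ x ∈ Set.Icc (0 : ℝ) 1, ∀ y ∈ Set.Icc (0 : ℝ) 1, x ≤ y →
        ‖fourierCoef φ x k - fourierCoef φ y k‖ ≤ w k y - w k x := by
  have htop : ∑' k : ℤ, coefVariation φ k ≠ ∞ := ne_top_of_le_ne_top ENNReal.ofReal_ne_top hv
  have hk : ∀ k, coefVariation φ k ≠ ∞ := fun k => ENNReal.ne_top_of_tsum_ne_top htop k
  choose w h1 h2 h3 h4 using fun k => exists_monotone_dist_le (hk k)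
  have hs : Summable fun k => (coefVariation φ k).toReal := ENNReal.summable_toReal htop
  have hsum : ∀ x, Summable fun k => w k x := fun x =>
    Summable.of_nonneg_of_le (fun k => h2 k x) (fun k => h3 k x) hs
  refine ⟨w, h1, h2, hsum, fun x => ?_, fun k x hx y hy hxy => ?_⟩
  · refine ((hsum x).tsum_le_tsum (fun k => h3 k x) hs).trans ?_
    have h5 : ∑' k, (coefVariation φ k).toReal = (vSum φ).toReal :=
      (ENNReal.tsum_toReal_eq hk).symm
    calc _ = (vSum φ).toReal := h5
      _ ≤ (ENNReal.ofReal v).toReal := ENNReal.toReal_mono ENNReal.ofReal_ne_top hv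
      _ = max v 0 := ENNReal.toReal_ofReal'
  · rw [← dist_eq_norm]
    exact h4 k x hx y hy hxy

/-- Replacing coefficients at grid points by their averages over cells. -/
theorem Tame.sum_abs_sub_cellCoef_le {φ : ℝ → ℝ → ℝ} (hφ : Tame φ) {v : ℝ}
    (hv0 : 0 ≤ v) (hv : vSum φ ≤ ENNReal.ofReal v) {n : ℕ} (s : Finset ℤ) :
    ∑ t ∈ Finset.Icc (1 : ℤ) n, ∑ k ∈ s, |cosCoef φ (t / n) k / n - cellCoef φ n t k| ≤ v / n := by
  obtain ⟨w, h1, h2, h3, h4, h5⟩ := exists_variation_majorants hv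
  rw [Finset.sum_comm]
  -- On a cell the coefficient moves by at most the increment of its majorant, the cell has length
  -- 1/n, and the increments telescope over t.
  have key : ∀ k, ∑ t ∈ Finset.Icc (1 : ℤ) n, |cosCoef φ (t / n) k / n - cellCoef φ n t k|
      ≤ w k 1 / n := by
    intro k
    calc _ ≤ ∑ t ∈ Finset.Icc (1 : ℤ) n, (w k (t / n) - w k ((t - 1 : ℤ) / n)) * (1 / n) := by
          refine Finset.sum_le_sum fun t ht => ?_
          rw [Finset.mem_Icc] at ht
          obtain ⟨ha, hb⟩ := cell_ends_mem ht.1 ht.2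
          obtain ⟨a, b, c, d⟩ := cell_mem ht.1 ht.2
          have e : cosCoef φ (t / n) k / n - cellCoef φ n t k
              = ∫ u in (((t : ℝ) - 1) / n)..(t / n), (cosCoef φ (t / n) k - cosCoef φ u k) := by
            rw [intervalIntegral.integral_sub intervalIntegrable_const
              (hφ.cosCoef_intervalIntegrable k ha hb), intervalIntegral.integral_const, cell_length,
              cellCoef]
            simp [div_eq_inv_mul]
          rw [e, ← Real.norm_eq_abs]
          have := intervalIntegral.norm_integral_le_of_norm_le_const
            (f := fun u => cosCoef φ (t / n) k - cosCoef φ u k)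
            (C := w k (t / n) - w k ((t - 1 : ℤ) / n))
            (a := ((t : ℝ) - 1) / n) (b := t / n) fun u hu => ?_
          · rwa [cell_length, abs_of_nonneg (by positivity)] at this
          · rw [Set.uIoc_of_le b] at hu
            have hu1 : u ∈ Set.Icc (0 : ℝ) 1 := ⟨a.trans hu.1.le, hu.2.trans c⟩
            calc ‖cosCoef φ (t / n) k - cosCoef φ u k‖
                ≤ ‖fourierCoef φ u k - fourierCoef φ (t / n) k‖ := by
                  rw [norm_sub_rev, cosCoef, cosCoef, ← Complex.sub_re]
                  exact Complex.abs_re_le_norm _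
              _ ≤ w k (t / n) - w k u := h5 k u hu1 _ hb hu.2
              _ ≤ _ := by
                  have : w k ((t - 1 : ℤ) / n) ≤ w k u := h1 k (by push_cast; exact hu.1.le)
                  linarith
      _ = (w k (n / n) - w k (0 / n)) * (1 / n) := by
          rw [← Finset.sum_mul]
          congr 1
          have := sum_Icc_sub n (fun i => w k ((i : ℝ) / n))
          simpa using this
      _ ≤ w k 1 / n := by
          rw [mul_one_div]
          gcongr
          -- Here n = 0 is allowed and n / n is then 0, so the inequality n / n ≤ 1 is used instead
          -- of equality.
          have : w k ((n : ℝ) / n) ≤ w k 1 := h1 k (div_self_le_one _)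
          linarith [h2 k (0 / n)]
  calc _ ≤ ∑ k ∈ s, w k 1 / n := Finset.sum_le_sum fun k _ => key k
    _ = (∑ k ∈ s, w k 1) / n := (Finset.sum_div _ _ _).symm
    _ ≤ v / n := by
        gcongr
        have := h4 1
        rw [max_eq_left hv0] at this
        exact ((h3 1).sum_le_tsum s fun k _ => h2 k 1).trans this

/-- The `L¹` modulus of continuity of a slice. -/
theorem Tame.exists_L1_modulus {φ : ℝ → ℝ → ℝ} (hφ : Tame φ) {v : ℝ}
    (hv0 : 0 ≤ v) (hv : vSum φ ≤ ENNReal.ofReal v) :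
    ∃ w : ℝ → ℝ, Monotone w ∧ (∀ x, 0 ≤ w x) ∧ (∀ x, w x ≤ v) ∧
      ∀ x ∈ Set.Icc (0 : ℝ) 1, ∀ y ∈ Set.Icc (0 : ℝ) 1, x ≤ y →
        ∫ l in (-Real.pi)..Real.pi, |φ x l - φ y l| ≤ w y - w x := by
  obtain ⟨w, h1, h2, h3, h4, h5⟩ := exists_variation_majorants hv
  refine ⟨fun x => ∑' k, w k x, fun x y hxy => (h3 x).tsum_le_tsum (fun k => h1 k hxy) (h3 y),
    fun x => tsum_nonneg fun k => h2 k x, fun x => (h4 x).trans_eq (max_eq_left hv0),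
    fun x hx y hy hxy => ?_⟩
  -- The difference of two slices, viewed as a function constant in time, so that
  -- `Tame.integral_abs_le` applies to it.
  have hT : Tame fun _ l => φ x l - φ y l := by
    obtain ⟨M, hM⟩ := hφ.bdd
    exact ⟨((hφ.measurable_slice x).sub (hφ.measurable_slice y)).comp measurable_snd, M + M,
      fun u _ l hl => (abs_sub _ _).trans (add_le_add (hM x hx l hl) (hM y hy l hl))⟩
  have hF : ∀ k, fourierCoef (fun _ l => φ x l - φ y l) x k
      = fourierCoef φ x k - fourierCoef φ y k := by
    intro k
    unfold fourierCoef
    rw [← intervalIntegral.integral_sub (hφ.intervalIntegrable_mul_exp hx k)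
      (hφ.intervalIntegrable_mul_exp hy k)]
    congr 1
    ext l
    push_cast
    ring
  have h := hT.integral_abs_le hx
  simp only [hF] at h
  have hsub : Summable fun k => w k y - w k x := (h3 y).sub (h3 x)
  have h6 : ∑' k, ‖fourierCoef φ x k - fourierCoef φ y k‖ₑ
      ≤ ENNReal.ofReal (∑' k, w k y - ∑' k, w k x) := by
    rw [← (h3 y).tsum_sub (h3 x), ENNReal.ofReal_tsum_of_nonneg (fun k => sub_nonneg.2 (h1 k hxy)) hsub]
    refine ENNReal.tsum_le_tsum fun k => ?_
    rw [← ofReal_norm]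
    exact ENNReal.ofReal_le_ofReal (h5 k x hx y hy hxy)
  refine (ENNReal.ofReal_le_ofReal_iff ?_).1 (h.trans h6)
  exact sub_nonneg.2 ((h3 x).tsum_le_tsum (fun k => h1 k hxy) (h3 y))

/-- Majorants of the Fourier coefficients. -/
theorem exists_coef_majorants {φ : ℝ → ℝ → ℝ} {ρ : ℝ} (h : rhoInf φ ≤ ENNReal.ofReal ρ) :
    ∃ c : ℤ → ℝ, (∀ k, 0 ≤ c k) ∧ Summable c ∧ ∑' k, c k ≤ max ρ 0 ∧
      ∀ k, ∀ u ∈ Set.Icc (0 : ℝ) 1, ‖fourierCoef φ u k‖ ≤ c k := by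
  have htop : rhoInf φ ≠ ∞ := ne_top_of_le_ne_top ENNReal.ofReal_ne_top h
  have hk : ∀ k, (⨆ u ∈ Set.Icc (0 : ℝ) 1, ‖fourierCoef φ u k‖ₑ) ≠ ∞ := fun k =>
    ENNReal.ne_top_of_tsum_ne_top htop k
  refine ⟨fun k => (⨆ u ∈ Set.Icc (0 : ℝ) 1, ‖fourierCoef φ u k‖ₑ).toReal,
    fun k => ENNReal.toReal_nonneg, ENNReal.summable_toReal htop, ?_, fun k u hu => ?_⟩
  · calc _ = (rhoInf φ).toReal := (ENNReal.tsum_toReal_eq hk).symm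
      _ ≤ (ENNReal.ofReal ρ).toReal := ENNReal.toReal_mono ENNReal.ofReal_ne_top h
      _ = max ρ 0 := ENNReal.toReal_ofReal'
  · rw [← toReal_enorm]
    exact ENNReal.toReal_mono (hk k) (le_iSup₂ (f := fun u _ => ‖fourierCoef φ u k‖ₑ) u hu)

theorem abs_cosCoef_le (φ : ℝ → ℝ → ℝ) (u : ℝ) (k : ℤ) : |cosCoef φ u k| ≤ ‖fourierCoef φ u k‖ :=
  Complex.abs_re_le_norm _

theorem tfMeasure_eq : tfMeasure = (volume.restrict (Set.Icc (0 : ℝ) 1)).prod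
    (volume.restrict (Set.Icc (-Real.pi) Real.pi)) := by
  rw [tfMeasure, Measure.prod_restrict]
  rfl

instance : IsFiniteMeasure tfMeasure := by
  rw [tfMeasure_eq]
  infer_instance

/-- The endpoint u = 0 is removed because the coefficient curves are controlled only on (0, 1]. -/
theorem ae_tfMeasure_mem : ∀ᵐ p ∂tfMeasure, p.1 ∈ Set.Ioc (0 : ℝ) 1 ∧
    p.2 ∈ Set.Icc (-Real.pi) Real.pi := by
  rw [tfMeasure_eq, ← restrict_Ioc_eq_restrict_Icc, Measure.prod_restrict]
  filter_upwards [ae_restrict_mem (measurableSet_Ioc.prod measurableSet_Icc)] with p hp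
  exact hp

theorem Tame.memLp {φ : ℝ → ℝ → ℝ} (hφ : Tame φ) (p : ℝ≥0∞) :
    MemLp (fun x : ℝ × ℝ => φ x.1 x.2) p tfMeasure := by
  obtain ⟨M, hM⟩ := hφ.bdd
  refine MemLp.of_bound hφ.meas.aestronglyMeasurable M ?_
  filter_upwards [ae_tfMeasure_mem] with x hx
  exact hM _ (Set.Ioc_subset_Icc_self hx.1) _ hx.2

/-! ### Expansion of the spectral density and of its functionals -/

section Sample

variable {Ω : Type*} [MeasurableSpace Ω] {P : Measure Ω} [IsProbabilityMeasure P]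
  {κ K : ℝ} {ε : ℤ → Ω → ℝ} {aT : ℕ → ℤ → ℤ → ℝ} {a : ℝ → ℤ → ℝ} {X : ℕ → ℤ → Ω → ℝ}

namespace IsLocallyStationary

theorem exists_curve_majorant (hX : IsLocallyStationary P κ K ε aT a X) (j : ℤ) :
    ∃ v : ℝ → ℝ, Monotone v ∧ (∀ x, 0 ≤ v x) ∧ (∀ x, v x ≤ K / ell κ j) ∧
      ∀ x ∈ Set.Ioc (0 : ℝ) 1, ∀ y ∈ Set.Ioc (0 : ℝ) 1, x ≤ y → |a x j - a y j| ≤ v y - v x := by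
  have h := hX.curve_variation j
  have htop := ne_top_of_le_ne_top ENNReal.ofReal_ne_top h
  obtain ⟨v, h1, h2, h3, h4⟩ := exists_monotone_dist_le htop
  refine ⟨v, h1, h2, fun x => (h3 x).trans ?_, h4⟩
  calc _ ≤ (ENNReal.ofReal (K / ell κ j)).toReal := ENNReal.toReal_mono ENNReal.ofReal_ne_top h
    _ = _ := ENNReal.toReal_ofReal (hX.weight_nonneg j)

/-- Jordan decomposition: the curve is the difference of the monotone functions v and v - a. -/
theorem aemeasurable_curve (hX : IsLocallyStationary P κ K ε aT a X) (j : ℤ) :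
    AEMeasurable (fun u => a u j) (volume.restrict (Set.Icc (0 : ℝ) 1)) := by
  rw [← restrict_Ioc_eq_restrict_Icc]
  obtain ⟨v, h1, h2, h3, h4⟩ := hX.exists_curve_majorant j
  have h5 : MonotoneOn (fun u => v u - a u j) (Set.Ioc 0 1) := by
    intro x hx y hy hxy
    have := (abs_le.1 (h4 x hx y hy hxy)).1
    simp only
    linarith
  have h6 := aemeasurable_restrict_of_monotoneOn (μ := volume) measurableSet_Ioc h5
  have h7 := (h1.measurable.aemeasurable (μ := volume.restrict (Set.Ioc (0 : ℝ) 1))).sub h6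
  refine h7.congr (ae_of_all _ fun u => ?_)
  simp

theorem curve_summable (hX : IsLocallyStationary P κ K ε aT a X) {u : ℝ}
    (hu : u ∈ Set.Ioc (0 : ℝ) 1) : Summable fun j => |a u j| :=
  Summable.of_nonneg_of_le (fun _ => abs_nonneg _) (fun j => hX.curve_bound u hu j)
    hX.summable_weight

/-- The expansion of the spectral density. -/
theorem hasSum_spectralDensity (hX : IsLocallyStationary P κ K ε aT a X) {u : ℝ}
    (hu : u ∈ Set.Ioc (0 : ℝ) 1) (l : ℝ) :
    HasSum (fun p : ℤ × ℤ => 1 / (2 * Real.pi) * (a u p.1 * a u p.2 * Real.cos ((p.1 - p.2 : ℤ) * l)))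
      (spectralDensity a u l) := by
  set g : ℤ → ℂ := fun j => (a u j : ℂ) * Complex.exp (-Complex.I * (l : ℂ) * (j : ℂ)) with hg
  have hnorm : ∀ j, ‖g j‖ = |a u j| := fun j => by
    rw [hg]
    simp only [norm_mul, Complex.norm_real, Real.norm_eq_abs]
    have : -Complex.I * (l : ℂ) * (j : ℂ) = ((-(l * j) : ℝ) : ℂ) * Complex.I := by push_cast; ring
    rw [this, Complex.norm_exp_ofReal_mul_I, mul_one]
  have hgs : Summable fun j => ‖g j‖ := by
    simp only [hnorm]
    exact hX.curve_summable hu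
  have hcs : Summable fun j => ‖(starRingEnd ℂ) (g j)‖ := by
    simpa using hgs
  -- The squared modulus is the transfer function times its conjugate, a product of two absolutely
  -- convergent series.
  have h1 : HasSum (fun p : ℤ × ℤ => g p.1 * (starRingEnd ℂ) (g p.2))
      ((∑' j, g j) * (starRingEnd ℂ) (∑' j, g j)) := by
    rw [Complex.conj_tsum, tsum_mul_tsum_of_summable_norm hgs hcs]
    exact (summable_mul_of_summable_norm hgs hcs).hasSum
  have h2 := (Complex.hasSum_re h1).mul_left (1 / (2 * Real.pi))
  rw [Complex.mul_conj] at h2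
  have hval : spectralDensity a u l
      = 1 / (2 * Real.pi) * ((Complex.normSq (∑' j, g j) : ℝ) : ℂ).re := by
    rw [Complex.ofReal_re, Complex.normSq_eq_norm_sq]
    rfl
  rw [hval]
  refine h2.congr_fun fun p => ?_
  congr 1
  simp only [hg, map_mul, Complex.conj_ofReal, ← Complex.exp_conj]
  rw [mul_mul_mul_comm, ← Complex.exp_add, ← Complex.ofReal_mul, Complex.re_ofReal_mul]
  congr 1
  have : -Complex.I * (l : ℂ) * (p.1 : ℂ) +
      (starRingEnd ℂ) (-Complex.I) * (l : ℂ) * (starRingEnd ℂ) (p.2 : ℂ)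
      = ((-((p.1 - p.2 : ℤ) * l) : ℝ) : ℂ) * Complex.I := by
    simp
    ring
  rw [this, Complex.exp_ofReal_mul_I_re, Real.cos_neg]

theorem spectralDensity_nonneg (a : ℝ → ℤ → ℝ) (u l : ℝ) : 0 ≤ spectralDensity a u l := by
  unfold spectralDensity
  have := Real.pi_pos
  positivity

theorem summable_weight_prod (hX : IsLocallyStationary P κ K ε aT a X) :
    Summable fun p : ℤ × ℤ => K / ell κ p.1 * (K / ell κ p.2) := by
  have h := hX.summable_weight.mul_of_nonneg hX.summable_weight hX.weight_nonneg hX.weight_nonneg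
  exact h

theorem abs_curve_mul_le (hX : IsLocallyStationary P κ K ε aT a X) {u : ℝ}
    (hu : u ∈ Set.Ioc (0 : ℝ) 1) (i j : ℤ) : |a u i * a u j| ≤ K / ell κ i * (K / ell κ j) := by
  rw [abs_mul]
  gcongr
  · exact hX.weight_nonneg i
  · exact hX.curve_bound u hu i
  · exact hX.curve_bound u hu j

theorem spectralDensity_le (hX : IsLocallyStationary P κ K ε aT a X) {u : ℝ}
    (hu : u ∈ Set.Ioc (0 : ℝ) 1) (l : ℝ) :
    spectralDensity a u l ≤ 1 / (2 * Real.pi) * (∑' j, K / ell κ j) ^ 2 := by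
  have h := hX.hasSum_spectralDensity hu l
  have e : (∑' j, K / ell κ j) ^ 2 = ∑' p : ℤ × ℤ, K / ell κ p.1 * (K / ell κ p.2) := by
    rw [sq]
    exact hX.summable_weight.tsum_mul_tsum hX.summable_weight hX.summable_weight_prod
  rw [e]
  have hpi := Real.pi_pos
  refine hasSum_le (fun p => ?_) h (hX.summable_weight_prod.hasSum.mul_left _)
  refine mul_le_mul_of_nonneg_left ?_ (by positivity)
  calc _ ≤ |a u p.1 * a u p.2 * Real.cos ((p.1 - p.2 : ℤ) * l)| := le_abs_self _
    _ ≤ |a u p.1 * a u p.2| := by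
        rw [abs_mul _ (Real.cos _)]
        exact mul_le_of_le_one_right (abs_nonneg _) (Real.abs_cos_le_one _)
    _ ≤ _ := hX.abs_curve_mul_le hu _ _

theorem aemeasurable_curve_fst (hX : IsLocallyStationary P κ K ε aT a X) (j : ℤ) :
    AEMeasurable (fun p : ℝ × ℝ => a p.1 j) tfMeasure := by
  rw [tfMeasure_eq]
  exact (hX.aemeasurable_curve j).comp_fst

theorem aemeasurable_spectralDensity (hX : IsLocallyStationary P κ K ε aT a X) :
    AEMeasurable (fun p : ℝ × ℝ => spectralDensity a p.1 p.2) tfMeasure := by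
  unfold spectralDensity
  refine AEMeasurable.const_mul (AEMeasurable.pow_const (AEMeasurable.norm ?_) 2) _
  refine AEMeasurable.tsum fun j => ?_
  refine AEMeasurable.mul (Complex.measurable_ofReal.comp_aemeasurable
    (hX.aemeasurable_curve_fst j)) (Measurable.aemeasurable ?_)
  fun_prop

/-- The limiting spectral functional in terms of Fourier coefficients. -/
theorem hasSum_integral_mul_spectralDensity (hX : IsLocallyStationary P κ K ε aT a X)
    {φ : ℝ → ℝ → ℝ} (hφ : Tame φ) :
    Integrable (fun p : ℝ × ℝ => φ p.1 p.2 * spectralDensity a p.1 p.2) tfMeasure ∧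
    HasSum (fun q : ℤ × ℤ => ∫ u in (0 : ℝ)..1, a u q.2 * a u (q.2 - q.1) * cosCoef φ u q.1)
      (2 * Real.pi * ∫ p, φ p.1 p.2 * spectralDensity a p.1 p.2 ∂tfMeasure) := by
  have hpi := Real.pi_pos
  obtain ⟨M0, hM0⟩ := hφ.bdd
  set M := max M0 0 with hMdef
  have hM : ∀ u ∈ Set.Icc (0 : ℝ) 1, ∀ l ∈ Set.Icc (-Real.pi) Real.pi, |φ u l| ≤ M :=
    fun u hu l hl => (hM0 u hu l hl).trans (le_max_left _ _)
  have hM00 : 0 ≤ M := le_max_right _ _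
  have hint : Integrable (fun p : ℝ × ℝ => φ p.1 p.2 * spectralDensity a p.1 p.2) tfMeasure := by
    refine Integrable.of_bound ((hφ.meas.aemeasurable.mul
      hX.aemeasurable_spectralDensity).aestronglyMeasurable)
      (M * (1 / (2 * Real.pi) * (∑' j, K / ell κ j) ^ 2)) ?_
    filter_upwards [ae_tfMeasure_mem] with p hp
    rw [norm_mul, Real.norm_eq_abs, Real.norm_eq_abs,
      abs_of_nonneg (spectralDensity_nonneg a p.1 p.2)]
    gcongr
    · exact spectralDensity_nonneg a _ _
    · exact hM _ (Set.Ioc_subset_Icc_self hp.1) _ hp.2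
    · exact hX.spectralDensity_le hp.1 _
  refine ⟨hint, ?_⟩
  -- One term of the expansion of φ f, up to the factor 2π. Domination by products of weights allows
  -- sum and integral to be exchanged.
  set F : ℤ × ℤ → ℝ × ℝ → ℝ := fun q p =>
    a p.1 q.1 * a p.1 q.2 * (φ p.1 p.2 * Real.cos ((q.1 - q.2 : ℤ) * p.2)) with hF
  have hFbound : ∀ q, ∀ᵐ p ∂tfMeasure, ‖F q p‖ ≤ K / ell κ q.1 * (K / ell κ q.2) * M := by
    intro q
    filter_upwards [ae_tfMeasure_mem] with p hp
    rw [hF, norm_mul, Real.norm_eq_abs, Real.norm_eq_abs, abs_mul (φ _ _)]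
    have h1 := hX.weight_nonneg q.1
    have h2 := hX.weight_nonneg q.2
    gcongr
    · exact hX.abs_curve_mul_le hp.1 _ _
    · exact (mul_le_of_le_one_right (abs_nonneg _) (Real.abs_cos_le_one _)).trans
        (hM _ (Set.Ioc_subset_Icc_self hp.1) _ hp.2)
  have hFint : ∀ q, Integrable (F q) tfMeasure := by
    intro q
    refine Integrable.of_bound (AEMeasurable.aestronglyMeasurable ?_) _ (hFbound q)
    refine ((hX.aemeasurable_curve_fst _).mul (hX.aemeasurable_curve_fst _)).mul
      (Measurable.aemeasurable ?_)
    have h1 : Measurable fun p : ℝ × ℝ => φ p.1 p.2 := hφ.meas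
    exact h1.mul (by fun_prop)
  have hsum := hasSum_integral_of_summable_integral_norm hFint (by
    refine Summable.of_nonneg_of_le (fun q => integral_nonneg fun _ => norm_nonneg _) (fun q => ?_)
      ((hX.summable_weight_prod.mul_right M).mul_right (tfMeasure.real Set.univ))
    calc ∫ p, ‖F q p‖ ∂tfMeasure ≤ ∫ _, K / ell κ q.1 * (K / ell κ q.2) * M ∂tfMeasure :=
          integral_mono_ae (hFint q).norm (integrable_const _) (hFbound q)
      _ = _ := by rw [integral_const, smul_eq_mul, mul_comm])
  have hFtsum : ∫ p, ∑' q, F q p ∂tfMeasure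
      = 2 * Real.pi * ∫ p, φ p.1 p.2 * spectralDensity a p.1 p.2 ∂tfMeasure := by
    rw [← integral_const_mul]
    refine integral_congr_ae ?_
    filter_upwards [ae_tfMeasure_mem] with p hp
    have h := ((hX.hasSum_spectralDensity hp.1 p.2).mul_left (2 * Real.pi * φ p.1 p.2)).tsum_eq
    rw [← mul_assoc, ← h]
    refine tsum_congr fun q => ?_
    simp only [hF]
    field_simp
  rw [hFtsum] at hsum
  have hFval : ∀ q : ℤ × ℤ, ∫ p, F q p ∂tfMeasure
      = ∫ u in (0 : ℝ)..1, a u q.1 * a u q.2 * cosCoef φ u (q.1 - q.2) := by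
    intro q
    have h1 := hFint q
    rw [tfMeasure_eq] at h1 ⊢
    rw [integral_prod _ h1, intervalIntegral.integral_of_le zero_le_one,
      ← integral_Icc_eq_integral_Ioc]
    refine integral_congr_ae ?_
    filter_upwards [ae_restrict_mem measurableSet_Icc] with u hu
    simp only [hF]
    rw [integral_const_mul, hφ.cosCoef_eq hu, intervalIntegral.integral_of_le Tame.neg_pi_le_pi,
      ← integral_Icc_eq_integral_Ioc]
  simp only [hFval] at hsum
  -- Indices (i, j) are replaced by (lag, i), the form in which the covariances of the process
  -- appear.
  let e : ℤ × ℤ ≃ ℤ × ℤ :=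
    { toFun := fun p => (p.2, p.2 - p.1)
      invFun := fun q => (q.1 - q.2, q.1)
      left_inv := fun p => by ext <;> simp
      right_inv := fun q => by ext <;> simp }
  rw [← e.hasSum_iff] at hsum
  refine hsum.congr_fun fun q => ?_
  simp [e]

end IsLocallyStationary

end Sample

/-! ### The bias of the smoothed quadratic functional -/

theorem mem_lagSet {n : ℕ} {t k : ℤ} : k ∈ lagSet n t ↔ (-(n : ℤ) ≤ k ∧ k ≤ n) ∧
    (1 ≤ (2 * t + 1 + k) / 2 ∧ (2 * t + 1 + k) / 2 ≤ n) ∧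
      (1 ≤ (2 * t + 1 - k) / 2 ∧ (2 * t + 1 - k) / 2 ≤ n) := by
  simp only [lagSet, Finset.mem_filter, Finset.mem_Icc, floor_lag_add, floor_lag_sub]

/-- Only midpoints within |k| of an end of the sample can lose the lag k. -/
theorem card_not_mem_lagSet_le (n : ℕ) (k : ℤ) :
    ((((Finset.Icc (1 : ℤ) n).filter fun t => k ∉ lagSet n t).card : ℕ) : ℝ) ≤ 2 * |(k : ℝ)| := by
  have hsub : (Finset.Icc (1 : ℤ) n).filter (fun t => k ∉ lagSet n t)
      ⊆ Finset.Icc 1 |k| ∪ Finset.Icc (n - |k| + 1) n := by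
    intro t ht
    simp only [Finset.mem_filter, Finset.mem_Icc, mem_lagSet, Finset.mem_union] at ht ⊢
    rcases abs_cases k with ⟨h, _⟩ | ⟨h, _⟩ <;> rw [h] <;> omega
  have h1 := (Finset.card_le_card hsub).trans (Finset.card_union_le _ _)
  rw [Int.card_Icc, Int.card_Icc] at h1
  have h2 : (((Finset.Icc (1 : ℤ) n).filter fun t => k ∉ lagSet n t).card : ℤ) ≤ 2 * |k| := by
    have := abs_nonneg k
    omega
  have h3 : ((((Finset.Icc (1 : ℤ) n).filter fun t => k ∉ lagSet n t).card : ℤ) : ℝ)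
      ≤ ((2 * |k| : ℤ) : ℝ) := by exact_mod_cast h2
  push_cast at h3
  exact h3

section Sample

variable {Ω : Type*} [MeasurableSpace Ω] {P : Measure Ω} [IsProbabilityMeasure P]
  {κ K : ℝ} {ε : ℤ → Ω → ℝ} {aT : ℕ → ℤ → ℤ → ℝ} {a : ℝ → ℤ → ℝ} {X : ℕ → ℤ → Ω → ℝ}

namespace IsLocallyStationary

/-- Products of the coefficients at the two observation times belonging to midpoint `t` and
lag `k`, and zero if one of these times lies outside of the observation window. -/
def lagProduct (aT : ℕ → ℤ → ℤ → ℝ) (n : ℕ) (t k i : ℤ) : ℝ :=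
  if k ∈ lagSet n t then aT n ((2 * t + 1 + k) / 2) i * aT n ((2 * t + 1 - k) / 2) (i - k) else 0

set_option maxHeartbeats 1000000 in
/-- Comparison of the coefficient products with those of the limiting curves. -/
theorem sum_integral_lagProduct_le (hX : IsLocallyStationary P κ K ε aT a X) {B : ℝ}
    (hB : ∀ j : ℤ, |(j : ℝ)| ≤ B * ell κ j) (hB0 : 0 ≤ B) (φ : ℝ → ℝ → ℝ) {n : ℕ} (hn : 1 ≤ n)
    (k i : ℤ) {c : ℝ} (hc : ∀ u ∈ Set.Icc (0 : ℝ) 1, |cosCoef φ u k| ≤ c) :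
    ∑ t ∈ Finset.Icc (1 : ℤ) n, |∫ u in (((t : ℝ) - 1) / n)..(t / n),
        (lagProduct aT n t k i - a u i * a u (i - k)) * cosCoef φ u k|
      ≤ c / n * ((K + 12 * B * K + 12 * ∑' j, K / ell κ j) * (K / ell κ i + K / ell κ (i - k))) := by
  have hc0 : 0 ≤ c := (abs_nonneg _).trans (hc 0 ⟨le_rfl, zero_le_one⟩)
  have hn0 : (0 : ℝ) < n := by exact_mod_cast hn
  set j := i - k with hj
  set S := ∑' j, K / ell κ j with hS
  have hwi := hX.weight_nonneg i
  have hwj := hX.weight_nonneg j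
  set wi := K / ell κ i with hwidef
  set wj := K / ell κ j with hwjdef
  clear_value wi wj S
  obtain ⟨vi, hvi1, hvi2, hvi3, hvi4⟩ := hX.exists_curve_majorant i
  obtain ⟨vj, hvj1, hvj2, hvj3, hvj4⟩ := hX.exists_curve_majorant j
  rw [← hwidef] at hvi3
  rw [← hwjdef] at hvj3
  -- A crude radius: both observation times with midpoint t, and t times n-scaled points of its
  -- cell, lie between t - 1 - m and t + m.
  set m : ℕ := k.natAbs + 1 with hm
  have hmk : (m : ℤ) = |k| + 1 := by simp [hm]
  set r : ℤ → ℤ := fun t => (2 * t + 1 + k) / 2 with hr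
  set s : ℤ → ℤ := fun t => (2 * t + 1 - k) / 2 with hs
  set Vi : ℤ → ℝ := fun t => vi ((t + m : ℤ) / n) - vi ((t - 1 - m : ℤ) / n) with hVi
  set Vj : ℤ → ℝ := fun t => vj ((t + m : ℤ) / n) - vj ((t - 1 - m : ℤ) / n) with hVj
  have hVi0 : ∀ t, 0 ≤ Vi t := fun t => sub_nonneg.2 (hvi1 (by
    gcongr
    omega))
  have hVj0 : ∀ t, 0 ≤ Vj t := fun t => sub_nonneg.2 (hvj1 (by
    gcongr
    omega))
  -- pointwise bound
  set D : ℤ → ℝ := fun t => (if k ∈ lagSet n t then |aT n (r t) i - a (r t / n) i| * wj +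
    wi * |aT n (s t) j - a (s t / n) j| else 0) + (Vi t * wj + wi * Vj t) +
    (if k ∈ lagSet n t then 0 else wi * wj) with hD
  have hpt : ∀ t ∈ Finset.Icc (1 : ℤ) n, ∀ u ∈ Set.Ioc (((t : ℝ) - 1) / n) (t / n),
      |lagProduct aT n t k i - a u i * a u j| ≤ D t := by
    intro t ht u hu
    rw [Finset.mem_Icc] at ht
    obtain ⟨ha, hb, hc', hd⟩ := cell_mem ht.1 ht.2
    have hu1 : u ∈ Set.Ioc (0 : ℝ) 1 := ⟨ha.trans_lt hu.1, hu.2.trans hc'⟩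
    by_cases hk : k ∈ lagSet n t
    · have hk' := mem_lagSet.1 hk
      simp only [lagProduct, hD, if_pos hk, add_zero]
      have near : ∀ (v : ℝ → ℝ) (f : ℝ → ℝ), Monotone v → (∀ x ∈ Set.Ioc (0 : ℝ) 1,
          ∀ y ∈ Set.Ioc (0 : ℝ) 1, x ≤ y → |f x - f y| ≤ v y - v x) → ∀ q : ℤ, 1 ≤ q → q ≤ n →
          t - 1 - m ≤ q → q ≤ t + m →
          |f (q / n) - f u| ≤ v ((t + m : ℤ) / n) - v ((t - 1 - m : ℤ) / n) := by
        intro v f hv hf q hq1 hq2 hq3 hq4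
        obtain ⟨_, _, q3, q4⟩ := cell_mem hq1 hq2
        have hq : (q : ℝ) / n ∈ Set.Ioc (0 : ℝ) 1 := ⟨q4, q3⟩
        have l1 : v ((t - 1 - m : ℤ) / n) ≤ v (q / n) := hv (by gcongr)
        have l2 : v (q / n) ≤ v ((t + m : ℤ) / n) := hv (by gcongr)
        have l3 : v ((t - 1 - m : ℤ) / n) ≤ v u := hv (by
          refine le_trans ?_ hu.1.le
          gcongr
          push_cast
          have : (0 : ℝ) ≤ m := m.cast_nonneg
          linarith)
        have l4 : v u ≤ v ((t + m : ℤ) / n) := hv (by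
          refine le_trans hu.2 ?_
          gcongr
          omega)
        rcases le_total ((q : ℝ) / n) u with h | h
        · have := hf _ hq _ hu1 h
          linarith
        · have := hf _ hu1 _ hq h
          rw [abs_sub_comm]
          linarith
      have b1 : |a (r t / n) i - a u i| ≤ Vi t := by
        refine near vi (fun x => a x i) hvi1 hvi4 (r t) hk'.2.1.1 hk'.2.1.2 ?_ ?_ <;>
        · simp only [hr]
          rcases abs_cases k with ⟨h, _⟩ | ⟨h, _⟩ <;> rw [h] at hmk <;> omega
      have b2 : |a (s t / n) j - a u j| ≤ Vj t := by
        refine near vj (fun x => a x j) hvj1 hvj4 (s t) hk'.2.2.1 hk'.2.2.2 ?_ ?_ <;>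
        · simp only [hs]
          rcases abs_cases k with ⟨h, _⟩ | ⟨h, _⟩ <;> rw [h] at hmk <;> omega
      have b3 : |aT n (s t) j| ≤ wj := hwjdef ▸ hX.coeff_bound n (s t) j hk'.2.2.1 hk'.2.2.2
      have b4 : |a u i| ≤ wi := hwidef ▸ hX.curve_bound u hu1 i
      -- The two factors are changed one at a time, each in two moves: from the array coefficient to
      -- the curve at its own observation time, then from there to u.
      have e : aT n (r t) i * aT n (s t) j - a u i * a u j
          = (aT n (r t) i - a (r t / n) i) * aT n (s t) j + (a (r t / n) i - a u i) * aT n (s t) j +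
            a u i * (aT n (s t) j - a (s t / n) j) + a u i * (a (s t / n) j - a u j) := by ring
      rw [show aT n ((2 * t + 1 + k) / 2) i * aT n ((2 * t + 1 - k) / 2) j
        = aT n (r t) i * aT n (s t) j from rfl, e]
      have c1 := mul_le_mul_of_nonneg_left b3 (abs_nonneg (aT n (r t) i - a (r t / n) i))
      have c2 := mul_le_mul b1 b3 (abs_nonneg _) (hVi0 t)
      have c3 := mul_le_mul_of_nonneg_right b4 (abs_nonneg (aT n (s t) j - a (s t / n) j))
      have c4 := mul_le_mul b4 b2 (abs_nonneg _) hwi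
      rw [← abs_mul] at c1 c2 c3 c4
      have t1 := abs_add_le ((aT n (r t) i - a (r t / n) i) * aT n (s t) j +
        (a (r t / n) i - a u i) * aT n (s t) j + a u i * (aT n (s t) j - a (s t / n) j))
        (a u i * (a (s t / n) j - a u j))
      have t2 := abs_add_le ((aT n (r t) i - a (r t / n) i) * aT n (s t) j +
        (a (r t / n) i - a u i) * aT n (s t) j) (a u i * (aT n (s t) j - a (s t / n) j))
      have t3 := abs_add_le ((aT n (r t) i - a (r t / n) i) * aT n (s t) j)
        ((a (r t / n) i - a u i) * aT n (s t) j)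
      linarith
    · simp only [lagProduct, hD, if_neg hk, zero_sub, abs_neg, zero_add]
      have := hX.abs_curve_mul_le hu1 i j
      rw [← hwidef, ← hwjdef] at this
      have h1 := mul_nonneg (hVi0 t) hwj
      have h2 := mul_nonneg hwi (hVj0 t)
      linarith
  have hcell : ∀ t ∈ Finset.Icc (1 : ℤ) n, |∫ u in (((t : ℝ) - 1) / n)..(t / n),
      (lagProduct aT n t k i - a u i * a u j) * cosCoef φ u k| ≤ D t * c * (1 / n) := by
    intro t ht
    have ht' := Finset.mem_Icc.1 ht
    obtain ⟨ha, hb, hc', hd⟩ := cell_mem ht'.1 ht'.2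
    have := intervalIntegral.norm_integral_le_of_norm_le_const
      (f := fun u => (lagProduct aT n t k i - a u i * a u j) * cosCoef φ u k)
      (C := D t * c) (a := ((t : ℝ) - 1) / n) (b := t / n) fun u hu => ?_
    · rwa [cell_length, abs_of_nonneg (a := 1 / (n : ℝ)) (by positivity)] at this
    · rw [Set.uIoc_of_le hb] at hu
      have hu1 : u ∈ Set.Icc (0 : ℝ) 1 := ⟨ha.trans hu.1.le, hu.2.trans hc'⟩
      rw [norm_mul]
      exact mul_le_mul (hpt t ht u hu) (hc u hu1) (abs_nonneg _)
        ((abs_nonneg _).trans (hpt t ht u hu))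
  -- summation over `t`
  have approx : ∀ (q : ℤ → ℤ) (l : ℤ), Function.Injective q →
      (∀ t, k ∈ lagSet n t → 1 ≤ q t ∧ q t ≤ n) →
      ∑ t ∈ (Finset.Icc (1 : ℤ) n).filter (fun t => k ∈ lagSet n t),
        |aT n (q t) l - a (q t / n) l| ≤ K := by
    intro q l hq hq2
    rw [← Finset.sum_image (g := q) (f := fun t => |aT n t l - a (t / n) l|) fun x _ y _ h => hq h]
    refine le_trans (Finset.sum_le_sum_of_subset_of_nonneg ?_ fun _ _ _ => abs_nonneg _)
      (hX.coeff_approx n l)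
    intro x hx
    simp only [Finset.mem_image, Finset.mem_filter] at hx
    obtain ⟨t, ht, rfl⟩ := hx
    exact Finset.mem_Icc.2 (hq2 t ht.2)
  -- Windows of 2m + 1 steps overlap, so their increments sum to at most 2m + 1 times the total
  -- variation.
  have vsum : ∀ (v : ℝ → ℝ) (w : ℝ), (∀ x, 0 ≤ v x) → (∀ x, v x ≤ w) →
      ∑ t ∈ Finset.Icc (1 : ℤ) n, (v ((t + m : ℤ) / n) - v ((t - 1 - m : ℤ) / n))
        ≤ (2 * m + 1 : ℕ) * w := by
    intro v w h1 h2
    have := sum_Icc_increment_le n (fun i : ℤ => v ((i : ℝ) / n)) (fun i => h1 _) (fun i => h2 _)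
      (-1 - m) (2 * m + 1)
    refine le_trans (le_of_eq ?_) this
    refine Finset.sum_congr rfl fun t _ => ?_
    congr 4 <;> push_cast <;> ring
  have hsumD : ∑ t ∈ Finset.Icc (1 : ℤ) n, D t
      ≤ K * (wi + wj) + (6 * |(k : ℝ)| + 6) * (wi * wj) + 2 * |(k : ℝ)| * (wi * wj) := by
    simp only [hD, Finset.sum_add_distrib]
    have s1 : ∑ t ∈ Finset.Icc (1 : ℤ) n, (if k ∈ lagSet n t then
        |aT n (r t) i - a (r t / n) i| * wj + wi * |aT n (s t) j - a (s t / n) j| else 0)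
        ≤ K * wj + wi * K := by
      rw [← Finset.sum_filter, Finset.sum_add_distrib, ← Finset.sum_mul, ← Finset.mul_sum]
      have a1 := approx r i (fun x y h => by simp only [hr] at h; omega)
        (fun t ht => (mem_lagSet.1 ht).2.1)
      have a2 := approx s j (fun x y h => by simp only [hs] at h; omega)
        (fun t ht => (mem_lagSet.1 ht).2.2)
      gcongr
    have s2 : ∑ t ∈ Finset.Icc (1 : ℤ) n, Vi t * wj ≤ (2 * m + 1 : ℕ) * wi * wj := by
      rw [← Finset.sum_mul]
      gcongr
      exact vsum vi wi hvi2 hvi3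
    have s3 : ∑ t ∈ Finset.Icc (1 : ℤ) n, wi * Vj t ≤ wi * ((2 * m + 1 : ℕ) * wj) := by
      rw [← Finset.mul_sum]
      gcongr
      exact vsum vj wj hvj2 hvj3
    have s4 : ∑ t ∈ Finset.Icc (1 : ℤ) n, (if k ∈ lagSet n t then 0 else wi * wj)
        ≤ 2 * |(k : ℝ)| * (wi * wj) := by
      have : ∀ t, (if k ∈ lagSet n t then 0 else wi * wj) = if k ∉ lagSet n t then wi * wj else 0 :=
        fun t => by split_ifs <;> simp_all
      simp only [this]
      rw [← Finset.sum_filter, Finset.sum_const, nsmul_eq_mul]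
      gcongr
      exact card_not_mem_lagSet_le n k
    have hmr : ((2 * m + 1 : ℕ) : ℝ) = 2 * |(k : ℝ)| + 3 := by
      have : ((m : ℤ) : ℝ) = |(k : ℝ)| + 1 := by rw [hmk]; push_cast; ring
      push_cast at this ⊢
      rw [this]
      ring
    rw [hmr] at s2 s3
    have hw := mul_nonneg hwi hwj
    have hk0 := abs_nonneg (k : ℝ)
    nlinarith [mul_nonneg hk0 hw]
  -- Window width and boundary loss are both proportional to |k|. Since |k| ≤ |i| + |i - k| and ℓ(j)
  -- grows at least linearly, one of the two weights absorbs this factor.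
  have hkw : |(k : ℝ)| * (wi * wj) ≤ B * K * (wi + wj) := by
    have hki : |(k : ℝ)| ≤ |(i : ℝ)| + |(j : ℝ)| := by
      have : (k : ℝ) = i - j := by rw [hj]; push_cast; ring
      rw [this]
      exact abs_sub _ _
    have hiw : ∀ q : ℤ, |(q : ℝ)| * (K / ell κ q) ≤ B * K := by
      intro q
      have hq := ell_pos κ q
      rw [← mul_div_assoc, div_le_iff₀ hq]
      nlinarith [hB q, hX.K_nonneg]
    have h1 := mul_le_mul_of_nonneg_right (hiw i) hwj
    have h2 := mul_le_mul_of_nonneg_right (hiw j) hwi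
    have h3 := mul_le_mul_of_nonneg_right hki (mul_nonneg hwi hwj)
    rw [← hwidef] at h1
    rw [← hwjdef] at h2
    nlinarith
  have hww : wi * wj ≤ S * (wi + wj) := by
    have h1 : wi ≤ S := hS ▸ hwidef ▸ hX.summable_weight.le_tsum _ fun j _ => hX.weight_nonneg j
    nlinarith [mul_le_mul_of_nonneg_right h1 hwj, mul_nonneg (hwi.trans h1) hwi]
  calc _ ≤ ∑ t ∈ Finset.Icc (1 : ℤ) n, D t * c * (1 / n) := Finset.sum_le_sum hcell
    _ = c / n * ∑ t ∈ Finset.Icc (1 : ℤ) n, D t := by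
        rw [Finset.mul_sum]
        refine Finset.sum_congr rfl fun t _ => ?_
        ring
    _ ≤ _ := by
        gcongr
        have hBK : 0 ≤ B * K * (wi + wj) := by
          have := hX.K_nonneg
          positivity
        have hSw : 0 ≤ S * (wi + wj) := by
          have : 0 ≤ S := hS ▸ hX.tsum_weight_nonneg
          positivity
        nlinarith

end IsLocallyStationary

end Sample

section Sample

variable {Ω : Type*} [MeasurableSpace Ω] {P : Measure Ω} [IsProbabilityMeasure P]
  {κ K : ℝ} {ε : ℤ → Ω → ℝ} {aT : ℕ → ℤ → ℤ → ℝ} {a : ℝ → ℤ → ℝ} {X : ℕ → ℤ → Ω → ℝ}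

namespace IsLocallyStationary

theorem intervalIntegrable_curve_mul_cosCoef (hX : IsLocallyStationary P κ K ε aT a X)
    {φ : ℝ → ℝ → ℝ} (hφ : Tame φ) (i j k : ℤ) :
    IntervalIntegrable (fun u => a u i * a u j * cosCoef φ u k) volume 0 1 := by
  obtain ⟨M, hM⟩ := hφ.exists_cosCoef_bound
  rw [intervalIntegrable_iff_integrableOn_Ioc_of_le zero_le_one]
  have hms : ∀ i, AEStronglyMeasurable (fun u => a u i) (volume.restrict (Set.Ioc (0 : ℝ) 1)) :=
    fun i => ((hX.aemeasurable_curve i).mono_measure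
      (Measure.restrict_mono Set.Ioc_subset_Icc_self le_rfl)).aestronglyMeasurable
  refine Integrable.mono' (integrable_const (K / ell κ i * (K / ell κ j) * M))
    (((hms i).mul (hms j)).mul (measurable_cosCoef hφ.meas k).aestronglyMeasurable) ?_
  refine (ae_restrict_iff' measurableSet_Ioc).2 (Eventually.of_forall fun u hu => ?_)
  rw [norm_mul]
  exact mul_le_mul (hX.abs_curve_mul_le hu i j) (hM u (Set.Ioc_subset_Icc_self hu) k) (abs_nonneg _)
    (mul_nonneg (hX.weight_nonneg _) (hX.weight_nonneg _))

theorem tsum_lagProduct (hX : IsLocallyStationary P κ K ε aT a X) (n : ℕ) (t k : ℤ) :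
    Summable (fun i => lagProduct aT n t k i) ∧ ∑' i, lagProduct aT n t k i =
      if k ∈ lagSet n t then
        ∫ ω, X n ((2 * t + 1 + k) / 2) ω * X n ((2 * t + 1 - k) / 2) ω ∂P else 0 := by
  by_cases hk : k ∈ lagSet n t
  · have h := mem_lagSet.1 hk
    simp only [lagProduct, if_pos hk]
    constructor
    · refine Summable.of_norm_bounded (hX.summable_weight_mul k) fun i => ?_
      rw [norm_mul]
      exact mul_le_mul (hX.coeff_bound n _ i h.2.1.1 h.2.1.2)
        (hX.coeff_bound n _ _ h.2.2.1 h.2.2.2) (abs_nonneg _) (hX.weight_nonneg _)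
    · rw [hX.covariance_eq h.2.1.1 h.2.1.2 h.2.2.1 h.2.2.2,
        show (2 * t + 1 + k) / 2 - (2 * t + 1 - k) / 2 = k by omega]
  · simp [lagProduct, if_neg hk, summable_zero]

/-- The bias of the smoothed quadratic functional is of order `ρ_∞(φ) / n`. -/
theorem exists_bias_bound (hX : IsLocallyStationary P κ K ε aT a X) :
    ∃ C : ℝ, 0 ≤ C ∧ ∀ (φ : ℝ → ℝ → ℝ) (ρ : ℝ), Tame φ → 0 ≤ ρ → rhoInf φ ≤ ENNReal.ofReal ρ →
      ∀ n : ℕ, 1 ≤ n →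
      |1 / (2 * Real.pi) * ∑ r ∈ Finset.Icc (1 : ℤ) n, ∑ s ∈ Finset.Icc (1 : ℤ) n,
          cellCoef φ n ((r + s) / 2) (r - s) * ∫ ω, X n r ω * X n s ω ∂P
        - ∫ p, φ p.1 p.2 * spectralDensity a p.1 p.2 ∂tfMeasure| ≤ C * ρ / n := by
  obtain ⟨B, hB1, hB⟩ := exists_abs_le_mul_ell hX.kappa_pos
  set w : ℤ → ℝ := fun j => K / ell κ j with hw
  set S := ∑' j, w j with hS
  have hw0 : ∀ j, 0 ≤ w j := hX.weight_nonneg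
  have hws : Summable w := hX.summable_weight
  have hS0 : 0 ≤ S := tsum_nonneg hw0
  have hK := hX.K_nonneg
  set M := K + 12 * B * K + 12 * S with hM
  have hM0 : 0 ≤ M := by positivity
  refine ⟨M * (2 * S), by positivity, fun φ ρ hφ hρ0 hρ n hn => ?_⟩
  have hn0 : (0 : ℝ) < n := by exact_mod_cast hn
  have hpi := Real.pi_pos
  obtain ⟨c, hc0, hcs, hcρ, hc⟩ := exists_coef_majorants hρ
  rw [max_eq_left hρ0] at hcρ
  set P1 : ℤ × ℤ → ℝ := fun q => ∑ t ∈ Finset.Icc (1 : ℤ) n,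
    lagProduct aT n t q.1 q.2 * cellCoef φ n t q.1 with hP1
  set P2 : ℤ × ℤ → ℝ := fun q => ∫ u in (0 : ℝ)..1, a u q.2 * a u (q.2 - q.1) * cosCoef φ u q.1
    with hP2
  -- The comparison is made for each lag and each product of coefficients separately, because this
  -- majorant is summable over all pairs with total proportional to ρ/n.
  have hdiff : ∀ q : ℤ × ℤ, |P1 q - P2 q|
      ≤ M / n * (c q.1 * w q.2 + c q.1 * w (q.2 - q.1)) := by
    rintro ⟨k, i⟩
    have hint := hX.intervalIntegrable_curve_mul_cosCoef hφ i (i - k) k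
    have e : P1 (k, i) - P2 (k, i) = ∑ t ∈ Finset.Icc (1 : ℤ) n,
        ∫ u in (((t : ℝ) - 1) / n)..(t / n),
          (lagProduct aT n t k i - a u i * a u (i - k)) * cosCoef φ u k := by
      simp only [hP1, hP2]
      rw [← sum_cell_integral hn hint, ← Finset.sum_sub_distrib]
      refine Finset.sum_congr rfl fun t ht => ?_
      have ht' := Finset.mem_Icc.1 ht
      have hsub := cell_subset ht'.1 ht'.2
      have hends := cell_ends_mem ht'.1 ht'.2
      simp only [sub_mul]
      rw [intervalIntegral.integral_sub, intervalIntegral.integral_const_mul]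
      · rfl
      · exact (hφ.cosCoef_intervalIntegrable k hends.1 hends.2).const_mul _
      · refine hint.mono_set ?_
        rw [Set.uIcc_of_le (cell_mem ht'.1 ht'.2).2.1, Set.uIcc_of_le zero_le_one]
        exact hsub
    rw [e]
    refine (Finset.abs_sum_le_sum_abs _ _).trans
      ((hX.sum_integral_lagProduct_le hB (by linarith) φ hn k i (c := c k) fun u hu =>
        (abs_cosCoef_le φ u k).trans (hc k u hu)).trans (le_of_eq ?_))
    simp only [hM, hw, hS]
    ring
  have hm1 : HasSum (fun q : ℤ × ℤ => c q.1 * w q.2) ((∑' k, c k) * S) := by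
    have hs := hcs.mul_of_nonneg hws hc0 hw0
    rw [hS, hcs.tsum_mul_tsum hws hs]
    exact hs.hasSum
  have hm2 : HasSum (fun q : ℤ × ℤ => c q.1 * w (q.2 - q.1)) ((∑' k, c k) * S) := by
    let e : ℤ × ℤ ≃ ℤ × ℤ :=
      { toFun := fun p => (p.1, p.2 - p.1)
        invFun := fun q => (q.1, q.2 + q.1)
        left_inv := fun p => by simp
        right_inv := fun q => by simp }
    exact (Equiv.hasSum_iff e).2 hm1
  have hm := (hm1.add hm2).mul_left (M / n)
  obtain ⟨-, hs2⟩ := hX.hasSum_integral_mul_spectralDensity hφ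
  have hsd : Summable fun q => P1 q - P2 q := Summable.of_norm_bounded hm.summable hdiff
  have hs1 : Summable P1 := by
    have := hsd.add hs2.summable
    simpa [hP2] using this
  have hbound : |∑' q, P1 q - ∑' q, P2 q| ≤ M / n * ((∑' k, c k) * S + (∑' k, c k) * S) := by
    rw [← hs1.tsum_sub hs2.summable]
    exact tsum_of_norm_bounded (f := fun q => P1 q - P2 q) hm hdiff
  -- Summing the coefficient products over i produces the covariances; lags outside the window
  -- contribute zero, and `sum_lagSet_eq` converts the rest to pairs of times.
  have htsum : ∑' q, P1 q = ∑ r ∈ Finset.Icc (1 : ℤ) n, ∑ s ∈ Finset.Icc (1 : ℤ) n,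
      cellCoef φ n ((r + s) / 2) (r - s) * ∫ ω, X n r ω * X n s ω ∂P := by
    rw [hs1.tsum_prod]
    have hk : ∀ k, ∑' i, P1 (k, i) = ∑ t ∈ Finset.Icc (1 : ℤ) n, if k ∈ lagSet n t then
        cellCoef φ n t k * ∫ ω, X n ((2 * t + 1 + k) / 2) ω * X n ((2 * t + 1 - k) / 2) ω ∂P
        else 0 := by
      intro k
      simp only [hP1]
      rw [Summable.tsum_finsetSum fun t _ => (hX.tsum_lagProduct n t k).1.mul_right _]
      refine Finset.sum_congr rfl fun t _ => ?_
      rw [tsum_mul_right, (hX.tsum_lagProduct n t k).2]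
      split_ifs <;> ring
    simp only [hk]
    rw [tsum_eq_sum (s := Finset.Icc (-(n : ℤ)) n), Finset.sum_comm,
      ← sum_lagSet_eq n fun t k r s => cellCoef φ n t k * ∫ ω, X n r ω * X n s ω ∂P]
    · refine Finset.sum_congr rfl fun t _ => ?_
      rw [← Finset.sum_filter]
      have hf : (Finset.Icc (-(n : ℤ)) n).filter (fun k => k ∈ lagSet n t) = lagSet n t := by
        ext k
        simp only [Finset.mem_filter, Finset.mem_Icc, mem_lagSet]
        tauto
      rw [hf]
      simp only [floor_lag_add, floor_lag_sub]
    · intro k hk'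
      refine Finset.sum_eq_zero fun t _ => if_neg fun h => hk' ?_
      exact Finset.mem_Icc.2 (mem_lagSet.1 h).1
  rw [htsum, hs2.tsum_eq] at hbound
  have e2 : ∀ x y : ℝ, 1 / (2 * Real.pi) * x - y = 1 / (2 * Real.pi) * (x - 2 * Real.pi * y) := by
    intro x y
    field_simp
  rw [e2, abs_mul, abs_of_pos (by positivity : 0 < 1 / (2 * Real.pi))]
  have hle : 1 / (2 * Real.pi) ≤ 1 := by
    rw [div_le_one (by positivity)]
    linarith [Real.two_le_pi]
  calc _ ≤ 1 * (M / n * ((∑' k, c k) * S + (∑' k, c k) * S)) :=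
        mul_le_mul hle hbound (abs_nonneg _) zero_le_one
    _ = M * (2 * S) / n * ∑' k, c k := by ring
    _ ≤ M * (2 * S) / n * ρ := by gcongr
    _ = _ := by ring

end IsLocallyStationary

end Sample

/-! ### Centred quadratic forms of the observations -/

section Sample

variable {Ω : Type*} [MeasurableSpace Ω] {P : Measure Ω} [IsProbabilityMeasure P]
  {κ K : ℝ} {ε : ℤ → Ω → ℝ} {aT : ℕ → ℤ → ℤ → ℝ} {a : ℝ → ℤ → ℝ} {X : ℕ → ℤ → Ω → ℝ}

theorem IsGaussianArray.hasGaussianLaw (hG : IsGaussianArray P X) (n : ℕ) :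
    HasGaussianLaw (fun ω (t : ↥(Finset.Icc (1 : ℤ) n)) => X n t ω) P := by
  have h := (hG n).hasGaussianLaw Finset.univ
  exact h.map_fun (ContinuousLinearMap.pi fun t : ↥(Finset.Icc (1 : ℤ) n) =>
    ContinuousLinearMap.proj (R := ℝ)
      (φ := fun _ : ↥(Finset.univ : Finset (Set.Icc (1 : ℤ) n)) => ℝ)
      ⟨⟨t, Finset.mem_Icc.1 t.2⟩, Finset.mem_univ _⟩)

/-- A bound for the absolute row sums of all covariance matrices of the process. -/
def covConst (κ K : ℝ) : ℝ := 1 + ∑' p : ℤ × ℤ, K / ell κ p.2 * (K / ell κ (p.2 - p.1))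

/-- A centred quadratic form of the observations. -/
def centredSum (P : Measure Ω) (X : ℕ → ℤ → Ω → ℝ) (n : ℕ) (U : ℤ → ℤ → ℝ) (ω : Ω) : ℝ :=
  ∑ r ∈ Finset.Icc (1 : ℤ) n, ∑ s ∈ Finset.Icc (1 : ℤ) n,
    U r s * (X n r ω * X n s ω - ∫ ω', X n r ω' * X n s ω' ∂P)

theorem sum_sum_coe_sort (n : ℕ) (g : ℤ → ℤ → ℝ) :
    ∑ i : ↥(Finset.Icc (1 : ℤ) n), ∑ j : ↥(Finset.Icc (1 : ℤ) n), g i j =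
      ∑ r ∈ Finset.Icc (1 : ℤ) n, ∑ s ∈ Finset.Icc (1 : ℤ) n, g r s := by
  rw [← Finset.sum_coe_sort (Finset.Icc (1 : ℤ) n)]
  exact Finset.sum_congr rfl fun i _ => Finset.sum_coe_sort (Finset.Icc (1 : ℤ) n) fun s => g i s

theorem centredSum_eq (n : ℕ) (U : ℤ → ℤ → ℝ) (ω : Ω) : centredSum P X n U ω =
    centredForm P (fun (i : ↥(Finset.Icc (1 : ℤ) n)) => X n i) (fun i j => U i j) ω :=
  (sum_sum_coe_sort n fun r s => U r s * (X n r ω * X n s ω - ∫ ω', X n r ω' * X n s ω' ∂P)).symm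

theorem centredSum_sub (n : ℕ) (U V : ℤ → ℤ → ℝ) (ω : Ω) :
    centredSum P X n (fun r s => U r s - V r s) ω = centredSum P X n U ω - centredSum P X n V ω := by
  simp only [centredSum, sub_mul, Finset.sum_sub_distrib]

namespace IsLocallyStationary

theorem one_le_covConst (hX : IsLocallyStationary P κ K ε aT a X) : 1 ≤ covConst κ K := by
  unfold covConst
  have : 0 ≤ ∑' p : ℤ × ℤ, K / ell κ p.2 * (K / ell κ (p.2 - p.1)) :=
    tsum_nonneg fun p => mul_nonneg (hX.weight_nonneg _) (hX.weight_nonneg _)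
  linarith

theorem covConst_pos (hX : IsLocallyStationary P κ K ε aT a X) : 0 < covConst κ K :=
  zero_lt_one.trans_le hX.one_le_covConst

theorem sum_abs_cov_le_covConst (hX : IsLocallyStationary P κ K ε aT a X) {n : ℕ} {r : ℤ}
    (hr : r ∈ Finset.Icc (1 : ℤ) n) :
    ∑ s ∈ Finset.Icc (1 : ℤ) n, |∫ ω, X n r ω * X n s ω ∂P| ≤ covConst κ K := by
  rw [Finset.mem_Icc] at hr
  have := hX.sum_abs_covariance_le hr.1 hr.2
  unfold covConst
  linarith

theorem abs_cov_le_covConst (hX : IsLocallyStationary P κ K ε aT a X) {n : ℕ} {r s : ℤ}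
    (hr : r ∈ Finset.Icc (1 : ℤ) n) (hs : s ∈ Finset.Icc (1 : ℤ) n) :
    |∫ ω, X n r ω * X n s ω ∂P| ≤ covConst κ K :=
  (Finset.single_le_sum (f := fun s => |∫ ω, X n r ω * X n s ω ∂P|) (fun _ _ => abs_nonneg _)
    hs).trans (hX.sum_abs_cov_le_covConst hr)

theorem sum_abs_cov_coe_le (hX : IsLocallyStationary P κ K ε aT a X) {n : ℕ}
    (i : ↥(Finset.Icc (1 : ℤ) n)) :
    ∑ j : ↥(Finset.Icc (1 : ℤ) n), |∫ ω, X n i ω * X n j ω ∂P| ≤ covConst κ K :=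
  (Finset.sum_coe_sort (Finset.Icc (1 : ℤ) n) fun s => |∫ ω, X n i ω * X n s ω ∂P|).trans_le
    (hX.sum_abs_cov_le_covConst i.2)

theorem mean_coe (hX : IsLocallyStationary P κ K ε aT a X) {n : ℕ}
    (i : ↥(Finset.Icc (1 : ℤ) n)) : ∫ ω, X n i ω ∂P = 0 :=
  hX.mean_zero (Finset.mem_Icc.1 i.2).1 (Finset.mem_Icc.1 i.2).2

theorem centredSum_tail (hX : IsLocallyStationary P κ K ε aT a X) (hG : IsGaussianArray P X)
    (n : ℕ) (U : ℤ → ℤ → ℝ) {F L T : ℝ} (hF0 : 0 ≤ F) (hL0 : 0 < L) (hT : 0 ≤ T)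
    (hUF : ∑ r ∈ Finset.Icc (1 : ℤ) n, ∑ s ∈ Finset.Icc (1 : ℤ) n, U r s ^ 2 ≤ F ^ 2)
    (hr : ∀ r ∈ Finset.Icc (1 : ℤ) n, ∑ s ∈ Finset.Icc (1 : ℤ) n, |U r s| ≤ L)
    (hc : ∀ s ∈ Finset.Icc (1 : ℤ) n, ∑ r ∈ Finset.Icc (1 : ℤ) n, |U r s| ≤ L) :
    P {ω | 4 * covConst κ K * (F * Real.sqrt T + L * T) < |centredSum P X n U ω|}
      ≤ ENNReal.ofReal (2 * Real.exp (-T)) := by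
  simp only [centredSum_eq]
  refine centredForm_tail (hG.hasGaussianLaw n) hX.mean_coe hX.covConst_pos hF0 hL0 hT
    hX.sum_abs_cov_coe_le _ ?_ ?_ ?_
  · exact (sum_sum_coe_sort n fun r s => U r s ^ 2).trans_le hUF
  · exact fun i => (Finset.sum_coe_sort (Finset.Icc (1 : ℤ) n) fun s => |U i s|).trans_le (hr i i.2)
  · exact fun j => (Finset.sum_coe_sort (Finset.Icc (1 : ℤ) n) fun r => |U r j|).trans_le (hc j j.2)

theorem centredSum_tail_frobenius (hX : IsLocallyStationary P κ K ε aT a X)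
    (hG : IsGaussianArray P X) (n : ℕ) (U : ℤ → ℤ → ℝ) {F T : ℝ} (hF0 : 0 < F) (hT : 1 ≤ T)
    (hUF : ∑ r ∈ Finset.Icc (1 : ℤ) n, ∑ s ∈ Finset.Icc (1 : ℤ) n, U r s ^ 2 ≤ F ^ 2) :
    P {ω | 8 * covConst κ K * F * T < |centredSum P X n U ω|}
      ≤ ENNReal.ofReal (2 * Real.exp (-T)) := by
  simp only [centredSum_eq]
  exact centredForm_tail_frobenius (hG.hasGaussianLaw n) hX.mean_coe hX.covConst_pos hF0 hT
    hX.sum_abs_cov_coe_le _ ((sum_sum_coe_sort n fun r s => U r s ^ 2).trans_le hUF)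

theorem centredSum_sixth_moment (hX : IsLocallyStationary P κ K ε aT a X)
    (hG : IsGaussianArray P X) (n : ℕ) (U : ℤ → ℤ → ℝ) {F : ℝ} (hF0 : 0 < F)
    (hUF : ∑ r ∈ Finset.Icc (1 : ℤ) n, ∑ s ∈ Finset.Icc (1 : ℤ) n, U r s ^ 2 ≤ F ^ 2) :
    ∫⁻ ω, ENNReal.ofReal (centredSum P X n U ω ^ 6) ∂P
      ≤ ENNReal.ofReal (10 ^ 8 * (covConst κ K * F) ^ 6) := by
  simp only [centredSum_eq]
  exact centredForm_sixth_moment (hG.hasGaussianLaw n) hX.mean_coe hX.covConst_pos hF0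
    hX.sum_abs_cov_coe_le _ ((sum_sum_coe_sort n fun r s => U r s ^ 2).trans_le hUF)

theorem aemeasurable_centredSum (hG : IsGaussianArray P X) (n : ℕ) (U : ℤ → ℤ → ℝ) :
    AEMeasurable (centredSum P X n U) P := by
  have : centredSum P X n U = _ := funext fun ω => centredSum_eq (P := P) (X := X) n U ω
  rw [this]
  exact aemeasurable_centredForm (hG.hasGaussianLaw n) _

/-- Cauchy–Schwarz over the n² pairs of times. This bound needs no entropy and handles all
sufficiently small differences at once. -/
theorem abs_centredSum_le (hX : IsLocallyStationary P κ K ε aT a X) {n : ℕ} {U : ℤ → ℤ → ℝ}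
    {F B : ℝ} (hF : 0 ≤ F)
    (hUF : ∑ r ∈ Finset.Icc (1 : ℤ) n, ∑ s ∈ Finset.Icc (1 : ℤ) n, U r s ^ 2 ≤ F ^ 2) {ω : Ω}
    (hB0 : 0 ≤ B) (hB : ∀ r ∈ Finset.Icc (1 : ℤ) n, X n r ω ^ 2 ≤ B) :
    |centredSum P X n U ω| ≤ F * (n * (B + covConst κ K)) := by
  have hC := hX.covConst_pos
  refine abs_le_of_sq_le_sq ?_ (by positivity)
  simp only [centredSum, ← Finset.sum_product'] at hUF ⊢
  set s := Finset.Icc (1 : ℤ) n ×ˢ Finset.Icc (1 : ℤ) n with hs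
  have hcard : (s.card : ℝ) = n ^ 2 := by
    rw [hs, Finset.card_product, Int.card_Icc]
    simp [sq]
  calc _ ≤ (∑ p ∈ s, U p.1 p.2 ^ 2) *
        ∑ p ∈ s, (X n p.1 ω * X n p.2 ω - ∫ ω', X n p.1 ω' * X n p.2 ω' ∂P) ^ 2 :=
        Finset.sum_mul_sq_le_sq_mul_sq _ _ _
    _ ≤ F ^ 2 * ∑ p ∈ s, (B + covConst κ K) ^ 2 := by
        refine mul_le_mul hUF (Finset.sum_le_sum fun p hp => ?_)
          (Finset.sum_nonneg fun _ _ => sq_nonneg _) (sq_nonneg _)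
        rw [hs, Finset.mem_product] at hp
        rw [sq_le_sq, abs_of_nonneg (a := B + covConst κ K) (by positivity)]
        refine (abs_sub _ _).trans (add_le_add ?_ (hX.abs_cov_le_covConst hp.1 hp.2))
        refine abs_le_of_sq_le_sq ?_ hB0
        rw [mul_pow, sq B]
        gcongr
        · exact hB _ hp.1
        · exact hB _ hp.2
    _ = _ := by
        rw [Finset.sum_const, nsmul_eq_mul, hcard]
        ring

/-- The maximum of the squared observations is of order `log n`. -/
theorem measure_max_sq_le (hX : IsLocallyStationary P κ K ε aT a X) (hG : IsGaussianArray P X)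
    {n : ℕ} (hn : 2 ≤ n) :
    P {ω | ∃ t ∈ Finset.Icc (1 : ℤ) n, 18 * covConst κ K * Real.log n < X n t ω ^ 2}
      ≤ ENNReal.ofReal (2 / n) := by
  have hC := hX.covConst_pos
  have hn2 : (2 : ℝ) ≤ n := by exact_mod_cast hn
  have hlog : 1 / 2 ≤ Real.log n := by
    have h1 := Real.log_two_gt_d9
    have h2 := Real.log_le_log zero_lt_two hn2
    linarith
  have key : ∀ t ∈ Finset.Icc (1 : ℤ) n, P {ω | 18 * covConst κ K * Real.log n < X n t ω ^ 2}
      ≤ ENNReal.ofReal (2 * Real.exp (-(2 * Real.log n))) := by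
    intro t ht
    -- The matrix has the single entry (t, t). With T = 2 log n the tail is 2/n², enough for a union
    -- over n times; 18 is 16 from the tail bound plus 2 for the variance, using 2 log n ≥ 1.
    refine (measure_mono fun ω hω => ?_).trans (hX.centredSum_tail_frobenius hG n
      (fun r s => if r = t then if s = t then 1 else 0 else 0) zero_lt_one
      (T := 2 * Real.log n) (by linarith) (le_of_eq ?_))
    · rw [Set.mem_ofPred_eq] at hω ⊢
      have e : centredSum P X n (fun r s => if r = t then if s = t then 1 else 0 else 0) ω
          = X n t ω * X n t ω - ∫ ω', X n t ω' * X n t ω' ∂P := by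
        unfold centredSum
        rw [Finset.sum_eq_single_of_mem t ht, Finset.sum_eq_single_of_mem t ht]
        · simp
        · intro s _ hs
          simp [hs]
        · intro r _ hr
          simp [hr]
      rw [e]
      have h1 := (abs_le.1 (hX.abs_cov_le_covConst ht ht)).2
      refine lt_of_lt_of_le ?_ (le_abs_self _)
      nlinarith
    · rw [Finset.sum_eq_single_of_mem t ht, Finset.sum_eq_single_of_mem t ht]
      · simp
      · intro s _ hs
        simp [hs]
      · intro r _ hr
        simp [hr]
  have hsub : {ω | ∃ t ∈ Finset.Icc (1 : ℤ) n, 18 * covConst κ K * Real.log n < X n t ω ^ 2}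
      = ⋃ t ∈ Finset.Icc (1 : ℤ) n, {ω | 18 * covConst κ K * Real.log n < X n t ω ^ 2} := by
    ext ω
    simp
  rw [hsub]
  refine (measure_biUnion_finset_le _ _).trans ((Finset.sum_le_sum key).trans (le_of_eq ?_))
  rw [Finset.sum_const, Int.card_Icc, nsmul_eq_mul, ← ENNReal.ofReal_natCast,
    ← ENNReal.ofReal_mul (by positivity)]
  congr 1
  have hn0 : (0 : ℝ) < n := by linarith
  have : ((n : ℤ) + 1 - 1).toNat = n := by simp
  rw [this, Real.exp_neg, two_mul (Real.log n), Real.exp_add, Real.exp_log hn0]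
  field_simp

end IsLocallyStationary

end Sample

/-! ### Matrix norms of smoothed coefficient arrays -/

/-- The `L²` norm `ρ₂` as a real number. -/
def l2 (φ : ℝ → ℝ → ℝ) : ℝ := (rho2 φ).toReal

theorem l2_nonneg (φ : ℝ → ℝ → ℝ) : 0 ≤ l2 φ := ENNReal.toReal_nonneg

theorem Tame.rho2_ne_top {φ : ℝ → ℝ → ℝ} (hφ : Tame φ) : rho2 φ ≠ ∞ := (hφ.memLp 2).2.ne

theorem Tame.rho2_eq {φ : ℝ → ℝ → ℝ} (hφ : Tame φ) : rho2 φ = ENNReal.ofReal (l2 φ) :=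
  (ENNReal.ofReal_toReal hφ.rho2_ne_top).symm

theorem sq_l2_of_memLp {φ : ℝ → ℝ → ℝ}
    (hφ : MemLp (fun p : ℝ × ℝ => φ p.1 p.2) 2 tfMeasure) :
    l2 φ ^ 2 = ∫ p, φ p.1 p.2 ^ 2 ∂tfMeasure := by
  have h := hφ.eLpNorm_eq_integral_rpow_norm two_ne_zero ENNReal.ofNat_ne_top
  unfold l2 rho2
  have h0 : 0 ≤ ∫ p : ℝ × ℝ, φ p.1 p.2 ^ 2 ∂tfMeasure := integral_nonneg fun p => sq_nonneg _
  rw [h, ENNReal.toReal_ofReal (by positivity)]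
  simp only [ENNReal.toReal_ofNat, Real.rpow_ofNat, Real.norm_eq_abs, sq_abs]
  rw [← Real.rpow_natCast, ← Real.rpow_mul h0]
  norm_num

theorem Tame.sq_l2 {φ : ℝ → ℝ → ℝ} (hφ : Tame φ) :
    l2 φ ^ 2 = ∫ p, φ p.1 p.2 ^ 2 ∂tfMeasure := sq_l2_of_memLp (hφ.memLp 2)

theorem Tame.integral_tfMeasure {φ : ℝ → ℝ → ℝ} (hφ : Tame φ) :
    ∫ p, φ p.1 p.2 ^ 2 ∂tfMeasure
      = ∫ u in (0 : ℝ)..1, ∫ l in (-Real.pi)..Real.pi, φ u l ^ 2 := by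
  have h := (hφ.memLp 2).integrable_sq
  rw [tfMeasure_eq] at h ⊢
  rw [integral_prod _ h, intervalIntegral.integral_of_le zero_le_one, integral_Icc_eq_integral_Ioc]
  refine setIntegral_congr_fun measurableSet_Ioc fun u _ => ?_
  rw [intervalIntegral.integral_of_le neg_pi_le_pi, integral_Icc_eq_integral_Ioc]

theorem Tame.intervalIntegrable_sq {φ : ℝ → ℝ → ℝ} (hφ : Tame φ) :
    IntervalIntegrable (fun u => ∫ l in (-Real.pi)..Real.pi, φ u l ^ 2) volume 0 1 := by
  have h := (hφ.memLp 2).integrable_sq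
  rw [tfMeasure_eq] at h
  rw [intervalIntegrable_iff_integrableOn_Icc_of_le zero_le_one]
  refine h.integral_prod_left.congr (Eventually.of_forall fun u => ?_)
  simp only
  rw [intervalIntegral.integral_of_le neg_pi_le_pi, integral_Icc_eq_integral_Ioc]

theorem Tame.intervalIntegrable_sq_cosCoef {φ : ℝ → ℝ → ℝ} (hφ : Tame φ) (k : ℤ) {a b : ℝ}
    (ha : a ∈ Set.Icc (0 : ℝ) 1) (hb : b ∈ Set.Icc (0 : ℝ) 1) :
    IntervalIntegrable (fun u => cosCoef φ u k ^ 2) volume a b := by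
  obtain ⟨M, hM⟩ := hφ.exists_cosCoef_bound
  refine intervalIntegrable_of_integrableOn_unit ?_ ha hb
  refine Integrable.of_bound ((measurable_cosCoef hφ.meas k).pow_const 2).aestronglyMeasurable
    (M ^ 2) ?_
  filter_upwards [ae_restrict_mem measurableSet_Icc] with u hu
  rw [norm_pow]
  gcongr
  exact hM u hu k

/-- Cauchy–Schwarz on an interval, by expanding the integrated square around the mean. -/
theorem Tame.sq_integral_cosCoef_le {φ : ℝ → ℝ → ℝ} (hφ : Tame φ) (k : ℤ) {a b : ℝ} (hab : a ≤ b)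
    (ha : a ∈ Set.Icc (0 : ℝ) 1) (hb : b ∈ Set.Icc (0 : ℝ) 1) :
    (∫ u in a..b, cosCoef φ u k) ^ 2 ≤ (b - a) * ∫ u in a..b, cosCoef φ u k ^ 2 := by
  set c := ∫ u in a..b, cosCoef φ u k with hc
  rcases hab.eq_or_lt with rfl | hlt
  · simp [hc]
  have h0 : 0 ≤ ∫ u in a..b, (cosCoef φ u k - c / (b - a)) ^ 2 :=
    intervalIntegral.integral_nonneg hab fun _ _ => sq_nonneg _
  have e : ∫ u in a..b, (cosCoef φ u k - c / (b - a)) ^ 2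
      = (∫ u in a..b, cosCoef φ u k ^ 2) - c ^ 2 / (b - a) := by
    have hd : b - a ≠ 0 := (sub_pos.2 hlt).ne'
    have i1 := hφ.intervalIntegrable_sq_cosCoef k ha hb
    have i2 := hφ.cosCoef_intervalIntegrable k ha hb
    have : ∀ u, (cosCoef φ u k - c / (b - a)) ^ 2
        = cosCoef φ u k ^ 2 - 2 * (c / (b - a)) * cosCoef φ u k + (c / (b - a)) ^ 2 :=
      fun u => by ring
    simp only [this]
    rw [intervalIntegral.integral_add (i1.sub (i2.const_mul _)) (by simp),
      intervalIntegral.integral_sub i1 (i2.const_mul _), intervalIntegral.integral_const_mul,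
      intervalIntegral.integral_const, ← hc, smul_eq_mul]
    field_simp
    ring
  rw [e] at h0
  have h1 : c ^ 2 / (b - a) ≤ ∫ u in a..b, cosCoef φ u k ^ 2 := by linarith
  rwa [div_le_iff₀' (sub_pos.2 hlt)] at h1

/-- Cauchy–Schwarz on each cell and Bessel's inequality on each slice. This is the reason for
averaging over cells: values at grid points are not controlled by ρ₂. -/
theorem Tame.sum_sq_cellCoef_le {φ : ℝ → ℝ → ℝ} (hφ : Tame φ) {n : ℕ} (hn : 1 ≤ n)
    (s : Finset ℤ) :
    ∑ t ∈ Finset.Icc (1 : ℤ) n, ∑ k ∈ s, cellCoef φ n t k ^ 2 ≤ 2 * Real.pi * l2 φ ^ 2 / n := by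
  have hn0 : (0 : ℝ) < n := by exact_mod_cast hn
  have h01 : (0 : ℝ) ∈ Set.Icc (0 : ℝ) 1 ∧ (1 : ℝ) ∈ Set.Icc (0 : ℝ) 1 := by simp
  calc _ ≤ ∑ t ∈ Finset.Icc (1 : ℤ) n, ∑ k ∈ s,
        1 / n * ∫ u in (((t : ℝ) - 1) / n)..(t / n), cosCoef φ u k ^ 2 := by
        refine Finset.sum_le_sum fun t ht => Finset.sum_le_sum fun k _ => ?_
        rw [Finset.mem_Icc] at ht
        have hends := cell_ends_mem ht.1 ht.2
        have := hφ.sq_integral_cosCoef_le k (cell_mem ht.1 ht.2).2.1 hends.1 hends.2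
        rwa [cell_length] at this
    _ = 1 / n * ∑ k ∈ s, ∫ u in (0 : ℝ)..1, cosCoef φ u k ^ 2 := by
        rw [Finset.sum_comm, Finset.mul_sum]
        refine Finset.sum_congr rfl fun k _ => ?_
        rw [← Finset.mul_sum,
          sum_cell_integral hn (hφ.intervalIntegrable_sq_cosCoef k h01.1 h01.2)]
    _ = 1 / n * ∫ u in (0 : ℝ)..1, ∑ k ∈ s, cosCoef φ u k ^ 2 := by
        rw [intervalIntegral.integral_finsetSum
          fun k _ => hφ.intervalIntegrable_sq_cosCoef k h01.1 h01.2]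
    _ ≤ 1 / n * ∫ u in (0 : ℝ)..1, 2 * Real.pi * ∫ l in (-Real.pi)..Real.pi, φ u l ^ 2 := by
        gcongr
        refine intervalIntegral.integral_mono_on zero_le_one ?_
          (hφ.intervalIntegrable_sq.const_mul _) fun u hu => hφ.sum_sq_cosCoef_le hu s
        have := IntervalIntegrable.sum s fun k _ => hφ.intervalIntegrable_sq_cosCoef k h01.1 h01.2
        exact this.congr fun u _ => by simp
    _ = _ := by
        rw [intervalIntegral.integral_const_mul, ← hφ.integral_tfMeasure, ← hφ.sq_l2]
        ring

/-- The coefficient array of the smoothed quadratic functional. -/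
def smoothedCoef (φ : ℝ → ℝ → ℝ) (n : ℕ) (r s : ℤ) : ℝ :=
  1 / (2 * Real.pi) * cellCoef φ n ((r + s) / 2) (r - s)

theorem midpoint_mem {n : ℕ} {r s : ℤ} (hr : r ∈ Finset.Icc (1 : ℤ) n)
    (hs : s ∈ Finset.Icc (1 : ℤ) n) : 1 ≤ (r + s) / 2 ∧ (r + s) / 2 ≤ n := by
  rw [Finset.mem_Icc] at hr hs
  omega

theorem Tame.sum_sq_smoothedCoef_le {φ : ℝ → ℝ → ℝ} (hφ : Tame φ) {n : ℕ} (hn : 1 ≤ n) :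
    ∑ r ∈ Finset.Icc (1 : ℤ) n, ∑ s ∈ Finset.Icc (1 : ℤ) n, smoothedCoef φ n r s ^ 2
      ≤ (l2 φ / Real.sqrt n) ^ 2 := by
  have hn0 : (0 : ℝ) < n := by exact_mod_cast hn
  have hpi := Real.pi_pos
  have h := (sum_pairs_le n (fun t k => cellCoef φ n t k ^ 2) fun _ _ => sq_nonneg _).trans
    (hφ.sum_sq_cellCoef_le hn _)
  simp only [smoothedCoef, mul_pow, ← Finset.mul_sum]
  rw [div_pow (l2 φ), Real.sq_sqrt hn0.le]
  calc _ ≤ (1 / (2 * Real.pi)) ^ 2 * (2 * Real.pi * l2 φ ^ 2 / n) := by gcongr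
    _ = 1 / (2 * Real.pi) * (l2 φ ^ 2 / n) := by field_simp
    _ ≤ 1 * (l2 φ ^ 2 / n) := by
        gcongr
        rw [div_le_one (by positivity)]
        linarith [Real.two_le_pi]
    _ = _ := one_mul _

/-- Along a row or column all lags are distinct, so the suprema of the coefficients add up to at
most ρ; the factor 1/n is the cell length. -/
theorem sum_abs_smoothedCoef_le {φ : ℝ → ℝ → ℝ} {ρ : ℝ} (hρ0 : 0 ≤ ρ)
    (hρ : rhoInf φ ≤ ENNReal.ofReal ρ) {n : ℕ} {r : ℤ}
    (hr : r ∈ Finset.Icc (1 : ℤ) n) :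
    ∑ s ∈ Finset.Icc (1 : ℤ) n, |smoothedCoef φ n r s| ≤ ρ / n ∧
      ∑ s ∈ Finset.Icc (1 : ℤ) n, |smoothedCoef φ n s r| ≤ ρ / n := by
  obtain ⟨c, hc0, hcs, hcρ, hc⟩ := exists_coef_majorants hρ
  rw [max_eq_left hρ0] at hcρ
  have hpi := Real.pi_pos
  have hcell : ∀ t : ℤ, 1 ≤ t → t ≤ n → ∀ k,
      |1 / (2 * Real.pi) * cellCoef φ n t k| ≤ c k / n := by
    intro t ht1 ht2 k
    obtain ⟨ha, hb, hc', hd⟩ := cell_mem ht1 ht2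
    have h1 : |cellCoef φ n t k| ≤ c k * |(t : ℝ) / n - ((t : ℝ) - 1) / n| := by
      rw [← Real.norm_eq_abs]
      refine intervalIntegral.norm_integral_le_of_norm_le_const fun u hu => ?_
      rw [Set.uIoc_of_le hb] at hu
      exact (abs_cosCoef_le φ u k).trans (hc k u ⟨ha.trans hu.1.le, hu.2.trans hc'⟩)
    rw [cell_length, abs_of_nonneg (a := 1 / (n : ℝ)) (by positivity)] at h1
    rw [abs_mul, abs_of_pos (by positivity : 0 < 1 / (2 * Real.pi))]
    calc _ ≤ 1 * |cellCoef φ n t k| := by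
          gcongr
          rw [div_le_one (by positivity)]
          linarith [Real.two_le_pi]
      _ ≤ _ := by
          rw [one_mul]
          exact h1.trans (le_of_eq (by ring))
  have hsum : ∀ q : ℤ → ℤ, Function.Injective q →
      ∑ s ∈ Finset.Icc (1 : ℤ) n, c (q s) / n ≤ ρ / n := by
    intro q hq
    rw [← Finset.sum_div]
    gcongr
    rw [← Finset.sum_image (f := c) (g := q) fun x _ y _ h => hq h]
    exact (hcs.sum_le_tsum _ fun k _ => hc0 k).trans hcρ
  constructor
  · refine (Finset.sum_le_sum fun s hs => ?_).trans
      (hsum (fun s => r - s) fun x y h => by simpa using h)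
    obtain ⟨h1, h2⟩ := midpoint_mem hr hs
    exact hcell _ h1 h2 _
  · refine (Finset.sum_le_sum fun s hs => ?_).trans
      (hsum (fun s => s - r) fun x y h => by simpa using h)
    obtain ⟨h1, h2⟩ := midpoint_mem hs hr
    exact hcell _ h1 h2 _

/-! ### The smoothed quadratic functional -/

/-- The quadratic functional `∫ φ J_n` of the pre-periodogram, averaged over the observation
times. -/
def quadForm (n : ℕ) (x : ℤ → ℝ) (φ : ℝ → ℝ → ℝ) : ℝ :=
  1 / (2 * Real.pi * n) * ∑ r ∈ Finset.Icc (1 : ℤ) n, ∑ s ∈ Finset.Icc (1 : ℤ) n,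
    cosCoef φ (((r + s) / 2 : ℤ) / n) (r - s) * (x r * x s)

theorem Tame.sum_integral_mul_prePeriodogram {φ : ℝ → ℝ → ℝ} (hφ : Tame φ) (n : ℕ) (x : ℤ → ℝ) :
    1 / n * ∑ t ∈ Finset.Icc (1 : ℤ) n,
      ∫ l in (-Real.pi)..Real.pi, φ (t / n) l * (prePeriodogram n x t l).re = quadForm n x φ := by
  have hpi := Real.pi_ne_zero
  have h : ∀ t ∈ Finset.Icc (1 : ℤ) n,
      ∫ l in (-Real.pi)..Real.pi, φ (t / n) l * (prePeriodogram n x t l).re =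
      1 / (2 * Real.pi) * ∑ k ∈ lagSet n t, cosCoef φ (t / n) k *
        (x ⌊(t : ℝ) + 1 / 2 + k / 2⌋ * x ⌊(t : ℝ) + 1 / 2 - k / 2⌋) := by
    intro t ht
    rw [Finset.mem_Icc] at ht
    exact (hφ.integral_mul_prePeriodogram n x t (cell_ends_mem ht.1 ht.2).2).2
  rw [Finset.sum_congr rfl h, ← Finset.mul_sum,
    sum_lagSet_eq n fun t k r s => cosCoef φ (t / n) k * (x r * x s), ← mul_assoc]
  unfold quadForm
  congr 1
  rw [one_div_mul_one_div, mul_comm]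

theorem Tame.smoothedCoef_sub {φ ψ : ℝ → ℝ → ℝ} (hφ : Tame φ) (hψ : Tame ψ) {n : ℕ} {r s : ℤ}
    (hr : r ∈ Finset.Icc (1 : ℤ) n) (hs : s ∈ Finset.Icc (1 : ℤ) n) :
    smoothedCoef (fun u l => φ u l - ψ u l) n r s = smoothedCoef φ n r s - smoothedCoef ψ n r s := by
  obtain ⟨h1, h2⟩ := midpoint_mem hr hs
  unfold smoothedCoef
  rw [hφ.cellCoef_sub hψ h1 h2, mul_sub]

/-- The fluctuation of the smoothed quadratic functional. -/
def smoothedDev {Ω : Type*} [MeasurableSpace Ω] (P : Measure Ω) (X : ℕ → ℤ → Ω → ℝ) (n : ℕ)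
    (φ : ℝ → ℝ → ℝ) (ω : Ω) : ℝ :=
  centredSum P X n (smoothedCoef φ n) ω

section Sample

variable {Ω : Type*} [MeasurableSpace Ω] {P : Measure Ω} [IsProbabilityMeasure P]
  {κ K : ℝ} {ε : ℤ → Ω → ℝ} {aT : ℕ → ℤ → ℤ → ℝ} {a : ℝ → ℤ → ℝ} {X : ℕ → ℤ → Ω → ℝ}

theorem smoothedDev_sub {φ ψ : ℝ → ℝ → ℝ} (hφ : Tame φ) (hψ : Tame ψ) (n : ℕ) (ω : Ω) :
    smoothedDev P X n (fun u l => φ u l - ψ u l) ω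
      = smoothedDev P X n φ ω - smoothedDev P X n ψ ω := by
  unfold smoothedDev
  rw [← centredSum_sub]
  unfold centredSum
  refine Finset.sum_congr rfl fun r hr => Finset.sum_congr rfl fun s hs => ?_
  rw [hφ.smoothedCoef_sub hψ hr hs]

namespace IsLocallyStationary

/-- Bernstein's inequality for the smoothed quadratic functional. -/
theorem smoothedDev_tail (hX : IsLocallyStationary P κ K ε aT a X) (hG : IsGaussianArray P X)
    {φ : ℝ → ℝ → ℝ} (hφ : Tame φ) {ρ T : ℝ} (hρ0 : 0 < ρ) (hρ : rhoInf φ ≤ ENNReal.ofReal ρ)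
    (hT : 0 ≤ T) {n : ℕ} (hn : 1 ≤ n) :
    P {ω | 4 * covConst κ K * (l2 φ * Real.sqrt (T / n) + ρ * (T / n)) < |smoothedDev P X n φ ω|}
      ≤ ENNReal.ofReal (2 * Real.exp (-T)) := by
  have hn0 : (0 : ℝ) < n := by exact_mod_cast hn
  have h := hX.centredSum_tail hG n (smoothedCoef φ n) (F := l2 φ / Real.sqrt n) (L := ρ / n)
    (div_nonneg (l2_nonneg φ) (Real.sqrt_nonneg _)) (by positivity) hT
    (hφ.sum_sq_smoothedCoef_le hn) (fun r hr => (sum_abs_smoothedCoef_le hρ0.le hρ hr).1)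
    (fun r hr => (sum_abs_smoothedCoef_le hρ0.le hρ hr).2)
  have e : l2 φ * Real.sqrt (T / n) + ρ * (T / n)
      = l2 φ / Real.sqrt n * Real.sqrt T + ρ / n * T := by
    rw [Real.sqrt_div hT]
    ring
  rwa [e]

/-- An exponential inequality for the smoothed quadratic functional in terms of `ρ₂` alone. -/
theorem smoothedDev_tail_l2 (hX : IsLocallyStationary P κ K ε aT a X) (hG : IsGaussianArray P X)
    {φ : ℝ → ℝ → ℝ} (hφ : Tame φ) {ρ T : ℝ} (hρ0 : 0 < ρ) (hρ : l2 φ ≤ ρ)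
    (hT : 1 ≤ T) {n : ℕ} (hn : 1 ≤ n) :
    P {ω | 8 * covConst κ K * (ρ / Real.sqrt n) * T < |smoothedDev P X n φ ω|}
      ≤ ENNReal.ofReal (2 * Real.exp (-T)) := by
  have hn0 : (0 : ℝ) < n := by exact_mod_cast hn
  refine hX.centredSum_tail_frobenius hG n (smoothedCoef φ n) (by positivity) hT
    ((hφ.sum_sq_smoothedCoef_le hn).trans ?_)
  have := l2_nonneg φ
  gcongr

theorem abs_smoothedDev_le (hX : IsLocallyStationary P κ K ε aT a X) {φ : ℝ → ℝ → ℝ} (hφ : Tame φ)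
    {n : ℕ} (hn : 1 ≤ n) {B : ℝ} {ω : Ω} (hB0 : 0 ≤ B)
    (hB : ∀ r ∈ Finset.Icc (1 : ℤ) n, X n r ω ^ 2 ≤ B) :
    |smoothedDev P X n φ ω| ≤ l2 φ * Real.sqrt n * (B + covConst κ K) := by
  have hn0 : (0 : ℝ) < n := by exact_mod_cast hn
  refine (hX.abs_centredSum_le (div_nonneg (l2_nonneg φ) (Real.sqrt_nonneg _))
    (hφ.sum_sq_smoothedCoef_le hn) hB0 hB).trans (le_of_eq ?_)
  have h := Real.mul_self_sqrt hn0.le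
  have h2 : Real.sqrt n ≠ 0 := (Real.sqrt_pos.2 hn0).ne'
  field_simp
  rw [sq, h]

/-- The total error of the cell averages, from `Tame.sum_abs_sub_cellCoef_le`, is multiplied by a
bound for all products of two observations. -/
theorem abs_quadForm_sub_le {φ : ℝ → ℝ → ℝ} (hφ : Tame φ) {v : ℝ} (hv0 : 0 ≤ v)
    (hv : vSum φ ≤ ENNReal.ofReal v) {n : ℕ} {x : ℤ → ℝ} {B : ℝ} (hB0 : 0 ≤ B)
    (hB : ∀ r ∈ Finset.Icc (1 : ℤ) n, x r ^ 2 ≤ B) :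
    |quadForm n x φ - ∑ r ∈ Finset.Icc (1 : ℤ) n, ∑ s ∈ Finset.Icc (1 : ℤ) n,
      smoothedCoef φ n r s * (x r * x s)| ≤ v * B / n := by
  have hpi := Real.pi_pos
  set G : ℤ → ℤ → ℝ := fun t k => |cosCoef φ (t / n) k / n - cellCoef φ n t k| with hG
  have e : quadForm n x φ - ∑ r ∈ Finset.Icc (1 : ℤ) n, ∑ s ∈ Finset.Icc (1 : ℤ) n,
      smoothedCoef φ n r s * (x r * x s) = ∑ r ∈ Finset.Icc (1 : ℤ) n, ∑ s ∈ Finset.Icc (1 : ℤ) n,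
      1 / (2 * Real.pi) * (cosCoef φ (((r + s) / 2 : ℤ) / n) (r - s) / n
        - cellCoef φ n ((r + s) / 2) (r - s)) * (x r * x s) := by
    unfold quadForm smoothedCoef
    rw [Finset.mul_sum, ← Finset.sum_sub_distrib]
    refine Finset.sum_congr rfl fun r _ => ?_
    rw [Finset.mul_sum, ← Finset.sum_sub_distrib]
    refine Finset.sum_congr rfl fun s _ => ?_
    rw [one_div_mul_eq_div, mul_comm (2 * Real.pi) (n : ℝ), ← div_div]
    ring
  rw [e]
  refine (Finset.abs_sum_le_sum_abs _ _).trans ?_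
  calc _ ≤ ∑ r ∈ Finset.Icc (1 : ℤ) n, ∑ s ∈ Finset.Icc (1 : ℤ) n,
        G ((r + s) / 2) (r - s) * B := by
        refine Finset.sum_le_sum fun r hr => (Finset.abs_sum_le_sum_abs _ _).trans
          (Finset.sum_le_sum fun s hs => ?_)
        rw [abs_mul, abs_mul, abs_of_pos (by positivity : 0 < 1 / (2 * Real.pi))]
        have h1 : |x r * x s| ≤ B := by
          refine abs_le_of_sq_le_sq ?_ hB0
          rw [mul_pow, sq B]
          exact mul_le_mul (hB r hr) (hB s hs) (sq_nonneg _) hB0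
        have h2 : 1 / (2 * Real.pi) ≤ 1 := by
          rw [div_le_one (by positivity)]
          linarith [Real.two_le_pi]
        refine mul_le_mul ?_ h1 (abs_nonneg _) (abs_nonneg _)
        exact mul_le_of_le_one_left (abs_nonneg _) h2
    _ = (∑ r ∈ Finset.Icc (1 : ℤ) n, ∑ s ∈ Finset.Icc (1 : ℤ) n, G ((r + s) / 2) (r - s)) * B := by
        simp only [Finset.sum_mul]
    _ ≤ v / n * B := by
        gcongr
        exact (sum_pairs_le n G fun _ _ => abs_nonneg _).trans
          (hφ.sum_abs_sub_cellCoef_le hv0 hv _)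
    _ = _ := by ring

/-- The quadratic functional equals its limit plus the fluctuation of its smoothed version, up to
an error of order `1 / n`. -/
theorem exists_quadForm_error (hX : IsLocallyStationary P κ K ε aT a X) :
    ∃ C : ℝ, 0 ≤ C ∧ ∀ (φ : ℝ → ℝ → ℝ) (c : ℝ), Tame φ → 0 ≤ c → rhoInf φ ≤ ENNReal.ofReal c →
      vSum φ ≤ ENNReal.ofReal c → ∀ n : ℕ, 1 ≤ n → ∀ (ω : Ω) (B : ℝ), 0 ≤ B →
      (∀ r ∈ Finset.Icc (1 : ℤ) n, X n r ω ^ 2 ≤ B) →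
      |quadForm n (fun t => X n t ω) φ - ∫ p, φ p.1 p.2 * spectralDensity a p.1 p.2 ∂tfMeasure
        - smoothedDev P X n φ ω| ≤ c * (B + C) / n := by
  obtain ⟨C, hC0, hC⟩ := hX.exists_bias_bound
  refine ⟨C, hC0, fun φ c hφ hc0 hρ hv n hn ω B hB0 hB => ?_⟩
  have h1 := abs_quadForm_sub_le hφ hc0 hv (x := fun t => X n t ω) hB0 hB
  have h2 := hC φ c hφ hc0 hρ n hn
  have e : smoothedDev P X n φ ω = (∑ r ∈ Finset.Icc (1 : ℤ) n, ∑ s ∈ Finset.Icc (1 : ℤ) n,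
      smoothedCoef φ n r s * (X n r ω * X n s ω))
      - 1 / (2 * Real.pi) * ∑ r ∈ Finset.Icc (1 : ℤ) n, ∑ s ∈ Finset.Icc (1 : ℤ) n,
          cellCoef φ n ((r + s) / 2) (r - s) * ∫ ω, X n r ω * X n s ω ∂P := by
    unfold smoothedDev centredSum
    rw [Finset.mul_sum, ← Finset.sum_sub_distrib]
    refine Finset.sum_congr rfl fun r _ => ?_
    rw [Finset.mul_sum, ← Finset.sum_sub_distrib]
    refine Finset.sum_congr rfl fun s _ => ?_
    unfold smoothedCoef
    ring
  rw [e]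
  have h3 : c * (B + C) / n = c * B / n + C * c / n := by ring
  rw [h3]
  refine le_trans (le_of_eq ?_) ((abs_add_le _ _).trans (add_le_add h1 h2))
  congr 1
  ring

end IsLocallyStationary

end Sample

/-! ### The contrast as a real number -/

/-- A candidate spectral density whose reciprocal takes values in `[m, M]` and has summable Fourier
coefficients and variations, both bounded by `c`. -/
structure Regular (m M c : ℝ) (g : ℝ → ℝ → ℝ) : Prop where
  meas : Measurable (Function.uncurry g)
  low : ∀ u ∈ Set.Icc (0 : ℝ) 1, ∀ l ∈ Set.Icc (-Real.pi) Real.pi, m ≤ recip g u l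
  up : ∀ u ∈ Set.Icc (0 : ℝ) 1, ∀ l ∈ Set.Icc (-Real.pi) Real.pi, recip g u l ≤ M
  rho : rhoInf (recip g) ≤ ENNReal.ofReal c
  var : vSum (recip g) ≤ ENNReal.ofReal c

theorem measurable_recip {g : ℝ → ℝ → ℝ} (hg : Measurable (Function.uncurry g)) :
    Measurable (Function.uncurry (recip g)) := by
  have : Function.uncurry (recip g) = fun p => 1 / Function.uncurry g p := rfl
  rw [this]
  exact measurable_const.div hg

theorem Regular.tame {m M c : ℝ} {g : ℝ → ℝ → ℝ} (hg : Regular m M c g) (hm : 0 < m) :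
    Tame (recip g) :=
  ⟨measurable_recip hg.meas, M, fun u hu l hl => by
    rw [abs_of_nonneg (hm.le.trans (hg.low u hu l hl))]
    exact hg.up u hu l hl⟩

theorem Regular.tame_log {m M c : ℝ} {g : ℝ → ℝ → ℝ} (hg : Regular m M c g) (hm : 0 < m) :
    Tame fun u l => Real.log (recip g u l) := by
  refine ⟨Real.measurable_log.comp (measurable_recip hg.meas), |Real.log m| + |Real.log M|,
    fun u hu l hl => ?_⟩
  have h1 := Real.log_le_log hm (hg.low u hu l hl)
  have h2 := Real.log_le_log (hm.trans_le (hg.low u hu l hl)) (hg.up u hu l hl)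
  rw [abs_le]
  constructor
  · linarith [neg_abs_le (Real.log m), abs_nonneg (Real.log M)]
  · linarith [le_abs_self (Real.log M), abs_nonneg (Real.log m)]

/-- The limiting contrast as a function of the reciprocal. -/
def realContrast (f φ : ℝ → ℝ → ℝ) : ℝ :=
  1 / (4 * Real.pi) * ((∫ p, φ p.1 p.2 * f p.1 p.2 ∂tfMeasure)
    - ∫ p, Real.log (φ p.1 p.2) ∂tfMeasure)

/-- For a regular candidate the integrand is integrable, so neither part of the extended-real
contrast is infinite and real arithmetic becomes available. -/
theorem contrast_eq {f : ℝ → ℝ → ℝ} {m M c : ℝ} {g : ℝ → ℝ → ℝ} (hg : Regular m M c g)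
    (hm : 0 < m) (hf : Integrable (fun p : ℝ × ℝ => recip g p.1 p.2 * f p.1 p.2) tfMeasure) :
    contrast f g = (realContrast f (recip g) : EReal) := by
  have hlog := ((hg.tame_log hm).memLp 1).integrable le_rfl
  have hfun : contrastIntegrand f g = fun p : ℝ × ℝ => 1 / (4 * Real.pi) *
      (recip g p.1 p.2 * f p.1 p.2 - Real.log (recip g p.1 p.2)) := by
    ext p
    unfold contrastIntegrand recip
    rw [one_div (g p.1 p.2), Real.log_inv]
    ring
  have hint : Integrable (contrastIntegrand f g) tfMeasure := by
    rw [hfun]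
    exact (hf.sub hlog).const_mul _
  have h := integral_eq_lintegral_pos_part_sub_lintegral_neg_part hint
  have h2 : ∫ p, contrastIntegrand f g p ∂tfMeasure = realContrast f (recip g) := by
    rw [hfun, integral_const_mul, integral_sub hf hlog]
    rfl
  unfold contrast
  have hfin : ∀ s : ℝ × ℝ → ℝ, Integrable s tfMeasure → ∫⁻ p, ENNReal.ofReal (s p) ∂tfMeasure ≠ ∞ :=
    fun s hs => ne_top_of_le_ne_top hs.2.ne (lintegral_mono fun p =>
      (ENNReal.ofReal_le_ofReal (le_abs_self _)).trans_eq (Real.enorm_eq_ofReal_abs _).symm)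
  rw [← h2, h, EReal.coe_sub, EReal.coe_ennreal_toReal (hfin _ hint),
    EReal.coe_ennreal_toReal (hfin (fun p => -contrastIntegrand f g p) hint.neg)]

/-- The logarithmic part of the empirical contrast. -/
theorem Regular.abs_sum_log_sub_le {m M c : ℝ} {g : ℝ → ℝ → ℝ} (hg : Regular m M c g)
    (hm : 0 < m) (hc : 0 ≤ c) {n : ℕ} (hn : 1 ≤ n) :
    |1 / n * ∑ t ∈ Finset.Icc (1 : ℤ) n, (∫ l in (-Real.pi)..Real.pi, Real.log (recip g (t / n) l))
      - ∫ p, Real.log (recip g p.1 p.2) ∂tfMeasure| ≤ c / (n * m) := by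
  have hn0 : (0 : ℝ) < n := by exact_mod_cast hn
  have hφ := hg.tame hm
  have hL := hg.tame_log hm
  set L : ℝ → ℝ := fun u => ∫ l in (-Real.pi)..Real.pi, Real.log (recip g u l) with hLdef
  have hint1 := (hL.memLp 1).integrable le_rfl
  rw [tfMeasure_eq] at hint1
  have hLint : IntegrableOn L (Set.Icc 0 1) := by
    refine hint1.integral_prod_left.congr (Eventually.of_forall fun u => ?_)
    simp only [hLdef]
    rw [intervalIntegral.integral_of_le Tame.neg_pi_le_pi, integral_Icc_eq_integral_Ioc]
  have hI : ∫ p, Real.log (recip g p.1 p.2) ∂tfMeasure = ∫ u in (0 : ℝ)..1, L u := by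
    rw [tfMeasure_eq, integral_prod _ hint1, intervalIntegral.integral_of_le zero_le_one,
      integral_Icc_eq_integral_Ioc]
    refine setIntegral_congr_fun measurableSet_Ioc fun u _ => ?_
    simp only [hLdef]
    rw [intervalIntegral.integral_of_le Tame.neg_pi_le_pi, integral_Icc_eq_integral_Ioc]
  have hLi : IntervalIntegrable L volume 0 1 :=
    intervalIntegrable_of_integrableOn_unit hLint (by simp) (by simp)
  obtain ⟨w, hw1, hw2, hw3, hw4⟩ := hφ.exists_L1_modulus hc hg.var
  have hLmod : ∀ x ∈ Set.Icc (0 : ℝ) 1, ∀ y ∈ Set.Icc (0 : ℝ) 1, x ≤ y →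
      |L y - L x| ≤ (w y - w x) / m := by
    intro x hx y hy hxy
    rw [hLdef]
    simp only
    rw [← intervalIntegral.integral_sub (hL.intervalIntegrable hy) (hL.intervalIntegrable hx),
      ← Real.norm_eq_abs]
    refine (intervalIntegral.norm_integral_le_integral_norm Tame.neg_pi_le_pi).trans ?_
    calc _ ≤ ∫ l in (-Real.pi)..Real.pi, |recip g x l - recip g y l| * m⁻¹ := by
          refine intervalIntegral.integral_mono_on Tame.neg_pi_le_pi
            ((hL.intervalIntegrable hy).sub (hL.intervalIntegrable hx)).norm
            (((hφ.intervalIntegrable hx).sub (hφ.intervalIntegrable hy)).norm.mul_const _)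
            fun l hl => ?_
          rw [Real.norm_eq_abs]
          have h1 := hg.low x hx l hl
          have h2 := hg.low y hy l hl
          -- The logarithm is Lipschitz with constant 1/m on [m, ∞), so the L¹ modulus of the
          -- reciprocals passes to their logarithms.
          have key : ∀ s t : ℝ, m ≤ s → m ≤ t → Real.log s - Real.log t ≤ |s - t| * m⁻¹ := by
            intro s t hs ht
            have ht0 := hm.trans_le ht
            rw [← Real.log_div (hm.trans_le hs).ne' ht0.ne']
            calc Real.log (s / t) ≤ s / t - 1 := Real.log_le_sub_one_of_pos
                  (div_pos (hm.trans_le hs) ht0)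
              _ = (s - t) * t⁻¹ := by field_simp
              _ ≤ |s - t| * t⁻¹ := by
                  gcongr
                  exact le_abs_self _
              _ ≤ _ := by gcongr
          rw [abs_le]
          constructor
          · have := key _ _ h1 h2
            linarith
          · have := key _ _ h2 h1
            rwa [abs_sub_comm] at this
      _ = (∫ l in (-Real.pi)..Real.pi, |recip g x l - recip g y l|) * m⁻¹ :=
          intervalIntegral.integral_mul_const _ _
      _ ≤ (w y - w x) * m⁻¹ := by
          gcongr
          exact hw4 x hx y hy hxy
      _ = _ := (div_eq_mul_inv _ _).symm
  have hcell : ∀ t ∈ Finset.Icc (1 : ℤ) n,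
      |1 / n * L (t / n) - ∫ u in (((t : ℝ) - 1) / n)..(t / n), L u|
        ≤ (w (t / n) - w ((t - 1 : ℤ) / n)) / m * (1 / n) := by
    intro t ht
    rw [Finset.mem_Icc] at ht
    obtain ⟨ha, hb⟩ := cell_ends_mem ht.1 ht.2
    have hab := (cell_mem ht.1 ht.2).2.1
    have e : 1 / n * L (t / n) - ∫ u in (((t : ℝ) - 1) / n)..(t / n), L u
        = ∫ u in (((t : ℝ) - 1) / n)..(t / n), (L (t / n) - L u) := by
      rw [intervalIntegral.integral_sub intervalIntegrable_const
        (intervalIntegrable_of_integrableOn_unit hLint ha hb), intervalIntegral.integral_const,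
        cell_length, smul_eq_mul]
    rw [e, ← Real.norm_eq_abs]
    have := intervalIntegral.norm_integral_le_of_norm_le_const
      (f := fun u => L (t / n) - L u) (C := (w (t / n) - w ((t - 1 : ℤ) / n)) / m)
      (a := ((t : ℝ) - 1) / n) (b := t / n) fun u hu => ?_
    · rwa [cell_length, abs_of_nonneg (a := 1 / (n : ℝ)) (by positivity)] at this
    · rw [Set.uIoc_of_le hab] at hu
      refine (hLmod u (cell_subset ht.1 ht.2 ⟨hu.1.le, hu.2⟩) _ hb hu.2).trans ?_
      gcongr
      refine hw1 (le_trans (le_of_eq ?_) hu.1.le)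
      push_cast
      rfl
  change |1 / n * ∑ t ∈ Finset.Icc (1 : ℤ) n, L (t / n) - _| ≤ _
  rw [hI, ← sum_cell_integral hn hLi, Finset.mul_sum, ← Finset.sum_sub_distrib]
  refine (Finset.abs_sum_le_sum_abs _ _).trans ((Finset.sum_le_sum hcell).trans ?_)
  rw [← Finset.sum_mul, ← Finset.sum_div]
  have htel := sum_Icc_sub n fun i : ℤ => w ((i : ℝ) / n)
  rw [htel]
  calc _ ≤ c / m * (1 / n) := by
        gcongr
        have h1 := hw3 ((n : ℤ) / n)
        have h2 := hw2 ((0 : ℤ) / n)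
        linarith
    _ = _ := by
        field_simp

theorem Regular.empContrast_eq {m M c : ℝ} {g : ℝ → ℝ → ℝ} (hg : Regular m M c g)
    (hm : 0 < m) (n : ℕ) (x : ℤ → ℝ) : empContrast n x g = 1 / (4 * Real.pi) *
      (quadForm n x (recip g) - 1 / n * ∑ t ∈ Finset.Icc (1 : ℤ) n,
        ∫ l in (-Real.pi)..Real.pi, Real.log (recip g (t / n) l)) := by
  have hφ := hg.tame hm
  have hL := hg.tame_log hm
  rw [← hφ.sum_integral_mul_prePeriodogram, ← mul_sub, ← Finset.sum_sub_distrib]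
  unfold empContrast
  rw [← Finset.mul_sum, mul_left_comm]
  congr 2
  refine Finset.sum_congr rfl fun t ht => ?_
  rw [Finset.mem_Icc] at ht
  have hu := (cell_ends_mem ht.1 ht.2).2
  rw [← intervalIntegral.integral_sub (hφ.integral_mul_prePeriodogram n x t hu).1
    (hL.intervalIntegrable hu)]
  congr 1
  ext l
  simp only [recip, one_div, Real.log_inv]
  ring

/-! ### Quadratic lower bounds for the contrast -/

/-- Writing log z = 2 log √z and using log √z ≤ √z - 1 gives z - 1 - 2(√z - 1), a perfect square.
This Hellinger-type bound stays effective as z tends to 0 or infinity. -/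
theorem sq_sqrt_sub_one_le {z : ℝ} (hz : 0 < z) : (Real.sqrt z - 1) ^ 2 ≤ z - 1 - Real.log z := by
  have hs := Real.sqrt_pos.2 hz
  have h1 := Real.log_le_sub_one_of_pos hs
  have h2 : Real.log z = 2 * Real.log (Real.sqrt z) := by
    rw [Real.log_sqrt hz.le]
    ring
  have h3 := Real.sq_sqrt hz.le
  nlinarith

theorem sub_one_sub_log_nonneg {z : ℝ} (hz : 0 < z) : 0 ≤ z - 1 - Real.log z := by
  linarith [Real.log_le_sub_one_of_pos hz]

theorem sub_one_sub_log_le {z : ℝ} (hz : 0 < z) : z - 1 - Real.log z ≤ (z - 1) ^ 2 / z := by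
  have h1 := Real.log_le_sub_one_of_pos (inv_pos.2 hz)
  rw [Real.log_inv] at h1
  have e : (z - 1) ^ 2 / z = z + z⁻¹ - 2 := by
    field_simp
    ring
  rw [e]
  linarith

/-- Comparison of a reciprocal density `x` with the true one, `1 / f`, clipped at `M`. -/
theorem sq_sub_min_le {x f M : ℝ} (hx : 0 < x) (hxM : x ≤ M) (hf : 0 < f) :
    (x - min (1 / f) M) ^ 2 ≤ 4 * M ^ 2 * (x * f - 1 - Real.log (x * f)) := by
  have hM := hx.trans_le hxM
  have hxf := mul_pos hx hf
  refine le_trans ?_ (mul_le_mul_of_nonneg_left (sq_sqrt_sub_one_le hxf) (by positivity))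
  set s := Real.sqrt (x * f) with hs
  have hs0 : 0 ≤ s := Real.sqrt_nonneg _
  have hs2 : s ^ 2 = x * f := Real.sq_sqrt hxf.le
  rw [show 4 * M ^ 2 * (s - 1) ^ 2 = (2 * M * (s - 1)) ^ 2 by ring, sq_le_sq]
  rw [abs_mul, abs_of_pos (by positivity : 0 < 2 * M)]
  -- Without clipping, x - 1/f = (s + 1)(s - 1)/f, and s + 1 ≤ 2Mf because both 1 and s are at most
  -- Mf.
  rcases le_total (1 / f) M with h | h
  · rw [min_eq_left h]
    have e : x - 1 / f = (s + 1) / f * (s - 1) := by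
      have : (s + 1) / f * (s - 1) = (s ^ 2 - 1) / f := by ring
      rw [this, hs2]
      field_simp
    rw [e, abs_mul, abs_of_nonneg (a := (s + 1) / f) (by positivity)]
    refine mul_le_mul_of_nonneg_right ?_ (abs_nonneg _)
    have h1 : 1 ≤ M * f := by rwa [div_le_iff₀ hf] at h
    have h2 : s ≤ M * f := by
      refine abs_le_of_sq_le_sq' ?_ (by positivity) |>.2
      rw [hs2]
      nlinarith [mul_le_mul_of_nonneg_right hxM hf.le]
    rw [div_le_iff₀ hf]
    linarith
  -- When clipping is active, f ≤ 1/M gives s ≤ √(x/M) ≤ 1, and M - x factors as M(1 - r)(1 + r).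
  · rw [min_eq_right h]
    have hfM : f ≤ 1 / M := by
      rw [le_div_iff₀ hM]
      rw [le_div_iff₀ hf] at h
      linarith
    set r := Real.sqrt (x / M) with hr
    have hr0 : 0 ≤ r := Real.sqrt_nonneg _
    have hr2 : r ^ 2 = x / M := Real.sq_sqrt (by positivity)
    have hr1 : r ≤ 1 := by
      rw [hr]
      exact Real.sqrt_le_one.2 ((div_le_one hM).2 hxM)
    have hsr : s ≤ r := by
      refine Real.sqrt_le_sqrt ?_
      calc x * f ≤ x * (1 / M) := by gcongr
        _ = x / M := by ring
    rw [abs_sub_comm, abs_of_nonneg (sub_nonneg.2 hxM), abs_sub_comm, abs_of_nonneg (by linarith)]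
    have e : M - x = M * (1 - r) * (1 + r) := by
      have : M * (1 - r) * (1 + r) = M * (1 - r ^ 2) := by ring
      rw [this, hr2]
      field_simp
    rw [e]
    have h3 : M * (1 - r) * (1 + r) ≤ M * (1 - r) * 2 := by
      refine mul_le_mul_of_nonneg_left (by linarith) (mul_nonneg hM.le (by linarith))
    nlinarith

/-- Clipping at M is a contraction that fixes y, so the triangle inequality through the clipped 1/f
loses only a factor 2 in each square. -/
theorem sq_sub_le_of_correct {x y f M : ℝ} (hx : 0 < x) (hxM : x ≤ M) (hyM : y ≤ M)
    (hf : 0 < f) :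
    (x - y) ^ 2 ≤ 8 * M ^ 2 * (x * f - 1 - Real.log (x * f)) + 2 * (1 / f - y) ^ 2 := by
  have h1 := sq_sub_min_le hx hxM hf
  have h2 : (min (1 / f) M - y) ^ 2 ≤ (1 / f - y) ^ 2 := by
    rw [sq_le_sq]
    calc |min (1 / f) M - y| = |min (1 / f) M - min y M| := by rw [min_eq_left hyM]
      _ ≤ max |1 / f - y| |M - M| := abs_min_sub_min_le_max _ _ _ _
      _ = _ := by simp
  nlinarith [sq_nonneg (x - min (1 / f) M - (min (1 / f) M - y))]

/-- Strong concavity of the logarithm: 4xy/(x + y)² = 1 - (x - y)²/(x + y)², and x + y ≤ 2M. -/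
theorem neg_log_midpoint_le {x y M : ℝ} (hx : 0 < x) (hy : 0 < y) (hxM : x ≤ M) (hyM : y ≤ M) :
    (x - y) ^ 2 / (8 * M ^ 2) ≤ Real.log ((x + y) / 2) - (Real.log x + Real.log y) / 2 := by
  have hM := hx.trans_le hxM
  have hs : 0 < x + y := by linarith
  have e : Real.log ((x + y) / 2) - (Real.log x + Real.log y) / 2
      = -(1 / 2) * Real.log (x * y * 4 / (x + y) ^ 2) := by
    have h4 : Real.log 4 = 2 * Real.log 2 := by
      rw [show (4 : ℝ) = 2 ^ 2 by norm_num, Real.log_pow]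
      norm_num
    rw [Real.log_div hs.ne' two_ne_zero, Real.log_div (by positivity) (by positivity),
      Real.log_mul (by positivity) (by positivity), Real.log_mul hx.ne' hy.ne', Real.log_pow, h4]
    push_cast
    ring
  rw [e]
  have h1 := Real.log_le_sub_one_of_pos (show 0 < x * y * 4 / (x + y) ^ 2 by positivity)
  have h2 : x * y * 4 / (x + y) ^ 2 - 1 = -((x - y) ^ 2 / (x + y) ^ 2) := by
    field_simp
    ring
  have h3 : (x - y) ^ 2 / (4 * M ^ 2) ≤ (x - y) ^ 2 / (x + y) ^ 2 := by
    gcongr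
    nlinarith
  have h4 : (x - y) ^ 2 / (8 * M ^ 2) = 1 / 2 * ((x - y) ^ 2 / (4 * M ^ 2)) := by
    field_simp
    ring
  rw [h4]
  linarith

section Curvature

variable {f : ℝ → ℝ → ℝ} {Cf : ℝ} {m M c : ℝ} {g g₀ : ℝ → ℝ → ℝ}

theorem Regular.integrable_mul (hg : Regular m M c g) (hm : 0 < m)
    (hfm : AEMeasurable (fun p : ℝ × ℝ => f p.1 p.2) tfMeasure)
    (hfC : ∀ᵐ p ∂tfMeasure, |f p.1 p.2| ≤ Cf) :
    Integrable (fun p : ℝ × ℝ => recip g p.1 p.2 * f p.1 p.2) tfMeasure := by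
  have h1 := ((hg.tame hm).memLp 1).integrable le_rfl
  exact h1.mul_bdd hfm.aestronglyMeasurable (by simpa using hfC)

/-- Quadratic growth of the contrast around a minimizer over a convex class. -/
theorem sq_l2_le_of_convex (hg : Regular m M c g) (hg₀ : Regular m M c g₀) (hm : 0 < m)
    (hfm : AEMeasurable (fun p : ℝ × ℝ => f p.1 p.2) tfMeasure)
    (hfC : ∀ᵐ p ∂tfMeasure, |f p.1 p.2| ≤ Cf)
    (hmid : realContrast f (recip g₀)
      ≤ realContrast f (fun u l => (recip g u l + recip g₀ u l) / 2)) :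
    l2 (fun u l => recip g u l - recip g₀ u l) ^ 2
      ≤ 16 * Real.pi * M ^ 2 * (realContrast f (recip g) - realContrast f (recip g₀)) := by
  have hpi := Real.pi_pos
  have i1 := hg.integrable_mul hm hfm hfC
  have i2 := hg₀.integrable_mul hm hfm hfC
  have l1 := ((hg.tame_log hm).memLp 1).integrable le_rfl
  have l2' := ((hg₀.tame_log hm).memLp 1).integrable le_rfl
  have hd := (hg.tame hm).sub (hg₀.tame hm)
  have hM : 0 < M := hm.trans_le ((hg.low 0 (by simp) 0 (by simp [hpi.le])).trans
    (hg.up 0 (by simp) 0 (by simp [hpi.le])))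
  have hmidT : Tame fun u l => Real.log ((recip g u l + recip g₀ u l) / 2) := by
    refine ⟨Real.measurable_log.comp (((measurable_recip hg.meas).add
      (measurable_recip hg₀.meas)).div_const 2), |Real.log m| + |Real.log M|, fun u hu l hl => ?_⟩
    have a1 := hg.low u hu l hl
    have a2 := hg₀.low u hu l hl
    have a3 := hg.up u hu l hl
    have a4 := hg₀.up u hu l hl
    have h1 := Real.log_le_log hm (show m ≤ (recip g u l + recip g₀ u l) / 2 by linarith)
    have h2 := Real.log_le_log (show 0 < (recip g u l + recip g₀ u l) / 2 by linarith)
      (show (recip g u l + recip g₀ u l) / 2 ≤ M by linarith)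
    rw [abs_le]
    constructor
    · linarith [neg_abs_le (Real.log m), abs_nonneg (Real.log M)]
    · linarith [le_abs_self (Real.log M), abs_nonneg (Real.log m)]
  have lm := (hmidT.memLp 1).integrable le_rfl
  have hsq := (hd.memLp 2).integrable_sq
  have l12 : Integrable (fun p : ℝ × ℝ => (Real.log (recip g p.1 p.2)
    + Real.log (recip g₀ p.1 p.2)) / 2) tfMeasure := (l1.add l2').div_const 2
  have key : (∫ p, (recip g p.1 p.2 - recip g₀ p.1 p.2) ^ 2 / (8 * M ^ 2) ∂tfMeasure)
      ≤ ∫ p, (Real.log ((recip g p.1 p.2 + recip g₀ p.1 p.2) / 2)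
        - (Real.log (recip g p.1 p.2) + Real.log (recip g₀ p.1 p.2)) / 2) ∂tfMeasure := by
    refine integral_mono_ae (hsq.div_const _) (lm.sub l12) ?_
    filter_upwards [ae_tfMeasure_mem] with p hp
    have hu := Set.Ioc_subset_Icc_self hp.1
    exact neg_log_midpoint_le (hm.trans_le (hg.low _ hu _ hp.2)) (hm.trans_le (hg₀.low _ hu _ hp.2))
      (hg.up _ hu _ hp.2) (hg₀.up _ hu _ hp.2)
  rw [integral_div, ← hd.sq_l2, integral_sub lm l12, integral_div,
    integral_add l1 l2'] at key
  -- The f-part of the contrast is linear in the reciprocal, so it is additive at the midpoint and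
  -- all curvature comes from the logarithm.
  have hmul : ∫ p, (recip g p.1 p.2 + recip g₀ p.1 p.2) / 2 * f p.1 p.2 ∂tfMeasure
      = ((∫ p, recip g p.1 p.2 * f p.1 p.2 ∂tfMeasure)
        + ∫ p, recip g₀ p.1 p.2 * f p.1 p.2 ∂tfMeasure) / 2 := by
    rw [← integral_add i1 i2, ← integral_div]
    congr 1
    ext p
    ring
  unfold realContrast at hmid ⊢
  rw [hmul] at hmid
  have h4 : 0 < 1 / (4 * Real.pi) := by positivity
  have hmid' := le_of_mul_le_mul_left hmid h4
  rw [div_le_iff₀ (by positivity)] at key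
  have e : ∀ A B : ℝ, 16 * Real.pi * M ^ 2 * (1 / (4 * Real.pi) * A - 1 / (4 * Real.pi) * B)
      = 4 * M ^ 2 * (A - B) := by
    intro A B
    field_simp
    ring
  rw [e]
  refine key.trans ?_
  rw [show ∀ A, 4 * M ^ 2 * A = A / 2 * (8 * M ^ 2) from fun A => by ring]
  gcongr
  linarith

/-- Quadratic growth of the contrast in a correctly specified model. -/
theorem sq_l2_le_of_correct (hg : Regular m M c g) (hg₀ : Regular m M c g₀) (hm : 0 < m)
    (hfm : AEMeasurable (fun p : ℝ × ℝ => f p.1 p.2) tfMeasure)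
    (hfC : ∀ᵐ p ∂tfMeasure, |f p.1 p.2| ≤ Cf) (hf0 : ∀ᵐ p ∂tfMeasure, 0 < f p.1 p.2)
    (hfin : rho2Dist (recip f) (recip g₀) ≠ ∞) :
    l2 (fun u l => recip g u l - recip g₀ u l) ^ 2
      ≤ 32 * Real.pi * M ^ 2 * (realContrast f (recip g) - realContrast f (recip g₀))
        + (8 * M ^ 2 * Cf / m + 2) * (rho2Dist (recip f) (recip g₀)).toReal ^ 2 := by
  have hpi := Real.pi_pos
  have hMp : ∀ {g}, Regular m M c g → 0 < M := fun {g} hg =>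
    hm.trans_le ((hg.low 0 (by simp) 0 (by simp [hpi.le])).trans
      (hg.up 0 (by simp) 0 (by simp [hpi.le])))
  have hM := hMp hg
  have i1 := hg.integrable_mul hm hfm hfC
  have i2 := hg₀.integrable_mul hm hfm hfC
  have l1 := ((hg.tame_log hm).memLp 1).integrable le_rfl
  have l2' := ((hg₀.tame_log hm).memLp 1).integrable le_rfl
  have hd := (hg.tame hm).sub (hg₀.tame hm)
  have hsq := (hd.memLp 2).integrable_sq
  have hrf : AEStronglyMeasurable (fun p : ℝ × ℝ => recip f p.1 p.2) tfMeasure := by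
    have : AEMeasurable (fun p : ℝ × ℝ => 1 / f p.1 p.2) tfMeasure := hfm.const_div 1
    exact this.aestronglyMeasurable
  have hE : MemLp (fun p : ℝ × ℝ => recip f p.1 p.2 - recip g₀ p.1 p.2) 2 tfMeasure :=
    ⟨hrf.sub ((hg₀.tame hm).memLp 2).1, hfin.lt_top⟩
  have hEsq := hE.integrable_sq
  have hEl2 : (rho2Dist (recip f) (recip g₀)).toReal ^ 2
      = ∫ p, (recip f p.1 p.2 - recip g₀ p.1 p.2) ^ 2 ∂tfMeasure := sq_l2_of_memLp hE
  have hrfL : MemLp (fun p : ℝ × ℝ => recip f p.1 p.2) 2 tfMeasure := by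
    have := hE.add ((hg₀.tame hm).memLp 2)
    refine this.ae_eq (Eventually.of_forall fun p => ?_)
    simp
  -- |log f| is at most f + 1/f: f is bounded, and 1/f is square integrable because it lies at
  -- finite distance from a bounded function.
  have hlogf : Integrable (fun p : ℝ × ℝ => Real.log (f p.1 p.2)) tfMeasure := by
    have h1 : Integrable (fun p : ℝ × ℝ => recip f p.1 p.2) tfMeasure :=
      hrfL.integrable one_le_two
    refine Integrable.mono' ((integrable_const Cf).add h1)
      (Real.measurable_log.comp_aemeasurable hfm).aestronglyMeasurable ?_
    filter_upwards [hfC, hf0] with p hp hp0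
    have a1 := Real.log_le_sub_one_of_pos hp0
    have a2 := Real.log_le_sub_one_of_pos (inv_pos.2 hp0)
    rw [Real.log_inv] at a2
    have a3 : recip f p.1 p.2 = (f p.1 p.2)⁻¹ := one_div _
    have a4 := inv_pos.2 hp0
    have a5 := (le_abs_self _).trans hp
    simp only [Pi.add_apply]
    rw [Real.norm_eq_abs, abs_le, a3]
    constructor <;> linarith
  -- the Kullback--Leibler type integrands
  set H : (ℝ → ℝ → ℝ) → ℝ × ℝ → ℝ := fun g p => recip g p.1 p.2 * f p.1 p.2 - 1
    - Real.log (recip g p.1 p.2 * f p.1 p.2) with hH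
  have hHeq : ∀ g, Regular m M c g → H g =ᵐ[tfMeasure] fun p => recip g p.1 p.2 * f p.1 p.2
      - Real.log (recip g p.1 p.2) - (1 + Real.log (f p.1 p.2)) := by
    intro g hg
    filter_upwards [hf0, ae_tfMeasure_mem] with p hp hp2
    have := hm.trans_le (hg.low _ (Set.Ioc_subset_Icc_self hp2.1) _ hp2.2)
    simp only [hH]
    rw [Real.log_mul this.ne' hp.ne']
    ring
  have hHint : Integrable (H g) tfMeasure :=
    ((i1.sub l1).sub ((integrable_const 1).add hlogf)).congr (hHeq g hg).symm
  have hHint₀ : Integrable (H g₀) tfMeasure :=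
    ((i2.sub l2').sub ((integrable_const 1).add hlogf)).congr (hHeq g₀ hg₀).symm
  have s1 : Integrable (fun p : ℝ × ℝ => recip g p.1 p.2 * f p.1 p.2
    - Real.log (recip g p.1 p.2)) tfMeasure := i1.sub l1
  have s2 : Integrable (fun p : ℝ × ℝ => recip g₀ p.1 p.2 * f p.1 p.2
    - Real.log (recip g₀ p.1 p.2)) tfMeasure := i2.sub l2'
  have s3 : Integrable (fun p : ℝ × ℝ => 1 + Real.log (f p.1 p.2)) tfMeasure :=
    (integrable_const 1).add hlogf
  -- The terms in log f are the same for both candidates and cancel.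
  have hdiff : 4 * Real.pi * (realContrast f (recip g) - realContrast f (recip g₀))
      = ∫ p, H g p ∂tfMeasure - ∫ p, H g₀ p ∂tfMeasure := by
    rw [integral_congr_ae (hHeq g hg), integral_congr_ae (hHeq g₀ hg₀)]
    rw [integral_sub s1 s3, integral_sub s2 s3, integral_sub i1 l1, integral_sub i2 l2']
    unfold realContrast
    field_simp
    ring
  -- With z = f/g₀, the bound (z - 1)²/z equals f g₀ (1/f - 1/g₀)²; boundedness of f and the lower
  -- bound m on 1/g₀ control the weight.
  have hup : ∫ p, H g₀ p ∂tfMeasure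
      ≤ Cf / m * (rho2Dist (recip f) (recip g₀)).toReal ^ 2 := by
    rw [hEl2, ← integral_const_mul]
    refine integral_mono_ae hHint₀ (hEsq.const_mul _) ?_
    filter_upwards [hfC, hf0, ae_tfMeasure_mem] with p hp hp0 hp2
    have hlow := hg₀.low _ (Set.Ioc_subset_Icc_self hp2.1) _ hp2.2
    have hφ := hm.trans_le hlow
    refine (sub_one_sub_log_le (mul_pos hφ hp0)).trans ?_
    have e : (recip g₀ p.1 p.2 * f p.1 p.2 - 1) ^ 2 / (recip g₀ p.1 p.2 * f p.1 p.2)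
        = f p.1 p.2 / recip g₀ p.1 p.2 * (recip f p.1 p.2 - recip g₀ p.1 p.2) ^ 2 := by
      have : recip f p.1 p.2 = 1 / f p.1 p.2 := rfl
      rw [this]
      field_simp
      ring
    rw [e]
    have hp' := (le_abs_self _).trans hp
    have hCf := hp0.le.trans hp'
    gcongr
  have hlow : l2 (fun u l => recip g u l - recip g₀ u l) ^ 2
      ≤ 8 * M ^ 2 * ∫ p, H g p ∂tfMeasure
        + 2 * (rho2Dist (recip f) (recip g₀)).toReal ^ 2 := by
    rw [hd.sq_l2, hEl2, ← integral_const_mul, ← integral_const_mul,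
      ← integral_add (hHint.const_mul _) (hEsq.const_mul _)]
    refine integral_mono_ae hsq ((hHint.const_mul _).add (hEsq.const_mul _)) ?_
    filter_upwards [hf0, ae_tfMeasure_mem] with p hp0 hp2
    have hu := Set.Ioc_subset_Icc_self hp2.1
    exact sq_sub_le_of_correct (hm.trans_le (hg.low _ hu _ hp2.2)) (hg.up _ hu _ hp2.2)
      (hg₀.up _ hu _ hp2.2) hp0
  set E := (rho2Dist (recip f) (recip g₀)).toReal ^ 2 with hEdef
  have h5 : ∫ p, H g p ∂tfMeasure ≤ 4 * Real.pi * (realContrast f (recip g)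
      - realContrast f (recip g₀)) + Cf / m * E := by linarith
  calc _ ≤ _ := hlow
    _ ≤ 8 * M ^ 2 * (4 * Real.pi * (realContrast f (recip g)
      - realContrast f (recip g₀)) + Cf / m * E) + 2 * E := by gcongr
    _ = _ := by ring

end Curvature

/-! ### From bounds for the fluctuation to rates of convergence -/

/-- If x exceeded the bound, then d ≤ x, so the right side is at most (α + β)xd, and cancelling x
contradicts the assumption. -/
theorem le_of_sq_le_mul_add {x d α β : ℝ} (hd : 0 ≤ d) (hα : 0 ≤ α) (hβ : 0 ≤ β)
    (h : x ^ 2 ≤ α * (x * d) + β * d ^ 2) : x ≤ (α + β + 1) * d := by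
  by_contra! hlt
  have h1 : d ≤ x := by nlinarith [mul_nonneg (add_nonneg hα hβ) hd]
  have hx0 : 0 < x := lt_of_le_of_lt (by positivity) hlt
  have h2 : β * d ^ 2 ≤ β * (x * d) := by
    rw [sq]
    gcongr
  have h3 : x * x ≤ x * ((α + β) * d) := by nlinarith
  have h4 := le_of_mul_le_mul_left h3 hx0
  nlinarith

theorem rho2Dist_triangle {φ ψ χ : ℝ → ℝ → ℝ}
    (hφ : AEStronglyMeasurable (fun p : ℝ × ℝ => φ p.1 p.2) tfMeasure)
    (hψ : AEStronglyMeasurable (fun p : ℝ × ℝ => ψ p.1 p.2) tfMeasure)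
    (hχ : AEStronglyMeasurable (fun p : ℝ × ℝ => χ p.1 p.2) tfMeasure) :
    rho2Dist φ χ ≤ rho2Dist φ ψ + rho2Dist ψ χ := by
  have h := eLpNorm_add_le (hφ.sub hψ) (hψ.sub hχ) (p := 2) one_le_two
  refine le_trans (le_of_eq ?_) h
  unfold rho2Dist rho2
  congr 1
  ext p
  simp

theorem rho2Dist_comm (φ ψ : ℝ → ℝ → ℝ) : rho2Dist φ ψ = rho2Dist ψ φ :=
  eLpNorm_sub_comm (fun p : ℝ × ℝ => φ p.1 p.2) (fun p => ψ p.1 p.2) 2 tfMeasure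

section Sample

variable {Ω : Type*} [MeasurableSpace Ω] {P : Measure Ω} [IsProbabilityMeasure P]
  {κ K : ℝ} {ε : ℤ → Ω → ℝ} {aT : ℕ → ℤ → ℤ → ℝ} {a : ℝ → ℤ → ℝ} {X : ℕ → ℤ → Ω → ℝ}

namespace IsLocallyStationary

/-- The basic inequality for minimizers of approximate contrasts. -/
theorem exists_basic_inequality (hX : IsLocallyStationary P κ K ε aT a X) :
    ∃ C : ℝ, 0 ≤ C ∧ ∀ (m M c : ℝ) (g g₀ : ℝ → ℝ → ℝ), 0 < m → m ≤ 1 → 0 ≤ c →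
      Regular m M c g → Regular m M c g₀ → ∀ n : ℕ, 1 ≤ n → ∀ (ω : Ω) (B η : ℝ), 0 ≤ B →
      (∀ r ∈ Finset.Icc (1 : ℤ) n, X n r ω ^ 2 ≤ B) → ∀ Lt : (ℝ → ℝ → ℝ) → ℝ, Lt g ≤ Lt g₀ →
      |Lt g - empContrast n (fun t => X n t ω) g| ≤ η →
      |Lt g₀ - empContrast n (fun t => X n t ω) g₀| ≤ η →
      realContrast (spectralDensity a) (recip g) - realContrast (spectralDensity a) (recip g₀) ≤
        2 * η + |smoothedDev P X n (fun u l => recip g u l - recip g₀ u l) ω|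
          + c * (B + C) / (n * m) := by
  obtain ⟨C, hC0, hC⟩ := hX.exists_quadForm_error
  -- The additional 1 accounts for the Riemann sum error c/(nm) of the logarithmic part.
  refine ⟨C + 1, by linarith, fun m M c g g₀ hm hm1 hc hg hg₀ n hn ω B η hB0 hB Lt hLt h1 h2 => ?_⟩
  have hn0 : (0 : ℝ) < n := by exact_mod_cast hn
  have hpi := Real.pi_pos
  have key : ∀ g, Regular m M c g → |4 * Real.pi * (empContrast n (fun t => X n t ω) g
      - realContrast (spectralDensity a) (recip g)) - smoothedDev P X n (recip g) ω|
      ≤ c * (B + (C + 1)) / (n * m) := by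
    intro g hg
    have e1 := hC (recip g) c (hg.tame hm) hc hg.rho hg.var n hn ω B hB0 hB
    have e2 := hg.abs_sum_log_sub_le hm hc hn
    rw [hg.empContrast_eq hm]
    unfold realContrast
    have e3 : c * (B + C) / n ≤ c * (B + C) / (n * m) := by
      have : (n : ℝ) * m ≤ n := mul_le_of_le_one_right hn0.le hm1
      gcongr
    have e4 : c * (B + (C + 1)) / (n * m) = c * (B + C) / (n * m) + c / (n * m) := by ring
    rw [e4]
    refine le_trans (le_of_eq ?_) ((abs_sub _ _).trans (add_le_add (e1.trans e3) e2))
    congr 1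
    field_simp
    ring
  have k1 := abs_le.1 (key g hg)
  have k2 := abs_le.1 (key g₀ hg₀)
  have a1 := abs_le.1 h1
  have a2 := abs_le.1 h2
  rw [smoothedDev_sub (hg.tame hm) (hg₀.tame hm)]
  have a3 := neg_abs_le (smoothedDev P X n (recip g) ω - smoothedDev P X n (recip g₀) ω)
  set S := |smoothedDev P X n (recip g) ω - smoothedDev P X n (recip g₀) ω| with hS
  have hS0 : 0 ≤ S := abs_nonneg _
  set R := c * (B + (C + 1)) / (n * m) with hR
  have hR0 : 0 ≤ R := by positivity
  set r1 := realContrast (spectralDensity a) (recip g)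
  set r2 := realContrast (spectralDensity a) (recip g₀)
  set q1 := empContrast n (fun t => X n t ω) g
  set q2 := empContrast n (fun t => X n t ω) g₀
  have f1 : q1 - q2 ≤ 2 * η := by linarith
  have f2 : 4 * Real.pi * ((r1 - r2) - (q1 - q2)) ≤ S + 2 * R := by linarith
  have f3 : (r1 - r2) - (q1 - q2) ≤ (S + 2 * R) / (4 * Real.pi) := by
    rw [le_div_iff₀ (by positivity)]
    linarith
  have f4 : (S + 2 * R) / (4 * Real.pi) ≤ S + R := by
    rw [div_le_iff₀ (by positivity)]
    nlinarith [Real.two_le_pi]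
  linarith

/-- Rates of convergence of approximate minimum contrast estimators, given a bound for the
fluctuation of the smoothed quadratic functional. -/
theorem convergesAtRate (hX : IsLocallyStationary P κ K ε aT a X) (hG : IsGaussianArray P X)
    {Fn : ℕ → Set (ℝ → ℝ → ℝ)} {fF : ℝ → ℝ → ℝ} {m M c τ : ℕ → ℝ} {δ : ℕ → ℝ≥0∞}
    {Lt : ℕ → Ω → (ℝ → ℝ → ℝ) → ℝ} {ft : ℕ → Ω → ℝ → ℝ → ℝ} {g₀ : ℕ → ℝ → ℝ → ℝ} {κ₀ C₄ : ℝ}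
    {C₅ : ℝ≥0}
    (hft : ∀ n, 1 ≤ n → ∀ᵐ ω ∂P, ft n ω ∈ Fn n ∧ ∀ g ∈ Fn n, Lt n ω (ft n ω) ≤ Lt n ω g)
    (hfF : AEStronglyMeasurable (fun p : ℝ × ℝ => recip fF p.1 p.2) tfMeasure)
    (hm0 : ∀ n, 1 ≤ n → 0 < m n) (hm1 : ∀ n, 1 ≤ n → m n ≤ 1) (hM1 : ∀ n, 1 ≤ n → 1 ≤ M n)
    (hMc : ∀ n, 1 ≤ n → M n ^ 2 ≤ c n)
    (hreg : ∀ n, 1 ≤ n → ∀ g ∈ Fn n, Regular (m n) (M n) (c n) g) (hκ₀ : 0 < κ₀) (hC₄ : 0 ≤ C₄)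
    (hτ : ∀ᶠ n : ℕ in atTop, 0 ≤ τ n ∧ Real.log n / n ≤ τ n ^ 2)
    (hδ : ∀ᶠ n in atTop, ENNReal.ofReal (κ₀ * (M n / m n * Real.sqrt (c n) * τ n)) ≤ δ n)
    (hg₀ : ∀ᶠ n in atTop, δ n ≠ ∞ → g₀ n ∈ Fn n ∧
      rho2Dist (recip (g₀ n)) (recip fF) ≤ C₅ * δ n ∧ ∀ g ∈ Fn n,
      l2 (fun u l => recip g u l - recip (g₀ n) u l) ^ 2 ≤ 32 * Real.pi * M n ^ 2 *
        (realContrast (spectralDensity a) (recip g)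
          - realContrast (spectralDensity a) (recip (g₀ n))) + C₄ * (δ n).toReal ^ 2)
    (hD : ∀ e : ℝ≥0∞, 0 < e → ∃ C : ℝ, 0 ≤ C ∧ ∀ᶠ n in atTop, δ n ≠ ∞ →
      P {ω | ∃ g ∈ Fn n, C * (l2 (fun u l => recip g u l - recip (g₀ n) u l) * τ n
        + c n * τ n ^ 2) <
          |smoothedDev P X n (fun u l => recip g u l - recip (g₀ n) u l) ω|} ≤ e)
    (hclose : CriterionClose P X Fn M Lt δ) : ConvergesAtRate P ft fF δ := by
  intro e he
  obtain ⟨C₁, hC₁0, hC₁⟩ := hX.exists_basic_inequality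
  have he3 : 0 < e / 3 := ENNReal.div_pos he.ne' (by simp)
  obtain ⟨C₂, hC₂0, hC₂⟩ := hD (e / 3) he3
  have hcov := hX.covConst_pos
  set C₃ := 18 * covConst κ K + 2 * C₁ with hC₃
  have hC₃0 : 0 ≤ C₃ := by positivity
  have hpi := Real.pi_pos
  set α := 32 * Real.pi * (C₂ / κ₀) with hα
  set β := 32 * Real.pi * (2 + (C₂ + C₃) / κ₀ ^ 2) + C₄ with hβ
  have hα0 : 0 ≤ α := by positivity
  have hβ0 : 0 ≤ β := by positivity
  set C : ℝ≥0 := Real.toNNReal (α + β + 1) + C₅ with hC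
  have hCpos : 0 < C := by
    have : 0 < Real.toNNReal (α + β + 1) := Real.toNNReal_pos.2 (by linarith)
    positivity
  refine ⟨C, ?_⟩
  have ev1 : ∀ᶠ n : ℕ in atTop, ENNReal.ofReal (2 / n) ≤ e / 3 := by
    have h : Tendsto (fun n : ℕ => ENNReal.ofReal (2 / n)) atTop (𝓝 0) := by
      rw [← ENNReal.ofReal_zero]
      exact ENNReal.tendsto_ofReal (tendsto_const_div_atTop_nhds_zero_nat 2)
    exact (h.eventually_lt_const he3).mono fun n hn => hn.le
  have ev2 := ((hclose 1 one_pos).eventually_lt_const he3).mono fun n hn => hn.le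
  filter_upwards [ev1, ev2, hC₂, hτ, hδ, hg₀, eventually_ge_atTop 2] with n h1 h2 h3 h4 h5 h6 hn2
  by_cases htop : δ n = ∞
  · have : {ω | (C : ℝ≥0∞) * δ n < rho2Dist (recip (ft n ω)) (recip fF)} = ∅ := by
      ext ω
      simp [htop, ENNReal.mul_top, hCpos.ne']
    simp only [this, measure_empty, zero_le]
  have hn1 : 1 ≤ n := by omega
  have hn0 : (0 : ℝ) < n := by exact_mod_cast hn1
  obtain ⟨hg₀F, hg₀5, hg₀c⟩ := h6 htop
  have h3' := h3 htop
  obtain ⟨hτ0, hτ2⟩ := h4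
  set A₁ := {ω | ∃ t ∈ Finset.Icc (1 : ℤ) n, 18 * covConst κ K * Real.log n < X n t ω ^ 2} with hA₁
  set A₂ := {ω | ((1 : ℝ≥0) : ℝ≥0∞) * (δ n ^ 2 / ENNReal.ofReal (M n) ^ 2)
    < supGap (Fn n) (Lt n ω) (empContrast n fun t => X n t ω)} with hA₂
  set A₃ := {ω | ∃ g ∈ Fn n, C₂ * (l2 (fun u l => recip g u l - recip (g₀ n) u l) * τ n
        + c n * τ n ^ 2) <
          |smoothedDev P X n (fun u l => recip g u l - recip (g₀ n) u l) ω|} with hA₃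
  have hle : P (A₁ ∪ A₂ ∪ A₃) ≤ e := by
    calc P (A₁ ∪ A₂ ∪ A₃) ≤ P A₁ + P A₂ + P A₃ :=
          (measure_union_le _ _).trans (add_le_add (measure_union_le _ _) le_rfl)
      _ ≤ e / 3 + e / 3 + e / 3 :=
          add_le_add (add_le_add ((hX.measure_max_sq_le hG hn2).trans h1) h2) h3'
      _ = e := ENNReal.add_thirds e
  refine le_trans (measure_mono_ae ?_) hle
  filter_upwards [hft n hn1] with ω hω hZ
  change ω ∈ A₁ ∪ A₂ ∪ A₃
  by_contra hnot
  simp only [Set.mem_union, not_or] at hnot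
  obtain ⟨⟨hn1', hn2'⟩, hn3'⟩ := hnot
  simp only [hA₁, Set.mem_ofPred_eq, not_exists, not_and, not_lt] at hn1'
  rw [hA₂, Set.mem_ofPred_eq, not_lt] at hn2'
  simp only [hA₃, Set.mem_ofPred_eq, not_exists, not_and, not_lt] at hn3'
  change (C : ℝ≥0∞) * δ n < rho2Dist (recip (ft n ω)) (recip fF) at hZ
  refine absurd hZ (not_lt.2 ?_)
  have hm := hm0 n hn1
  have hm1' := hm1 n hn1
  have hM := hM1 n hn1
  have hM0 : 0 < M n := by linarith
  have hMc' := hMc n hn1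
  have hc0 : 0 ≤ c n := (sq_nonneg _).trans hMc'
  set g := ft n ω with hgdef
  have hgF := hω.1
  have rg := hreg n hn1 g hgF
  have rg₀ := hreg n hn1 _ hg₀F
  set d := (δ n).toReal with hd
  have hd0 : 0 ≤ d := ENNReal.toReal_nonneg
  have hδd : δ n = ENNReal.ofReal d := (ENNReal.ofReal_toReal htop).symm
  have hn2R : (2 : ℝ) ≤ n := by exact_mod_cast hn2
  have hlog : 1 / 2 ≤ Real.log n := by
    have h1 := Real.log_two_gt_d9
    have h2 := Real.log_le_log zero_lt_two hn2R
    linarith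
  -- the gap between the criterion and the empirical contrast
  have hgap : ∀ g' ∈ Fn n, |Lt n ω g' - empContrast n (fun t => X n t ω) g'| ≤ d ^ 2 / M n ^ 2 := by
    intro g' hg'
    have h : ENNReal.ofReal |Lt n ω g' - empContrast n (fun t => X n t ω) g'|
        ≤ ENNReal.ofReal (d ^ 2 / M n ^ 2) := by
      have e1 : ENNReal.ofReal |Lt n ω g' - empContrast n (fun t => X n t ω) g'|
          ≤ supGap (Fn n) (Lt n ω) (empContrast n fun t => X n t ω) :=
        le_iSup₂ (f := fun g _ => ENNReal.ofReal
          |Lt n ω g - empContrast n (fun t => X n t ω) g|) g' hg'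
      refine (e1.trans hn2').trans (le_of_eq ?_)
      rw [ENNReal.coe_one, one_mul, hδd, ENNReal.ofReal_div_of_pos (by positivity),
        ENNReal.ofReal_pow hd0, ENNReal.ofReal_pow hM0.le]
    exact (ENNReal.ofReal_le_ofReal_iff (by positivity)).1 h
  have hbasic := hC₁ (m n) (M n) (c n) g (g₀ n) hm hm1' hc0 rg rg₀ n hn1 ω
    (18 * covConst κ K * Real.log n) (d ^ 2 / M n ^ 2) (by positivity) hn1' (Lt n ω)
    (hω.2 _ hg₀F) (hgap g hgF) (hgap _ hg₀F)
  have hdev := hn3' g hgF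
  have hcurv := hg₀c g hgF
  set x := l2 (fun u l => recip g u l - recip (g₀ n) u l) with hx
  have hx0 : 0 ≤ x := l2_nonneg _
  set Δ := realContrast (spectralDensity a) (recip g)
    - realContrast (spectralDensity a) (recip (g₀ n)) with hΔ
  set S := |smoothedDev P X n (fun u l => recip g u l - recip (g₀ n) u l) ω| with hS
  -- the remainder
  have hrem : c n * (18 * covConst κ K * Real.log n + C₁) / (n * m n)
      ≤ C₃ * (c n * τ n ^ 2 / m n) := by
    have e1 : 18 * covConst κ K * Real.log n + C₁ ≤ C₃ * Real.log n := by
      rw [hC₃]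
      nlinarith
    calc _ ≤ c n * (C₃ * Real.log n) / (n * m n) := by gcongr
      _ = C₃ * (c n * (Real.log n / n) / m n) := by
          field_simp
      _ ≤ _ := by gcongr
  have hδ' : κ₀ * (M n / m n * Real.sqrt (c n) * τ n) ≤ d := by
    rw [hδd] at h5
    exact (ENNReal.ofReal_le_ofReal_iff hd0).1 h5
  set y := M n * Real.sqrt (c n) * τ n with hy
  have hy0 : 0 ≤ y := by positivity
  have hyd : y ≤ m n * (d / κ₀) := by
    have : κ₀ * (M n / m n * Real.sqrt (c n) * τ n) = κ₀ * y / m n := by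
      rw [hy]
      ring
    rw [this, div_le_iff₀ hm] at hδ'
    rw [← mul_div_assoc, le_div_iff₀ hκ₀]
    linarith
  have hdk : 0 ≤ d / κ₀ := by positivity
  have hy1 : y ≤ d / κ₀ := hyd.trans (mul_le_of_le_one_left hdk hm1')
  have hy2 : y ^ 2 = M n ^ 2 * (c n * τ n ^ 2) := by
    rw [hy, mul_pow, mul_pow, Real.sq_sqrt hc0]
    ring
  have hMs : M n ≤ Real.sqrt (c n) := Real.le_sqrt_of_sq_le hMc'
  -- The condition M² ≤ c is used here: one factor M of M²τ is replaced by √c.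
  have b1 : M n ^ 2 * τ n ≤ d / κ₀ := by
    refine le_trans ?_ hy1
    rw [hy, sq]
    gcongr
  have b2 : M n ^ 2 * (c n * τ n ^ 2) ≤ (d / κ₀) ^ 2 := by
    rw [← hy2]
    gcongr
  -- The remainder of the logarithm carries 1/m; it is absorbed because the rate dominates y/m and
  -- not merely y.
  have b3 : M n ^ 2 * (c n * τ n ^ 2 / m n) ≤ (d / κ₀) ^ 2 := by
    rw [← mul_div_assoc, ← hy2, div_le_iff₀ hm]
    calc y ^ 2 = y * y := sq y
      _ ≤ m n * (d / κ₀) * (d / κ₀) := by gcongr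
      _ = _ := by ring
  have b4 : M n ^ 2 * Δ ≤ 2 * d ^ 2 + C₂ * (x * (d / κ₀) + (d / κ₀) ^ 2) + C₃ * (d / κ₀) ^ 2 := by
    calc M n ^ 2 * Δ ≤ M n ^ 2 * (2 * (d ^ 2 / M n ^ 2)
          + C₂ * (x * τ n + c n * τ n ^ 2) + C₃ * (c n * τ n ^ 2 / m n)) := by
          gcongr
          linarith
      _ = 2 * d ^ 2 + C₂ * (x * (M n ^ 2 * τ n) + M n ^ 2 * (c n * τ n ^ 2))
          + C₃ * (M n ^ 2 * (c n * τ n ^ 2 / m n)) := by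
          field_simp
      _ ≤ _ := by gcongr
  have hfin : x ^ 2 ≤ α * (x * d) + β * d ^ 2 := by
    have e1 : α * (x * d) + β * d ^ 2 = 32 * Real.pi *
        (2 * d ^ 2 + C₂ * (x * (d / κ₀) + (d / κ₀) ^ 2) + C₃ * (d / κ₀) ^ 2) + C₄ * d ^ 2 := by
      rw [hα, hβ]
      field_simp
      ring
    rw [e1]
    calc x ^ 2 ≤ 32 * Real.pi * (M n ^ 2 * Δ) + C₄ * d ^ 2 := by linarith
      _ ≤ _ := by gcongr
  have hxd := le_of_sq_le_mul_add hd0 hα0 hβ0 hfin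
  have tg := rg.tame hm
  have tg₀ := rg₀.tame hm
  calc rho2Dist (recip g) (recip fF)
      ≤ rho2Dist (recip g) (recip (g₀ n)) + rho2Dist (recip (g₀ n)) (recip fF) :=
        rho2Dist_triangle (tg.memLp 2).1 (tg₀.memLp 2).1 hfF
    _ ≤ ENNReal.ofReal (α + β + 1) * δ n + C₅ * δ n := by
        refine add_le_add ?_ hg₀5
        have : rho2Dist (recip g) (recip (g₀ n)) = ENNReal.ofReal x := (tg.sub tg₀).rho2_eq
        rw [this, hδd, ← ENNReal.ofReal_mul (by positivity)]
        exact ENNReal.ofReal_le_ofReal hxd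
    _ = C * δ n := by
        rw [hC, ENNReal.coe_add, add_mul]
        rfl

end IsLocallyStationary

end Sample

/-! ### Covering numbers -/

/-- A finite entropy bound excludes the empty infimum, and an infimum over natural numbers is
attained. -/
theorem exists_cover {η x : ℝ} {Φ : Set (ℝ → ℝ → ℝ)} (h : metricEntropy η Φ ≤ (x : EReal)) :
    ∃ m : ℕ, 1 ≤ m ∧ HasCover η Φ m ∧ (m : ℝ) ≤ Real.exp x := by
  classical
  by_cases hex : ∃ m : ℕ, 1 ≤ m ∧ HasCover η Φ m
  · refine ⟨Nat.find hex, (Nat.find_spec hex).1, (Nat.find_spec hex).2, ?_⟩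
    have h1 : ((Nat.find hex : ℕ) : ℕ∞) ≤ coveringNumber η Φ := by
      unfold coveringNumber
      exact le_iInf₂ fun m hm => by exact_mod_cast Nat.find_min' hex hm
    have hpos : 1 ≤ Nat.find hex := (Nat.find_spec hex).1
    have h2 : ENNReal.log ((Nat.find hex : ℕ) : ℝ≥0∞) ≤ (x : EReal) := by
      refine le_trans (ENNReal.log_monotone ?_) h
      exact_mod_cast ENat.toENNReal_le.2 h1
    have h0 : ((Nat.find hex : ℕ) : ℝ≥0∞) ≠ 0 := by
      exact_mod_cast (by omega : Nat.find hex ≠ 0)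
    rw [ENNReal.log_pos_real h0 (ENNReal.natCast_ne_top _), EReal.coe_le_coe_iff,
      ENNReal.toReal_natCast] at h2
    rw [← Real.log_le_iff_le_exp (by exact_mod_cast hpos)]
    exact h2
  · exfalso
    have : coveringNumber η Φ = ⊤ := by
      unfold coveringNumber
      refine iInf₂_eq_top.2 fun m hm => absurd ⟨m, hm⟩ hex
    unfold metricEntropy at h
    rw [this, ENat.toENNReal_top, ENNReal.log_top] at h
    exact absurd h (not_le.2 (EReal.coe_lt_top x))

theorem Tame.rhoInf_sub_le {φ ψ : ℝ → ℝ → ℝ} (hφ : Tame φ) (hψ : Tame ψ) :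
    rhoInf (fun u l => φ u l - ψ u l) ≤ rhoInf φ + rhoInf ψ := by
  unfold rhoInf
  rw [← ENNReal.tsum_add]
  refine ENNReal.tsum_le_tsum fun j => iSup₂_le fun u hu => ?_
  rw [hφ.fourierCoef_sub hψ hu]
  exact (enorm_sub_le).trans (add_le_add
    (le_iSup₂ (f := fun u (_ : u ∈ Set.Icc (0 : ℝ) 1) => ‖fourierCoef φ u j‖ₑ) u hu)
    (le_iSup₂ (f := fun u (_ : u ∈ Set.Icc (0 : ℝ) 1) => ‖fourierCoef ψ u j‖ₑ) u hu))

theorem Tame.l2_sub_triangle {φ ψ χ : ℝ → ℝ → ℝ} (hφ : Tame φ) (hψ : Tame ψ) (hχ : Tame χ) :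
    l2 (fun u l => φ u l - χ u l)
      ≤ l2 (fun u l => φ u l - ψ u l) + l2 (fun u l => ψ u l - χ u l) := by
  have h := rho2Dist_triangle (hφ.memLp 2).1 (hψ.memLp 2).1 (hχ.memLp 2).1
  have e1 : rho2Dist φ ψ = _ := (hφ.sub hψ).rho2_eq
  have e2 : rho2Dist ψ χ = _ := (hψ.sub hχ).rho2_eq
  have e3 : rho2Dist φ χ = _ := (hφ.sub hχ).rho2_eq
  rw [e1, e2, e3, ← ENNReal.ofReal_add (l2_nonneg _) (l2_nonneg _)] at h
  exact (ENNReal.ofReal_le_ofReal_iff (add_nonneg (l2_nonneg _) (l2_nonneg _))).1 h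

theorem Tame.l2_sub_comm (φ ψ : ℝ → ℝ → ℝ) :
    l2 (fun u l => φ u l - ψ u l) = l2 (fun u l => ψ u l - φ u l) :=
  congrArg ENNReal.toReal (rho2Dist_comm φ ψ)

theorem Tame.l2_sub_lt {φ ψ : ℝ → ℝ → ℝ} (hφ : Tame φ) (hψ : Tame ψ) {η : ℝ}
    (h : rho2Dist φ ψ < ENNReal.ofReal η) : l2 (fun u l => φ u l - ψ u l) < η := by
  have e1 : rho2Dist φ ψ = ENNReal.ofReal (l2 fun u l => φ u l - ψ u l) := (hφ.sub hψ).rho2_eq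
  rw [e1] at h
  exact (ENNReal.ofReal_lt_ofReal_iff_of_nonneg (l2_nonneg _)).1 h

theorem Regular.rhoInf_sub_le {m M c : ℝ} {g g' : ℝ → ℝ → ℝ} (hg : Regular m M c g)
    (hg' : Regular m M c g') (hm : 0 < m) (hc : 0 ≤ c) :
    rhoInf (fun u l => recip g u l - recip g' u l) ≤ ENNReal.ofReal (2 * c) := by
  refine ((hg.tame hm).rhoInf_sub_le (hg'.tame hm)).trans ?_
  rw [two_mul, ENNReal.ofReal_add hc hc]
  exact add_le_add hg.rho hg'.rho

/-- Adds the error off the net to Bernstein's bound on the net; c ≥ 1 lets every bare τ² be counted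
as cτ². -/
theorem sieve_arithmetic {V s b c x τ : ℝ} (hV : 0 ≤ V) (hs : 0 ≤ s) (hb : 0 ≤ b) (hc : 1 ≤ c)
    (hx : 0 ≤ x) (hτ : 0 ≤ τ) :
    V * 20 * τ ^ 2 + 4 * V * ((τ + x) * (s * τ) + 2 * c * (b * τ ^ 2))
      ≤ V * (8 * s + 8 * b + 20) * (x * τ + c * τ ^ 2) := by
  have hcτ : 0 ≤ c * τ ^ 2 - τ ^ 2 := sub_nonneg.2 (le_mul_of_one_le_left (sq_nonneg _) hc)
  have f1 : 0 ≤ V * 20 * (c * τ ^ 2 - τ ^ 2) := by positivity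
  have f2 : 0 ≤ 4 * (V * s) * (c * τ ^ 2 - τ ^ 2) := by positivity
  have f3 : 0 ≤ 4 * (V * s) * (c * τ ^ 2) := by positivity
  have f4 : 0 ≤ (V * 20 + 4 * (V * s) + 8 * (V * b)) * (x * τ) := by positivity
  linarith

section Sample

variable {Ω : Type*} [MeasurableSpace Ω] {P : Measure Ω} [IsProbabilityMeasure P]
  {κ K : ℝ} {ε : ℤ → Ω → ℝ} {aT : ℕ → ℤ → ℤ → ℝ} {a : ℝ → ℤ → ℝ} {X : ℕ → ℤ → Ω → ℝ}

namespace IsLocallyStationary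

/-- Bernstein's inequality, uniformly over finitely many functions. -/
theorem smoothedDev_tail_fin (hX : IsLocallyStationary P κ K ε aT a X) (hG : IsGaussianArray P X)
    {N : ℕ} {ψ : Fin N → ℝ → ℝ → ℝ} (hψ : ∀ i, Tame (ψ i)) {ρ T : ℝ} (hρ0 : 0 < ρ)
    (hρ : ∀ i, rhoInf (ψ i) ≤ ENNReal.ofReal ρ) (hT : 0 ≤ T) {n : ℕ} (hn : 1 ≤ n) :
    P {ω | ∃ i, 4 * covConst κ K * (l2 (ψ i) * Real.sqrt (T / n) + ρ * (T / n))
      < |smoothedDev P X n (ψ i) ω|} ≤ ENNReal.ofReal (N * (2 * Real.exp (-T))) := by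
  have e : {ω | ∃ i, 4 * covConst κ K * (l2 (ψ i) * Real.sqrt (T / n) + ρ * (T / n))
      < |smoothedDev P X n (ψ i) ω|} = ⋃ i, {ω | 4 * covConst κ K *
        (l2 (ψ i) * Real.sqrt (T / n) + ρ * (T / n)) < |smoothedDev P X n (ψ i) ω|} := by
    ext ω
    simp
  rw [e]
  refine (measure_iUnion_fintype_le P _).trans ((Finset.sum_le_sum fun i _ =>
    hX.smoothedDev_tail hG (hψ i) hρ0 (hρ i) hT hn).trans (le_of_eq ?_))
  rw [Finset.sum_const, Finset.card_univ, Fintype.card_fin, nsmul_eq_mul,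
    ENNReal.ofReal_mul (Nat.cast_nonneg _), ENNReal.ofReal_natCast]

/-- The fluctuation over a sieve with entropy of logarithmic growth. -/
theorem sieve_fluctuation (hX : IsLocallyStationary P κ K ε aT a X) (hG : IsGaussianArray P X)
    {A : ℝ} (hA : 0 < A) {G : Set (ℝ → ℝ → ℝ)} {m M c k : ℝ} (hm : 0 < m) (hc : 1 ≤ c)
    (hk : 1 ≤ k) (hreg : ∀ g ∈ G, Regular m M c g) {n : ℕ} (hn : 2 ≤ n)
    (hent : metricEntropy (1 / (n : ℝ) ^ 2) (recipClass G)
      ≤ ((A * k * Real.log (n / (1 / (n : ℝ) ^ 2)) : ℝ) : EReal))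
    {g₀ : ℝ → ℝ → ℝ} (hg₀ : g₀ ∈ G) :
    P {ω | ∃ g ∈ G, covConst κ K * (8 * Real.sqrt (3 * A + 1) + 8 * (3 * A + 1) + 20) *
        (l2 (fun u l => recip g u l - recip g₀ u l) * Real.sqrt (k * Real.log n / n)
          + c * Real.sqrt (k * Real.log n / n) ^ 2) <
          |smoothedDev P X n (fun u l => recip g u l - recip g₀ u l) ω|}
      ≤ ENNReal.ofReal (2 / n) + ENNReal.ofReal (2 / n) := by
  have hn1 : 1 ≤ n := by omega
  have hn2 : (2 : ℝ) ≤ n := by exact_mod_cast hn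
  have hn0 : (0 : ℝ) < n := by linarith
  have hcov := hX.covConst_pos
  have hlog : 1 / 2 ≤ Real.log n := by
    have h1 := Real.log_two_gt_d9
    have h2 := Real.log_le_log zero_lt_two hn2
    linarith
  have hlog0 : 0 < Real.log n := by linarith
  have hk0 : 0 < k := by linarith
  obtain ⟨N, -, ⟨ctr, hctr, hcover⟩, hN⟩ := exists_cover hent
  choose h hhG hh using hctr
  -- At radius n⁻² the entropy is at most 3Ak log n, since log(n · n²) = 3 log n. The extra k log n
  -- leaves a probability of at most 2/n after the union over the net.
  set T := (3 * A + 1) * k * Real.log n with hT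
  have hT0 : 0 ≤ T := by positivity
  have hNT : N * (2 * Real.exp (-T)) ≤ 2 / n := by
    have e1 : Real.log (n / (1 / (n : ℝ) ^ 2)) = 3 * Real.log n := by
      rw [show (n : ℝ) / (1 / (n : ℝ) ^ 2) = n ^ 3 by field_simp, Real.log_pow]
      norm_num
    rw [e1] at hN
    calc N * (2 * Real.exp (-T)) ≤ Real.exp (A * k * (3 * Real.log n)) * (2 * Real.exp (-T)) := by
          gcongr
      _ = 2 * Real.exp (-(k * Real.log n)) := by
          rw [mul_left_comm, ← Real.exp_add, hT]
          ring_nf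
      _ ≤ 2 * Real.exp (-Real.log n) := by
          gcongr
          nlinarith
      _ = 2 / n := by
          rw [Real.exp_neg, Real.exp_log hn0]
          rfl
  have r₀ := hreg _ hg₀
  have t₀ := r₀.tame hm
  have th : ∀ i, Tame (recip (h i)) := fun i => (hreg _ (hhG i)).tame hm
  have hbern := (hX.smoothedDev_tail_fin hG
    (ψ := fun i => fun u l => recip (h i) u l - recip g₀ u l)
    (fun i => (th i).sub t₀) (ρ := 2 * c) (by linarith)
    (fun i => (hreg _ (hhG i)).rhoInf_sub_le r₀ hm (by linarith)) hT0 hn1).trans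
    (ENNReal.ofReal_le_ofReal hNT)
  refine le_trans (measure_mono ?_) ((measure_union_le _ _).trans
    (add_le_add hbern (hX.measure_max_sq_le hG hn)))
  rintro ω ⟨g, hgG, hg⟩
  by_contra hnot
  simp only [Set.mem_union, not_or, Set.mem_ofPred_eq, not_exists, not_lt, not_and] at hnot
  obtain ⟨hnot1, hnot2⟩ := hnot
  refine absurd hg (not_lt.2 ?_)
  have tg := (hreg g hgG).tame hm
  obtain ⟨i, hi⟩ := hcover (recip g) ⟨g, hgG, rfl⟩
  rw [← hh i] at hi
  have hlt := tg.l2_sub_lt (th i) hi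
  set η : ℝ := 1 / (n : ℝ) ^ 2 with hη
  set x := l2 (fun u l => recip g u l - recip g₀ u l) with hx
  have hx0 : 0 ≤ x := l2_nonneg _
  set τ := Real.sqrt (k * Real.log n / n) with hτ
  have hτ0 : 0 ≤ τ := Real.sqrt_nonneg _
  have hτ2 : τ ^ 2 = k * Real.log n / n := Real.sq_sqrt (by positivity)
  have hlogτ : Real.log n / n ≤ τ ^ 2 := by
    rw [hτ2]
    gcongr
    nlinarith
  have hηn : η ≤ 1 / n / 2 := by
    rw [hη, div_div, div_le_div_iff₀ (by positivity) (by positivity)]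
    nlinarith
  have hητ : η ≤ τ := by
    refine abs_le_of_sq_le_sq' ?_ hτ0 |>.2
    refine le_trans ?_ hlogτ
    have e1 : η ^ 2 ≤ η := by
      rw [sq]
      refine mul_le_of_le_one_left (by positivity) (hηn.trans ?_)
      rw [div_div, div_le_one (by positivity)]
      linarith
    refine e1.trans (hηn.trans ?_)
    rw [div_div, div_le_div_iff₀ (by positivity) hn0]
    nlinarith
  have hTn : T / n = (3 * A + 1) * τ ^ 2 := by
    rw [hτ2, hT]
    ring
  have hsT : Real.sqrt (T / n) = Real.sqrt (3 * A + 1) * τ := by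
    rw [hTn, Real.sqrt_mul (by positivity), Real.sqrt_sq hτ0]
  -- The first part has distance below n⁻² and is bounded deterministically off the event of large
  -- observations; the second runs over a finite family.
  have e1 : smoothedDev P X n (fun u l => recip g u l - recip g₀ u l) ω
      = smoothedDev P X n (fun u l => recip g u l - recip (h i) u l) ω
        + smoothedDev P X n (fun u l => recip (h i) u l - recip g₀ u l) ω := by
    rw [smoothedDev_sub tg t₀, smoothedDev_sub tg (th i), smoothedDev_sub (th i) t₀]
    ring
  have e2 := hX.abs_smoothedDev_le (tg.sub (th i)) hn1 (B := 18 * covConst κ K * Real.log n)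
    (by positivity) hnot2
  have e3 := hnot1 i
  have e4 : l2 (fun u l => recip (h i) u l - recip g₀ u l) ≤ η + x := by
    refine ((th i).l2_sub_triangle tg t₀).trans ?_
    rw [Tame.l2_sub_comm]
    linarith
  rw [hsT, hTn] at e3
  set s := Real.sqrt (3 * A + 1) with hs
  have hs0 : 0 ≤ s := Real.sqrt_nonneg _
  have hsqrtn : Real.sqrt n ≤ n := by
    rw [Real.sqrt_le_left hn0.le]
    nlinarith
  have e5 : l2 (fun u l => recip g u l - recip (h i) u l) * Real.sqrt n *
      (18 * covConst κ K * Real.log n + covConst κ K) ≤ covConst κ K * 20 * τ ^ 2 := by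
    calc _ ≤ η * n * (covConst κ K * 20 * Real.log n) := by
          have : covConst κ K * 1 ≤ covConst κ K * (2 * Real.log n) := by
            gcongr
            linarith
          gcongr
          linarith
      _ = covConst κ K * 20 * (Real.log n / n) := by
          rw [hη]
          field_simp
      _ ≤ _ := by gcongr
  have e6 : 4 * covConst κ K * (l2 (fun u l => recip (h i) u l - recip g₀ u l) * (s * τ)
      + 2 * c * ((3 * A + 1) * τ ^ 2)) ≤ 4 * covConst κ K * ((τ + x) * (s * τ)
      + 2 * c * ((3 * A + 1) * τ ^ 2)) := by
    gcongr
    linarith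
  rw [e1]
  exact (abs_add_le _ _).trans ((add_le_add (e2.trans e5) (e3.trans e6)).trans
    (sieve_arithmetic hcov.le hs0 (by positivity) hc hx0 hτ0))

end IsLocallyStationary

end Sample

/-! ### Consequences of the model assumptions -/

theorem IsContrastMin.realContrast_le {f : ℝ → ℝ → ℝ} {G : Set (ℝ → ℝ → ℝ)} {m M c : ℝ}
    {g₀ : ℝ → ℝ → ℝ} (h : IsContrastMin f G g₀) (hm : 0 < m) (hreg : ∀ g ∈ G, Regular m M c g)
    (hf : ∀ g ∈ G, Integrable (fun p : ℝ × ℝ => recip g p.1 p.2 * f p.1 p.2) tfMeasure)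
    {g : ℝ → ℝ → ℝ} (hg : g ∈ G) : realContrast f (recip g₀) ≤ realContrast f (recip g) := by
  have h1 := h.2 g hg
  rw [contrast_eq (hreg g hg) hm (hf g hg), contrast_eq (hreg g₀ h.1) hm (hf g₀ h.1),
    EReal.coe_le_coe_iff] at h1
  exact h1

/-- In a correctly specified model the true spectral density minimizes the contrast. -/
theorem eqAE_of_memAE {f : ℝ → ℝ → ℝ} {F : Set (ℝ → ℝ → ℝ)} {fF : ℝ → ℝ → ℝ}
    (hF : IsModelClass F) (huniq : ∀ g, IsContrastMin f F g → EqAE g fF) (h : MemAE f F) :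
    EqAE fF f ∧ ∀ᵐ p ∂tfMeasure, 0 < f p.1 p.2 := by
  obtain ⟨g, hgF, hg⟩ := h
  have hpos : ∀ g ∈ F, ∀ᵐ p ∂tfMeasure, 0 < g p.1 p.2 := fun g hg => by
    filter_upwards [ae_tfMeasure_mem] with p hp
    exact (hF g hg).2 _ (Set.Ioc_subset_Icc_self hp.1) _ hp.2
  have hmin : IsContrastMin f F g := by
    refine ⟨hgF, fun g' hg' => ?_⟩
    -- The integrand log g + f/g is minimal at g = f pointwise. Hence positive and negative parts
    -- can be compared separately, without integrability.
    have hle : ∀ᵐ p ∂tfMeasure, contrastIntegrand f g p ≤ contrastIntegrand f g' p := by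
      filter_upwards [hg, hpos g hgF, hpos g' hg'] with p h1 h2 h3
      unfold contrastIntegrand
      rw [← h1]
      have h4 := sub_one_sub_log_nonneg (div_pos h2 h3)
      rw [Real.log_div h2.ne' h3.ne'] at h4
      have h5 : g p.1 p.2 / g p.1 p.2 = 1 := div_self h2.ne'
      have hpi := Real.pi_pos
      rw [h5]
      refine mul_le_mul_of_nonneg_left ?_ (by positivity)
      linarith
    unfold contrast
    refine EReal.sub_le_sub ?_ ?_ <;> rw [EReal.coe_ennreal_le_coe_ennreal_iff]
    · exact lintegral_mono_ae (hle.mono fun p hp => ENNReal.ofReal_le_ofReal hp)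
    · exact lintegral_mono_ae (hle.mono fun p hp => ENNReal.ofReal_le_ofReal (neg_le_neg hp))
  have h1 := huniq g hmin
  constructor
  · filter_upwards [h1, hg] with p h1 h2
    rw [← h1, h2]
  · filter_upwards [hg, hpos g hgF] with p h1 h2
    rwa [← h1]

/-- The constant `max (ρ_∞, v_Σ, (M^*)²)`. -/
def complexity (Mup rInf vS : ℕ → ℝ) (n : ℕ) : ℝ := max (max (rInf n) (vS n)) (Mup n ^ 2)

theorem ModelAssumptions.regular {f : ℝ → ℝ → ℝ} {Fn : ℕ → Set (ℝ → ℝ → ℝ)}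
    {F : Set (ℝ → ℝ → ℝ)} {fF : ℝ → ℝ → ℝ} {Mlow Mup rInf vT vS : ℕ → ℝ}
    (hM : ModelAssumptions f Fn F fF Mlow Mup rInf vT vS) {n : ℕ} (hn : 1 ≤ n) {g : ℝ → ℝ → ℝ}
    (hg : g ∈ Fn n) : Regular (Mlow n) (Mup n) (complexity Mup rInf vS n) g := by
  have hmem : recip g ∈ recipClass (Fn n) := ⟨g, hg, rfl⟩
  have hpos : ∀ u ∈ Set.Icc (0 : ℝ) 1, ∀ l ∈ Set.Icc (-Real.pi) Real.pi, 0 < recip g u l :=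
    fun u hu l hl => one_div_pos.2 ((hM.sieve_model n hn g hg).2 u hu l hl)
  refine ⟨(hM.sieve_model n hn g hg).1, fun u hu l hl => ?_, fun u hu l hl => ?_, ?_, ?_⟩
  · have := (hM.bounds n hn _ hmem u hu l hl).1
    rwa [abs_of_pos (hpos u hu l hl)] at this
  · have := (hM.bounds n hn _ hmem u hu l hl).2
    rw [abs_of_pos (hpos u hu l hl)] at this
    exact this.le
  · exact ((le_iSup₂ (f := fun φ (_ : φ ∈ recipClass (Fn n)) => rhoInf φ) _ hmem).trans
      (hM.rhoInf_le n hn)).trans (ENNReal.ofReal_le_ofReal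
        ((le_max_left _ _).trans (le_max_left _ _)))
  · exact ((le_iSup₂ (f := fun φ (_ : φ ∈ recipClass (Fn n)) => vSum φ) _ hmem).trans
      (hM.vSum_le n hn)).trans (ENNReal.ofReal_le_ofReal
        ((le_max_right _ _).trans (le_max_left _ _)))

theorem ModelAssumptions.one_le_complexity {f : ℝ → ℝ → ℝ} {Fn : ℕ → Set (ℝ → ℝ → ℝ)}
    {F : Set (ℝ → ℝ → ℝ)} {fF : ℝ → ℝ → ℝ} {Mlow Mup rInf vT vS : ℕ → ℝ}
    (hM : ModelAssumptions f Fn F fF Mlow Mup rInf vT vS) {n : ℕ} (hn : 1 ≤ n) :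
    1 ≤ complexity Mup rInf vS n := by
  refine le_trans ?_ (le_max_right _ _)
  have := hM.one_le_up n hn
  nlinarith

theorem aestronglyMeasurable_recip {G : Set (ℝ → ℝ → ℝ)} (hG : IsModelClass G) {g : ℝ → ℝ → ℝ}
    (hg : g ∈ G) : AEStronglyMeasurable (fun p : ℝ × ℝ => recip g p.1 p.2) tfMeasure :=
  (measurable_recip (hG g hg).1).aestronglyMeasurable

section Sample

variable {Ω : Type*} [MeasurableSpace Ω] {P : Measure Ω} [IsProbabilityMeasure P]
  {κ K : ℝ} {ε : ℤ → Ω → ℝ} {aT : ℕ → ℤ → ℤ → ℝ} {a : ℝ → ℤ → ℝ} {X : ℕ → ℤ → Ω → ℝ}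

namespace IsLocallyStationary

theorem exists_spectralDensity_bound (hX : IsLocallyStationary P κ K ε aT a X) :
    ∃ C : ℝ, 0 ≤ C ∧ ∀ᵐ p ∂tfMeasure, |spectralDensity a p.1 p.2| ≤ C := by
  have hpi := Real.pi_pos
  refine ⟨1 / (2 * Real.pi) * (∑' j, K / ell κ j) ^ 2, by positivity, ?_⟩
  filter_upwards [ae_tfMeasure_mem] with p hp
  rw [abs_of_nonneg (spectralDensity_nonneg a p.1 p.2)]
  exact hX.spectralDensity_le hp.1 _

theorem integrable_recip_mul (hX : IsLocallyStationary P κ K ε aT a X) {m M c : ℝ}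
    {g : ℝ → ℝ → ℝ} (hg : Regular m M c g) (hm : 0 < m) :
    Integrable (fun p : ℝ × ℝ => recip g p.1 p.2 * spectralDensity a p.1 p.2) tfMeasure := by
  obtain ⟨C, -, hC⟩ := hX.exists_spectralDensity_bound
  exact hg.integrable_mul hm hX.aemeasurable_spectralDensity hC

/-- Quadratic growth of the contrast around its minimizer over a class with convex reciprocals. -/
theorem sq_l2_le_of_isContrastMin (hX : IsLocallyStationary P κ K ε aT a X)
    {G : Set (ℝ → ℝ → ℝ)} {m M c : ℝ} (hm : 0 < m) (hreg : ∀ g ∈ G, Regular m M c g)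
    (hconv : Convex ℝ (recipClass G)) {g₀ : ℝ → ℝ → ℝ}
    (h₀ : IsContrastMin (spectralDensity a) G g₀) {g : ℝ → ℝ → ℝ} (hg : g ∈ G) :
    l2 (fun u l => recip g u l - recip g₀ u l) ^ 2 ≤ 32 * Real.pi * M ^ 2 *
      (realContrast (spectralDensity a) (recip g)
        - realContrast (spectralDensity a) (recip g₀)) := by
  obtain ⟨C, -, hC⟩ := hX.exists_spectralDensity_bound
  have hle : ∀ g ∈ G, realContrast (spectralDensity a) (recip g₀)
      ≤ realContrast (spectralDensity a) (recip g) := fun g hg =>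
    h₀.realContrast_le hm hreg (fun g hg => hX.integrable_recip_mul (hreg g hg) hm) hg
  -- Convexity of the class enters only through this midpoint.
  have hmid : (fun u l => (recip g u l + recip g₀ u l) / 2) ∈ recipClass G := by
    have h := hconv ⟨g, hg, rfl⟩ ⟨g₀, h₀.1, rfl⟩ (a := 1 / 2) (b := 1 / 2) (by norm_num)
      (by norm_num) (by norm_num)
    convert h using 1
    ext u l
    simp only [Pi.add_apply, Pi.smul_apply, smul_eq_mul]
    ring
  obtain ⟨g', hg', he⟩ := hmid
  have h1 := hle g' hg'
  rw [he] at h1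
  have h2 := sq_l2_le_of_convex (hreg g hg) (hreg g₀ h₀.1) hm hX.aemeasurable_spectralDensity hC h1
  -- The constant 16π is enlarged to 32π so that this case and the correctly specified one satisfy
  -- the same growth condition.
  refine h2.trans ?_
  have h3 := sub_nonneg.2 (hle g hg)
  have hpi := Real.pi_pos
  gcongr
  norm_num

/-! ### Rates for sieve estimation -/

/-- The infimum defining the approximation error need not be attained. An element within s n of it
suffices, and s n is positive for n ≥ 2; the sum of both terms is at most twice their maximum. -/
theorem exists_sieve_reference {f : ℝ → ℝ → ℝ} (Fn : ℕ → Set (ℝ → ℝ → ℝ)) (s : ℕ → ℝ≥0∞)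
    (hs : ∀ n, 2 ≤ n → s n ≠ 0) : ∃ g₀ : ℕ → ℝ → ℝ → ℝ, ∀ n, 2 ≤ n → approxError f Fn n ≠ ∞ →
      g₀ n ∈ Fn n ∧ rho2Dist (recip f) (recip (g₀ n)) ≤ 2 * max (s n) (approxError f Fn n) := by
  have h : ∀ n, ∃ g₀ : ℝ → ℝ → ℝ, 2 ≤ n → approxError f Fn n ≠ ∞ →
      g₀ ∈ Fn n ∧ rho2Dist (recip f) (recip g₀) ≤ 2 * max (s n) (approxError f Fn n) := by
    intro n
    by_cases hn : 2 ≤ n ∧ approxError f Fn n ≠ ∞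
    · obtain ⟨hn2, hfin⟩ := hn
      have hlt : approxError f Fn n < approxError f Fn n + s n :=
        ENNReal.lt_add_right hfin (hs n hn2)
      obtain ⟨g₀, hg⟩ := iInf_lt_iff.1 hlt
      obtain ⟨hgF, hg⟩ := iInf_lt_iff.1 hg
      refine ⟨g₀, fun _ _ => ⟨hgF, hg.le.trans ?_⟩⟩
      rw [two_mul]
      exact add_le_add (le_max_right _ _) (le_max_left _ _)
    · exact ⟨0, fun h1 h2 => absurd ⟨h1, h2⟩ hn⟩
  choose g₀ h using h
  exact ⟨g₀, h⟩

/-- The sieve rate, given a reference density with quadratic growth of the contrast. -/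
theorem sieve_rate (hX : IsLocallyStationary P κ K ε aT a X) (hG : IsGaussianArray P X)
    {Fn : ℕ → Set (ℝ → ℝ → ℝ)} {F : Set (ℝ → ℝ → ℝ)} {fF : ℝ → ℝ → ℝ}
    {Mlow Mup rInf vT vS : ℕ → ℝ}
    (hM : ModelAssumptions (spectralDensity a) Fn F fF Mlow Mup rInf vT vS)
    {Lt : ℕ → Ω → (ℝ → ℝ → ℝ) → ℝ} {ft : ℕ → Ω → ℝ → ℝ → ℝ}
    (hft : ∀ n, 1 ≤ n → ∀ᵐ ω ∂P, ft n ω ∈ Fn n ∧ ∀ g ∈ Fn n, Lt n ω (ft n ω) ≤ Lt n ω g)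
    {A : ℝ} {k : ℕ → ℝ} (hA : 0 < A) (hk : ∀ n, 1 ≤ n → 1 ≤ k n)
    (hent : ∀ n : ℕ, 2 ≤ n → ∀ η : ℝ, 0 < η → η ≤ 1 →
      metricEntropy η (recipClass (Fn n)) ≤ ((A * k n * Real.log (n / η) : ℝ) : EReal))
    {e : ℕ → ℝ≥0∞} {g₀ : ℕ → ℝ → ℝ → ℝ} {C₄ : ℝ} {C₅ : ℝ≥0} (hC₄ : 0 ≤ C₄)
    (hg₀ : ∀ n, 2 ≤ n → sieveRate Mlow Mup rInf vS k e n ≠ ∞ → g₀ n ∈ Fn n ∧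
      rho2Dist (recip (g₀ n)) (recip fF) ≤ C₅ * sieveRate Mlow Mup rInf vS k e n ∧ ∀ g ∈ Fn n,
      l2 (fun u l => recip g u l - recip (g₀ n) u l) ^ 2 ≤ 32 * Real.pi * Mup n ^ 2 *
        (realContrast (spectralDensity a) (recip g)
          - realContrast (spectralDensity a) (recip (g₀ n)))
        + C₄ * (sieveRate Mlow Mup rInf vS k e n).toReal ^ 2)
    (hclose : CriterionClose P X Fn Mup Lt (sieveRate Mlow Mup rInf vS k e)) :
    ConvergesAtRate P ft fF (sieveRate Mlow Mup rInf vS k e) := by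
  have hcov := hX.covConst_pos
  refine hX.convergesAtRate hG (m := Mlow) (M := Mup) (c := complexity Mup rInf vS)
    (τ := fun n => Real.sqrt (k n * Real.log n / n)) (g₀ := g₀) (κ₀ := 1) hft
    (aestronglyMeasurable_recip hM.target_model hM.min_exists.1) hM.low_pos hM.low_le_one
    hM.one_le_up (fun n _ => le_max_right _ _) (fun n hn g hg => hM.regular hn hg) one_pos hC₄
    ?_ ?_ ((eventually_ge_atTop 2).mono hg₀) ?_ hclose
  · filter_upwards [eventually_ge_atTop 1] with n hn
    have hlog : 0 ≤ Real.log n := Real.log_natCast_nonneg n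
    have hk' := hk n hn
    refine ⟨Real.sqrt_nonneg _, ?_⟩
    rw [Real.sq_sqrt (by positivity)]
    gcongr
    nlinarith
  · filter_upwards [eventually_ge_atTop 1] with n hn
    have hm := hM.low_pos n hn
    have hM1 := hM.one_le_up n hn
    have hc := hM.one_le_complexity hn
    rw [one_mul, mul_assoc, ENNReal.ofReal_mul (by positivity)]
    unfold sieveRate
    gcongr
    refine le_trans (ENNReal.ofReal_le_ofReal (le_of_eq ?_)) (le_max_left _ _)
    rw [← Real.sqrt_mul (by linarith)]
    congr 1
    unfold complexity
    ring
  · intro e' he'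
    refine ⟨covConst κ K * (8 * Real.sqrt (3 * A + 1) + 8 * (3 * A + 1) + 20), by positivity, ?_⟩
    have hlim : Tendsto (fun n : ℕ => ENNReal.ofReal (2 / n) + ENNReal.ofReal (2 / n)) atTop
        (𝓝 0) := by
      have h : Tendsto (fun n : ℕ => ENNReal.ofReal (2 / n)) atTop (𝓝 0) := by
        rw [← ENNReal.ofReal_zero]
        exact ENNReal.tendsto_ofReal (tendsto_const_div_atTop_nhds_zero_nat 2)
      simpa using h.add h
    filter_upwards [hlim.eventually_lt_const he', eventually_ge_atTop 2] with n h1 hn htop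
    have hn1 : 1 ≤ n := by omega
    have hn0 : (0 : ℝ) < n := by exact_mod_cast hn1
    have hn1' : (1 : ℝ) ≤ n := by exact_mod_cast hn1
    refine (hX.sieve_fluctuation hG hA (hM.low_pos n hn1) (hM.one_le_complexity hn1) (hk n hn1)
      (fun g hg => hM.regular hn1 hg) hn (hent n hn _ (by positivity) ?_)
      (hg₀ n hn htop).1).trans h1.le
    rw [div_le_one (by positivity)]
    nlinarith

/-- The reference point is a near-best approximation of 1/f in the sieve. The approximation term of
`sq_l2_le_of_correct` has the factor M²/m, which is at most (M/m)² since m ≤ 1, so it is absorbed by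
the square of the rate. -/
theorem sieve_correct (hX : IsLocallyStationary P κ K ε aT a X) (hG : IsGaussianArray P X)
    {Fn : ℕ → Set (ℝ → ℝ → ℝ)} {F : Set (ℝ → ℝ → ℝ)} {fF : ℝ → ℝ → ℝ}
    {Mlow Mup rInf vT vS : ℕ → ℝ}
    (hM : ModelAssumptions (spectralDensity a) Fn F fF Mlow Mup rInf vT vS)
    {Lt : ℕ → Ω → (ℝ → ℝ → ℝ) → ℝ} {ft : ℕ → Ω → ℝ → ℝ → ℝ}
    (hft : ∀ n, 1 ≤ n → ∀ᵐ ω ∂P, ft n ω ∈ Fn n ∧ ∀ g ∈ Fn n, Lt n ω (ft n ω) ≤ Lt n ω g)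
    {A : ℝ} {k : ℕ → ℝ} (hA : 0 < A) (hk : ∀ n, 1 ≤ n → 1 ≤ k n)
    (hent : ∀ n : ℕ, 2 ≤ n → ∀ η : ℝ, 0 < η → η ≤ 1 →
      metricEntropy η (recipClass (Fn n)) ≤ ((A * k n * Real.log (n / η) : ℝ) : EReal))
    (hf : MemAE (spectralDensity a) F)
    (hclose : CriterionClose P X Fn Mup Lt
      (sieveRate Mlow Mup rInf vS k (approxError (spectralDensity a) Fn))) :
    ConvergesAtRate P ft fF
      (sieveRate Mlow Mup rInf vS k (approxError (spectralDensity a) Fn)) := by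
  obtain ⟨Cf, hCf0, hCf⟩ := hX.exists_spectralDensity_bound
  obtain ⟨hfF, hfpos⟩ := eqAE_of_memAE hM.target_model hM.min_unique hf
  set s : ℕ → ℝ≥0∞ := fun n => ENNReal.ofReal (Real.sqrt
    (max (max (rInf n) (vS n)) (Mup n ^ 2) * k n * Real.log n / n)) with hs
  have hs0 : ∀ n, 2 ≤ n → s n ≠ 0 := by
    intro n hn
    have hn1 : 1 ≤ n := by omega
    have hn2 : (2 : ℝ) ≤ n := by exact_mod_cast hn
    have hlog : 0 < Real.log n := Real.log_pos (by linarith)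
    have hc : 1 ≤ max (max (rInf n) (vS n)) (Mup n ^ 2) := hM.one_le_complexity hn1
    have hk' := hk n hn1
    rw [hs, ENNReal.ofReal_ne_zero_iff]
    exact Real.sqrt_pos.2 (by positivity)
  obtain ⟨g₀, hg₀⟩ := exists_sieve_reference (f := spectralDensity a) Fn s hs0
  refine hX.sieve_rate hG hM hft hA hk hent (g₀ := g₀) (C₄ := 32 * Cf + 8) (C₅ := 2)
    (by positivity) (fun n hn htop => ?_) hclose
  have hn1 : 1 ≤ n := by omega
  have hm := hM.low_pos n hn1
  have hm1 := hM.low_le_one n hn1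
  have hM1 := hM.one_le_up n hn1
  have hM0 : 0 < Mup n := by linarith
  set δ := sieveRate Mlow Mup rInf vS k (approxError (spectralDensity a) Fn) n with hδ
  have hδeq : δ = ENNReal.ofReal (Mup n / Mlow n) *
      max (s n) (approxError (spectralDensity a) Fn n) := rfl
  have hratio : 1 ≤ Mup n / Mlow n := by
    rw [one_le_div hm]
    linarith
  have hmaxtop : max (s n) (approxError (spectralDensity a) Fn n) ≠ ∞ := by
    intro h
    rw [hδeq, h, ENNReal.mul_top] at htop
    · exact htop rfl
    · exact ENNReal.ofReal_ne_zero_iff.2 (by positivity)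
  have happrox : approxError (spectralDensity a) Fn n ≠ ∞ :=
    ne_top_of_le_ne_top hmaxtop (le_max_right _ _)
  obtain ⟨hgF, hgd⟩ := hg₀ n hn happrox
  have hdist : rho2Dist (recip (spectralDensity a)) (recip (g₀ n)) ≠ ∞ :=
    ne_top_of_le_ne_top (ENNReal.mul_ne_top ENNReal.ofNat_ne_top hmaxtop) hgd
  refine ⟨hgF, ?_, fun g hg => ?_⟩
  · have e1 : rho2Dist (recip (g₀ n)) (recip fF)
        = rho2Dist (recip (spectralDensity a)) (recip (g₀ n)) := by
      rw [rho2Dist_comm]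
      refine eLpNorm_congr_ae ?_
      filter_upwards [hfF] with p hp
      simp only [recip, hp]
    rw [e1]
    refine hgd.trans ?_
    have : max (s n) (approxError (spectralDensity a) Fn n) ≤ δ := by
      rw [hδeq]
      exact le_mul_of_one_le_left zero_le (by simpa using ENNReal.ofReal_le_ofReal hratio)
    have h2 : ((2 : ℝ≥0) : ℝ≥0∞) = 2 := rfl
    rw [h2]
    gcongr
  · refine (sq_l2_le_of_correct (hM.regular hn1 hg) (hM.regular hn1 hgF) hm
      hX.aemeasurable_spectralDensity hCf hfpos hdist).trans
      (add_le_add le_rfl ?_)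
    set x := (rho2Dist (recip (spectralDensity a)) (recip (g₀ n))).toReal with hx
    set q := (max (s n) (approxError (spectralDensity a) Fn n)).toReal with hq
    have hx0 : 0 ≤ x := ENNReal.toReal_nonneg
    have hxq : x ≤ 2 * q := by
      have := ENNReal.toReal_mono (ENNReal.mul_ne_top ENNReal.ofNat_ne_top hmaxtop) hgd
      rwa [ENNReal.toReal_mul, ENNReal.toReal_ofNat] at this
    have hδq : δ.toReal = Mup n / Mlow n * q := by
      rw [hδeq, ENNReal.toReal_mul, ENNReal.toReal_ofReal (by positivity)]
    rw [hδq]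
    calc (8 * Mup n ^ 2 * Cf / Mlow n + 2) * x ^ 2
        ≤ (8 * Mup n ^ 2 * Cf / Mlow n + 2) * (2 * q) ^ 2 := by gcongr
      _ = (32 * Cf * (Mup n ^ 2 / Mlow n) + 8) * q ^ 2 := by ring
      _ ≤ (32 * Cf * (Mup n / Mlow n) ^ 2 + 8 * (Mup n / Mlow n) ^ 2) * q ^ 2 := by
          have h1 : Mup n ^ 2 / Mlow n ≤ (Mup n / Mlow n) ^ 2 := by
            rw [div_pow]
            gcongr
            nlinarith
          have h2 : 1 ≤ (Mup n / Mlow n) ^ 2 := one_le_pow₀ hratio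
          gcongr
          linarith
      _ = _ := by ring

/-- The reference point is the minimizer over the sieve. Convexity gives curvature there without an
approximation term, and its distance from the target enters only through the triangle inequality. -/
theorem sieve_misspecified (hX : IsLocallyStationary P κ K ε aT a X) (hG : IsGaussianArray P X)
    {Fn : ℕ → Set (ℝ → ℝ → ℝ)} {F : Set (ℝ → ℝ → ℝ)} {fF : ℝ → ℝ → ℝ}
    {Mlow Mup rInf vT vS : ℕ → ℝ}
    (hM : ModelAssumptions (spectralDensity a) Fn F fF Mlow Mup rInf vT vS)
    {Lt : ℕ → Ω → (ℝ → ℝ → ℝ) → ℝ} {ft : ℕ → Ω → ℝ → ℝ → ℝ}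
    (hft : ∀ n, 1 ≤ n → ∀ᵐ ω ∂P, ft n ω ∈ Fn n ∧ ∀ g ∈ Fn n, Lt n ω (ft n ω) ≤ Lt n ω g)
    {A : ℝ} {k : ℕ → ℝ} (hA : 0 < A) (hk : ∀ n, 1 ≤ n → 1 ≤ k n)
    (hent : ∀ n : ℕ, 2 ≤ n → ∀ η : ℝ, 0 < η → η ≤ 1 →
      metricEntropy η (recipClass (Fn n)) ≤ ((A * k n * Real.log (n / η) : ℝ) : EReal))
    (hconv : ∀ n, 1 ≤ n → Convex ℝ (recipClass (Fn n))) {fFn : ℕ → ℝ → ℝ → ℝ}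
    (hmin : ∀ n, 1 ≤ n → IsContrastMin (spectralDensity a) (Fn n) (fFn n))
    (hclose : CriterionClose P X Fn Mup Lt
      (sieveRate Mlow Mup rInf vS k fun n => rho2Dist (recip fF) (recip (fFn n)))) :
    ConvergesAtRate P ft fF
      (sieveRate Mlow Mup rInf vS k fun n => rho2Dist (recip fF) (recip (fFn n))) := by
  refine hX.sieve_rate hG hM hft hA hk hent (g₀ := fFn) (C₄ := 0) (C₅ := 1) le_rfl
    (fun n hn _ => ?_) hclose
  have hn1 : 1 ≤ n := by omega
  have hm := hM.low_pos n hn1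
  refine ⟨(hmin n hn1).1, ?_, fun g hg => ?_⟩
  · rw [ENNReal.coe_one, one_mul, rho2Dist_comm]
    unfold sieveRate
    refine (le_max_right _ _).trans (le_mul_of_one_le_left zero_le ?_)
    have hratio : 1 ≤ Mup n / Mlow n := by
      rw [one_le_div hm]
      linarith [hM.low_le_one n hn1, hM.one_le_up n hn1]
    simpa using ENNReal.ofReal_le_ofReal hratio
  · rw [zero_mul, add_zero]
    exact hX.sq_l2_le_of_isContrastMin hm (fun g hg => hM.regular hn1 hg) (hconv n hn1)
      (hmin n hn1) hg

end IsLocallyStationary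

end Sample

/-! ### Fluctuations over classes of polynomial entropy -/

/-- The fluctuation of differences at distance at most `η n` is of order `τ n ^ 2`. -/
def HasModulus {Ω : Type*} [MeasurableSpace Ω] (P : Measure Ω) (X : ℕ → ℤ → Ω → ℝ)
    (G : Set (ℝ → ℝ → ℝ)) (τ η : ℕ → ℝ) : Prop :=
  ∀ e : ℝ≥0∞, 0 < e → ∃ C : ℝ, 0 ≤ C ∧ ∀ᶠ n in atTop,
    P {ω | ∃ g ∈ G, ∃ g' ∈ G, l2 (fun u l => recip g u l - recip g' u l) ≤ η n ∧
      C * τ n ^ 2 < |smoothedDev P X n (fun u l => recip g u l - recip g' u l) ω|} ≤ e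

theorem tendsto_ofReal_exp_neg {s : ℕ → ℝ} (hs : Tendsto s atTop atTop) {A : ℝ} (hA : 0 < A) :
    Tendsto (fun n => ENNReal.ofReal (2 * Real.exp (-(A * s n)))) atTop (𝓝 0) := by
  have h1 : Tendsto (fun n => A * s n) atTop atTop := hs.const_mul_atTop hA
  have h2 := (Real.tendsto_exp_neg_atTop_nhds_zero.comp h1).const_mul 2
  rw [mul_zero] at h2
  have h3 := ENNReal.tendsto_ofReal h2
  rwa [ENNReal.ofReal_zero] at h3

theorem tendsto_ofReal_two_div : Tendsto (fun n : ℕ => ENNReal.ofReal (2 / n)) atTop (𝓝 0) := by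
  rw [← ENNReal.ofReal_zero]
  exact ENNReal.tendsto_ofReal (tendsto_const_div_atTop_nhds_zero_nat 2)

section Sample

variable {Ω : Type*} [MeasurableSpace Ω] {P : Measure Ω} [IsProbabilityMeasure P]
  {κ K : ℝ} {ε : ℤ → Ω → ℝ} {aT : ℕ → ℤ → ℤ → ℝ} {a : ℝ → ℤ → ℝ} {X : ℕ → ℤ → Ω → ℝ}
  {G : Set (ℝ → ℝ → ℝ)} {m M c A γ : ℝ} {τ η η' : ℕ → ℝ}

namespace IsLocallyStationary

/-- A crude bound for differences at very small distance. -/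
theorem hasModulus_of_le (hX : IsLocallyStationary P κ K ε aT a X) (hG : IsGaussianArray P X)
    (hm : 0 < m) (hreg : ∀ g ∈ G, Regular m M c g)
    (hη : ∀ᶠ n : ℕ in atTop, η n ≤ 1 / (n : ℝ) ^ 2)
    (hτ : ∀ᶠ n : ℕ in atTop, Real.log n / n ≤ τ n ^ 2) : HasModulus P X G τ η := by
  intro e he
  have hcov := hX.covConst_pos
  refine ⟨covConst κ K * 20, by positivity, ?_⟩
  filter_upwards [hη, hτ, tendsto_ofReal_two_div.eventually_lt_const he, eventually_ge_atTop 2]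
    with n h1 h2 h3 hn
  refine le_trans (measure_mono ?_) ((hX.measure_max_sq_le hG hn).trans h3.le)
  rintro ω ⟨g, hg, g', hg', hl, hlt⟩
  by_contra hnot
  simp only [Set.mem_ofPred_eq, not_exists, not_lt, not_and] at hnot
  have hn1 : 1 ≤ n := by omega
  have hn2 : (2 : ℝ) ≤ n := by exact_mod_cast hn
  have hn0 : (0 : ℝ) < n := by linarith
  have hlog : 1 / 2 ≤ Real.log n := by
    have h1 := Real.log_two_gt_d9
    have h2 := Real.log_le_log zero_lt_two hn2
    linarith
  have hsqrtn : Real.sqrt n ≤ n := by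
    rw [Real.sqrt_le_left hn0.le]
    nlinarith
  have e2 := hX.abs_smoothedDev_le (((hreg g hg).tame hm).sub ((hreg g' hg').tame hm)) hn1
    (B := 18 * covConst κ K * Real.log n) (by positivity) hnot
  refine absurd hlt (not_lt.2 (e2.trans ?_))
  have hlog20 : 18 * covConst κ K * Real.log n + covConst κ K ≤ covConst κ K * 20 * Real.log n := by
    have : covConst κ K * 1 ≤ covConst κ K * (2 * Real.log n) := by
      gcongr
      linarith
    linarith
  calc _ ≤ 1 / (n : ℝ) ^ 2 * n * (covConst κ K * 20 * Real.log n) := by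
        have := l2_nonneg (fun u l => recip g u l - recip g' u l)
        gcongr
        exact hl.trans h1
    _ = covConst κ K * 20 * (Real.log n / n) := by field_simp
    _ ≤ _ := by gcongr

/-- One step of chaining, with the exponential inequality in terms of `ρ₂` alone. -/
theorem hasModulus_of_finer (hX : IsLocallyStationary P κ K ε aT a X) (hG : IsGaussianArray P X)
    (hm : 0 < m) (hreg : ∀ g ∈ G, Regular m M c g) (hA : 0 < A)
    (hent : ∀ η : ℝ, 0 < η → metricEntropy η (recipClass G) ≤ ((A * η ^ (-γ) : ℝ) : EReal))
    (h : HasModulus P X G τ η') (hη : ∀ᶠ n : ℕ in atTop, 0 < η' n ∧ η' n ≤ η n) {C₀ : ℝ}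
    (hC₀ : 0 ≤ C₀) (hrate : ∀ᶠ n : ℕ in atTop, η n / Real.sqrt n * η' n ^ (-γ) ≤ C₀ * τ n ^ 2)
    (hlim : Tendsto (fun n => η' n ^ (-γ)) atTop atTop) : HasModulus P X G τ η := by
  intro e he
  have hcov := hX.covConst_pos
  have he2 : 0 < e / 2 := ENNReal.div_pos he.ne' (by simp)
  obtain ⟨C, hC0, hC⟩ := h (e / 2) he2
  refine ⟨2 * C + 72 * covConst κ K * A * C₀, by positivity, ?_⟩
  filter_upwards [hη, hrate, hC, (tendsto_ofReal_exp_neg hlim hA).eventually_lt_const he2,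
    hlim.eventually_ge_atTop (1 / A), eventually_ge_atTop 1] with n h1 h2 h3 h4 h5 hn
  obtain ⟨hη0, hηη⟩ := h1
  obtain ⟨N, -, ⟨ctr, hctr, hcover⟩, hN⟩ := exists_cover (hent _ hη0)
  choose h hhG hh using hctr
  -- The union runs over pairs of centres, which uses two of the three multiples; the third makes
  -- the probability tend to zero.
  set T := 3 * A * η' n ^ (-γ) with hT
  have hAη : 1 ≤ A * η' n ^ (-γ) := by
    rw [div_le_iff₀ hA] at h5
    linarith
  have hT1 : 1 ≤ T := by
    rw [hT]
    linarith
  have hηn : 0 < η n := hη0.trans_le hηη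
  have th : ∀ i, Tame (recip (h i)) := fun i => (hreg _ (hhG i)).tame hm
  set B : Fin N × Fin N → Set Ω := fun p => {ω |
    l2 (fun u l => recip (h p.1) u l - recip (h p.2) u l) ≤ 3 * η n ∧
    8 * covConst κ K * (3 * η n / Real.sqrt n) * T <
      |smoothedDev P X n (fun u l => recip (h p.1) u l - recip (h p.2) u l) ω|} with hB
  have hBp : ∀ p, P (B p) ≤ ENNReal.ofReal (2 * Real.exp (-T)) := by
    intro p
    by_cases hp : l2 (fun u l => recip (h p.1) u l - recip (h p.2) u l) ≤ 3 * η n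
    · refine (measure_mono fun ω hω => ?_).trans
        (hX.smoothedDev_tail_l2 hG ((th p.1).sub (th p.2)) (by positivity) hp hT1 hn)
      exact hω.2
    · have : B p = ∅ := by
        ext ω
        simp [hB, hp]
      rw [this, measure_empty]
      exact zero_le
  have hBU : P (⋃ p, B p) ≤ e / 2 := by
    refine (measure_iUnion_fintype_le P _).trans ((Finset.sum_le_sum fun p _ => hBp p).trans ?_)
    rw [Finset.sum_const, Finset.card_univ, Fintype.card_prod, Fintype.card_fin, nsmul_eq_mul,
      ← ENNReal.ofReal_natCast, ← ENNReal.ofReal_mul (Nat.cast_nonneg _)]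
    refine le_trans (ENNReal.ofReal_le_ofReal ?_) h4.le
    push_cast
    calc (N : ℝ) * N * (2 * Real.exp (-T))
        ≤ Real.exp (A * η' n ^ (-γ)) * Real.exp (A * η' n ^ (-γ)) * (2 * Real.exp (-T)) := by
          gcongr
      _ = 2 * Real.exp (-(A * η' n ^ (-γ))) := by
          rw [mul_left_comm, ← Real.exp_add, ← Real.exp_add, hT]
          ring_nf
  rw [← ENNReal.add_halves e]
  refine le_trans (measure_mono ?_) ((measure_union_le _ _).trans (add_le_add h3 hBU))
  rintro ω ⟨g, hg, g', hg', hl, hlt⟩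
  by_contra hnot
  simp only [Set.mem_union, not_or, Set.mem_ofPred_eq, not_exists, not_lt, not_and, hB,
    Set.mem_iUnion] at hnot
  obtain ⟨hn1, hn2⟩ := hnot
  have tg := (hreg g hg).tame hm
  have tg' := (hreg g' hg').tame hm
  obtain ⟨i, hi⟩ := hcover (recip g) ⟨g, hg, rfl⟩
  obtain ⟨j, hj⟩ := hcover (recip g') ⟨g', hg', rfl⟩
  rw [← hh i] at hi
  rw [← hh j] at hj
  have hi' := (tg.l2_sub_lt (th i) hi).le
  have hj' := (tg'.l2_sub_lt (th j) hj).le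
  have a1 := hn1 g hg _ (hhG i) hi'
  have a2 := hn1 g' hg' _ (hhG j) hj'
  -- The two centres are at distance at most η' + η + η' ≤ 3η, the range on which their difference
  -- was controlled.
  have a3 := hn2 (i, j) (by
    have b1 := (th i).l2_sub_triangle tg (th j)
    have b2 := tg.l2_sub_triangle tg' (th j)
    rw [Tame.l2_sub_comm (recip (h i)) (recip g)] at b1
    simp only
    linarith)
  simp only at a3
  refine absurd hlt (not_lt.2 ?_)
  have e1 : smoothedDev P X n (fun u l => recip g u l - recip g' u l) ω
      = smoothedDev P X n (fun u l => recip g u l - recip (h i) u l) ω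
        - smoothedDev P X n (fun u l => recip g' u l - recip (h j) u l) ω
        + smoothedDev P X n (fun u l => recip (h i) u l - recip (h j) u l) ω := by
    rw [smoothedDev_sub tg tg', smoothedDev_sub tg (th i), smoothedDev_sub tg' (th j),
      smoothedDev_sub (th i) (th j)]
    ring
  have a4 : 8 * covConst κ K * (3 * η n / Real.sqrt n) * T ≤ 72 * covConst κ K * A * C₀ * τ n ^ 2 :=
    calc _ = 72 * covConst κ K * A * (η n / Real.sqrt n * η' n ^ (-γ)) := by
          rw [hT]
          ring
      _ ≤ 72 * covConst κ K * A * (C₀ * τ n ^ 2) := by gcongr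
      _ = _ := by ring
  rw [e1]
  refine (abs_add_le _ _).trans ((add_le_add ((abs_sub _ _).trans (add_le_add a1 a2))
    (a3.trans a4)).trans (le_of_eq ?_))
  ring

/-- The fluctuation around a fixed function, by Bernstein's inequality on the coarsest scale. -/
theorem fluctuation_of_hasModulus (hX : IsLocallyStationary P κ K ε aT a X) (hG : IsGaussianArray P X)
    (hm : 0 < m) (hc : 1 ≤ c) (hreg : ∀ g ∈ G, Regular m M c g) (hA : 0 < A)
    (hent : ∀ η : ℝ, 0 < η → metricEntropy η (recipClass G) ≤ ((A * η ^ (-γ) : ℝ) : EReal))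
    (h : HasModulus P X G τ η) (hη : ∀ᶠ n : ℕ in atTop, 0 < η n ∧ η n ≤ τ n)
    (hrate : ∀ᶠ n : ℕ in atTop, η n ^ (-γ) / n ≤ τ n ^ 2)
    (hlim : Tendsto (fun n => η n ^ (-γ)) atTop atTop) {g₀ : ℝ → ℝ → ℝ} (hg₀ : g₀ ∈ G)
    {e : ℝ≥0∞} (he : 0 < e) : ∃ C : ℝ, 0 ≤ C ∧ ∀ᶠ n in atTop,
      P {ω | ∃ g ∈ G, C * (l2 (fun u l => recip g u l - recip g₀ u l) * τ n + c * τ n ^ 2) <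
          |smoothedDev P X n (fun u l => recip g u l - recip g₀ u l) ω|} ≤ e := by
  have hcov := hX.covConst_pos
  have he2 : 0 < e / 2 := ENNReal.div_pos he.ne' (by simp)
  obtain ⟨C, hC0, hC⟩ := h (e / 2) he2
  set s := Real.sqrt (2 * A) with hs
  have hs0 : 0 ≤ s := Real.sqrt_nonneg _
  refine ⟨C + 4 * covConst κ K * (s + 4 * A), by positivity, ?_⟩
  filter_upwards [hη, hrate, hC, (tendsto_ofReal_exp_neg hlim hA).eventually_lt_const he2,
    eventually_ge_atTop 1] with n h1 h2 h3 h4 hn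
  obtain ⟨hη0, hητ⟩ := h1
  have hn0 : (0 : ℝ) < n := by exact_mod_cast hn
  have hτ0 : 0 < τ n := hη0.trans_le hητ
  obtain ⟨N, -, ⟨ctr, hctr, hcover⟩, hN⟩ := exists_cover (hent _ hη0)
  choose h hhG hh using hctr
  -- The reference point is fixed, so the union runs over single centres and two multiples of the
  -- entropy suffice.
  set T := 2 * (A * η n ^ (-γ)) with hT
  have hp : 0 < η n ^ (-γ) := Real.rpow_pos_of_pos hη0 _
  have hT0 : 0 ≤ T := by positivity
  have th : ∀ i, Tame (recip (h i)) := fun i => (hreg _ (hhG i)).tame hm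
  have r₀ := hreg _ hg₀
  have t₀ := r₀.tame hm
  have hbern := hX.smoothedDev_tail_fin hG
    (ψ := fun i => fun u l => recip (h i) u l - recip g₀ u l)
    (fun i => (th i).sub t₀) (ρ := 2 * c) (by linarith)
    (fun i => (hreg _ (hhG i)).rhoInf_sub_le r₀ hm (by linarith)) hT0 hn
  have hNT : ENNReal.ofReal (N * (2 * Real.exp (-T))) ≤ e / 2 := by
    refine le_trans (ENNReal.ofReal_le_ofReal ?_) h4.le
    calc N * (2 * Real.exp (-T)) ≤ Real.exp (A * η n ^ (-γ)) * (2 * Real.exp (-T)) := by gcongr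
      _ = _ := by
        rw [mul_left_comm, ← Real.exp_add, hT]
        ring_nf
  rw [← ENNReal.add_halves e]
  refine le_trans (measure_mono ?_) ((measure_union_le _ _).trans
    (add_le_add h3 (hbern.trans hNT)))
  rintro ω ⟨g, hg, hlt⟩
  by_contra hnot
  simp only [Set.mem_union, not_or, Set.mem_ofPred_eq, not_exists, not_lt, not_and] at hnot
  obtain ⟨hn1, hn2⟩ := hnot
  have tg := (hreg g hg).tame hm
  obtain ⟨i, hi⟩ := hcover (recip g) ⟨g, hg, rfl⟩
  rw [← hh i] at hi
  have hi' := (tg.l2_sub_lt (th i) hi).le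
  have a1 := hn1 g hg _ (hhG i) hi'
  have a2 := hn2 i
  have a3 := (th i).l2_sub_triangle tg t₀
  rw [Tame.l2_sub_comm (recip (h i)) (recip g)] at a3
  refine absurd hlt (not_lt.2 ?_)
  have e1 : smoothedDev P X n (fun u l => recip g u l - recip g₀ u l) ω
      = smoothedDev P X n (fun u l => recip g u l - recip (h i) u l) ω
        + smoothedDev P X n (fun u l => recip (h i) u l - recip g₀ u l) ω := by
    rw [smoothedDev_sub tg t₀, smoothedDev_sub tg (th i), smoothedDev_sub (th i) t₀]
    ring
  set x := l2 (fun u l => recip g u l - recip g₀ u l) with hx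
  have hx0 : 0 ≤ x := l2_nonneg _
  have hTn : T / n ≤ 2 * A * τ n ^ 2 := by
    calc T / n = 2 * A * (η n ^ (-γ) / n) := by
          rw [hT]
          ring
      _ ≤ _ := by gcongr
  have hsT : Real.sqrt (T / n) ≤ s * τ n := by
    refine (Real.sqrt_le_sqrt hTn).trans (le_of_eq ?_)
    rw [Real.sqrt_mul (by positivity), Real.sqrt_sq hτ0.le]
  have a4 : 4 * covConst κ K * (l2 (fun u l => recip (h i) u l - recip g₀ u l)
      * Real.sqrt (T / n) + 2 * c * (T / n))
      ≤ 4 * covConst κ K * ((τ n + x) * (s * τ n) + 2 * c * (2 * A * τ n ^ 2)) := by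
    gcongr
    linarith
  rw [e1]
  refine (abs_add_le _ _).trans ((add_le_add a1 (a2.trans a4)).trans ?_)
  have hcτ : 0 ≤ c * τ n ^ 2 - τ n ^ 2 := sub_nonneg.2 (le_mul_of_one_le_left (sq_nonneg _) hc)
  have f1 : 0 ≤ (C + 4 * (covConst κ K * s)) * (c * τ n ^ 2 - τ n ^ 2) := by positivity
  have f4 : 0 ≤ (C + 16 * (covConst κ K * A)) * (x * τ n) := by positivity
  linarith

end IsLocallyStationary

end Sample

/-! ### Dyadic decomposition of sums of products -/

/-- The sum of `e` over the `b`-th dyadic block of length `2 ^ j`. -/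
def blockSum (e : ℕ → ℝ) (j b : ℕ) : ℝ := ∑ i ∈ Finset.range (2 ^ j), e (b * 2 ^ j + i)

/-- The difference of the sums of `e` over two adjacent blocks of length `2 ^ j`. -/
def blockDiff (e : ℕ → ℝ) (j c : ℕ) : ℝ := blockSum e j (2 * c) - blockSum e j (2 * c + 1)

theorem blockSum_zero (e : ℕ → ℝ) (b : ℕ) : blockSum e 0 b = e b := by simp [blockSum]

theorem blockSum_succ (e : ℕ → ℝ) (j b : ℕ) :
    blockSum e (j + 1) b = blockSum e j (2 * b) + blockSum e j (2 * b + 1) := by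
  unfold blockSum
  rw [pow_succ, mul_two, Finset.sum_range_add]
  congr 1 <;> refine Finset.sum_congr rfl fun i _ => ?_ <;> congr 1 <;> ring

theorem sum_range_two_mul {M : Type*} [AddCommMonoid M] (f : ℕ → M) (L : ℕ) :
    ∑ b ∈ Finset.range (2 * L), f b = ∑ c ∈ Finset.range L, (f (2 * c) + f (2 * c + 1)) := by
  induction L with
  | zero => simp
  | succ L ih =>
    rw [Finset.sum_range_succ, ← ih, show 2 * (L + 1) = 2 * L + 1 + 1 by ring,
      Finset.sum_range_succ, Finset.sum_range_succ, add_assoc]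

theorem sum_blockSum {e : ℕ → ℝ} {j L : ℕ} :
    ∑ b ∈ Finset.range L, blockSum e j b = ∑ i ∈ Finset.range (L * 2 ^ j), e i := by
  induction L with
  | zero => simp
  | succ L ih => rw [Finset.sum_range_succ, ih, add_mul, one_mul, Finset.sum_range_add, blockSum]

/-- A Haar expansion: for sibling blocks, aa' + bb' is half of (a + b)(a' + b') + (a - b)(a' - b'),
and this is iterated on the sums. -/
theorem sum_mul_eq_dyadic (e y : ℕ → ℝ) (Q J : ℕ) (hJ : J ≤ Q) :
    ∑ t ∈ Finset.range (2 ^ Q), e t * y t =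
      1 / 2 ^ J * ∑ b ∈ Finset.range (2 ^ (Q - J)), blockSum e J b * blockSum y J b +
      ∑ j ∈ Finset.range J, 1 / 2 ^ (j + 1) *
        ∑ c ∈ Finset.range (2 ^ (Q - j - 1)), blockDiff e j c * blockDiff y j c := by
  induction J with
  | zero => simp [blockSum_zero]
  | succ J ih =>
    rw [ih (by omega), Finset.sum_range_succ, ← add_assoc, add_right_comm]
    congr 1
    have h2 : 2 ^ (Q - J) = 2 * 2 ^ (Q - J - 1) := by
      rw [← pow_succ']
      congr 1
      omega
    rw [h2, sum_range_two_mul, show Q - (J + 1) = Q - J - 1 by omega, ← mul_add,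
      ← Finset.sum_add_distrib, pow_succ, Finset.mul_sum, Finset.mul_sum]
    refine Finset.sum_congr rfl fun c _ => ?_
    rw [blockSum_succ, blockSum_succ, blockDiff, blockDiff]
    field_simp
    ring

theorem sq_blockSum_le (e : ℕ → ℝ) (j b : ℕ) :
    blockSum e j b ^ 2 ≤ 2 ^ j * blockSum (fun i => e i ^ 2) j b := by
  unfold blockSum
  have := sq_sum_le_card_mul_sum_sq (s := Finset.range (2 ^ j)) (f := fun i => e (b * 2 ^ j + i))
  simpa using this

theorem sum_sq_blockDiff_le (e : ℕ → ℝ) (j L : ℕ) :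
    ∑ c ∈ Finset.range L, blockDiff e j c ^ 2
      ≤ 2 ^ (j + 1) * ∑ i ∈ Finset.range (L * 2 ^ (j + 1)), e i ^ 2 := by
  have h : ∑ i ∈ Finset.range (L * 2 ^ (j + 1)), e i ^ 2
      = ∑ c ∈ Finset.range L, (blockSum (fun i => e i ^ 2) j (2 * c)
        + blockSum (fun i => e i ^ 2) j (2 * c + 1)) := by
    rw [← sum_blockSum (e := fun i => e i ^ 2)]
    exact Finset.sum_congr rfl fun c _ => blockSum_succ _ _ _
  rw [h, Finset.mul_sum]
  refine Finset.sum_le_sum fun c _ => ?_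
  have h1 := sq_blockSum_le e j (2 * c)
  have h2 := sq_blockSum_le e j (2 * c + 1)
  unfold blockDiff
  rw [pow_succ (2 : ℝ) j]
  nlinarith [sq_nonneg (blockSum e j (2 * c) + blockSum e j (2 * c + 1))]

theorem abs_sub_le_sum_increments (e : ℕ → ℝ) (s d : ℕ) :
    |e s - e (s + d)| ≤ ∑ i ∈ Finset.range d, |e (s + i + 1) - e (s + i)| := by
  rw [abs_sub_comm]
  have h := Finset.sum_range_sub (fun i => e (s + i)) d
  simp only [add_zero] at h
  rw [← h]
  exact Finset.abs_sum_le_sum_abs _ _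

/-- The i-th entries of sibling blocks are 2^j steps apart within the parent block, so each of the
2^j differences is at most the variation over that parent. -/
theorem sum_abs_blockDiff_le (e : ℕ → ℝ) (j L : ℕ) :
    ∑ c ∈ Finset.range L, |blockDiff e j c|
      ≤ 2 ^ j * ∑ i ∈ Finset.range (L * 2 ^ (j + 1)), |e (i + 1) - e i| := by
  set D : ℕ → ℝ := fun i => |e (i + 1) - e i| with hD
  have hD0 : ∀ i, 0 ≤ D i := fun i => abs_nonneg _
  rw [← sum_blockSum (e := D), Finset.mul_sum]
  refine Finset.sum_le_sum fun c _ => ?_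
  unfold blockDiff
  simp only [blockSum]
  rw [← Finset.sum_sub_distrib]
  refine (Finset.abs_sum_le_sum_abs _ _).trans ?_
  have key : ∀ i ∈ Finset.range (2 ^ j), |e (2 * c * 2 ^ j + i) - e ((2 * c + 1) * 2 ^ j + i)|
      ≤ ∑ i ∈ Finset.range (2 ^ (j + 1)), D (c * 2 ^ (j + 1) + i) := by
    intro i hi
    rw [Finset.mem_range] at hi
    rw [show (2 * c + 1) * 2 ^ j + i = 2 * c * 2 ^ j + i + 2 ^ j by ring]
    refine (abs_sub_le_sum_increments e _ _).trans ?_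
    have h1 : ∑ i' ∈ Finset.range (2 ^ j), |e (2 * c * 2 ^ j + i + i' + 1) - e (2 * c * 2 ^ j + i + i')|
        = ∑ i' ∈ (Finset.range (2 ^ j)).map (addLeftEmbedding i), D (c * 2 ^ (j + 1) + i') := by
      rw [Finset.sum_map]
      refine Finset.sum_congr rfl fun i' _ => ?_
      simp only [hD, addLeftEmbedding_apply]
      rw [show c * 2 ^ (j + 1) + (i + i') = 2 * c * 2 ^ j + i + i' by ring]
    rw [h1]
    refine Finset.sum_le_sum_of_subset_of_nonneg ?_ fun i _ _ => hD0 _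
    intro x hx
    simp only [Finset.mem_map, Finset.mem_range, addLeftEmbedding_apply] at hx ⊢
    obtain ⟨i', hi', rfl⟩ := hx
    rw [pow_succ]
    omega
  refine (Finset.sum_le_sum key).trans (le_of_eq ?_)
  rw [Finset.sum_const, Finset.card_range, nsmul_eq_mul]
  push_cast
  rfl

/-- Truncation at a fixed level, with the excess controlled by second and sixth powers. -/
theorem abs_mul_le_truncate (x z : ℝ) {T : ℝ} (hT : 0 < T) :
    |x * z| ≤ T * |x| + T * x ^ 2 / 2 + z ^ 6 / (2 * T ^ 5) := by
  set w := |z| / T with hw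
  have hz : |z| = T * w := by
    rw [hw]
    field_simp
  have hw0 : 0 ≤ w := by positivity
  have hz6 : z ^ 6 / (2 * T ^ 5) = T * w ^ 6 / 2 := by
    rw [← Even.pow_abs (by decide : Even 6) z, hz]
    field_simp
  rw [abs_mul, hz, hz6, ← sq_abs x]
  have hx := abs_nonneg x
  suffices h : |x| * w ≤ |x| + |x| ^ 2 / 2 + w ^ 6 / 2 by
    calc |x| * (T * w) = T * (|x| * w) := by ring
      _ ≤ T * (|x| + |x| ^ 2 / 2 + w ^ 6 / 2) := by gcongr
      _ = _ := by ring
  rcases le_total w 1 with h1 | h1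
  · have : |x| * w ≤ |x| := mul_le_of_le_one_right hx h1
    have : 0 ≤ w ^ 6 := by positivity
    have : 0 ≤ |x| ^ 2 := by positivity
    linarith
  · have h2 : w ^ 2 ≤ w ^ 6 := pow_le_pow_right₀ h1 (by norm_num)
    nlinarith [sq_nonneg (|x| - w)]

/-- The truncation level for blocks of length `2 ^ j`. -/
def blockLevel (Q j : ℕ) : ℝ := Real.sqrt (2 ^ Q) * (9 / 10) ^ (Q - j)

theorem blockLevel_pos (Q j : ℕ) : 0 < blockLevel Q j := by
  unfold blockLevel
  positivity

/-- The weighted sixth powers of all dyadic block differences. -/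
def blockEnergy (Q : ℕ) (y : ℕ → ℝ) : ℝ :=
  1 / 2 ^ Q * (blockSum y Q 0 ^ 6 / (2 * blockLevel Q Q ^ 5)) +
    ∑ j ∈ Finset.range Q, 1 / 2 ^ (j + 1) *
      ∑ c ∈ Finset.range (2 ^ (Q - j - 1)), blockDiff y j c ^ 6 / (2 * blockLevel Q j ^ 5)

theorem sum_geometric_reflect_le {r : ℝ} (h0 : 0 ≤ r) (h1 : r < 1) (Q : ℕ) :
    ∑ j ∈ Finset.range Q, r ^ (Q - j) ≤ r / (1 - r) := by
  have h := Finset.sum_range_reflect (fun i => r ^ (i + 1)) Q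
  have h2 : ∑ j ∈ Finset.range Q, r ^ (Q - j) = ∑ i ∈ Finset.range Q, r ^ (i + 1) := by
    rw [← h]
    refine Finset.sum_congr rfl fun j hj => ?_
    rw [Finset.mem_range] at hj
    congr 1
    omega
  rw [h2]
  simp only [pow_succ']
  rw [← Finset.mul_sum, div_eq_mul_inv]
  gcongr
  rw [← tsum_geometric_of_lt_one h0 h1]
  exact (summable_geometric_of_lt_one h0 h1).sum_le_tsum _ fun i _ => by positivity

/-- In the Haar expansion, variation bounds the coefficient differences in ℓ¹ and square sums bound
them in ℓ²; truncation pays with sixth powers of the differences of y. The levels decay like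
(9/10)^(Q-j): the main terms sum to 1 + 9 = 10, while the excess in the expected energy still has
ratio 1/(2 · 0.9⁵) < 1. -/
theorem abs_sum_mul_le_dyadic (e y : ℕ → ℝ) (Q : ℕ) {u s : ℝ} (hu0 : ∀ i, |e i| ≤ u)
    (hu : ∑ i ∈ Finset.range (2 ^ Q), |e (i + 1) - e i| ≤ u)
    (hs : ∑ i ∈ Finset.range (2 ^ Q), e i ^ 2 ≤ s) :
    |∑ t ∈ Finset.range (2 ^ Q), e t * y t|
      ≤ 10 * Real.sqrt (2 ^ Q) * (u + s) + blockEnergy Q y := by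
  have hu00 : 0 ≤ u := (abs_nonneg _).trans (hu0 0)
  have hs0 : 0 ≤ s := (Finset.sum_nonneg fun i _ => sq_nonneg _).trans hs
  set R := Real.sqrt (2 ^ Q) with hR
  have hR0 : 0 ≤ R := Real.sqrt_nonneg _
  have htop : |1 / 2 ^ Q * (blockSum e Q 0 * blockSum y Q 0)| ≤ R * (u + s)
      + 1 / 2 ^ Q * (blockSum y Q 0 ^ 6 / (2 * blockLevel Q Q ^ 5)) := by
    have hl : blockLevel Q Q = R := by simp [blockLevel, hR]
    have h1 : |blockSum e Q 0| ≤ 2 ^ Q * u := by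
      unfold blockSum
      refine (Finset.abs_sum_le_sum_abs _ _).trans ((Finset.sum_le_sum fun i _ => hu0 _).trans ?_)
      simp
    have h2 : blockSum e Q 0 ^ 2 ≤ 2 ^ Q * s := by
      refine (sq_blockSum_le e Q 0).trans ?_
      gcongr
      simpa [blockSum] using hs
    rw [abs_mul, abs_of_nonneg (by positivity : (0 : ℝ) ≤ 1 / 2 ^ Q)]
    have h3 := abs_mul_le_truncate (blockSum e Q 0) (blockSum y Q 0) (blockLevel_pos Q Q)
    calc _ ≤ 1 / 2 ^ Q * (blockLevel Q Q * |blockSum e Q 0| + blockLevel Q Q * blockSum e Q 0 ^ 2 / 2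
          + blockSum y Q 0 ^ 6 / (2 * blockLevel Q Q ^ 5)) := by gcongr
      _ ≤ 1 / 2 ^ Q * (R * (2 ^ Q * u) + R * (2 ^ Q * s) / 2
          + blockSum y Q 0 ^ 6 / (2 * blockLevel Q Q ^ 5)) := by
          rw [hl]
          gcongr
      _ = R * (u + s / 2) + 1 / 2 ^ Q * (blockSum y Q 0 ^ 6 / (2 * blockLevel Q Q ^ 5)) := by
          field_simp
      _ ≤ _ := by
          gcongr
          linarith
  have hlev : ∀ j ∈ Finset.range Q, |1 / 2 ^ (j + 1) *
        ∑ c ∈ Finset.range (2 ^ (Q - j - 1)), blockDiff e j c * blockDiff y j c|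
      ≤ R * (u + s) * (9 / 10) ^ (Q - j) + 1 / 2 ^ (j + 1) *
        ∑ c ∈ Finset.range (2 ^ (Q - j - 1)), blockDiff y j c ^ 6 / (2 * blockLevel Q j ^ 5) := by
    intro j hj
    rw [Finset.mem_range] at hj
    have hl : 2 ^ (Q - j - 1) * 2 ^ (j + 1) = 2 ^ Q := by
      rw [← pow_add]
      congr 1
      omega
    have h1 := sum_abs_blockDiff_le e j (2 ^ (Q - j - 1))
    have h2 := sum_sq_blockDiff_le e j (2 ^ (Q - j - 1))
    rw [hl] at h1 h2
    have h3 := h1.trans (mul_le_mul_of_nonneg_left hu (by positivity))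
    have h4 := h2.trans (mul_le_mul_of_nonneg_left hs (by positivity))
    rw [abs_mul, abs_of_nonneg (by positivity : (0 : ℝ) ≤ 1 / 2 ^ (j + 1))]
    have hT := blockLevel_pos Q j
    calc _ ≤ 1 / 2 ^ (j + 1) * ∑ c ∈ Finset.range (2 ^ (Q - j - 1)),
          (blockLevel Q j * |blockDiff e j c| + blockLevel Q j / 2 * blockDiff e j c ^ 2
            + blockDiff y j c ^ 6 / (2 * blockLevel Q j ^ 5)) := by
          gcongr
          refine (Finset.abs_sum_le_sum_abs _ _).trans (Finset.sum_le_sum fun c _ => ?_)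
          refine (abs_mul_le_truncate _ _ hT).trans (le_of_eq ?_)
          ring
      _ = 1 / 2 ^ (j + 1) * (blockLevel Q j * ∑ c ∈ Finset.range (2 ^ (Q - j - 1)), |blockDiff e j c|
            + blockLevel Q j / 2 * ∑ c ∈ Finset.range (2 ^ (Q - j - 1)), blockDiff e j c ^ 2)
          + 1 / 2 ^ (j + 1) * ∑ c ∈ Finset.range (2 ^ (Q - j - 1)),
            blockDiff y j c ^ 6 / (2 * blockLevel Q j ^ 5) := by
          rw [Finset.sum_add_distrib, Finset.sum_add_distrib, Finset.mul_sum (a := blockLevel Q j),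
            Finset.mul_sum (a := blockLevel Q j / 2), ← mul_add]
      _ ≤ 1 / 2 ^ (j + 1) * (blockLevel Q j * (2 ^ j * u) + blockLevel Q j / 2 * (2 ^ (j + 1) * s))
          + 1 / 2 ^ (j + 1) * ∑ c ∈ Finset.range (2 ^ (Q - j - 1)),
            blockDiff y j c ^ 6 / (2 * blockLevel Q j ^ 5) := by gcongr
      _ = R * ((u + s) / 2) * (9 / 10) ^ (Q - j) + 1 / 2 ^ (j + 1) *
          ∑ c ∈ Finset.range (2 ^ (Q - j - 1)),
            blockDiff y j c ^ 6 / (2 * blockLevel Q j ^ 5) := by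
          congr 1
          rw [blockLevel, ← hR, pow_succ]
          field_simp
      _ ≤ _ := by
          gcongr
          linarith
  have hid := sum_mul_eq_dyadic e y Q Q le_rfl
  rw [Nat.sub_self, pow_zero, Finset.sum_range_one] at hid
  rw [hid]
  refine (abs_add_le _ _).trans ((add_le_add htop ((Finset.abs_sum_le_sum_abs _ _).trans
    (Finset.sum_le_sum hlev))).trans ?_)
  rw [Finset.sum_add_distrib, ← Finset.mul_sum]
  have hg := sum_geometric_reflect_le (r := 9 / 10) (by norm_num) (by norm_num) Q
  have hg' : ∑ j ∈ Finset.range Q, (9 / 10 : ℝ) ^ (Q - j) ≤ 9 := hg.trans (by norm_num)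
  have hRu : 0 ≤ R * (u + s) := by positivity
  have := mul_le_mul_of_nonneg_left hg' hRu
  unfold blockEnergy
  linarith

/-- The expected energy, given the natural bounds for the sixth moments of block sums. -/
theorem lintegral_blockEnergy_le {Ω : Type*} [MeasurableSpace Ω] {P : Measure Ω}
    {Y : ℕ → Ω → ℝ} {Q : ℕ} {B : ℝ} (hB : 0 ≤ B) (hY : ∀ t, AEMeasurable (Y t) P)
    (htop : ∫⁻ ω, ENNReal.ofReal (blockSum (fun t => Y t ω) Q 0 ^ 6) ∂P
      ≤ ENNReal.ofReal (B * 8 ^ (Q + 1)))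
    (hlev : ∀ j c, ∫⁻ ω, ENNReal.ofReal (blockDiff (fun t => Y t ω) j c ^ 6) ∂P
      ≤ ENNReal.ofReal (B * 8 ^ (j + 1))) :
    ∫⁻ ω, ENNReal.ofReal (blockEnergy Q fun t => Y t ω) ∂P
      ≤ ENNReal.ofReal (10 * B / Real.sqrt (2 ^ Q)) := by
  have hms : ∀ j b, AEMeasurable (fun ω => blockSum (fun t => Y t ω) j b) P := fun j b =>
    Finset.aemeasurable_fun_sum _ fun i _ => hY _
  have hmd : ∀ j c, AEMeasurable (fun ω => blockDiff (fun t => Y t ω) j c) P := fun j c =>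
    (hms _ _).sub (hms _ _)
  have hscale : ∀ (Z : Ω → ℝ) (a b : ℝ), 0 ≤ a → 0 ≤ b →
      ∫⁻ ω, ENNReal.ofReal (Z ω ^ 6) ∂P ≤ ENNReal.ofReal b →
      ∫⁻ ω, ENNReal.ofReal (a * Z ω ^ 6) ∂P ≤ ENNReal.ofReal (a * b) := by
    intro Z a b ha hb h
    simp only [ENNReal.ofReal_mul ha]
    rw [lintegral_const_mul' _ _ ENNReal.ofReal_ne_top]
    gcongr
  have hsq : Real.sqrt (2 ^ Q) ^ 2 = 2 ^ Q := Real.sq_sqrt (by positivity)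
  set R := Real.sqrt (2 ^ Q) with hR
  have hR0 : 0 < R := Real.sqrt_pos.2 (by positivity)
  have e1 : ∀ ω, ENNReal.ofReal (blockEnergy Q fun t => Y t ω)
      = ENNReal.ofReal (1 / 2 ^ Q / (2 * blockLevel Q Q ^ 5) * blockSum (fun t => Y t ω) Q 0 ^ 6)
        + ∑ j ∈ Finset.range Q, ∑ c ∈ Finset.range (2 ^ (Q - j - 1)),
          ENNReal.ofReal (1 / 2 ^ (j + 1) / (2 * blockLevel Q j ^ 5)
            * blockDiff (fun t => Y t ω) j c ^ 6) := by
    intro ω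
    have hT := fun j => blockLevel_pos Q j
    have h6 : ∀ x : ℝ, 0 ≤ x ^ 6 := fun x => Even.pow_nonneg (by decide) x
    unfold blockEnergy
    simp only [Finset.mul_sum]
    rw [ENNReal.ofReal_add (by have := hT Q; have := h6 (blockSum (fun t => Y t ω) Q 0); positivity)
      (Finset.sum_nonneg fun j _ => Finset.sum_nonneg fun c _ => by
        have := hT j
        have := h6 (blockDiff (fun t => Y t ω) j c)
        positivity),
      ENNReal.ofReal_sum_of_nonneg (fun j _ => Finset.sum_nonneg fun c _ => by
        have := hT j
        have := h6 (blockDiff (fun t => Y t ω) j c)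
        positivity)]
    congr 1
    · congr 1
      ring
    · refine Finset.sum_congr rfl fun j _ => ?_
      rw [ENNReal.ofReal_sum_of_nonneg fun c _ => by
        have := hT j
        have := h6 (blockDiff (fun t => Y t ω) j c)
        positivity]
      refine Finset.sum_congr rfl fun c _ => ?_
      congr 1
      ring
  simp only [e1]
  have hT := fun j => blockLevel_pos Q j
  rw [lintegral_add_left' (((hms Q 0).pow_const 6).const_mul _).ennreal_ofReal,
    lintegral_finsetSum' _ fun j _ => Finset.aemeasurable_fun_sum _ fun c _ =>
      (((hmd j c).pow_const 6).const_mul _).ennreal_ofReal]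
  have htop' := hscale _ (1 / 2 ^ Q / (2 * blockLevel Q Q ^ 5)) _
    (by have := hT Q; positivity) (by positivity) htop
  have htopv : 1 / 2 ^ Q / (2 * blockLevel Q Q ^ 5) * (B * 8 ^ (Q + 1)) = 4 * B / R := by
    have hl : blockLevel Q Q = R := by simp [blockLevel, hR]
    have h8 : (8 : ℝ) ^ (Q + 1) = 8 * R ^ 6 := by
      rw [pow_succ, show (8 : ℝ) = 2 ^ 3 by norm_num, ← pow_mul, mul_comm 3 Q, pow_mul, ← hsq]
      ring
    rw [hl, h8, ← hsq]
    field_simp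
    ring
  have hlev' : ∀ j ∈ Finset.range Q, ∫⁻ ω, ∑ c ∈ Finset.range (2 ^ (Q - j - 1)),
      ENNReal.ofReal (1 / 2 ^ (j + 1) / (2 * blockLevel Q j ^ 5)
        * blockDiff (fun t => Y t ω) j c ^ 6) ∂P
      ≤ ENNReal.ofReal (B / R * (50000 / 59049) ^ (Q - j)) := by
    intro j hj
    rw [Finset.mem_range] at hj
    rw [lintegral_finsetSum' _ fun c _ => (((hmd j c).pow_const 6).const_mul _).ennreal_ofReal]
    refine (Finset.sum_le_sum fun c _ => hscale _ _ _ (by have := hT j; positivity)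
      (by positivity) (hlev j c)).trans (le_of_eq ?_)
    rw [Finset.sum_const, Finset.card_range, nsmul_eq_mul, ← ENNReal.ofReal_natCast,
      ← ENNReal.ofReal_mul (Nat.cast_nonneg _)]
    congr 1
    obtain ⟨q, rfl⟩ := Nat.exists_eq_add_of_lt hj
    have q1 : j + q + 1 - j - 1 = q := by omega
    have q2 : j + q + 1 - j = q + 1 := by omega
    have h8 : (8 : ℝ) ^ (j + 1) = 8 * (2 ^ j) ^ 3 := by
      rw [pow_succ, show (8 : ℝ) = 2 ^ 3 by norm_num, ← pow_mul, ← pow_mul, mul_comm 3 j]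
      ring
    have hR6 : R ^ 4 = (2 ^ j * 2 ^ q * 2) ^ 2 := by
      rw [show R ^ 4 = (R ^ 2) ^ 2 by ring, hsq]
      ring
    -- 50000/59049 is 1/(2 · 0.9⁵), the ratio by which the energy decreases from one level to the
    -- next finer one.
    have h9 : (50000 / 59049 : ℝ) ^ (q + 1) = 1 / (2 ^ q * 2 * ((9 / 10) ^ (q + 1)) ^ 5) := by
      rw [show (50000 / 59049 : ℝ) = 1 / (2 * (9 / 10) ^ 5) by norm_num, div_pow, one_pow, mul_pow,
        ← pow_mul, ← pow_mul, mul_comm 5, pow_succ]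
    have hp : (0 : ℝ) < (9 / 10) ^ (q + 1) := by positivity
    rw [blockLevel, ← hR, q1, q2, h8, h9, mul_pow R, show R ^ 5 = R ^ 4 * R by ring, hR6, pow_succ]
    generalize (9 / 10 : ℝ) ^ (q + 1) = p at hp
    push_cast
    field_simp
    ring
  refine (add_le_add htop' (Finset.sum_le_sum hlev')).trans ?_
  rw [← ENNReal.ofReal_sum_of_nonneg (fun j _ => by positivity),
    ← ENNReal.ofReal_add (by have := hT Q; positivity)
      (Finset.sum_nonneg fun j _ => by positivity)]
  refine ENNReal.ofReal_le_ofReal ?_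
  rw [htopv, ← Finset.mul_sum]
  have hg := (sum_geometric_reflect_le (r := 50000 / 59049) (by norm_num) (by norm_num) Q).trans
    (show (50000 / 59049 : ℝ) / (1 - 50000 / 59049) ≤ 6 by norm_num)
  have hBR : 0 ≤ B / R := by positivity
  calc _ ≤ 4 * B / R + B / R * 6 := by gcongr
    _ = _ := by ring

/-! ### Coefficients along a lag -/

/-- The rescaled cell coefficients of lag `k`, indexed from `0` and extended by zero. -/
def gridCoef (φ : ℝ → ℝ → ℝ) (n : ℕ) (k : ℤ) (i : ℕ) : ℝ :=
  if i < n then n * cellCoef φ n (i + 1) k else 0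

theorem Tame.gridCoef_sub {φ ψ : ℝ → ℝ → ℝ} (hφ : Tame φ) (hψ : Tame ψ) (n : ℕ) (k : ℤ) (i : ℕ) :
    gridCoef (fun u l => φ u l - ψ u l) n k i = gridCoef φ n k i - gridCoef ψ n k i := by
  unfold gridCoef
  split_ifs with h
  · rw [hφ.cellCoef_sub hψ (by omega) (by omega)]
    ring
  · simp

/-- n times the cell integral is an average over the cell, so a bound valid throughout the cell is
inherited. -/
theorem Tame.abs_mul_cellCoef_sub_le {φ : ℝ → ℝ → ℝ} (hφ : Tame φ) {n : ℕ} {t k : ℤ} (h1 : 1 ≤ t)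
    (h2 : t ≤ n) {x b : ℝ} (hb : ∀ u ∈ Set.Icc (((t : ℝ) - 1) / n) (t / n), |cosCoef φ u k - x| ≤ b) :
    |n * cellCoef φ n t k - x| ≤ b := by
  obtain ⟨ha, hb'⟩ := cell_ends_mem h1 h2
  obtain ⟨-, hab, -, -⟩ := cell_mem h1 h2
  have hn : (0 : ℝ) < n := by
    have : (1 : ℤ) ≤ n := h1.trans h2
    exact_mod_cast this
  have e : cellCoef φ n t k - x / n = ∫ u in (((t : ℝ) - 1) / n)..(t / n), (cosCoef φ u k - x) := by
    rw [intervalIntegral.integral_sub (hφ.cosCoef_intervalIntegrable k ha hb')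
      intervalIntegrable_const, intervalIntegral.integral_const, cell_length, cellCoef]
    simp [div_eq_inv_mul]
  have h := intervalIntegral.norm_integral_le_of_norm_le_const (f := fun u => cosCoef φ u k - x)
    (C := b) (a := ((t : ℝ) - 1) / n) (b := t / n) fun u hu => by
      rw [Set.uIoc_of_le hab] at hu
      exact hb u (Set.Ioc_subset_Icc_self hu)
  rw [← e, cell_length, abs_of_nonneg (by positivity), Real.norm_eq_abs] at h
  have e2 : n * cellCoef φ n t k - x = n * (cellCoef φ n t k - x / n) := by
    field_simp
  rw [e2, abs_mul, abs_of_pos hn]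
  calc _ ≤ n * (b * (1 / n)) := by gcongr
    _ = b := by field_simp

/-- Consecutive cell averages are both compared with the value at the common grid point, which uses
increments over two cells and so counts the variation twice. The drop to zero after the last cell
costs one supremum, whence 3c. -/
theorem Tame.exists_gridCoef_bound {φ : ℝ → ℝ → ℝ} (hφ : Tame φ) {c : ℝ} (hc : 0 ≤ c)
    (hρ : rhoInf φ ≤ ENNReal.ofReal c) (hv : vSum φ ≤ ENNReal.ofReal c) (n N : ℕ) :
    ∃ u : ℤ → ℝ, (∀ s : Finset ℤ, ∑ k ∈ s, u k ≤ 3 * c) ∧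
      (∀ k i, |gridCoef φ n k i| ≤ u k) ∧
      ∀ k, ∑ i ∈ Finset.range N, |gridCoef φ n k (i + 1) - gridCoef φ n k i| ≤ u k := by
  obtain ⟨w, hw1, hw2, hw3, hw4, hw5⟩ := exists_variation_majorants hv
  obtain ⟨d, hd0, hds, hdρ, hd⟩ := exists_coef_majorants hρ
  rw [max_eq_left hc] at hdρ
  simp only [max_eq_left hc] at hw4
  set z : ℝ := ((N + 1 : ℕ) : ℝ) / n with hz
  have hcos : ∀ k, ∀ x ∈ Set.Icc (0 : ℝ) 1, ∀ y ∈ Set.Icc (0 : ℝ) 1,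
      |cosCoef φ x k - cosCoef φ y k| ≤ ‖fourierCoef φ x k - fourierCoef φ y k‖ := by
    intro k x _ y _
    rw [cosCoef, cosCoef, ← Complex.sub_re]
    exact Complex.abs_re_le_norm _
  have hsup : ∀ k i, |gridCoef φ n k i| ≤ d k := by
    intro k i
    unfold gridCoef
    split_ifs with h
    · have := hφ.abs_mul_cellCoef_sub_le (n := n) (t := i + 1) (k := k) (by omega) (by omega)
        (x := 0) (b := d k) fun u hu => by
          rw [sub_zero]
          exact (abs_cosCoef_le φ u k).trans (hd k u (cell_subset (by omega) (by omega) hu))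
      simpa using this
    · simpa using hd0 k
  -- The indicator term is the drop from the last genuine coefficient, of index n - 1, to the zero
  -- extension.
  have hinc : ∀ k i, |gridCoef φ n k (i + 1) - gridCoef φ n k i|
      ≤ (w k ((i + 2 : ℕ) / n) - w k ((i + 1 : ℕ) / n)) + (w k ((i + 1 : ℕ) / n) - w k ((i : ℕ) / n))
        + if i = n - 1 then d k else 0 := by
    intro k i
    have m1 : 0 ≤ w k ((i + 2 : ℕ) / n) - w k ((i + 1 : ℕ) / n) :=
      sub_nonneg.2 (hw1 k (by gcongr; simp))
    have m2 : 0 ≤ w k ((i + 1 : ℕ) / n) - w k ((i : ℕ) / n) := sub_nonneg.2 (hw1 k (by gcongr; simp))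
    rcases lt_trichotomy (i + 1) n with h | h | h
    · have c0 := hφ.abs_mul_cellCoef_sub_le (n := n) (t := (i : ℤ) + 1) (k := k) (by omega) (by omega)
        (x := cosCoef φ ((i + 1 : ℕ) / n) k) (b := w k ((i + 1 : ℕ) / n) - w k ((i : ℕ) / n)) ?_
      · have c1 := hφ.abs_mul_cellCoef_sub_le (n := n) (t := (i : ℤ) + 1 + 1) (k := k) (by omega)
          (by omega) (x := cosCoef φ ((i + 1 : ℕ) / n) k)
          (b := w k ((i + 2 : ℕ) / n) - w k ((i + 1 : ℕ) / n)) ?_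
        · rw [if_neg (by omega), add_zero, gridCoef, gridCoef, if_pos h, if_pos (by omega)]
          push_cast at c0 c1 ⊢
          rw [abs_le] at c0 c1 ⊢
          constructor <;> linarith
        · intro u hu
          have hu1 := cell_subset (n := n) (t := (i : ℤ) + 1 + 1) (by omega) (by omega) hu
          have hx := (cell_ends_mem (n := n) (t := (i : ℤ) + 1 + 1) (by omega) (by omega)).1
          push_cast at hu hx ⊢
          rw [add_sub_cancel_right] at hu hx
          have a1 := hcos k u hu1 _ hx
          rw [norm_sub_rev] at a1
          refine a1.trans ((hw5 k _ hx u hu1 hu.1).trans ?_)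
          have := hw1 k hu.2
          rw [show (i : ℝ) + 1 + 1 = i + 2 by ring] at this
          linarith
      · intro u hu
        have hu1 := cell_subset (n := n) (t := (i : ℤ) + 1) (by omega) (by omega) hu
        have hx := (cell_ends_mem (n := n) (t := (i : ℤ) + 1) (by omega) (by omega)).2
        push_cast at hu hx ⊢
        rw [add_sub_cancel_right] at hu
        refine (hcos k u hu1 _ hx).trans ((hw5 k u hu1 _ hx hu.2).trans ?_)
        have := hw1 k hu.1
        linarith
    · rw [if_pos (by omega)]
      have h1 : gridCoef φ n k (i + 1) = 0 := by
        rw [gridCoef, if_neg (by omega)]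
      rw [h1, zero_sub, abs_neg]
      linarith [hsup k i]
    · have h1 : gridCoef φ n k (i + 1) = 0 := by
        rw [gridCoef, if_neg (by omega)]
      have h2 : gridCoef φ n k i = 0 := by
        rw [gridCoef, if_neg (by omega)]
      rw [h1, h2, sub_zero, abs_zero]
      have : 0 ≤ if i = n - 1 then d k else 0 := by
        split_ifs
        · exact hd0 k
        · exact le_rfl
      linarith
  refine ⟨fun k => 2 * w k z + d k, fun s => ?_, fun k i => ?_, fun k => ?_⟩
  · rw [Finset.sum_add_distrib, ← Finset.mul_sum]
    have a1 := ((hw3 z).sum_le_tsum s fun k _ => hw2 k z).trans (hw4 z)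
    have a2 := (hds.sum_le_tsum s fun k _ => hd0 k).trans hdρ
    linarith
  · have := hw2 k z
    linarith [hsup k i]
  · refine (Finset.sum_le_sum fun i _ => hinc k i).trans ?_
    rw [Finset.sum_add_distrib, Finset.sum_add_distrib]
    have t1 := Finset.sum_range_sub (fun i : ℕ => w k ((i + 1 : ℕ) / n)) N
    have t2 := Finset.sum_range_sub (fun i : ℕ => w k ((i : ℕ) / n)) N
    have t3 : ∑ i ∈ Finset.range N, (if i = n - 1 then d k else 0) ≤ d k := by
      rw [Finset.sum_ite_eq']
      split_ifs
      · exact le_rfl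
      · exact hd0 k
    have t4 : w k ((N : ℕ) / n) ≤ w k z := hw1 k (by rw [hz]; gcongr; simp)
    have t5 := hw2 k ((0 : ℕ) / n)
    have t6 := hw2 k ((0 + 1 : ℕ) / n)
    simp only [add_assoc, Nat.reduceAdd] at t1 t2 t6 ⊢
    linarith

theorem Tame.sum_sq_gridCoef_le {φ : ℝ → ℝ → ℝ} (hφ : Tame φ) {n : ℕ} (hn : 1 ≤ n)
    (s : Finset ℤ) (N : ℕ) :
    ∑ k ∈ s, ∑ i ∈ Finset.range N, gridCoef φ n k i ^ 2 ≤ 2 * Real.pi * n * l2 φ ^ 2 := by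
  have hn0 : (0 : ℝ) < n := by exact_mod_cast hn
  have h := hφ.sum_sq_cellCoef_le hn s
  rw [Finset.sum_comm] at h
  simp only [sum_Icc_one_eq] at h
  have hle : ∀ k, ∑ i ∈ Finset.range N, gridCoef φ n k i ^ 2
      ≤ ∑ i ∈ Finset.range n, (n : ℝ) ^ 2 * cellCoef φ n (i + 1) k ^ 2 := by
    intro k
    have h1 : ∑ i ∈ Finset.range n, (n : ℝ) ^ 2 * cellCoef φ n (i + 1) k ^ 2
        = ∑ i ∈ Finset.range n, gridCoef φ n k i ^ 2 := by
      refine Finset.sum_congr rfl fun i hi => ?_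
      rw [gridCoef, if_pos (Finset.mem_range.1 hi), mul_pow]
    rw [h1]
    rw [← Finset.sum_filter_of_ne (p := fun i => i < n) fun i _ hi => by
      by_contra hlt
      exact hi (by rw [gridCoef, if_neg hlt]; simp)]
    refine Finset.sum_le_sum_of_subset_of_nonneg (fun i hi => ?_) fun i _ _ => sq_nonneg _
    exact Finset.mem_range.2 (Finset.mem_filter.1 hi).2
  refine (Finset.sum_le_sum fun k _ => hle k).trans ?_
  simp only [← Finset.mul_sum]
  calc _ ≤ (n : ℝ) ^ 2 * (2 * Real.pi * l2 φ ^ 2 / n) := by gcongr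
    _ = _ := by field_simp

/-! ### Products along a lag -/

section Sample

variable {Ω : Type*} [MeasurableSpace Ω] {P : Measure Ω} [IsProbabilityMeasure P]
  {κ K : ℝ} {ε : ℤ → Ω → ℝ} {aT : ℕ → ℤ → ℤ → ℝ} {a : ℝ → ℤ → ℝ} {X : ℕ → ℤ → Ω → ℝ}

/-- The pairs of time points with lag `k` and midpoint in the set `s`, indexed from `0`. -/
def lagIndicator (s : Finset ℕ) (k : ℤ) (r s' : ℤ) : ℝ :=
  if r - s' = k ∧ ∃ i ∈ s, (r + s') / 2 = (i : ℤ) + 1 then 1 else 0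

/-- The centred product of lag `k` and midpoint `i`, indexed from `0`. -/
def lagDev (P : Measure Ω) (X : ℕ → ℤ → Ω → ℝ) (n : ℕ) (k : ℤ) (i : ℕ) (ω : Ω) : ℝ :=
  centredSum P X n (lagIndicator {i} k) ω

/-- A pair of times has one midpoint, so at most one index contributes. Block sums along a lag are
therefore quadratic forms with coefficients 0 and 1. -/
theorem sum_lagDev (n : ℕ) (k : ℤ) (s : Finset ℕ) (ω : Ω) :
    ∑ i ∈ s, lagDev P X n k i ω = centredSum P X n (lagIndicator s k) ω := by
  unfold lagDev centredSum
  rw [Finset.sum_comm]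
  refine Finset.sum_congr rfl fun r _ => ?_
  rw [Finset.sum_comm]
  refine Finset.sum_congr rfl fun s' _ => ?_
  rw [← Finset.sum_mul]
  congr 1
  unfold lagIndicator
  by_cases hk : r - s' = k
  · by_cases hs : ∃ i ∈ s, (r + s') / 2 = (i : ℤ) + 1
    · obtain ⟨i, hi, hi'⟩ := hs
      rw [if_pos ⟨hk, i, hi, hi'⟩, Finset.sum_eq_single i]
      · simp [hk, hi']
      · intro j _ hj
        rw [if_neg]
        rintro ⟨-, j', hj', h⟩
        rw [Finset.mem_singleton] at hj'
        omega
      · exact fun h => absurd hi h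
    · rw [if_neg fun h => hs h.2]
      refine Finset.sum_eq_zero fun j hj => if_neg ?_
      rintro ⟨-, j', hj', h⟩
      rw [Finset.mem_singleton] at hj'
      exact hs ⟨j, hj, hj' ▸ h⟩
  · simp [hk]

theorem sum_lagIndicator_le (n : ℕ) (k : ℤ) (s : Finset ℕ) :
    ∑ r ∈ Finset.Icc (1 : ℤ) n, ∑ s' ∈ Finset.Icc (1 : ℤ) n, lagIndicator s k r s' ≤ s.card := by
  have h := sum_pairs_le n (fun t k' => if k' = k ∧ ∃ i ∈ s, t = (i : ℤ) + 1 then (1 : ℝ) else 0)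
    (fun t k' => by split_ifs <;> norm_num)
  refine h.trans ?_
  rw [← Finset.sum_product', Finset.sum_ite, Finset.sum_const_zero, add_zero, Finset.sum_const,
    nsmul_eq_mul, mul_one, Nat.cast_le]
  have hsub : (Finset.Icc (1 : ℤ) n ×ˢ Finset.Icc (-(n : ℤ)) n).filter
      (fun x => x.2 = k ∧ ∃ i ∈ s, x.1 = (i : ℤ) + 1) ⊆ s.image fun i : ℕ => ((i : ℤ) + 1, k) := by
    rintro ⟨t, k'⟩ hx
    simp only [Finset.mem_filter, Finset.mem_image] at hx ⊢
    obtain ⟨-, rfl, i, hi, rfl⟩ := hx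
    exact ⟨i, hi, rfl⟩
  exact (Finset.card_le_card hsub).trans Finset.card_image_le

/-- The quadratic form is regrouped by lag and midpoint. Zero padding up to N allows a power of two.
-/
theorem smoothedDev_eq_sum_lagDev (φ : ℝ → ℝ → ℝ) {n N : ℕ} (hn : 1 ≤ n) (hN : n ≤ N) (ω : Ω) :
    smoothedDev P X n φ ω = 1 / (2 * Real.pi * n) * ∑ k ∈ Finset.Icc (-(n : ℤ)) n,
      ∑ i ∈ Finset.range N, gridCoef φ n k i * lagDev P X n k i ω := by
  have hn0 : (n : ℝ) ≠ 0 := by positivity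
  unfold smoothedDev lagDev centredSum
  simp only [Finset.mul_sum]
  rw [← Finset.sum_product', ← Finset.sum_product', Finset.sum_congr rfl fun _ _ => (Finset.sum_product' _ _ _).symm, Finset.sum_comm]
  refine Finset.sum_congr rfl fun p hp => ?_
  obtain ⟨r, s⟩ := p
  rw [Finset.mem_product] at hp
  have hm := midpoint_mem hp.1 hp.2
  simp only [Finset.mem_Icc] at hp
  rw [Finset.sum_eq_single (r - s, ((r + s) / 2 - 1).toNat)]
  · have hi : ((((r + s) / 2 - 1).toNat : ℕ) : ℤ) + 1 = (r + s) / 2 := by omega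
    simp only [lagIndicator, Finset.mem_singleton, exists_eq_left, hi, and_self, if_true,
      smoothedCoef, gridCoef]
    rw [if_pos (by omega), one_mul, ← mul_assoc, ← mul_assoc]
    congr 1
    field_simp
  · rintro ⟨k, i⟩ _ hne
    simp only [lagIndicator, Finset.mem_singleton, exists_eq_left]
    rw [if_neg, zero_mul, mul_zero, mul_zero]
    rintro ⟨h1, h2⟩
    refine hne (Prod.ext h1.symm ?_)
    simp only
    omega
  · intro h
    refine absurd ?_ h
    simp only [Finset.mem_product, Finset.mem_Icc, Finset.mem_range]
    omega

namespace IsLocallyStationary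

/-- The squared Frobenius norm is at most the number of selected midpoints, so the sixth moment
grows like its cube, as for sums of independent variables. -/
theorem lintegral_lagSum_le (hX : IsLocallyStationary P κ K ε aT a X) (hG : IsGaussianArray P X)
    (n : ℕ) (k : ℤ) (s s' : Finset ℕ) {m : ℕ} (hs : s.card + s'.card ≤ 2 ^ m) :
    ∫⁻ ω, ENNReal.ofReal ((∑ i ∈ s, lagDev P X n k i ω - ∑ i ∈ s', lagDev P X n k i ω) ^ 6) ∂P
      ≤ ENNReal.ofReal (10 ^ 8 * covConst κ K ^ 6 * 8 ^ m) := by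
  simp only [sum_lagDev, ← centredSum_sub]
  have hF : Real.sqrt (2 ^ m) ^ 2 = 2 ^ m := Real.sq_sqrt (by positivity)
  refine (hX.centredSum_sixth_moment hG n _ (F := Real.sqrt (2 ^ m))
    (Real.sqrt_pos.2 (by positivity)) ?_).trans (le_of_eq ?_)
  · rw [hF]
    calc _ ≤ ∑ r ∈ Finset.Icc (1 : ℤ) n, ∑ t ∈ Finset.Icc (1 : ℤ) n,
          (lagIndicator s k r t + lagIndicator s' k r t) := by
          refine Finset.sum_le_sum fun r _ => Finset.sum_le_sum fun t _ => ?_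
          unfold lagIndicator
          split_ifs <;> norm_num
      _ ≤ s.card + s'.card := by
          simp only [Finset.sum_add_distrib]
          exact add_le_add (sum_lagIndicator_le n k s) (sum_lagIndicator_le n k s')
      _ ≤ 2 ^ m := by exact_mod_cast hs
  · congr 1
    rw [mul_pow, show Real.sqrt (2 ^ m) ^ 6 = (Real.sqrt (2 ^ m) ^ 2) ^ 3 by ring, hF, ← pow_mul,
      mul_comm m 3, pow_mul]
    norm_num
    ring

theorem lintegral_blockEnergy_lagDev_le (hX : IsLocallyStationary P κ K ε aT a X)
    (hG : IsGaussianArray P X) (n Q : ℕ) (k : ℤ) :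
    ∫⁻ ω, ENNReal.ofReal (blockEnergy Q fun i => lagDev P X n k i ω) ∂P
      ≤ ENNReal.ofReal (10 * (10 ^ 8 * covConst κ K ^ 6) / Real.sqrt (2 ^ Q)) := by
  have hcov := hX.covConst_pos
  have hblock : ∀ (j b : ℕ) (ω : Ω), blockSum (fun i => lagDev P X n k i ω) j b
      = ∑ i ∈ (Finset.range (2 ^ j)).map (addLeftEmbedding (b * 2 ^ j)), lagDev P X n k i ω := by
    intro j b ω
    rw [Finset.sum_map]
    rfl
  refine lintegral_blockEnergy_le (Y := lagDev P X n k) (by positivity)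
    (fun t => aemeasurable_centredSum hG n _) ?_ fun j c => ?_
  · have h := hX.lintegral_lagSum_le hG n k
      ((Finset.range (2 ^ Q)).map (addLeftEmbedding (0 * 2 ^ Q))) ∅ (m := Q + 1) (by
        rw [Finset.card_map, Finset.card_range, Finset.card_empty, pow_succ]
        omega)
    simpa only [hblock, Finset.sum_empty, sub_zero] using h
  · simp only [blockDiff, hblock]
    refine hX.lintegral_lagSum_le hG n k _ _ (m := j + 1) ?_
    rw [Finset.card_map, Finset.card_map, Finset.card_range, pow_succ]
    omega

/-- Uniform fluctuation over functions whose Fourier coefficients have summable variations, at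
distance `n ^ (-1/2)`. -/
theorem hasModulus_sqrt (hX : IsLocallyStationary P κ K ε aT a X) (hG : IsGaussianArray P X)
    {G : Set (ℝ → ℝ → ℝ)} {m M c : ℝ} (hm : 0 < m) (hc : 0 ≤ c) (hreg : ∀ g ∈ G, Regular m M c g)
    {τ η : ℕ → ℝ} (hη : ∀ᶠ n : ℕ in atTop, η n ≤ 1 / Real.sqrt n)
    (hτ : ∀ᶠ n : ℕ in atTop, 1 / Real.sqrt n ≤ τ n ^ 2) : HasModulus P X G τ η := by
  intro e he
  have hcov := hX.covConst_pos
  have hpi := Real.pi_pos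
  rcases eq_or_ne e ∞ with rfl | hetop
  · exact ⟨0, le_rfl, Eventually.of_forall fun n => le_top⟩
  set B := 10 ^ 8 * covConst κ K ^ 6 with hB
  have hB0 : 0 < B := by positivity
  have he0 : 0 < e.toReal := ENNReal.toReal_pos he.ne' hetop
  -- With this value Markov's inequality for the total energy, whose mean is at most 30BR, gives
  -- probability at most e.
  set Λ := 30 * B / e.toReal with hΛ
  have hΛ0 : 0 < Λ := by positivity
  refine ⟨20 * (6 * c + 2 * Real.pi) + 2 * Λ, by positivity, ?_⟩
  filter_upwards [hη, hτ, eventually_ge_atTop 1] with n h1 h2 hn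
  have hn0 : (0 : ℝ) < n := by exact_mod_cast hn
  set Q := Nat.clog 2 n with hQ
  have hNn : n ≤ 2 ^ Q := Nat.le_pow_clog (by norm_num) n
  have hN2 : 2 ^ Q ≤ 2 * n := by
    rcases hn.eq_or_lt with h | h
    · rw [hQ, ← h]
      simp
    · have h3 := Nat.pow_pred_clog_lt_self (b := 2) (by norm_num) h
      have h4 : Q ≠ 0 := by
        rw [hQ]
        exact (Nat.clog_pos (by norm_num) h).ne'
      obtain ⟨q, hq⟩ := Nat.exists_eq_succ_of_ne_zero h4
      rw [← hQ, hq, Nat.pred_succ] at h3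
      rw [hq, pow_succ]
      omega
  have hNn' : (n : ℝ) ≤ 2 ^ Q := by exact_mod_cast hNn
  have hN2' : (2 : ℝ) ^ Q ≤ 2 * n := by exact_mod_cast hN2
  set R := Real.sqrt (2 ^ Q) with hR
  have hR0 : 0 < R := Real.sqrt_pos.2 (by positivity)
  have hRsq : R ^ 2 = 2 ^ Q := Real.sq_sqrt (by positivity)
  set S := Finset.Icc (-(n : ℤ)) n with hS
  have hScard : (S.card : ℝ) ≤ 3 * n := by
    rw [hS, Int.card_Icc]
    have : (n + 1 - -(n : ℤ)).toNat ≤ 3 * n := by omega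
    exact_mod_cast this
  set E : Ω → ℝ≥0∞ := fun ω =>
    ∑ k ∈ S, ENNReal.ofReal (blockEnergy Q fun i => lagDev P X n k i ω) with hE
  have hmeasY : ∀ k i, AEMeasurable (lagDev P X n k i) P := fun k i => aemeasurable_centredSum hG n _
  have hmeas : ∀ k, AEMeasurable
      (fun ω => ENNReal.ofReal (blockEnergy Q fun i => lagDev P X n k i ω)) P := by
    intro k
    have hbs : ∀ j b, AEMeasurable (fun ω => blockSum (fun i => lagDev P X n k i ω) j b) P :=
      fun j b => Finset.aemeasurable_fun_sum _ fun i _ => hmeasY k _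
    unfold blockEnergy blockDiff
    refine AEMeasurable.ennreal_ofReal (AEMeasurable.add ?_ ?_)
    · exact ((((hbs Q 0).pow_const 6).div_const _).const_mul _)
    · refine Finset.aemeasurable_fun_sum _ fun j _ => AEMeasurable.const_mul ?_ _
      exact Finset.aemeasurable_fun_sum _ fun c _ =>
        (((hbs _ _).sub (hbs _ _)).pow_const 6).div_const _
  -- Each of the at most 3n lags contributes expected energy of order 1/R, and R² ≥ n.
  have hEint : ∫⁻ ω, E ω ∂P ≤ ENNReal.ofReal (30 * B * R) := by
    rw [hE, lintegral_finsetSum' _ fun k _ => hmeas k]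
    refine (Finset.sum_le_sum fun k _ => hX.lintegral_blockEnergy_lagDev_le hG n Q k).trans ?_
    rw [Finset.sum_const, nsmul_eq_mul, ← ENNReal.ofReal_natCast,
      ← ENNReal.ofReal_mul (Nat.cast_nonneg _)]
    refine ENNReal.ofReal_le_ofReal ?_
    calc (S.card : ℝ) * (10 * B / R) ≤ (3 * 2 ^ Q) * (10 * B / R) := by
          gcongr
          linarith
      _ = 30 * B * R := by
          rw [← hRsq]
          field_simp
          ring
  have hMarkov : P {ω | ENNReal.ofReal (Λ * R) ≤ E ω} ≤ e := by
    have hpos : ENNReal.ofReal (Λ * R) ≠ 0 := by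
      rw [Ne, ENNReal.ofReal_eq_zero, not_le]
      positivity
    refine (meas_ge_le_lintegral_div (Finset.aemeasurable_fun_sum _ fun k _ => hmeas k) hpos
      ENNReal.ofReal_ne_top).trans ?_
    rw [ENNReal.div_le_iff hpos ENNReal.ofReal_ne_top]
    refine hEint.trans (le_of_eq ?_)
    rw [← ENNReal.ofReal_toReal hetop, ← ENNReal.ofReal_mul he0.le]
    congr 1
    rw [hΛ]
    field_simp
  -- The energy does not depend on the two densities, so a single event serves all pairs and no
  -- covering is needed.
  refine le_trans (measure_mono ?_) hMarkov
  rintro ω ⟨g, hg, g', hg', hl, hlt⟩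
  by_contra hnot
  simp only [Set.mem_ofPred_eq, not_le] at hnot
  have tg := (hreg g hg).tame hm
  have tg' := (hreg g' hg').tame hm
  set ψ : ℝ → ℝ → ℝ := fun u l => recip g u l - recip g' u l with hψ
  have tψ : Tame ψ := tg.sub tg'
  obtain ⟨u, hu1, hu2, hu3⟩ := tg.exists_gridCoef_bound hc (hreg g hg).rho (hreg g hg).var n (2 ^ Q)
  obtain ⟨u', hu1', hu2', hu3'⟩ :=
    tg'.exists_gridCoef_bound hc (hreg g' hg').rho (hreg g' hg').var n (2 ^ Q)
  have henergy : ∑ k ∈ S, blockEnergy Q (fun i => lagDev P X n k i ω) ≤ Λ * R := by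
    have h3 : ∀ k ∈ S, 0 ≤ blockEnergy Q (fun i => lagDev P X n k i ω) := by
      intro k _
      have h6 : ∀ x : ℝ, 0 ≤ x ^ 6 := fun x => Even.pow_nonneg (by decide) x
      have hT := fun j => (blockLevel_pos Q j).le
      unfold blockEnergy
      refine add_nonneg (mul_nonneg (by positivity) (div_nonneg (h6 _) ?_))
        (Finset.sum_nonneg fun j _ => mul_nonneg (by positivity)
          (Finset.sum_nonneg fun c _ => div_nonneg (h6 _) ?_))
      · exact mul_nonneg zero_le_two (pow_nonneg (hT _) _)
      · exact mul_nonneg zero_le_two (pow_nonneg (hT _) _)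
    rw [hE] at hnot
    simp only at hnot
    rw [← ENNReal.ofReal_sum_of_nonneg h3] at hnot
    exact ((ENNReal.ofReal_lt_ofReal_iff (by positivity)).1 hnot).le
  -- Distance n^(-1/2) is exactly what keeps the square sum of all grid coefficients bounded.
  have hl2 : n * l2 ψ ^ 2 ≤ 1 := by
    have h3 : l2 ψ ≤ 1 / Real.sqrt n := hl.trans h1
    calc n * l2 ψ ^ 2 ≤ n * (1 / Real.sqrt n) ^ 2 := by
          have := l2_nonneg ψ
          gcongr
      _ = 1 := by
          rw [div_pow, Real.sq_sqrt hn0.le]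
          field_simp
  have hsq : ∑ k ∈ S, ∑ i ∈ Finset.range (2 ^ Q), gridCoef ψ n k i ^ 2 ≤ 2 * Real.pi := by
    refine (tψ.sum_sq_gridCoef_le hn S _).trans ?_
    rw [mul_assoc]
    exact mul_le_of_le_one_right (by positivity) hl2
  have hterm : ∀ k ∈ S, |∑ i ∈ Finset.range (2 ^ Q), gridCoef ψ n k i * lagDev P X n k i ω|
      ≤ 10 * R * ((u k + u' k) + ∑ i ∈ Finset.range (2 ^ Q), gridCoef ψ n k i ^ 2)
        + blockEnergy Q fun i => lagDev P X n k i ω := by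
    intro k _
    have hgs := fun i => tg.gridCoef_sub tg' n k i
    refine abs_sum_mul_le_dyadic _ _ Q (fun i => ?_) ?_ le_rfl
    · rw [hψ, hgs]
      exact (abs_sub _ _).trans (add_le_add (hu2 k i) (hu2' k i))
    · refine le_trans ?_ (add_le_add (hu3 k) (hu3' k))
      rw [← Finset.sum_add_distrib]
      refine Finset.sum_le_sum fun i _ => ?_
      rw [hψ, hgs, hgs, sub_sub_sub_comm]
      exact abs_sub _ _
  have htot : |∑ k ∈ S, ∑ i ∈ Finset.range (2 ^ Q), gridCoef ψ n k i * lagDev P X n k i ω|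
      ≤ R * (10 * (6 * c + 2 * Real.pi) + Λ) := by
    refine (Finset.abs_sum_le_sum_abs _ _).trans ((Finset.sum_le_sum hterm).trans ?_)
    rw [Finset.sum_add_distrib, ← Finset.mul_sum, Finset.sum_add_distrib, Finset.sum_add_distrib]
    calc _ ≤ 10 * R * (3 * c + 3 * c + 2 * Real.pi) + Λ * R := by
          gcongr
          · exact hu1 S
          · exact hu1' S
      _ = _ := by ring
  refine absurd hlt (not_lt.2 ?_)
  rw [smoothedDev_eq_sum_lagDev ψ hn hNn, abs_mul, abs_of_pos (by positivity)]
  have hRn : R ≤ 2 * Real.sqrt n := by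
    rw [hR, Real.sqrt_le_left (by positivity), mul_pow, Real.sq_sqrt hn0.le]
    linarith
  have hsn : 0 < Real.sqrt n := Real.sqrt_pos.2 hn0
  have hpi1 : 1 / (2 * Real.pi * n) ≤ 1 / n := by
    gcongr
    nlinarith [Real.pi_gt_three]
  calc _ ≤ 1 / n * (2 * Real.sqrt n * (10 * (6 * c + 2 * Real.pi) + Λ)) := by
        gcongr
        refine htot.trans ?_
        gcongr
    _ = (20 * (6 * c + 2 * Real.pi) + 2 * Λ) * (1 / Real.sqrt n) := by
        rw [← Real.sq_sqrt hn0.le, Real.sqrt_sq hsn.le]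
        field_simp
        ring
    _ ≤ _ := by gcongr

end IsLocallyStationary

end Sample

/-! ### Global estimation -/

/-- The global rate as a real number. -/
def globalRateReal (γ : ℝ) (n : ℕ) : ℝ :=
  if γ < 1 then (n : ℝ) ^ (-(1 / (2 * (γ + 1))))
  else (n : ℝ) ^ (-((2 - γ) / (4 * γ))) * Real.log n ^ ((γ - 1) / (2 * γ))

theorem eventually_log_div_le {p : ℝ} (hp : p < 1) :
    ∀ᶠ n : ℕ in atTop, Real.log n / n ≤ (n : ℝ) ^ (-p) := by
  have h := (isLittleO_log_rpow_atTop (sub_pos.2 hp)).bound zero_lt_one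
  filter_upwards [tendsto_natCast_atTop_atTop.eventually h, eventually_ge_atTop 1] with n h1 hn
  have hn0 : (0 : ℝ) < n := by exact_mod_cast hn
  rw [one_mul, Real.norm_eq_abs, Real.norm_eq_abs, abs_of_nonneg (Real.rpow_nonneg hn0.le _),
    Real.rpow_sub hn0, Real.rpow_one] at h1
  rw [div_le_iff₀ hn0, Real.rpow_neg hn0.le, ← div_eq_inv_mul]
  exact (le_abs_self _).trans h1

theorem tendsto_rpow_natCast {p : ℝ} (hp : 0 < p) :
    Tendsto (fun n : ℕ => (n : ℝ) ^ p) atTop atTop :=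
  (tendsto_rpow_atTop hp).comp tendsto_natCast_atTop_atTop

section Sample

variable {Ω : Type*} [MeasurableSpace Ω] {P : Measure Ω} [IsProbabilityMeasure P]
  {κ K : ℝ} {ε : ℤ → Ω → ℝ} {aT : ℕ → ℤ → ℤ → ℝ} {a : ℝ → ℤ → ℝ} {X : ℕ → ℤ → Ω → ℝ}
  {G : Set (ℝ → ℝ → ℝ)} {m M c A γ : ℝ}

namespace IsLocallyStationary

/-- Chaining steps are iterated until the radius is at most n⁻², where `hasModulus_of_le` applies.
Each step raises the exponent by at least d = 1/(2γ) - 1/(γ+1), which is positive because γ < 1, so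
finitely many steps suffice. -/
theorem hasModulus_rpow (hX : IsLocallyStationary P κ K ε aT a X) (hG : IsGaussianArray P X)
    (hm : 0 < m) (hreg : ∀ g ∈ G, Regular m M c g) (hA : 0 < A) (hγ0 : 0 < γ) (hγ1 : γ < 1)
    (hent : ∀ η : ℝ, 0 < η → metricEntropy η (recipClass G) ≤ ((A * η ^ (-γ) : ℝ) : EReal))
    {τ : ℕ → ℝ} (hτ : ∀ᶠ n : ℕ in atTop, τ n ^ 2 = (n : ℝ) ^ (-(1 / (γ + 1)))) :
    HasModulus P X G τ fun n => (n : ℝ) ^ (-(1 / (γ + 1))) := by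
  set p := 1 / (γ + 1) with hp
  have hp0 : 0 < p := by positivity
  have hp1 : p < 1 := by
    rw [hp, div_lt_one (by linarith)]
    linarith
  set d := 1 / (2 * γ) - p with hd
  have hd0 : 0 < d := by
    rw [hd, hp, sub_pos]
    gcongr
    linarith
  suffices h : ∀ L : ℕ, ∀ q : ℝ, p ≤ q → 2 ≤ q + L * d →
      HasModulus P X G τ fun n => (n : ℝ) ^ (-q) by
    obtain ⟨L, hL⟩ := exists_nat_ge (2 / d)
    refine h L p le_rfl ?_
    rw [div_le_iff₀ hd0] at hL
    linarith
  intro L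
  induction L with
  | zero =>
    intro q _ hq
    rw [Nat.cast_zero, zero_mul, add_zero] at hq
    refine hX.hasModulus_of_le hG hm hreg ?_ ?_
    · filter_upwards [eventually_ge_atTop 1] with n hn
      have hn1 : (1 : ℝ) ≤ n := by exact_mod_cast hn
      calc (n : ℝ) ^ (-q) ≤ (n : ℝ) ^ (-(2 : ℝ)) :=
            Real.rpow_le_rpow_of_exponent_le hn1 (by linarith)
        _ = 1 / (n : ℝ) ^ 2 := by
            rw [Real.rpow_neg (by linarith), Real.rpow_ofNat, one_div]
    · filter_upwards [eventually_log_div_le hp1, hτ] with n h1 h2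
      rwa [h2]
  | succ L ih =>
    intro q hpq hq
    -- The finest radius reachable in one step: this exponent solves q + 1/2 - γq' = p, equality in
    -- the rate condition of `hasModulus_of_finer`.
    set q' := (q + 1 / 2 - p) / γ with hq'
    have hγq : γ * q' = q + 1 / 2 - p := by
      rw [hq']
      field_simp
    have hγp : γ * p = 1 - p := by
      rw [hp]
      field_simp
      ring
    have hγd : γ * d = 1 / 2 - (1 - p) := by
      rw [hd, mul_sub, hγp]
      field_simp
    have hstep : q + d ≤ q' := by
      refine le_of_mul_le_mul_left ?_ hγ0
      rw [mul_add, hγq, hγd]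
      have : (1 - γ) * p ≤ (1 - γ) * q := by gcongr
      linarith
    have hq'0 : 0 < q' := by linarith
    push_cast at hq
    refine hX.hasModulus_of_finer hG hm hreg hA hent (ih q' (by linarith) (by linarith))
      (C₀ := 1) ?_ zero_le_one ?_ ?_
    · filter_upwards [eventually_ge_atTop 1] with n hn
      have hn1 : (1 : ℝ) ≤ n := by exact_mod_cast hn
      exact ⟨by positivity, Real.rpow_le_rpow_of_exponent_le hn1 (by linarith)⟩
    · filter_upwards [eventually_ge_atTop 1, hτ] with n hn h2
      have hn0 : (0 : ℝ) < n := by exact_mod_cast hn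
      rw [h2, one_mul, Real.sqrt_eq_rpow, ← Real.rpow_mul hn0.le, ← Real.rpow_sub hn0,
        ← Real.rpow_add hn0]
      refine le_of_eq ?_
      congr 1
      linarith
    · refine (tendsto_rpow_natCast (mul_pos hq'0 hγ0)).congr fun n => ?_
      rw [← Real.rpow_mul (Nat.cast_nonneg _), neg_mul_neg]

/-- The rate of the fluctuation over a class of polynomial entropy. -/
theorem global_fluctuation (hX : IsLocallyStationary P κ K ε aT a X) (hG : IsGaussianArray P X)
    (hm : 0 < m) (hc : 1 ≤ c) (hreg : ∀ g ∈ G, Regular m M c g) (hA : 0 < A) (hγ0 : 0 < γ)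
    (hγ2 : γ < 2)
    (hent : ∀ η : ℝ, 0 < η → metricEntropy η (recipClass G) ≤ ((A * η ^ (-γ) : ℝ) : EReal)) :
    (∀ᶠ n : ℕ in atTop, 0 ≤ globalRateReal γ n ∧ Real.log n / n ≤ globalRateReal γ n ^ 2) ∧
    ∀ g₀ ∈ G, ∀ e : ℝ≥0∞, 0 < e → ∃ C : ℝ, 0 ≤ C ∧ ∀ᶠ n in atTop,
      P {ω | ∃ g ∈ G, C * (l2 (fun u l => recip g u l - recip g₀ u l) * globalRateReal γ n
        + c * globalRateReal γ n ^ 2) <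
          |smoothedDev P X n (fun u l => recip g u l - recip g₀ u l) ω|} ≤ e := by
  rcases lt_or_ge γ 1 with hγ1 | hγ1
  · set p := 1 / (γ + 1) with hp
    have hp0 : 0 < p := by positivity
    have hp1 : p < 1 := by
      rw [hp, div_lt_one (by linarith)]
      linarith
    have hτ : ∀ n, globalRateReal γ n = (n : ℝ) ^ (-(p / 2)) := fun n => by
      rw [globalRateReal, if_pos hγ1, hp, div_div, mul_comm 2]
    have hτ2 : ∀ n, 1 ≤ n → globalRateReal γ n ^ 2 = (n : ℝ) ^ (-p) := fun n hn => by
      rw [hτ, ← Real.rpow_natCast, ← Real.rpow_mul (Nat.cast_nonneg _)]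
      congr 1
      push_cast
      ring
    refine ⟨?_, fun g₀ hg₀ e he => ?_⟩
    · filter_upwards [eventually_log_div_le hp1, eventually_ge_atTop 1] with n h1 hn
      rw [hτ2 n hn, hτ]
      exact ⟨by positivity, h1⟩
    · have hmod := hX.hasModulus_rpow hG hm hreg hA hγ0 hγ1 hent (τ := globalRateReal γ)
        ((eventually_ge_atTop 1).mono hτ2)
      refine hX.fluctuation_of_hasModulus hG hm hc hreg hA hent hmod ?_ ?_ ?_ hg₀ he
      · filter_upwards [eventually_ge_atTop 1] with n hn
        have hn1 : (1 : ℝ) ≤ n := by exact_mod_cast hn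
        rw [hτ]
        exact ⟨by positivity, Real.rpow_le_rpow_of_exponent_le hn1 (by rw [← hp]; linarith)⟩
      · filter_upwards [eventually_ge_atTop 1] with n hn
        have hn0 : (0 : ℝ) < n := by exact_mod_cast hn
        -- The exponents balance: γp - 1 = -p for p = 1/(γ + 1), so entropy over n equals τ² at
        -- radius n^(-p).
        rw [hτ2 n hn, ← Real.rpow_mul hn0.le, ← Real.rpow_sub_one hn0.ne', ← hp]
        refine le_of_eq ?_
        congr 1
        rw [hp]
        field_simp
        ring
      · refine (tendsto_rpow_natCast (mul_pos hp0 hγ0)).congr fun n => ?_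
        rw [← Real.rpow_mul (Nat.cast_nonneg _), neg_mul_neg]
  -- For γ ≥ 1 the logarithmic factor is eventually at least 1 and can be dropped from lower bounds
  -- on the rate. Both n^(-1/2) and the entropy term n^(γ/2 - 1) are at most n^(-2p).
  · set p := (2 - γ) / (4 * γ) with hp
    have hp0 : 0 ≤ p := div_nonneg (by linarith) (by linarith)
    have hp1 : 2 * p ≤ 1 / 2 := by
      rw [hp, mul_div, div_le_div_iff₀ (by linarith) (by norm_num)]
      linarith
    have hpγ : 2 * p ≤ 1 - γ / 2 := by
      have h1 : 2 * p * γ = 1 - γ / 2 := by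
        rw [hp]
        field_simp
        ring
      have h2 : 2 * p * 1 ≤ 2 * p * γ := by gcongr
      linarith
    have hτle : ∀ᶠ n : ℕ in atTop, 1 ≤ n ∧ (n : ℝ) ^ (-p) ≤ globalRateReal γ n := by
      filter_upwards [(Real.tendsto_log_atTop.comp tendsto_natCast_atTop_atTop).eventually_ge_atTop 1,
        eventually_ge_atTop 1] with n h1 hn
      refine ⟨hn, ?_⟩
      rw [globalRateReal, if_neg (not_lt.2 hγ1)]
      refine le_mul_of_one_le_right (by positivity) (Real.one_le_rpow h1 ?_)
      exact div_nonneg (by linarith) (by linarith)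
    have hτ2 : ∀ᶠ n : ℕ in atTop, 1 ≤ n ∧ (n : ℝ) ^ (-(2 * p)) ≤ globalRateReal γ n ^ 2 := by
      filter_upwards [hτle] with n h
      refine ⟨h.1, le_trans (le_of_eq ?_) (pow_le_pow_left₀ (by positivity) h.2 2)⟩
      rw [← Real.rpow_natCast, ← Real.rpow_mul (Nat.cast_nonneg _)]
      congr 1
      push_cast
      ring
    have hsqrt : ∀ n : ℕ, 1 / Real.sqrt n = (n : ℝ) ^ (-(1 / 2 : ℝ)) := fun n => by
      rw [Real.sqrt_eq_rpow, Real.rpow_neg (Nat.cast_nonneg _), one_div]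
    have hlow : ∀ᶠ n : ℕ in atTop, 1 / Real.sqrt n ≤ globalRateReal γ n ^ 2 := by
      filter_upwards [hτ2] with n h
      have hn1 : (1 : ℝ) ≤ n := by exact_mod_cast h.1
      rw [hsqrt]
      exact (Real.rpow_le_rpow_of_exponent_le hn1 (by linarith)).trans h.2
    refine ⟨?_, fun g₀ hg₀ e he => ?_⟩
    · filter_upwards [hτle, hlow, eventually_log_div_le (p := 1 / 2) (by norm_num)] with n h1 h2 h3
      rw [← hsqrt] at h3
      exact ⟨le_trans (by positivity) h1.2, h3.trans h2⟩
    · refine hX.fluctuation_of_hasModulus hG hm hc hreg hA hent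
        (hX.hasModulus_sqrt hG hm (by linarith) hreg (η := fun n : ℕ => (n : ℝ) ^ (-(1 / 2 : ℝ)))
          (Eventually.of_forall fun n => (hsqrt n).ge) hlow) ?_ ?_ ?_ hg₀ he
      · filter_upwards [hτle] with n h
        have hn1 : (1 : ℝ) ≤ n := by exact_mod_cast h.1
        exact ⟨by positivity, (Real.rpow_le_rpow_of_exponent_le hn1 (by linarith)).trans h.2⟩
      · filter_upwards [hτ2] with n h
        have hn1 : (1 : ℝ) ≤ n := by exact_mod_cast h.1
        have hn0 : (0 : ℝ) < n := by linarith
        rw [← Real.rpow_mul hn0.le, ← Real.rpow_sub_one hn0.ne']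
        exact (Real.rpow_le_rpow_of_exponent_le hn1 (by linarith)).trans h.2
      · refine (tendsto_rpow_natCast (mul_pos one_half_pos hγ0)).congr fun n => ?_
        rw [← Real.rpow_mul (Nat.cast_nonneg _), neg_mul_neg]

/-- Global estimation over a class of polynomial entropy. -/
theorem global_rate (hX : IsLocallyStationary P κ K ε aT a X) (hG : IsGaussianArray P X)
    {Fn : ℕ → Set (ℝ → ℝ → ℝ)} {F : Set (ℝ → ℝ → ℝ)} {fF : ℝ → ℝ → ℝ}
    {Mlow Mup rInf vT vS : ℕ → ℝ}
    (hM : ModelAssumptions (spectralDensity a) Fn F fF Mlow Mup rInf vT vS)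
    {Lt : ℕ → Ω → (ℝ → ℝ → ℝ) → ℝ} {ft : ℕ → Ω → ℝ → ℝ → ℝ}
    (hft : ∀ n, 1 ≤ n → ∀ᵐ ω ∂P, ft n ω ∈ Fn n ∧ ∀ g ∈ Fn n, Lt n ω (ft n ω) ≤ Lt n ω g)
    (hFn : ∀ n, 1 ≤ n → Fn n = F)
    (hF : MemAE (spectralDensity a) F ∨ Convex ℝ (recipClass F)) (hγ0 : 0 < γ) (hγ2 : γ < 2)
    (hA : 0 < A)
    (hent : ∀ η : ℝ, 0 < η → metricEntropy η (recipClass F) ≤ ((A * η ^ (-γ) : ℝ) : EReal))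
    (hclose : CriterionClose P X Fn Mup Lt (globalRate γ)) :
    ConvergesAtRate P ft fF (globalRate γ) := by
  -- The class is the same for every n, so its bounds at n = 1 hold throughout.
  set m := Mlow 1 with hm_def
  set M := Mup 1 with hM_def
  set c := complexity Mup rInf vS 1 with hc_def
  have hm : 0 < m := hM.low_pos 1 le_rfl
  have hM1 : 1 ≤ M := hM.one_le_up 1 le_rfl
  have hc : 1 ≤ c := hM.one_le_complexity le_rfl
  have hreg : ∀ g ∈ F, Regular m M c g := fun g hg =>
    hM.regular le_rfl (by rwa [hFn 1 le_rfl])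
  obtain ⟨hτ, hfluct⟩ := hX.global_fluctuation hG hm hc hreg hA hγ0 hγ2 hent
  have hfF := hM.min_exists.1
  have hself : rho2Dist (recip fF) (recip fF) = 0 := by
    simp [rho2Dist, rho2]
  have hcurv : ∀ g ∈ F, l2 (fun u l => recip g u l - recip fF u l) ^ 2 ≤ 32 * Real.pi * M ^ 2 *
      (realContrast (spectralDensity a) (recip g) - realContrast (spectralDensity a) (recip fF)) := by
    intro g hg
    rcases hF with hF | hF
    · obtain ⟨Cf, -, hCf⟩ := hX.exists_spectralDensity_bound
      obtain ⟨hae, hpos⟩ := eqAE_of_memAE hM.target_model hM.min_unique hF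
      have hdist : rho2Dist (recip (spectralDensity a)) (recip fF) = 0 := by
        rw [← hself]
        refine eLpNorm_congr_ae ?_
        filter_upwards [hae] with p hp
        simp only [recip, hp]
      have h := sq_l2_le_of_correct (hreg g hg) (hreg fF hfF) hm hX.aemeasurable_spectralDensity
        hCf hpos (by rw [hdist]; exact ENNReal.zero_ne_top)
      rw [hdist] at h
      simpa using h
    · exact hX.sq_l2_le_of_isContrastMin hm hreg hF hM.min_exists hg
  -- The global rate carries no factor (M/m)√c; as this is a fixed constant, it is moved into κ₀.
  set κ₀ := (M / m * Real.sqrt c)⁻¹ with hκ₀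
  have hκ : 0 < M / m * Real.sqrt c := by positivity
  refine hX.convergesAtRate hG (m := fun _ => m) (M := fun _ => M) (c := fun _ => c)
    (τ := globalRateReal γ) (g₀ := fun _ => fF) (κ₀ := κ₀) (C₄ := 0) (C₅ := 0) hft
    (aestronglyMeasurable_recip hM.target_model hfF) (fun _ _ => hm)
    (fun _ _ => hM.low_le_one 1 le_rfl) (fun _ _ => hM1) (fun _ _ => le_max_right _ _)
    (fun n hn g hg => hreg g (by rwa [hFn n hn] at hg)) (inv_pos.2 hκ) le_rfl hτ ?_ ?_ ?_ ?_
  · refine Eventually.of_forall fun n => le_of_eq ?_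
    rw [globalRate, hκ₀, ← mul_assoc, inv_mul_cancel₀ hκ.ne', one_mul, globalRateReal]
  · filter_upwards [eventually_ge_atTop 1] with n hn _
    rw [hFn n hn]
    refine ⟨hfF, by rw [hself]; exact zero_le, fun g hg => ?_⟩
    have := hcurv g hg
    linarith
  · intro e he
    obtain ⟨C, hC0, hC⟩ := hfluct fF hfF e he
    refine ⟨C, hC0, ?_⟩
    filter_upwards [hC, eventually_ge_atTop 1] with n h hn _
    rwa [hFn n hn]
  · intro b hb
    have hM0 : (0 : ℝ) < M := by linarith
    have hMne : ENNReal.ofReal M ^ 2 ≠ 0 := pow_ne_zero 2 (ENNReal.ofReal_ne_zero_iff.2 hM0)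
    have hMtop : ENNReal.ofReal M ^ 2 ≠ ∞ := ENNReal.pow_ne_top ENNReal.ofReal_ne_top
    -- Closeness is assumed relative to `Mup n`, which may vary, but is needed relative to the fixed
    -- M. Since `Mup n` is at least 1, the assumption at level b/M² suffices.
    have hb' : 0 < b / M.toNNReal ^ 2 := div_pos hb (pow_pos (Real.toNNReal_pos.2 hM0) 2)
    refine tendsto_of_tendsto_of_tendsto_of_le_of_le' tendsto_const_nhds (hclose _ hb')
      (Eventually.of_forall fun _ => zero_le) ?_
    filter_upwards [eventually_ge_atTop 1] with n hn
    refine measure_mono fun ω hω => ?_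
    rw [Set.mem_ofPred_eq] at hω ⊢
    refine lt_of_le_of_lt ?_ hω
    have h1 : 1 ≤ ENNReal.ofReal (Mup n) ^ 2 := by
      refine one_le_pow₀ ?_
      rw [ENNReal.one_le_ofReal]
      exact hM.one_le_up n hn
    have h2 : ((b / M.toNNReal ^ 2 : ℝ≥0) : ℝ≥0∞) = b / ENNReal.ofReal M ^ 2 := by
      rw [ENNReal.coe_div (pow_pos (Real.toNNReal_pos.2 hM0) 2).ne', ENNReal.coe_pow]
      rfl
    rw [h2]
    calc _ ≤ b / ENNReal.ofReal M ^ 2 * globalRate γ n ^ 2 := by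
          gcongr
          exact ENNReal.div_le_of_le_mul (le_mul_of_one_le_right zero_le h1)
      _ = _ := by
          simp only [div_eq_mul_inv]
          ring

end IsLocallyStationary

end Sample

end LocStat

end

/-! ### The three cases of the theorem -/

theorem theorem2p8 {Ω : Type*} [MeasurableSpace Ω] (P : Measure Ω) [IsProbabilityMeasure P]
    -- a Gaussian locally stationary process, with spectral density `LocStat.spectralDensity a`
    (κ K : ℝ) (ε : ℤ → Ω → ℝ) (aT : ℕ → ℤ → ℤ → ℝ) (a : ℝ → ℤ → ℝ) (X : ℕ → ℤ → Ω → ℝ)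
    (hX : LocStat.IsLocallyStationary P κ K ε aT a X) (hG : LocStat.IsGaussianArray P X)
    -- the sieve, the target class, and the minimizer of the limiting contrast over the latter
    (Fn : ℕ → Set (ℝ → ℝ → ℝ)) (F : Set (ℝ → ℝ → ℝ)) (fF : ℝ → ℝ → ℝ)
    (Mlow Mup rInf vT vS : ℕ → ℝ)
    (hM : LocStat.ModelAssumptions (LocStat.spectralDensity a) Fn F fF Mlow Mup rInf vT vS)
    -- the approximating criterion and its minimizer over the sieve
    (Lt : ℕ → Ω → (ℝ → ℝ → ℝ) → ℝ) (ft : ℕ → Ω → ℝ → ℝ → ℝ)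
    (hft : ∀ n, 1 ≤ n → ∀ᵐ ω ∂P, ft n ω ∈ Fn n ∧ ∀ g ∈ Fn n, Lt n ω (ft n ω) ≤ Lt n ω g) :
    -- Part I: sieve estimation
    (∀ (A : ℝ) (k : ℕ → ℝ), 0 < A → (∀ n, 1 ≤ n → 1 ≤ k n) →
      (∀ n : ℕ, 2 ≤ n → ∀ η : ℝ, 0 < η → η ≤ 1 →
        LocStat.metricEntropy η (LocStat.recipClass (Fn n)) ≤
          ((A * k n * Real.log (n / η) : ℝ) : EReal)) →
      -- correctly specified model
      (LocStat.MemAE (LocStat.spectralDensity a) F →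
        LocStat.CriterionClose P X Fn Mup Lt (LocStat.sieveRate Mlow Mup rInf vS k
          (LocStat.approxError (LocStat.spectralDensity a) Fn)) →
        LocStat.ConvergesAtRate P ft fF (LocStat.sieveRate Mlow Mup rInf vS k
          (LocStat.approxError (LocStat.spectralDensity a) Fn))) ∧
      -- misspecified model; `fFn n` is the minimizer of the limiting contrast over `Fn n`
      (¬ LocStat.MemAE (LocStat.spectralDensity a) F →
        (∀ n, 1 ≤ n → Convex ℝ (LocStat.recipClass (Fn n))) →
        ∀ fFn : ℕ → ℝ → ℝ → ℝ,
          (∀ n, 1 ≤ n → LocStat.IsContrastMin (LocStat.spectralDensity a) (Fn n) (fFn n)) →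
          LocStat.CriterionClose P X Fn Mup Lt (LocStat.sieveRate Mlow Mup rInf vS k
            (fun n => LocStat.rho2Dist (LocStat.recip fF) (LocStat.recip (fFn n)))) →
          LocStat.ConvergesAtRate P ft fF (LocStat.sieveRate Mlow Mup rInf vS k
            (fun n => LocStat.rho2Dist (LocStat.recip fF) (LocStat.recip (fFn n)))))) ∧
    -- Part II: global estimation
    ((∀ n, 1 ≤ n → Fn n = F) →
      (LocStat.MemAE (LocStat.spectralDensity a) F ∨ Convex ℝ (LocStat.recipClass F)) →
      ∀ (γ A : ℝ) (Ht : ℝ → ℝ), 0 < γ → γ < 2 → 0 < A →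
        ContinuousOn Ht (Set.Ioi 0) → AntitoneOn Ht (Set.Ioi 0) →
        (∀ η : ℝ, 0 < η → LocStat.metricEntropy η (LocStat.recipClass F) ≤ (Ht η : EReal)) →
        (∀ η : ℝ, 0 < η → Ht η ≤ A * η ^ (-γ)) →
        LocStat.CriterionClose P X Fn Mup Lt (LocStat.globalRate γ) →
        LocStat.ConvergesAtRate P ft fF (LocStat.globalRate γ)) := by
  refine ⟨fun A k hA hk hent => ⟨fun hf hclose => ?_, fun _ hconv fFn hmin hclose => ?_⟩,
    fun hFn hF γ A Ht hγ0 hγ2 hA _ _ hH hHA hclose => ?_⟩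
  · exact hX.sieve_correct hG hM hft hA hk hent hf hclose
  · exact hX.sieve_misspecified hG hM hft hA hk hent hconv hmin hclose
  · exact hX.global_rate hG hM hft hFn hF hγ0 hγ2 hA
      (fun η hη => (hH η hη).trans (EReal.coe_le_coe (hHA η hη))) hclose
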